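/- **Setting.** Let $\mathbb T=\{0,\dots,T\}$ with $T<\infty$, or $\mathbb T=\mathbb N_0$, or $\mathbb T=\mathbb N_0\cup\{\infty\}$ (with $T=\infty$ in the last two cases). Let $(\Omega,\mathcal F,(\mathcal F_t)_{t\in\mathbb T\cap\mathbb N_0},P)$ be a filtered probability space with $\mathcal F_0=\{\emptyset,\Omega\}$ and $\mathcal F=\mathcal F_T$, where $\mathcal F_\infty=\sigma(\bigcup_t\mathcal F_t)$. If $T=\infty$, assume that each $\mathcal F_t$, $t\in\mathbb N_0$, is $\sigma$-isomorphic to the Borel $\sigma$-field of a complete separable metric space and that $\bigcap_nA_n\ne\emptyset$ whenever $(A_n)$ is decreasing and $A_n$ is an atom of $\mathcal F_n$. Write $L^\infty_t=L^\infty(\Omega,\mathcal F_t,P)$. Let $\mathcal R^\infty$ be the space of bounded adapted processes $X=(X_t)_{t\in\mathbb T}$, let $\pi_{t,s}(X)_r=1_{\{t\le r\}}X_{r\wedge s}$, $\mathcal R^\infty_{t,s}=\pi_{t,s}(\mathcal R^\infty)$, $\mathcal R^\infty_t=\pi_{t,T}(\mathcal R^\infty)$, and $\mathbb T_t=\{s\in\mathbb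 T: s\ge t\}$. (In)equalities between random variables and sets hold $P$-a.s. unless stated otherwise. A dynamic convex risk measure for processes is a family of maps $\rho_t:\mathcal R^\infty_t\to L^\infty_t$, $t\in\mathbb T\cap\mathbb N_0$, such that for $X,Y\in\mathcal R_t^\infty$: $\rho_t(X+m1_{\mathbb T_t})=\rho_t(X)-m$ for $m\in L^\infty_t$; $\rho_t(X)\ge\rho_t(Y)$ if $X\le Y$; $\rho_t(\lambda X+(1-\lambda)Y)\le\lambda\rho_t(X)+(1-\lambda)\rho_t(Y)$ for $\lambda\in L^\infty_t$, $0\le\lambda\le1$; and $\rho_t(0)=0$. For $X\in\mathcal R^\infty$ put $\rho_t(X):=\rho_t(\pi_{t,T}(X))$. It is continuous from above at $t$ if $\rho_t(X^n)\nearrow\rho_t(X)$ whenever $X^n,X\in\mathcal R^\infty$ and $X^n_s\searrow X_s$ for all $s\in\mathbb T_t$. It is time consistent if for all $t\in\mathbb T$, $t<T$, and $X,Y\in\mathcal R^\infty$: $X_t=Y_t$ and $\rho_{t+1}(X)\le\rho_{t+1}(Y)$ imply $\rho_t(X)\le\rho_t(Y)$. Let $\mathcal A_t=\{X\in\mathcal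 R^\infty_t:\rho_t(X)\le0\}$ and $\mathcal A_{t,t+1}=\{X\in\mathcal R^\infty_{t,t+1}:\rho_t(X)\le0\}$. Let $\mu=(\mu_t)_{t\in\mathbb T}$ be adapted with $\mu_t>0$ and $\sum_{t\in\mathbb T}\mu_t=1$. On $\bar\Omega=\Omega\times\mathbb T$ with $\bar{\mathcal F}=\sigma(A\times\{t\}: t\in\mathbb T,\ A\in\mathcal F_t)$ let $E_{\bar P}[X]=E_P[\sum_{t\in\mathbb T}X_t\mu_t]$, and let $\mathcal M(\bar P)$ (resp. $\mathcal M^e(\bar P)$) be the set of probability measures on $\bar{\mathcal F}$ absolutely continuous with respect to (resp. equivalent to) $\bar P$. Let $\mathcal M_{\rm loc}(P)$ (resp. $\mathcal M^e_{\rm loc}(P)$) be the set of probability measures $Q$ on $\mathcal F$ with $Q\ll P$ (resp. $Q\approx P$) on $\mathcal F_t$ for all $t\in\mathbb T\cap\mathbb N_0$. For $Q\in\mathcal M_{\rm loc}(P)$, $\mathcal D(Q)$ is the set of predictable, nonnegative, non-increasing processes $D=(D_t)_{t\in\mathbb T}$ with $D_0=1$ such that: if $\mathbb T=\mathbb N_0$,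 $\lim_tD_t=0$ $Q$-a.s.; if $\mathbb T=\mathbb N_0\cup\{\infty\}$, $D_\infty=\lim_tD_t$ $Q$-a.s. and $D_\infty=0$ $Q$-a.s. on $\{\lim_t\frac{dQ}{dP}|_{\mathcal F_t}=\infty\}$. Put $\gamma_t=D_t-D_{t+1}$ for finite $t$ (with $D_{T+1}=0$ if $T<\infty$) and $\gamma_\infty=D_\infty$. A decomposition $\bar Q=Q\otimes D=Q\otimes\gamma$ of $\bar Q\in\mathcal M(\bar P)$ means $Q\in\mathcal M_{\rm loc}(P)$, $D\in\mathcal D(Q)$ and $E_{\bar Q}[X]=E_Q[\sum_{t\in\mathbb T}\gamma_tX_t]$ for all $X\in\mathcal R^\infty$. Define, $Q$-a.s. on $\{D_t>0\}$, $$\alpha_t(Q\otimes D)=Q\text{-}\operatorname*{ess\,sup}_{X\in\mathcal A_t}E_Q\Big[-\sum_{s\in\mathbb T_t}\tfrac{\gamma_s}{D_t}X_s\,\Big|\,\mathcal F_t\Big],\qquad \alpha_{t,t+1}(Q\otimes D)=\tfrac1{D_t}\,Q\text{-}\operatorname*{ess\,sup}_{X\in\mathcal A_{t,t+1}}E_Q[-\gamma_tX_t-D_{t+1}X_{t+1}\,|\,\mathcal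 F_t],$$ and $\alpha_t=\alpha_{t,t+1}=\infty$ on $\{D_t=0\}$, with $0\cdot\infty=0$. **Theorem.** Let $(\rho_t)_{t\in\mathbb T\cap\mathbb N_0}$ be a dynamic convex risk measure for processes such that each $\rho_t$ is continuous from above. Then the following are equivalent: (i) $(\rho_t)$ is time consistent; (ii) $\mathcal A_t=\mathcal A_{t,t+1}+\mathcal A_{t+1}$ for all $t\in\mathbb T$, $t<T$; (iii) for all $t\in\mathbb T$, $t<T$, and every $\bar Q=Q\otimes D\in\mathcal M(\bar P)$, $$D_t\alpha_t(Q\otimes D)=D_t\alpha_{t,t+1}(Q\otimes D)+E_Q[D_{t+1}\alpha_{t+1}(Q\otimes D)\,|\,\mathcal F_t]\quad Q\text{-a.s.};$$ (iv) for all $X\in\mathcal R^\infty$, $t\in\mathbb T$, $t<T$, and every $\bar Q=Q\otimes D\in\mathcal M(\bar P)$, $$E_Q[D_{t+1}(X_t+\rho_{t+1}(X)+\alpha_{t+1}(Q\otimes D))\,|\,\mathcal F_t]\le D_t(X_t+\rho_t(X)+\alpha_t(Q\otimes D))\quad Q\text{-a.s.}$$ Moreover, let $\bar{\mathcal Q}^*=\{\bar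 Q\in\mathcal M^e(\bar P):\alpha_0(\bar Q)<\infty\}$. A measure $\bar Q=Q\otimes\gamma\in\mathcal M(\bar P)$ belongs to $\mathcal M^e(\bar P)$ if and only if $Q\in\mathcal M^e_{\rm loc}(P)$, $\gamma_t>0$ $P$-a.s. for all $t\in\mathbb T$ and, in the case $\mathbb T=\mathbb N_0\cup\{\infty\}$, $P\ll Q$. If $\bar{\mathcal Q}^*\neq\emptyset$, then condition (iv) required only for $\bar Q\in\bar{\mathcal Q}^*$ already implies time consistency, and it then also implies the robust representation over $\bar{\mathcal Q}^*$: for all $t\in\mathbb T\cap\mathbb N_0$ and $X\in\mathcal R^\infty_t$, $$\rho_t(X)=\operatorname*{ess\,sup}_{Q\otimes\gamma\in\bar{\mathcal Q}^*}\Big(E_Q\Big[-\sum_{s\in\mathbb T_t}\tfrac{\gamma_s}{D_t}X_s\,\Big|\,\mathcal F_t\Big]-\alpha_t(Q\otimes\gamma)\Big)\quad P\text{-a.s.}$$ -/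

import Mathlib

open MeasureTheory ProbabilityTheory Filter Topology
open scoped ENNReal Pointwise

namespace ProcessRisk

/-! ### Essential suprema of families and conditional expectations of extended random variables -/

section Basics

variable {Ω : Type*} {m mΩ : MeasurableSpace Ω}

/-- `Z` is (a version of) the `ν`-essential supremum of the family `S` of `m`-measurable
extended random variables: the `ν`-a.s. least `m`-measurable upper bound. -/
structure IsEssSup (ν : Measure Ω) (m : MeasurableSpace Ω) (S : Set (Ω → EReal))
    (Z : Ω → EReal) : Prop where
  measurable : Measurable[m] Z
  le : ∀ f ∈ S, ∀ᵐ ω ∂ν, f ω ≤ Z ω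
  least : ∀ g : Ω → EReal, Measurable[m] g → (∀ f ∈ S, ∀ᵐ ω ∂ν, f ω ≤ g ω) →
    ∀ᵐ ω ∂ν, Z ω ≤ g ω

open Classical in
/-- A version of the essential supremum of a family. By `isEssSup_essSupFamily` the default branch
is never used for families of measurable functions; versions agree almost surely. -/
noncomputable def essSupFamily (ν : Measure Ω) (m : MeasurableSpace Ω) (S : Set (Ω → EReal)) :
    Ω → EReal :=
  if h : ∃ Z, IsEssSup ν m S Z then h.choose else fun _ => ⊤

theorem exists_isEssSup (ν : Measure Ω) [IsFiniteMeasure ν] (hm : m ≤ mΩ)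
    (S : Set (Ω → EReal)) (hS : ∀ f ∈ S, Measurable[m] f) : ∃ Z, IsEssSup ν m S Z := by
  classical
  -- for every rational level, a countable subfamily exhausting the sets where members exceed it
  have key : ∀ q : ℚ, ∃ C : Set (Ω → EReal), C ⊆ S ∧ C.Countable ∧ ∀ f ∈ S,
      ν ({ω | ((q : ℝ) : EReal) < f ω} \ ⋃ g ∈ C, {ω | ((q : ℝ) : EReal) < g ω}) = 0 := by
    intro q
    let U : Set (Ω → EReal) → Set Ω := fun C => ⋃ g ∈ C, {ω | ((q : ℝ) : EReal) < g ω}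
    let V : Set ℝ≥0∞ := {x | ∃ C : Set (Ω → EReal), C ⊆ S ∧ C.Countable ∧ x = ν (U C)}
    have hV : V.Nonempty := ⟨ν (U ∅), ∅, Set.empty_subset _, Set.countable_empty, rfl⟩
    obtain ⟨u, -, hu, huV⟩ := exists_seq_tendsto_sSup hV (OrderTop.bddAbove V)
    choose C hCS hCc hCu using huV
    have hWS : (⋃ n, C n) ⊆ S := Set.iUnion_subset hCS
    have hWc : (⋃ n, C n).Countable := Set.countable_iUnion hCc
    have hWge : sSup V ≤ ν (U (⋃ n, C n)) := by
      refine le_of_tendsto' hu fun n => ?_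
      rw [hCu n]
      exact measure_mono (Set.biUnion_subset_biUnion_left (Set.subset_iUnion C n))
    refine ⟨⋃ n, C n, hWS, hWc, fun f hf => ?_⟩
    have hmeas : ∀ g ∈ S, MeasurableSet {ω | ((q : ℝ) : EReal) < g ω} := fun g hg =>
      measurableSet_lt measurable_const ((hS g hg).mono hm le_rfl)
    have hUm : MeasurableSet (U (⋃ n, C n)) :=
      MeasurableSet.biUnion hWc fun g hg => hmeas g (hWS hg)
    have h1 : ν (U (insert f (⋃ n, C n))) ≤ sSup V :=
      le_sSup ⟨_, Set.insert_subset hf hWS, hWc.insert f, rfl⟩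
    have h2 : U (insert f (⋃ n, C n)) = {ω | ((q : ℝ) : EReal) < f ω} ∪ U (⋃ n, C n) :=
      Set.biUnion_insert _ _ _
    rw [h2] at h1
    have h3 : ν (({ω | ((q : ℝ) : EReal) < f ω} ∪ U (⋃ n, C n)) \ U (⋃ n, C n)) = 0 := by
      rw [measure_sdiff Set.subset_union_right hUm.nullMeasurableSet (measure_ne_top _ _)]
      exact tsub_eq_zero_of_le (h1.trans hWge)
    rwa [Set.union_sdiff_right] at h3
  choose C hCS hCc hC using key
  refine ⟨fun ω => ⨆ g ∈ ⋃ q, C q, g ω, ?_, ?_, ?_⟩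
  · exact Measurable.biSup _ (Set.countable_iUnion hCc) fun g hg =>
      hS g (Set.iUnion_subset hCS hg)
  · intro f hf
    have h : ∀ᵐ ω ∂ν, ∀ q : ℚ,
        ω ∉ {ω | ((q : ℝ) : EReal) < f ω} \ ⋃ g ∈ C q, {ω | ((q : ℝ) : EReal) < g ω} :=
      ae_all_iff.2 fun q => measure_eq_zero_iff_ae_notMem.1 (hC q f hf)
    filter_upwards [h] with ω hω
    by_contra hlt
    obtain ⟨q, hq1, hq2⟩ := EReal.lt_iff_exists_rat_btwn.1 (not_le.1 hlt)
    apply hω q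
    refine ⟨hq2, fun hmem => ?_⟩
    simp only [Set.mem_iUnion, Set.mem_ofPred_eq] at hmem
    obtain ⟨g, hg, hgq⟩ := hmem
    have : g ω ≤ ⨆ g ∈ ⋃ q, C q, g ω :=
      le_iSup₂ (f := fun (g : Ω → EReal) (_ : g ∈ ⋃ q, C q) => g ω) g (Set.mem_iUnion.2 ⟨q, hg⟩)
    exact absurd (hgq.trans_le this) (not_lt.2 hq1.le)
  · intro g _ hg
    have h : ∀ᵐ ω ∂ν, ∀ f ∈ ⋃ q, C q, f ω ≤ g ω :=
      (ae_ball_iff (Set.countable_iUnion hCc)).2 fun f hf => hg f (Set.iUnion_subset hCS hf)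
    filter_upwards [h] with ω hω
    exact iSup₂_le hω

theorem isEssSup_essSupFamily (ν : Measure Ω) [IsFiniteMeasure ν]
    (hm : m ≤ mΩ) (S : Set (Ω → EReal)) (hS : ∀ f ∈ S, Measurable[m] f) :
    IsEssSup ν m S (essSupFamily ν m S) := by
  have h := exists_isEssSup ν hm S hS
  rw [essSupFamily, dif_pos h]
  exact h.choose_spec

/-- Conditional expectation `E_ν[Y | m] = E_ν[Y⁺ | m] - E_ν[Y⁻ | m]` of an extended random variable.
It is only used for variables bounded from below, where the second term is finite. -/
noncomputable def condExpE (ν : Measure Ω) (m : MeasurableSpace Ω) (Y : Ω → EReal) : Ω → EReal :=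
  fun ω => ((condLExp m ν (fun ω' => (Y ω').toENNReal) ω : ℝ≥0∞) : EReal) -
    ((condLExp m ν (fun ω' => (-Y ω').toENNReal) ω : ℝ≥0∞) : EReal)

end Basics

/-! ### Time sets and filtrations -/

/-- The admissible sets of time points: `{0, …, T}` with `T` finite, `ℕ₀`, and `ℕ₀ ∪ {∞}`. -/
def IsTimeSet (𝕋 : Set ℕ∞) : Prop :=
  (∃ T : ℕ, 𝕋 = Set.Iic (T : ℕ∞)) ∨ 𝕋 = Set.Iio ⊤ ∨ 𝕋 = Set.univ

/-- The horizon is infinite. -/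
def InfiniteHorizon (𝕋 : Set ℕ∞) : Prop := ∀ n : ℕ, (n : ℕ∞) ∈ 𝕋

section Filtered

variable {Ω : Type*} [mΩ : MeasurableSpace Ω]

/-- The σ-field `𝓕_t` for `t ∈ ℕ₀ ∪ {∞}`, where `𝓕_∞ = σ(⋃ₙ 𝓕ₙ)`. -/
def sigmaAt (ℱ : Filtration ℕ mΩ) : ℕ∞ → MeasurableSpace Ω
  | (n : ℕ) => ℱ n
  | ⊤ => ⨆ n, ℱ n

/-- `m` is σ-isomorphic to the Borel σ-field of a complete separable metric space: there is a
bijection of σ-fields preserving inclusion in both directions (hence complements and countable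
unions). -/
def IsSigmaIsomorphicToPolish (m : MeasurableSpace Ω) : Prop :=
  ∃ (E : Type) (_ : TopologicalSpace E) (_ : PolishSpace E),
    Nonempty ({A : Set Ω // MeasurableSet[m] A} ≃o {B : Set E // MeasurableSet[borel E] B})

/-- `A` is an atom of the σ-field `m`: a nonempty measurable set without proper nonempty
measurable subset. -/
def IsSigmaAtom (m : MeasurableSpace Ω) (A : Set Ω) : Prop :=
  MeasurableSet[m] A ∧ A.Nonempty ∧ ∀ B, MeasurableSet[m] B → B ⊆ A → B = ∅ ∨ B = A

/-- The structural assumption on the filtration used for an infinite horizon. -/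
def IsRegularFiltration (ℱ : Filtration ℕ mΩ) : Prop :=
  (∀ n, IsSigmaIsomorphicToPolish (ℱ n)) ∧
  ∀ A : ℕ → Set Ω, Antitone A → (∀ n, IsSigmaAtom (ℱ n) (A n)) → (⋂ n, A n).Nonempty

/-! ### Bounded adapted processes -/

/-- `Y` represents an element of `L^∞(Ω, m, P)`. -/
def MemLinf (P : Measure Ω) (m : MeasurableSpace Ω) (Y : Ω → ℝ) : Prop :=
  Measurable[m] Y ∧ ∃ C : ℝ, ∀ᵐ ω ∂P, |Y ω| ≤ C

/-- (Representatives of) the space `𝓡^∞` of bounded adapted processes `(X_t)_{t ∈ 𝕋}`.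
The values of `X` at times outside `𝕋` are irrelevant. -/
def BddProcess (P : Measure Ω) (𝕋 : Set ℕ∞) (ℱ : Filtration ℕ mΩ) : Set (ℕ∞ → Ω → ℝ) :=
  {X | (∀ t ∈ 𝕋, Measurable[sigmaAt ℱ t] (X t)) ∧
    ∃ C : ℝ, ∀ t ∈ 𝕋, ∀ᵐ ω ∂P, |X t ω| ≤ C}

/-- The projection `π_{t,s}(X)_r = 1_{t ≤ r} X_{r ∧ s}`; `π_{t,T}` is `proj t ⊤` on `𝕋`. -/
noncomputable def proj (t s : ℕ∞) (X : ℕ∞ → Ω → ℝ) : ℕ∞ → Ω → ℝ :=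
  fun r ω => if t ≤ r then X (min r s) ω else 0

/-- The space `𝓡^∞_{t,s} = π_{t,s}(𝓡^∞)` (as classes modulo `P`-null sets). -/
def BddProcessBetween (P : Measure Ω) (𝕋 : Set ℕ∞) (ℱ : Filtration ℕ mΩ) (t s : ℕ∞) :
    Set (ℕ∞ → Ω → ℝ) :=
  {X | X ∈ BddProcess P 𝕋 ℱ ∧ ∀ r ∈ 𝕋, X r =ᵐ[P] proj t s X r}

/-- The space `𝓡^∞_t = π_{t,T}(𝓡^∞)`. -/
def BddProcessFrom (P : Measure Ω) (𝕋 : Set ℕ∞) (ℱ : Filtration ℕ mΩ) (t : ℕ∞) :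
    Set (ℕ∞ → Ω → ℝ) :=
  BddProcessBetween P 𝕋 ℱ t ⊤

/-! ### Conditional and dynamic convex risk measures for processes -/

/-- `r : 𝓡^∞_t → L^∞_t` is a conditional convex risk measure for processes. By monotonicity `r`
respects `P`-a.s. equality of processes. -/
structure IsCondConvexRiskMeasure (P : Measure Ω) (𝕋 : Set ℕ∞) (ℱ : Filtration ℕ mΩ) (t : ℕ)
    (r : (ℕ∞ → Ω → ℝ) → Ω → ℝ) : Prop where
  memLinf : ∀ X ∈ BddProcessFrom P 𝕋 ℱ t, MemLinf P (ℱ t) (r X)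
  cashInvariance : ∀ X ∈ BddProcessFrom P 𝕋 ℱ t, ∀ m : Ω → ℝ, MemLinf P (ℱ t) m →
    ∀ᵐ ω ∂P, r (fun s ω' => X s ω' + if (t : ℕ∞) ≤ s then m ω' else 0) ω = r X ω - m ω
  monotone : ∀ X ∈ BddProcessFrom P 𝕋 ℱ t, ∀ Y ∈ BddProcessFrom P 𝕋 ℱ t,
    (∀ s ∈ 𝕋, ∀ᵐ ω ∂P, X s ω ≤ Y s ω) → ∀ᵐ ω ∂P, r Y ω ≤ r X ω
  convex : ∀ X ∈ BddProcessFrom P 𝕋 ℱ t, ∀ Y ∈ BddProcessFrom P 𝕋 ℱ t,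
    ∀ l : Ω → ℝ, MemLinf P (ℱ t) l → (∀ᵐ ω ∂P, 0 ≤ l ω ∧ l ω ≤ 1) →
    ∀ᵐ ω ∂P, r (fun s ω' => l ω' * X s ω' + (1 - l ω') * Y s ω') ω
      ≤ l ω * r X ω + (1 - l ω) * r Y ω
  normalized : ∀ᵐ ω ∂P, r 0 ω = 0

/-- A dynamic convex risk measure for processes, `(ρ_t)` with `t ∈ 𝕋 ∩ ℕ₀`. -/
def IsDynamicConvexRiskMeasure (P : Measure Ω) (𝕋 : Set ℕ∞) (ℱ : Filtration ℕ mΩ)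
    (ρ : ℕ → (ℕ∞ → Ω → ℝ) → Ω → ℝ) : Prop :=
  ∀ t : ℕ, (t : ℕ∞) ∈ 𝕋 → IsCondConvexRiskMeasure P 𝕋 ℱ t (ρ t)

/-- `ρ_t(X) := ρ_t(π_{t,T}(X))` for `X ∈ 𝓡^∞`. -/
noncomputable def riskAt (ρ : ℕ → (ℕ∞ → Ω → ℝ) → Ω → ℝ) (t : ℕ) (X : ℕ∞ → Ω → ℝ) : Ω → ℝ :=
  ρ t (proj t ⊤ X)

/-- Continuity from above of `ρ_t`. -/
def IsContinuousFromAbove (P : Measure Ω) (𝕋 : Set ℕ∞) (ℱ : Filtration ℕ mΩ)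
    (ρ : ℕ → (ℕ∞ → Ω → ℝ) → Ω → ℝ) (t : ℕ) : Prop :=
  ∀ (Xn : ℕ → ℕ∞ → Ω → ℝ) (X : ℕ∞ → Ω → ℝ),
    (∀ n, Xn n ∈ BddProcess P 𝕋 ℱ) → X ∈ BddProcess P 𝕋 ℱ →
    (∀ s ∈ 𝕋, (t : ℕ∞) ≤ s → ∀ᵐ ω ∂P,
      Antitone (fun n => Xn n s ω) ∧ Tendsto (fun n => Xn n s ω) atTop (𝓝 (X s ω))) →
    ∀ᵐ ω ∂P, Monotone (fun n => riskAt ρ t (Xn n) ω) ∧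
      Tendsto (fun n => riskAt ρ t (Xn n) ω) atTop (𝓝 (riskAt ρ t X ω))

/-- (Strong) time consistency. -/
def IsTimeConsistent (P : Measure Ω) (𝕋 : Set ℕ∞) (ℱ : Filtration ℕ mΩ)
    (ρ : ℕ → (ℕ∞ → Ω → ℝ) → Ω → ℝ) : Prop :=
  ∀ t : ℕ, ((t + 1 : ℕ) : ℕ∞) ∈ 𝕋 → ∀ X ∈ BddProcess P 𝕋 ℱ, ∀ Y ∈ BddProcess P 𝕋 ℱ,
    (∀ᵐ ω ∂P, X t ω = Y t ω) → (∀ᵐ ω ∂P, riskAt ρ (t + 1) X ω ≤ riskAt ρ (t + 1) Y ω) →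
    ∀ᵐ ω ∂P, riskAt ρ t X ω ≤ riskAt ρ t Y ω

/-- The acceptance set `𝓐_t`. -/
def acceptance (P : Measure Ω) (𝕋 : Set ℕ∞) (ℱ : Filtration ℕ mΩ)
    (ρ : ℕ → (ℕ∞ → Ω → ℝ) → Ω → ℝ) (t : ℕ) : Set (ℕ∞ → Ω → ℝ) :=
  {X | X ∈ BddProcessFrom P 𝕋 ℱ t ∧ ∀ᵐ ω ∂P, ρ t X ω ≤ 0}

/-- The one-step acceptance set `𝓐_{t,t+1}`. -/
def acceptanceStep (P : Measure Ω) (𝕋 : Set ℕ∞) (ℱ : Filtration ℕ mΩ)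
    (ρ : ℕ → (ℕ∞ → Ω → ℝ) → Ω → ℝ) (t : ℕ) : Set (ℕ∞ → Ω → ℝ) :=
  {X | X ∈ BddProcessBetween P 𝕋 ℱ t ((t + 1 : ℕ) : ℕ∞) ∧ ∀ᵐ ω ∂P, ρ t X ω ≤ 0}

/-! ### The product space with its optional σ-field and reference measure -/

/-- The product space `Ω × 𝕋`, to be equipped with the optional σ-field: a point is a pair
`(state, time)`. (The filtration only serves to select the σ-field.) -/
structure OptionalSpace (𝕋 : Set ℕ∞) (ℱ : Filtration ℕ mΩ) where
  state : Ω
  time : 𝕋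

/-- The optional σ-field, generated by the sets `A × {t}` with `t ∈ 𝕋`, `A ∈ 𝓕_t`. -/
instance instMeasurableSpaceOptionalSpace (𝕋 : Set ℕ∞) (ℱ : Filtration ℕ mΩ) :
    MeasurableSpace (OptionalSpace 𝕋 ℱ) :=
  MeasurableSpace.generateFrom
    {B | ∃ (t : 𝕋) (A : Set Ω), MeasurableSet[sigmaAt ℱ t] A ∧
      B = {p : OptionalSpace 𝕋 ℱ | p.state ∈ A ∧ p.time = t}}

/-- A process regarded as a function on the product space. -/
def onOptional (𝕋 : Set ℕ∞) (ℱ : Filtration ℕ mΩ) (X : ℕ∞ → Ω → ℝ) (p : OptionalSpace 𝕋 ℱ) : ℝ :=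
  X p.time p.state

/-- An adapted reference process `μ > 0` with `∑_{t ∈ 𝕋} μ_t = 1`. -/
structure IsReferenceProcess (P : Measure Ω) (𝕋 : Set ℕ∞) (ℱ : Filtration ℕ mΩ)
    (μ : ℕ∞ → Ω → ℝ) : Prop where
  adapted : ∀ t ∈ 𝕋, Measurable[sigmaAt ℱ t] (μ t)
  pos : ∀ t ∈ 𝕋, ∀ᵐ ω ∂P, 0 < μ t ω
  sum_eq_one : ∀ᵐ ω ∂P, ∑' t : 𝕋, μ t ω = 1

/-- The measure `P ⊗ μ` on the optional σ-field, `E_{P ⊗ μ}[X] = E_P[∑_{t ∈ 𝕋} X_t μ_t]`. -/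
noncomputable def refMeasure (P : Measure Ω) (𝕋 : Set ℕ∞) (ℱ : Filtration ℕ mΩ)
    (μ : ℕ∞ → Ω → ℝ) : Measure (OptionalSpace 𝕋 ℱ) :=
  Measure.sum fun t : 𝕋 =>
    (P.withDensity fun ω => ENNReal.ofReal (μ t ω)).map
      (fun ω => (⟨ω, t⟩ : OptionalSpace 𝕋 ℱ))

/-! ### Locally absolutely continuous measures, discounting processes, decompositions -/

/-- `Q ∈ 𝓜_loc(P)`: `Q` is a probability measure with `Q ≪ P` on `𝓕_t` for `t ∈ 𝕋 ∩ ℕ₀`. -/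
def IsLocAC (P : Measure Ω) (𝕋 : Set ℕ∞) (ℱ : Filtration ℕ mΩ) (Q : Measure Ω) : Prop :=
  IsProbabilityMeasure Q ∧ ∀ n : ℕ, (n : ℕ∞) ∈ 𝕋 → Q.trim (ℱ.le n) ≪ P.trim (ℱ.le n)

/-- `Q ∈ 𝓜^e_loc(P)`: `Q` is a probability measure equivalent to `P` on `𝓕_t` for
`t ∈ 𝕋 ∩ ℕ₀`. -/
def IsLocEquiv (P : Measure Ω) (𝕋 : Set ℕ∞) (ℱ : Filtration ℕ mΩ) (Q : Measure Ω) : Prop :=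
  IsLocAC P 𝕋 ℱ Q ∧ ∀ n : ℕ, (n : ℕ∞) ∈ 𝕋 → P.trim (ℱ.le n) ≪ Q.trim (ℱ.le n)

/-- The density process `M_n = dQ/dP` on `𝓕_n`. -/
noncomputable def densityProcess (P : Measure Ω) (ℱ : Filtration ℕ mΩ) (Q : Measure Ω) (n : ℕ) :
    Ω → ℝ≥0∞ :=
  (Q.trim (ℱ.le n)).rnDeriv (P.trim (ℱ.le n))

/-- The terminal value `M_∞` of the density process (the limit exists `P`- and `Q`-a.s.). -/
noncomputable def densityLimit (P : Measure Ω) (ℱ : Filtration ℕ mΩ) (Q : Measure Ω) :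
    Ω → ℝ≥0∞ :=
  fun ω => limsup (fun n => densityProcess P ℱ Q n ω) atTop

/-- `D ∈ 𝓓(Q)`: predictable discounting processes. Here `D_∞ = lim D_t` if `∞ ∈ 𝕋`, and for
`𝕋 = ℕ₀` the limit is `0`. -/
structure IsDiscounting (P : Measure Ω) (𝕋 : Set ℕ∞) (ℱ : Filtration ℕ mΩ) (Q : Measure Ω)
    (D : ℕ∞ → Ω → ℝ) : Prop where
  measurable_zero : Measurable[ℱ 0] (D 0)
  predictable : ∀ n : ℕ, ((n + 1 : ℕ) : ℕ∞) ∈ 𝕋 → Measurable[ℱ n] (D ((n + 1 : ℕ) : ℕ∞))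
  measurable_top : ⊤ ∈ 𝕋 → Measurable[sigmaAt ℱ ⊤] (D ⊤)
  zero : ∀ᵐ ω ∂Q, D 0 ω = 1
  nonneg : ∀ t ∈ 𝕋, ∀ᵐ ω ∂Q, 0 ≤ D t ω
  nonincreasing : ∀ s ∈ 𝕋, ∀ t ∈ 𝕋, s ≤ t → ∀ᵐ ω ∂Q, D t ω ≤ D s ω
  tendsto_zero : InfiniteHorizon 𝕋 → ⊤ ∉ 𝕋 →
    ∀ᵐ ω ∂Q, Tendsto (fun n : ℕ => D n ω) atTop (𝓝 0)
  tendsto_top : ⊤ ∈ 𝕋 → ∀ᵐ ω ∂Q, Tendsto (fun n : ℕ => D n ω) atTop (𝓝 (D ⊤ ω))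
  singular : ⊤ ∈ 𝕋 → ∀ᵐ ω ∂Q, densityLimit P ℱ Q ω = ⊤ → D ⊤ ω = 0

open Classical in
/-- The optional random measure of a discounting process: `γ_t = D_t - D_{t+1}` for finite `t`, with
`D_{T+1} = 0` if `T` is finite, and `γ_∞ = D_∞`. -/
noncomputable def gammaOf (𝕋 : Set ℕ∞) (D : ℕ∞ → Ω → ℝ) : ℕ∞ → Ω → ℝ :=
  fun t ω => if t ≠ ⊤ ∧ t + 1 ∈ 𝕋 then D t ω - D (t + 1) ω else D t ω

/-- `Qbar ∈ 𝓜(P ⊗ μ)` with decomposition `Qbar = Q ⊗ D = Q ⊗ γ`, where `Q ∈ 𝓜_loc(P)`, `D ∈ 𝓓(Q)`,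
and `E_Qbar[X] = E_Q[∑_{t ∈ 𝕋} γ_t X_t]` for all `X ∈ 𝓡^∞`. -/
structure IsDecomposition (P : Measure Ω) (𝕋 : Set ℕ∞) (ℱ : Filtration ℕ mΩ) (μ : ℕ∞ → Ω → ℝ)
    (Qbar : Measure (OptionalSpace 𝕋 ℱ)) (Q : Measure Ω) (D : ℕ∞ → Ω → ℝ) : Prop where
  isProbabilityMeasure : IsProbabilityMeasure Qbar
  absolutelyContinuous : Qbar ≪ refMeasure P 𝕋 ℱ μ
  locAC : IsLocAC P 𝕋 ℱ Q
  discounting : IsDiscounting P 𝕋 ℱ Q D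
  integral_eq : ∀ X ∈ BddProcess P 𝕋 ℱ,
    ∫ p, onOptional 𝕋 ℱ X p ∂Qbar = ∫ ω, ∑' t : 𝕋, gammaOf 𝕋 D t ω * X t ω ∂Q

/-! ### Penalty functions -/

/-- `E_Q[-∑_{s ∈ 𝕋, s ≥ t} (γ_s / D_t) X_s | 𝓕_t]`; meaningful `Q`-a.s. on `{D_t > 0}`. -/
noncomputable def discountedLoss (𝕋 : Set ℕ∞) (ℱ : Filtration ℕ mΩ) (Q : Measure Ω)
    (D : ℕ∞ → Ω → ℝ) (t : ℕ) (X : ℕ∞ → Ω → ℝ) : Ω → ℝ :=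
  Q[fun ω => -∑' s : {s : ℕ∞ // s ∈ 𝕋 ∧ (t : ℕ∞) ≤ s}, gammaOf 𝕋 D s ω / D t ω * X s ω | ℱ t]

/-- The minimal penalty function `α_t(Q ⊗ D)`, equal to `∞` on `{D_t = 0}`. -/
noncomputable def penalty (P : Measure Ω) (𝕋 : Set ℕ∞) (ℱ : Filtration ℕ mΩ)
    (ρ : ℕ → (ℕ∞ → Ω → ℝ) → Ω → ℝ) (Q : Measure Ω) (D : ℕ∞ → Ω → ℝ) (t : ℕ) : Ω → EReal :=
  fun ω => if 0 < D t ω then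
    essSupFamily Q (ℱ t)
      {f | ∃ X ∈ acceptance P 𝕋 ℱ ρ t, f = fun ω' => (discountedLoss 𝕋 ℱ Q D t X ω' : EReal)} ω
    else ⊤

/-- The one-step minimal penalty function `α_{t,t+1}(Q ⊗ D)`, equal to `∞` on `{D_t = 0}`. -/
noncomputable def penaltyStep (P : Measure Ω) (𝕋 : Set ℕ∞) (ℱ : Filtration ℕ mΩ)
    (ρ : ℕ → (ℕ∞ → Ω → ℝ) → Ω → ℝ) (Q : Measure Ω) (D : ℕ∞ → Ω → ℝ) (t : ℕ) : Ω → EReal :=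
  fun ω => if 0 < D t ω then
    (((D t ω)⁻¹ : ℝ) : EReal) * essSupFamily Q (ℱ t)
      {f | ∃ X ∈ acceptanceStep P 𝕋 ℱ ρ t, f = fun ω' =>
        ((Q[fun ω'' => -gammaOf 𝕋 D t ω'' * X t ω''
            - D ((t + 1 : ℕ) : ℕ∞) ω'' * X ((t + 1 : ℕ) : ℕ∞) ω'' | ℱ t] ω' : ℝ) : EReal)} ω
    else ⊤

/-! ### The conditions to be compared -/

/-- Splitting of the acceptance sets: `𝓐_t = 𝓐_{t,t+1} + 𝓐_{t+1}` for all `t < T`. -/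
def AcceptanceSplitting (P : Measure Ω) (𝕋 : Set ℕ∞) (ℱ : Filtration ℕ mΩ)
    (ρ : ℕ → (ℕ∞ → Ω → ℝ) → Ω → ℝ) : Prop :=
  ∀ t : ℕ, ((t + 1 : ℕ) : ℕ∞) ∈ 𝕋 →
    acceptance P 𝕋 ℱ ρ t = acceptanceStep P 𝕋 ℱ ρ t + acceptance P 𝕋 ℱ ρ (t + 1)

/-- `D_t α_t = D_t α_{t,t+1} + E_Q[D_{t+1} α_{t+1} | 𝓕_t]`, `Q`-a.s., for all `t < T`. -/
def PenaltyRecursion (P : Measure Ω) (𝕋 : Set ℕ∞) (ℱ : Filtration ℕ mΩ)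
    (ρ : ℕ → (ℕ∞ → Ω → ℝ) → Ω → ℝ) (Q : Measure Ω) (D : ℕ∞ → Ω → ℝ) : Prop :=
  ∀ t : ℕ, ((t + 1 : ℕ) : ℕ∞) ∈ 𝕋 → ∀ᵐ ω ∂Q,
    (D t ω : EReal) * penalty P 𝕋 ℱ ρ Q D t ω =
      (D t ω : EReal) * penaltyStep P 𝕋 ℱ ρ Q D t ω +
        condExpE Q (ℱ t)
          (fun ω' => (D ((t + 1 : ℕ) : ℕ∞) ω' : EReal) * penalty P 𝕋 ℱ ρ Q D (t + 1) ω') ω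

/-- `E_Q[D_{t+1}(X_t + ρ_{t+1}(X) + α_{t+1}) | 𝓕_t] ≤ D_t(X_t + ρ_t(X) + α_t)`, `Q`-a.s.,
for all `X ∈ 𝓡^∞` and all `t < T`. -/
def SupermartingaleInequality (P : Measure Ω) (𝕋 : Set ℕ∞) (ℱ : Filtration ℕ mΩ)
    (ρ : ℕ → (ℕ∞ → Ω → ℝ) → Ω → ℝ) (Q : Measure Ω) (D : ℕ∞ → Ω → ℝ) : Prop :=
  ∀ X ∈ BddProcess P 𝕋 ℱ, ∀ t : ℕ, ((t + 1 : ℕ) : ℕ∞) ∈ 𝕋 → ∀ᵐ ω ∂Q,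
    condExpE Q (ℱ t)
      (fun ω' => (D ((t + 1 : ℕ) : ℕ∞) ω' : EReal) *
        ((X t ω' : EReal) + (riskAt ρ (t + 1) X ω' : EReal) + penalty P 𝕋 ℱ ρ Q D (t + 1) ω')) ω
    ≤ (D t ω : EReal) *
        ((X t ω : EReal) + (riskAt ρ t X ω : EReal) + penalty P 𝕋 ℱ ρ Q D t ω)

/-- `Qbar = Q ⊗ D` is equivalent to `P ⊗ μ` and has finite penalty `α_0`. -/
def IsEquivFinitePenalty (P : Measure Ω) (𝕋 : Set ℕ∞) (ℱ : Filtration ℕ mΩ) (μ : ℕ∞ → Ω → ℝ)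
    (ρ : ℕ → (ℕ∞ → Ω → ℝ) → Ω → ℝ) (Qbar : Measure (OptionalSpace 𝕋 ℱ)) (Q : Measure Ω)
    (D : ℕ∞ → Ω → ℝ) : Prop :=
  IsDecomposition P 𝕋 ℱ μ Qbar Q D ∧ refMeasure P 𝕋 ℱ μ ≪ Qbar ∧
    ∀ᵐ ω ∂Q, penalty P 𝕋 ℱ ρ Q D 0 ω < ⊤

/-- The robust representation of `ρ_t`, for all `t ∈ 𝕋 ∩ ℕ₀`, over the equivalent measures with
finite penalty:
`ρ_t(X) = ess sup (E_Q[-∑_{s ≥ t} (γ_s / D_t) X_s | 𝓕_t] - α_t(Q ⊗ D))` for `X ∈ 𝓡^∞_t`. -/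
def RobustRepresentation (P : Measure Ω) (𝕋 : Set ℕ∞) (ℱ : Filtration ℕ mΩ) (μ : ℕ∞ → Ω → ℝ)
    (ρ : ℕ → (ℕ∞ → Ω → ℝ) → Ω → ℝ) : Prop :=
  ∀ t : ℕ, (t : ℕ∞) ∈ 𝕋 → ∀ X ∈ BddProcessFrom P 𝕋 ℱ t,
    IsEssSup P (ℱ t)
      {f | ∃ Qbar Q D, IsEquivFinitePenalty P 𝕋 ℱ μ ρ Qbar Q D ∧
        f = fun ω => (discountedLoss 𝕋 ℱ Q D t X ω : EReal) - penalty P 𝕋 ℱ ρ Q D t ω}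
      (fun ω => (ρ t X ω : EReal))

end Filtered

end ProcessRisk

open ProcessRisk

namespace ProcessRisk

/-! ### Separation of convex sets of bounded functions by measures -/

section Separation

/-! Everything turns on `composed ρ t`, the map X ↦ ρ_t(X_t 1_{s=t} − ρ_{t+1}(X) 1_{s>t}). It is
again a conditional convex risk measure, continuous from above, and its acceptance set is 𝓐_{t,t+1}
+ 𝓐_{t+1} (`acceptanceStep_add_acceptance`). Conditions (i) and (ii) both say that it coincides with
ρ_t.

Penalties are handled as D_t α_t, the essential supremum of undivided conditional losses, attained
along an increasing sequence (`IsLossSup`). Over a sum of acceptance sets this supremum is the first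
one plus the conditional expectation of the second (`IsDecomposition.isLossSup_add`), so the right
side of (iii) is the penalty of `composed ρ t`. Hence (i) gives (iii). With the loss of the one-step
position X_t 1_{s=t} − ρ_{t+1}(X) 1_{s>t} it also gives (iv).

The converses are duality (`ae_le_of_forall_isDecomposition`): if under every Q ⊗ D the losses of X
are at most D_t V plus the penalty, then ρ_t(X) ≤ V. Were this false, the part of X + V on {ρ_t(X) >
V} could be separated from the acceptance set. Continuity from above makes that set closed under
bounded a.e. limits on the product space, and a Krein–Šmulian argument yields a separating measure
rather than a finitely additive functional (`exists_measure_one_le_integral`). The measure is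
normalized to a prescribed marginal on 𝓕_t and pasted at t. It has to be written as Q ⊗ D: the
supermartingale of conditional tail masses factors into a martingale and a predictable decreasing
process, and the martingale becomes a measure Q by an extension theorem resting on the atom
condition (`IsRegularFiltration.exists_extension`).

For the last assertion one member of 𝓠* is fixed and only the fraction 1 − δ of it is replaced after
t. This preserves equivalence, and the inequality (iv) summed over time keeps α_0 finite
(`exists_isEquivFinitePenalty_pasted`). For small δ the strict separation survives, so duality needs
𝓠* only. -/

theorem nonempty_iInter_of_convex_bounded {H : Type*} [NormedAddCommGroup H]
    [InnerProductSpace ℝ H] [CompleteSpace H] (K : ℕ → Set H) (hK : Antitone K)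
    (hne : ∀ n, (K n).Nonempty) (hconv : ∀ n, Convex ℝ (K n)) (hcl : ∀ n, IsClosed (K n))
    (C : ℝ) (hC : ∀ x ∈ K 0, ‖x‖ ≤ C) : (⋂ n, K n).Nonempty := by
  -- The points of least norm have increasing bounded norms, so the parallelogram law makes them a
  -- Cauchy sequence, whose limit lies in every `K n`. This takes the place of weak compactness.
  have hex : ∀ n, ∃ x ∈ K n, ∀ y ∈ K n, ‖x‖ ≤ ‖y‖ := by
    intro n
    obtain ⟨v, hv, hv'⟩ :=
      exists_norm_eq_iInf_of_complete_convex (hne n) (hcl n).isComplete (hconv n) 0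
    refine ⟨v, hv, fun y hy => ?_⟩
    have : (⨅ w : K n, ‖(0 : H) - w‖) ≤ ‖(0 : H) - y‖ :=
      ciInf_le (f := fun w : K n => ‖(0 : H) - w‖) ⟨0, by rintro _ ⟨w, rfl⟩; positivity⟩ ⟨y, hy⟩
    rw [← hv'] at this
    simpa using this
  choose x hx hmin using hex
  have hmono : Monotone fun n => ‖x n‖ ^ 2 := fun i j hij => by
    have := hmin i (x j) (hK hij (hx j))
    dsimp only
    gcongr
  have hbd : BddAbove (Set.range fun n => ‖x n‖ ^ 2) := by
    refine ⟨C ^ 2, ?_⟩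
    rintro _ ⟨n, rfl⟩
    have := hC (x n) (hK (Nat.zero_le n) (hx n))
    dsimp only
    gcongr
  have hlim := tendsto_atTop_ciSup hmono hbd
  have hpar : ∀ i j, i ≤ j → ‖x i - x j‖ ^ 2 ≤ 2 * (‖x j‖ ^ 2 - ‖x i‖ ^ 2) := by
    intro i j hij
    have hmid : (1 / 2 : ℝ) • x i + (1 / 2 : ℝ) • x j ∈ K i :=
      hconv i (hx i) (hK hij (hx j)) (by norm_num) (by norm_num) (by norm_num)
    have h1 := hmin i _ hmid
    rw [← smul_add, norm_smul] at h1
    have h2 := parallelogram_law_with_norm ℝ (x i) (x j)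
    norm_num at h1
    nlinarith [norm_nonneg (x i), norm_nonneg (x i + x j)]
  have hcau : CauchySeq x := by
    rw [Metric.cauchySeq_iff']
    intro ε hε
    have h1 : ∀ᶠ n in atTop, (⨆ n, ‖x n‖ ^ 2) - ε ^ 2 / 2 < ‖x n‖ ^ 2 :=
      hlim.eventually (lt_mem_nhds (by linarith [pow_pos hε 2]))
    obtain ⟨N, hN⟩ := h1.exists
    refine ⟨N, fun n hn => ?_⟩
    have h2 := hpar N n hn
    have h3 : ‖x n‖ ^ 2 ≤ ⨆ n, ‖x n‖ ^ 2 := le_ciSup hbd n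
    rw [dist_comm, dist_eq_norm]
    refine lt_of_pow_lt_pow_left₀ 2 hε.le ?_
    linarith
  obtain ⟨y, hy⟩ := cauchySeq_tendsto_of_complete hcau
  refine ⟨y, Set.mem_iInter.2 fun n => ?_⟩
  exact (hcl n).mem_of_tendsto hy ((eventually_ge_atTop n).mono fun j hj => hK hj (hx j))

variable {S : Type*} [MeasurableSpace S] {m : Measure S}

/-- The bounded functions are viewed in L². An L²-convergent sequence has an a.e. convergent
subsequence, so `hcl` gives closedness in norm; applied to constant sequences it also allows a
change of representative. -/
theorem nonempty_iInter_of_closed_ae [IsProbabilityMeasure m] (K : ℕ → Set (S → ℝ))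
    (hK : Antitone K) (C : ℝ) (hmeas : ∀ f ∈ K 0, Measurable f)
    (hbdd : ∀ f ∈ K 0, ∀ᵐ x ∂m, |f x| ≤ C)
    (hne : ∀ n, (K n).Nonempty) (hconv : ∀ n, Convex ℝ (K n))
    (hcl : ∀ (n : ℕ) (f : ℕ → S → ℝ) (g : S → ℝ), (∀ k, f k ∈ K n) → Measurable g →
      (∀ᵐ x ∂m, Tendsto (fun k => f k x) atTop (𝓝 (g x))) → g ∈ K n) :
    (⋂ n, K n).Nonempty := by
  have hL : ∀ f ∈ K 0, MemLp f 2 m := fun f hf =>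
    MemLp.of_bound (hmeas f hf).aestronglyMeasurable C (hbdd f hf)
  let K' : ℕ → Set (Lp ℝ 2 m) := fun n => {F | ∃ f ∈ K n, f =ᵐ[m] F}
  have hcl' : ∀ n, ∀ F ∈ K' n, (F : S → ℝ) ∈ K n := by
    rintro n F ⟨f, hf, hfF⟩
    refine hcl n (fun _ => f) F (fun _ => hf) (Lp.stronglyMeasurable F).measurable ?_
    filter_upwards [hfF] with x hx
    rw [hx]
    exact tendsto_const_nhds
  suffices h : (⋂ n, K' n).Nonempty by
    obtain ⟨F, hF⟩ := h
    exact ⟨F, Set.mem_iInter.2 fun n => hcl' n F (Set.mem_iInter.1 hF n)⟩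
  refine nonempty_iInter_of_convex_bounded K' ?_ ?_ ?_ ?_ |C| ?_
  · rintro i j hij F ⟨f, hf, hfF⟩
    exact ⟨f, hK hij hf, hfF⟩
  · intro n
    obtain ⟨f, hf⟩ := hne n
    exact ⟨(hL f (hK (Nat.zero_le n) hf)).toLp f, f, hf, (MemLp.coeFn_toLp _).symm⟩
  · rintro n F ⟨f, hf, hfF⟩ G ⟨g, hg, hgG⟩ a b ha hb hab
    refine ⟨a • f + b • g, hconv n hf hg ha hb hab, ?_⟩
    filter_upwards [hfF, hgG, Lp.coeFn_add (a • F) (b • G), Lp.coeFn_smul a F, Lp.coeFn_smul b G]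
      with x h1 h2 h3 h4 h5
    refine Eq.trans ?_ h3.symm
    simp only [Pi.add_apply, Pi.smul_apply, h4, h5, h1, h2]
  · intro n
    refine isClosed_of_closure_subset fun F hF => ?_
    obtain ⟨G, hG, hGF⟩ := mem_closure_iff_seq_limit.1 hF
    obtain ⟨ns, hns, hlim⟩ := (tendstoInMeasure_of_tendsto_Lp hGF).exists_seq_tendsto_ae
    exact ⟨F, hcl n (fun k => G (ns k)) F (fun k => hcl' n _ (hG _))
      (Lp.stronglyMeasurable F).measurable hlim, ae_eq_refl _⟩
  · rintro F ⟨f, hf, hfF⟩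
    refine Lp.norm_le_of_ae_bound (abs_nonneg C) ?_ |>.trans ?_
    · filter_upwards [hbdd f hf, hfF] with x h1 h2
      rw [← h2, Real.norm_eq_abs]
      exact h1.trans (le_abs_self C)
    · simp [measureUnivNNReal]

/-- A bounded function all of whose `L^p`-norms are bounded by `c` is bounded by `c`. -/
theorem ae_abs_le_of_eLpNorm_le [IsProbabilityMeasure m] {f : S → ℝ} (hf : Measurable f) {c : ℝ}
    (hc : 0 ≤ c)
    (h : ∀ p : ℕ, eLpNorm f ((p + 1 : ℕ) : ℝ≥0∞) m ≤ ENNReal.ofReal c) : ∀ᵐ x ∂m, |f x| ≤ c := by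
  -- Markov's inequality for |f|^(p+1) bounds this measure by (c/d)^(p+1), which tends to 0 as p
  -- grows.
  have key : ∀ d : ℝ, c < d → m {x | d ≤ |f x|} = 0 := by
    intro d hd
    have hd0 : 0 < d := hc.trans_lt hd
    have h1 : ∀ p : ℕ, m {x | d ≤ |f x|} ≤ (ENNReal.ofReal (c / d)) ^ (p + 1) := by
      intro p
      have h2 := mul_meas_ge_le_pow_eLpNorm' m (p := ((p + 1 : ℕ) : ℝ≥0∞)) (by simp)
        (by exact ENNReal.natCast_ne_top _) hf.aestronglyMeasurable (ENNReal.ofReal d)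
      have h3 : {x | ENNReal.ofReal d ≤ (‖f x‖₊ : ℝ≥0∞)} = {x | d ≤ |f x|} := by
        ext x
        rw [Set.mem_ofPred_eq, Set.mem_ofPred_eq, ← enorm_eq_nnnorm, ← ofReal_norm,
          ENNReal.ofReal_le_ofReal_iff (norm_nonneg _), Real.norm_eq_abs]
      have h4 : m {x | d ≤ |f x|} * ENNReal.ofReal d ^ (p + 1) ≤ ENNReal.ofReal c ^ (p + 1) := by
        rw [← h3, mul_comm]
        have h5 := h2.trans (ENNReal.rpow_le_rpow (h p) (by simp))
        rw [ENNReal.toReal_natCast, ENNReal.rpow_natCast, ENNReal.rpow_natCast] at h5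
        exact h5
      rw [ENNReal.ofReal_div_of_pos hd0, div_eq_mul_inv, mul_pow, ← ENNReal.inv_pow, ← div_eq_mul_inv]
      refine (ENNReal.le_div_iff_mul_le (Or.inl ?_) (Or.inl ?_)).2 h4
      · exact (ENNReal.pow_pos (ENNReal.ofReal_pos.2 hd0) _).ne'
      · exact ENNReal.pow_ne_top ENNReal.ofReal_ne_top
    have hlt : ENNReal.ofReal (c / d) < 1 := by
      rw [ENNReal.ofReal_lt_one]
      exact (div_lt_one hd0).2 hd
    have h2 : Tendsto (fun p : ℕ => ENNReal.ofReal (c / d) ^ (p + 1)) atTop (𝓝 0) :=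
      (tendsto_add_atTop_iff_nat 1).2 (ENNReal.tendsto_pow_atTop_nhds_zero_of_lt_one hlt)
    exact le_antisymm (ge_of_tendsto' h2 h1) zero_le
  have : ∀ᵐ x ∂m, ∀ n : ℕ, ¬ (c + 1 / ((n : ℝ) + 1) ≤ |f x|) := by
    refine ae_all_iff.2 fun n => ?_
    rw [ae_iff]
    simp only [not_not]
    exact key _ (by have : (0 : ℝ) < 1 / ((n : ℝ) + 1) := by positivity
                    linarith)
  filter_upwards [this] with x hx
  refine le_of_forall_pos_lt_add fun ε hε => ?_
  obtain ⟨n, hn⟩ := exists_nat_one_div_lt hε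
  have := not_le.1 (hx n)
  linarith

/-- If a convex, upward solid set of bounded functions is closed under bounded almost sure limits
and does not contain `0`, then membership is controlled by countably many `L^p`-norms. -/
theorem exists_seq_eLpNorm_not_le [IsProbabilityMeasure m] {𝒞 : Set (S → ℝ)}
    (hmeas : ∀ f ∈ 𝒞, Measurable f) (hconv : Convex ℝ 𝒞)
    (hclosed : ∀ (f : ℕ → S → ℝ) (g : S → ℝ) (C : ℝ), (∀ n, f n ∈ 𝒞) →
      (∀ n, ∀ᵐ x ∂m, |f n x| ≤ C) → Measurable g →
      (∀ᵐ x ∂m, Tendsto (fun n => f n x) atTop (𝓝 (g x))) → g ∈ 𝒞)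
    (h0 : (0 : S → ℝ) ∉ 𝒞) :
    ∃ (r : ℝ) (p : ℕ → ℕ), 0 < r ∧ ∀ (n : ℕ), ∀ f ∈ 𝒞, (∀ᵐ x ∂m, |f x| ≤ r * (n + 1)) →
      ∃ k < n, ¬ eLpNorm f ((p k + 1 : ℕ) : ℝ≥0∞) m ≤ ENNReal.ofReal (r * (k + 1)) := by
  -- Otherwise 𝒞 would contain functions of arbitrarily small supremum norm, and closedness would
  -- put 0 into 𝒞.
  obtain ⟨r, hr, hr'⟩ : ∃ r : ℝ, 0 < r ∧ ∀ f ∈ 𝒞, ¬ ∀ᵐ x ∂m, |f x| ≤ r := by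
    by_contra! hcon
    have h1 : ∀ n : ℕ, ∃ f ∈ 𝒞, ∀ᵐ x ∂m, |f x| ≤ 1 / ((n : ℝ) + 1) := fun n =>
      hcon _ (by positivity)
    choose f hf hfb using h1
    refine h0 (hclosed f 0 1 hf (fun n => ?_) measurable_zero ?_)
    · filter_upwards [hfb n] with x hx
      refine hx.trans ?_
      rw [div_le_one (by positivity)]
      linarith [(n.cast_nonneg : (0 : ℝ) ≤ n)]
    · filter_upwards [ae_all_iff.2 hfb] with x hx
      exact squeeze_zero_norm hx tendsto_one_div_add_atTop_nhds_zero_nat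
  let good : ℕ → (ℕ → ℕ) → Prop := fun n p => ∀ f ∈ 𝒞, (∀ᵐ x ∂m, |f x| ≤ r * (n + 1)) →
      ∃ k < n, ¬ eLpNorm f ((p k + 1 : ℕ) : ℝ≥0∞) m ≤ ENNReal.ofReal (r * (k + 1))
  have good_congr : ∀ n p q, (∀ k < n, p k = q k) → good n p → good n q := by
    intro n p q hpq hp f hf hfb
    obtain ⟨k, hk, hk'⟩ := hp f hf hfb
    exact ⟨k, hk, by rwa [hpq k hk] at hk'⟩
  -- Krein–Šmulian step. The first n exponents exclude all members of 𝒞 bounded by r(n+1). If no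
  -- exponent q worked at the next level, the sets `K q` would be nonempty, convex, closed and
  -- decreasing in q. A common point would have all its L^p-norms at most r(n+1), hence be bounded
  -- by r(n+1), which `good n p` forbids.
  have step : ∀ n p, good n p → ∃ q, good (n + 1) (Function.update p n q) := by
    intro n p hp
    by_contra! hcon
    let K : ℕ → Set (S → ℝ) := fun q => {f | f ∈ 𝒞 ∧ (∀ᵐ x ∂m, |f x| ≤ r * ((n + 1 : ℕ) + 1)) ∧
      (∀ k < n, eLpNorm f ((p k + 1 : ℕ) : ℝ≥0∞) m ≤ ENNReal.ofReal (r * (k + 1))) ∧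
      eLpNorm f ((q + 1 : ℕ) : ℝ≥0∞) m ≤ ENNReal.ofReal (r * (n + 1))}
    have hLp_conv : ∀ (q : ℕ) (c : ℝ≥0∞) (f g : S → ℝ), f ∈ 𝒞 → g ∈ 𝒞 →
        eLpNorm f ((q + 1 : ℕ) : ℝ≥0∞) m ≤ c → eLpNorm g ((q + 1 : ℕ) : ℝ≥0∞) m ≤ c →
        ∀ a b : ℝ, 0 ≤ a → 0 ≤ b → a + b = 1 →
        eLpNorm (a • f + b • g) ((q + 1 : ℕ) : ℝ≥0∞) m ≤ c := by
      intro q c f g hf hg h1 h2 a b ha hb hab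
      refine (eLpNorm_add_le ((hmeas f hf).const_smul a).aestronglyMeasurable
        ((hmeas g hg).const_smul b).aestronglyMeasurable ?_).trans ?_
      · exact_mod_cast Nat.le_add_left 1 q
      · rw [eLpNorm_const_smul, eLpNorm_const_smul]
        calc ‖a‖ₑ * eLpNorm f ((q + 1 : ℕ) : ℝ≥0∞) m + ‖b‖ₑ * eLpNorm g ((q + 1 : ℕ) : ℝ≥0∞) m
            ≤ ‖a‖ₑ * c + ‖b‖ₑ * c := by gcongr
          _ = c := by
            rw [← add_mul, Real.enorm_of_nonneg ha, Real.enorm_of_nonneg hb,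
              ← ENNReal.ofReal_add ha hb, hab, ENNReal.ofReal_one, one_mul]
    have hLp_lim : ∀ (q : ℕ) (c : ℝ≥0∞) (f : ℕ → S → ℝ) (g : S → ℝ), (∀ k, f k ∈ 𝒞) →
        (∀ k, eLpNorm (f k) ((q + 1 : ℕ) : ℝ≥0∞) m ≤ c) →
        (∀ᵐ x ∂m, Tendsto (fun k => f k x) atTop (𝓝 (g x))) →
        eLpNorm g ((q + 1 : ℕ) : ℝ≥0∞) m ≤ c := by
      intro q c f g hf h1 h2
      refine (Lp.eLpNorm_lim_le_liminf_eLpNorm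
        (fun k => (hmeas _ (hf k)).aestronglyMeasurable) g h2).trans ?_
      exact liminf_le_of_le (by isBoundedDefault) fun b hb => by
        obtain ⟨k, hk⟩ := hb.exists
        exact hk.trans (h1 k)
    suffices h : (⋂ q, K q).Nonempty by
      obtain ⟨f, hf⟩ := h
      have hf' := Set.mem_iInter.1 hf
      have hfb := ae_abs_le_of_eLpNorm_le (hmeas f (hf' 0).1) (c := r * (n + 1)) (by positivity)
        fun q => (hf' q).2.2.2
      obtain ⟨k, hk, hk'⟩ := hp f (hf' 0).1 hfb
      exact hk' ((hf' 0).2.2.1 k hk)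
    refine nonempty_iInter_of_closed_ae (m := m) K ?_ (r * ((n + 1 : ℕ) + 1))
      (fun f hf => hmeas f hf.1) (fun f hf => hf.2.1) ?_ ?_ ?_
    · rintro i j hij f ⟨h1, h2, h3, h4⟩
      refine ⟨h1, h2, h3, (eLpNorm_le_eLpNorm_of_exponent_le ?_
        (hmeas f h1).aestronglyMeasurable).trans h4⟩
      exact_mod_cast Nat.succ_le_succ hij
    · intro q
      have h1 := hcon q
      simp only [good, not_forall, not_exists, not_and, not_not] at h1
      obtain ⟨f, hf, hfb, h2⟩ := h1
      refine ⟨f, hf, hfb, fun k hk => ?_, ?_⟩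
      · have := h2 k (hk.trans (Nat.lt_succ_self n))
        rwa [Function.update_of_ne hk.ne] at this
      · have := h2 n (Nat.lt_succ_self n)
        rwa [Function.update_self] at this
    · rintro q f ⟨h1, h2, h3, h4⟩ g ⟨h1', h2', h3', h4'⟩ a b ha hb hab
      refine ⟨hconv h1 h1' ha hb hab, ?_, fun k hk => ?_, ?_⟩
      · filter_upwards [h2, h2'] with x hx hx'
        calc |a * f x + b * g x| ≤ |a * f x| + |b * g x| := abs_add_le _ _
          _ = a * |f x| + b * |g x| := by rw [abs_mul, abs_mul, abs_of_nonneg ha, abs_of_nonneg hb]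
          _ ≤ a * (r * ((n + 1 : ℕ) + 1)) + b * (r * ((n + 1 : ℕ) + 1)) := by gcongr
          _ = _ := by rw [← add_mul, hab, one_mul]
      · exact hLp_conv _ _ f g h1 h1' (h3 k hk) (h3' k hk) a b ha hb hab
      · exact hLp_conv _ _ f g h1 h1' h4 h4' a b ha hb hab
    · intro q f g hf hg hlim
      refine ⟨hclosed f g _ (fun k => (hf k).1) (fun k => (hf k).2.1) hg hlim, ?_,
        fun k hk => ?_, ?_⟩
      · filter_upwards [hlim, ae_all_iff.2 fun k => (hf k).2.1] with x hx hx'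
        exact le_of_tendsto' hx.abs hx'
      · exact hLp_lim _ _ f g (fun k => (hf k).1) (fun j => (hf j).2.2.1 k hk) hlim
      · exact hLp_lim _ _ f g (fun k => (hf k).1) (fun j => (hf j).2.2.2) hlim
  choose! Q hQ using step
  -- Stage n + 1 alters coordinate n only, so the stages stabilize to one sequence of exponents.
  let s : ℕ → ℕ → ℕ := fun n => Nat.rec (fun _ => 0) (fun n ps => Function.update ps n (Q n ps)) n
  have hs : ∀ n, s (n + 1) = Function.update (s n) n (Q n (s n)) := fun n => rfl
  have hgood : ∀ n, good n (s n) := by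
    intro n
    induction n with
    | zero => exact fun f hf hfb => absurd (by simpa using hfb) (hr' f hf)
    | succ n ih => rw [hs]; exact hQ n _ ih
  have heq : ∀ n, ∀ k < n, s n k = s (k + 1) k := by
    intro n
    induction n with
    | zero => simp
    | succ n ih =>
      intro k hk
      rcases Nat.lt_succ_iff_lt_or_eq.1 hk with h | rfl
      · rw [hs, Function.update_of_ne h.ne, ih k h]
      · rfl
  exact ⟨r, fun k => s (k + 1) k, hr, fun n => good_congr n _ _ (heq n) (hgood n)⟩

/-- A positive linear functional on `L^∞` that is continuous from above at `∅` is the integral with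
respect to a finite measure. -/
theorem exists_measure_of_functional [IsProbabilityMeasure m] (φ : Lp ℝ ∞ m →L[ℝ] ℝ)
    (hpos : ∀ F : Lp ℝ ∞ m, 0 ≤ᵐ[m] F → 0 ≤ φ F)
    (hcont : ∀ (E : ℕ → Set S) (hE : ∀ n, MeasurableSet (E n)), Antitone E → ⋂ n, E n = ∅ →
      Tendsto (fun n => φ (indicatorConstLp ∞ (hE n) (measure_ne_top m _) 1)) atTop (𝓝 0)) :
    ∃ ν : Measure S, IsFiniteMeasure ν ∧ ν ≪ m ∧
      ∀ (f : S → ℝ) (hf : MemLp f ∞ m), Measurable f → ∫ x, f x ∂ν = φ (hf.toLp f) := by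
  let I : ∀ E, MeasurableSet E → Lp ℝ ∞ m := fun E hE =>
    indicatorConstLp ∞ hE (measure_ne_top m _) 1
  have hI0 : ∀ E hE, 0 ≤ φ (I E hE) := fun E hE => by
    refine hpos _ ?_
    filter_upwards [indicatorConstLp_coeFn (p := ∞) (hs := hE) (hμs := measure_ne_top m E)
      (c := (1 : ℝ))] with x hx
    rw [hx]
    exact Set.indicator_nonneg (fun _ _ => zero_le_one) x
  have hIcongr : ∀ E F hE hF, E = F → I E hE = I F hF := by
    rintro E F hE hF rfl; rfl
  have hIunion : ∀ E F hE hF hEF, Disjoint E F → φ (I (E ∪ F) hEF) = φ (I E hE) + φ (I F hF) := by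
    intro E F hE hF hEF hdisj
    rw [← map_add]
    congr 1
    exact indicatorConstLp_disjoint_union hE hF (measure_ne_top m _) (measure_ne_top m _) hdisj 1
  -- The tails of a disjoint union decrease to ∅, so `hcont` removes the remainder left by finite
  -- additivity.
  have hsum : ∀ (E : ℕ → Set S) (hE : ∀ n, MeasurableSet (E n)), Pairwise (Function.onFun Disjoint E) →
      HasSum (fun n => φ (I (E n) (hE n))) (φ (I (⋃ n, E n) (.iUnion hE))) := by
    intro E hE hd
    rw [hasSum_iff_tendsto_nat_of_nonneg (fun n => hI0 _ _)]
    have hT : ∀ n, MeasurableSet (⋃ k, E (k + n)) := fun n => .iUnion fun k => hE _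
    have hanti : Antitone fun n => ⋃ k, E (k + n) := by
      refine antitone_nat_of_succ_le fun n => Set.iUnion_subset fun k => ?_
      refine Set.subset_iUnion_of_subset (k + 1) (Eq.subset ?_)
      congr 1
      omega
    have hempty : ⋂ n, ⋃ k, E (k + n) = ∅ := by
      refine Set.eq_empty_iff_forall_notMem.2 fun x hx => ?_
      simp only [Set.mem_iInter, Set.mem_iUnion] at hx
      obtain ⟨k, hk⟩ := hx 0
      obtain ⟨j, hj⟩ := hx (k + 1)
      exact Set.disjoint_left.1 (hd (by omega : k + 0 ≠ j + (k + 1))) hk hj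
    have hsplit : ∀ n, φ (I (⋃ n, E n) (.iUnion hE)) =
        ∑ i ∈ Finset.range n, φ (I (E i) (hE i)) + φ (I _ (hT n)) := by
      intro n
      induction n with
      | zero => simp
      | succ n ih =>
        rw [ih, Finset.sum_range_succ, add_assoc, ← hIunion (E n) _ (hE n) (hT (n + 1))
          ((hE n).union (hT (n + 1)))]
        · congr 2
          refine hIcongr _ _ _ _ ?_
          ext x
          simp only [Set.mem_iUnion, Set.mem_union]
          constructor
          · rintro ⟨k, hk⟩
            cases k with
            | zero => left; simpa using hk
            | succ k => right; exact ⟨k, by rwa [show k + (n + 1) = k + 1 + n by omega]⟩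
          · rintro (h | ⟨k, hk⟩)
            · exact ⟨0, by simpa using h⟩
            · exact ⟨k + 1, by rwa [show k + 1 + n = k + (n + 1) by omega]⟩
        · refine Set.disjoint_iUnion_right.2 fun k => hd (by omega)
    have h1 := (hcont _ hT hanti hempty).const_sub (φ (I (⋃ n, E n) (.iUnion hE)))
    rw [sub_zero] at h1
    refine h1.congr fun n => ?_
    rw [hsplit n]
    simp [I]
  let ν : Measure S := Measure.ofMeasurable (fun E hE => ENNReal.ofReal (φ (I E hE)))
    (by
      have : I ∅ MeasurableSet.empty = 0 := indicatorConstLp_empty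
      simp [this])
    (by
      intro E hE hd
      have h1 := hsum E hE hd
      rw [← h1.tsum_eq, ENNReal.ofReal_tsum_of_nonneg (fun n => hI0 _ _) h1.summable])
  have hν : ∀ E (hE : MeasurableSet E), ν E = ENNReal.ofReal (φ (I E hE)) := fun E hE =>
    Measure.ofMeasurable_apply E hE
  have hfin : IsFiniteMeasure ν := ⟨by rw [hν _ .univ]; exact ENNReal.ofReal_lt_top⟩
  have hac : ν ≪ m := by
    refine Measure.AbsolutelyContinuous.mk fun E hE h => ?_
    have : I E hE = 0 := by
      rw [Lp.eq_zero_iff_ae_eq_zero]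
      refine (indicatorConstLp_coeFn (p := ∞) (hs := hE) (hμs := measure_ne_top m E)
        (c := (1 : ℝ))).trans ?_
      exact indicator_meas_zero h
    rw [hν E hE, this, map_zero, ENNReal.ofReal_zero]
  refine ⟨ν, hfin, hac, ?_⟩
  have hsimple : ∀ (g : SimpleFunc S ℝ) (hg : MemLp g ∞ m), ∫ x, g x ∂ν = φ (hg.toLp g) := by
    intro g
    induction g using SimpleFunc.induction with
    | const c hs =>
      rename_i E
      intro hg
      have h1 : hg.toLp _ = c • I E hs := by
        rw [Lp.ext_iff]
        filter_upwards [hg.coeFn_toLp, Lp.coeFn_smul c (I E hs),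
          indicatorConstLp_coeFn (p := ∞) (hs := hs) (hμs := measure_ne_top m E) (c := (1 : ℝ))]
          with x h1 h2 h3
        rw [h1, h2, Pi.smul_apply, h3]
        by_cases hx : x ∈ E <;> simp [hx]
      rw [h1, map_smul]
      simp only [SimpleFunc.coe_piecewise, SimpleFunc.coe_const, Set.piecewise_eq_indicator,
        Function.const_zero]
      rw [integral_indicator hs]
      simp only [Function.const_apply, integral_const, MeasurableSet.univ, measureReal_restrict_apply,
        Set.univ_inter]
      rw [measureReal_def, hν E hs, ENNReal.toReal_ofReal (hI0 _ _)]
      simp [mul_comm]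
    | add hd hg1 hg2 =>
      rename_i g1 g2
      intro hg
      have hb : ∀ g : SimpleFunc S ℝ, MemLp g ∞ m := fun g => by
        obtain ⟨C, hC⟩ := g.exists_forall_norm_le
        exact memLp_top_of_bound g.aestronglyMeasurable C (ae_of_all _ hC)
      have h1 : hg.toLp _ = (hb g1).toLp _ + (hb g2).toLp _ := by
        rw [← MemLp.toLp_add]
        rfl
      rw [h1, map_add, ← hg1, ← hg2, ← integral_add]
      · rfl
      · exact SimpleFunc.integrable_of_isFiniteMeasure g1
      · exact SimpleFunc.integrable_of_isFiniteMeasure g2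
  intro f hf hfm
  obtain ⟨C, hC⟩ : ∃ C : ℝ, ∀ᵐ x ∂m, |f x| ≤ C := by
    refine ⟨(eLpNorm f ∞ m).toReal, ?_⟩
    filter_upwards [enorm_ae_le_eLpNormEssSup f m] with x hx
    rw [← Real.norm_eq_abs, ← toReal_enorm]
    exact ENNReal.toReal_mono hf.2.ne (by rwa [eLpNorm_exponent_top])
  have hfint : Integrable f ν := Integrable.of_bound hfm.aestronglyMeasurable C (hac.ae_le hC)
  refine eq_of_forall_dist_le fun ε hε => ?_
  obtain ⟨δ, hδ, hδε⟩ : ∃ δ : ℝ, 0 < δ ∧ δ * (ν.real Set.univ + ‖φ‖) ≤ ε := by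
    refine ⟨ε / (ν.real Set.univ + ‖φ‖ + 1), by positivity, ?_⟩
    rw [div_mul_eq_mul_div, div_le_iff₀ (by positivity)]
    nlinarith
  -- Truncation at the a.e. bound and rounding down to multiples of δ give a simple function within
  -- δ of `f`.
  let F : S → ℝ := fun x => δ * ⌊(max (-C) (min (f x) C)) / δ⌋
  have hFmeas : Measurable F := by
    have : Measurable fun x => max (-C) (min (f x) C) / δ :=
      ((measurable_const.max (hfm.min measurable_const))).div_const δ
    exact measurable_const.mul (measurable_from_top.comp this.floor)
  have hFfin : (Set.range F).Finite := by
    refine ((Set.finite_Icc ⌊-(|C|) / δ⌋ ⌊|C| / δ⌋).image fun z : ℤ => δ * (z : ℝ)).subset ?_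
    rintro _ ⟨x, rfl⟩
    refine ⟨⌊(max (-C) (min (f x) C)) / δ⌋, ⟨?_, ?_⟩, rfl⟩
    · refine Int.floor_le_floor (div_le_div_of_nonneg_right ?_ hδ.le)
      exact (neg_le_neg (le_abs_self C)).trans (le_max_left _ _)
    · refine Int.floor_le_floor (div_le_div_of_nonneg_right ?_ hδ.le)
      exact max_le (neg_le_abs C) ((min_le_right _ _).trans (le_abs_self C))
  let g : SimpleFunc S ℝ := ⟨F, fun y => hFmeas (measurableSet_singleton y), hFfin⟩
  have hg : MemLp g ∞ m := by
    obtain ⟨C, hC⟩ := g.exists_forall_norm_le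
    exact memLp_top_of_bound g.aestronglyMeasurable C (ae_of_all _ hC)
  have hfg : ∀ᵐ x ∂m, ‖f x - g x‖ ≤ δ := by
    filter_upwards [hC] with x hx
    have h1 : max (-C) (min (f x) C) = f x := by
      rw [min_eq_left (abs_le.1 hx).2, max_eq_right (abs_le.1 hx).1]
    have h2 : g x = δ * ⌊f x / δ⌋ := by
      change F x = _
      simp only [F, h1]
    rw [h2, Real.norm_eq_abs, abs_le]
    have h3 := Int.floor_le (f x / δ)
    have h4 := Int.lt_floor_add_one (f x / δ)
    rw [le_div_iff₀ hδ] at h3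
    rw [div_lt_iff₀ hδ] at h4
    constructor <;> nlinarith
  have h1 : |∫ x, f x ∂ν - ∫ x, g x ∂ν| ≤ δ * ν.real Set.univ := by
    rw [← integral_sub hfint (SimpleFunc.integrable_of_isFiniteMeasure g)]
    exact norm_integral_le_of_norm_le_const (hac.ae_le hfg)
  have h2 : |φ (hf.toLp f) - φ (hg.toLp g)| ≤ ‖φ‖ * δ := by
    rw [← map_sub, ← MemLp.toLp_sub]
    refine (φ.le_opNorm _).trans ?_
    gcongr
    refine Lp.norm_le_of_ae_bound hδ.le ?_ |>.trans ?_
    · filter_upwards [(hf.sub hg).coeFn_toLp, hfg] with x h3 h4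
      rw [h3]
      exact h4
    · simp
  rw [hsimple g hg] at h1
  rw [Real.dist_eq]
  have h3 := abs_sub_le (∫ x, f x ∂ν) (φ (hg.toLp g)) (φ (hf.toLp f))
  rw [abs_sub_comm (φ (hg.toLp g))] at h3
  linarith

/-- Separation of `0` from an upward solid convex set of bounded functions which is closed under
bounded almost sure limits, by a finite measure. -/
theorem exists_measure_one_le_integral [IsProbabilityMeasure m] {𝒞 : Set (S → ℝ)}
    (hmeas : ∀ f ∈ 𝒞, Measurable f) (hbdd : ∀ f ∈ 𝒞, ∃ C : ℝ, ∀ᵐ x ∂m, |f x| ≤ C)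
    (hconv : Convex ℝ 𝒞)
    (hsolid : ∀ f ∈ 𝒞, ∀ g : S → ℝ, Measurable g → (∃ C : ℝ, ∀ᵐ x ∂m, |g x| ≤ C) →
      (∀ᵐ x ∂m, f x ≤ g x) → g ∈ 𝒞)
    (hclosed : ∀ (f : ℕ → S → ℝ) (g : S → ℝ) (C : ℝ), (∀ n, f n ∈ 𝒞) →
      (∀ n, ∀ᵐ x ∂m, |f n x| ≤ C) → Measurable g →
      (∀ᵐ x ∂m, Tendsto (fun n => f n x) atTop (𝓝 (g x))) → g ∈ 𝒞)
    (hne : 𝒞.Nonempty) (h0 : (0 : S → ℝ) ∉ 𝒞) :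
    ∃ ν : Measure S, IsFiniteMeasure ν ∧ ν ≪ m ∧ ∀ f ∈ 𝒞, 1 ≤ ∫ x, f x ∂ν := by
  obtain ⟨r, p, hr, hp⟩ := exists_seq_eLpNorm_not_le hmeas hconv hclosed h0
  have hL : ∀ f ∈ 𝒞, MemLp f ∞ m := fun f hf => by
    obtain ⟨C, hC⟩ := hbdd f hf
    exact memLp_top_of_bound (hmeas f hf).aestronglyMeasurable C hC
  -- This set contains the L^∞-ball of radius r, so Hahn–Banach applies to it, and it misses 𝒞 by
  -- the choice of exponents. Being cut out by L^p-norms with finite p, it forces the separating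
  -- functional to be countably additive.
  let s : Set (Lp ℝ ∞ m) :=
    {F | ∀ k, eLpNorm F ((p k + 1 : ℕ) : ℝ≥0∞) m ≤ ENNReal.ofReal (r * (k + 1))}
  let t : Set (Lp ℝ ∞ m) := {F | ∃ f ∈ 𝒞, f =ᵐ[m] F}
  have hp1 : ∀ k, (1 : ℝ≥0∞) ≤ ((p k + 1 : ℕ) : ℝ≥0∞) := fun k => by
    exact_mod_cast Nat.le_add_left 1 _
  have hsconv : Convex ℝ s := by
    intro F hF G hG a b ha hb hab k
    rw [eLpNorm_congr_ae (Lp.coeFn_add (a • F) (b • G))]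
    refine (eLpNorm_add_le (Lp.aestronglyMeasurable _) (Lp.aestronglyMeasurable _) (hp1 k)).trans ?_
    rw [eLpNorm_congr_ae (Lp.coeFn_smul a F), eLpNorm_congr_ae (Lp.coeFn_smul b G),
      eLpNorm_const_smul, eLpNorm_const_smul]
    calc ‖a‖ₑ * eLpNorm F ((p k + 1 : ℕ) : ℝ≥0∞) m + ‖b‖ₑ * eLpNorm G ((p k + 1 : ℕ) : ℝ≥0∞) m
        ≤ ‖a‖ₑ * ENNReal.ofReal (r * (k + 1)) + ‖b‖ₑ * ENNReal.ofReal (r * (k + 1)) := by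
          gcongr
          exacts [hF k, hG k]
      _ = ENNReal.ofReal (r * (k + 1)) := by
        rw [← add_mul, Real.enorm_of_nonneg ha, Real.enorm_of_nonneg hb,
          ← ENNReal.ofReal_add ha hb, hab, ENNReal.ofReal_one, one_mul]
  have hnorm : ∀ (F : Lp ℝ ∞ m) k, eLpNorm F ((p k + 1 : ℕ) : ℝ≥0∞) m ≤ ENNReal.ofReal ‖F‖ := by
    intro F k
    rw [Lp.norm_def, ENNReal.ofReal_toReal (Lp.eLpNorm_ne_top F)]
    exact eLpNorm_le_eLpNorm_of_exponent_le le_top (Lp.aestronglyMeasurable F)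
  have hball : Metric.ball (0 : Lp ℝ ∞ m) r ⊆ s := by
    intro F hF k
    rw [mem_ball_zero_iff] at hF
    refine (hnorm F k).trans (ENNReal.ofReal_le_ofReal (hF.le.trans ?_))
    have : (0 : ℝ) ≤ k := k.cast_nonneg
    nlinarith
  have hint : (0 : Lp ℝ ∞ m) ∈ interior s :=
    mem_interior.2 ⟨_, hball, Metric.isOpen_ball, Metric.mem_ball_self hr⟩
  have htconv : Convex ℝ t := by
    rintro F ⟨f, hf, hfF⟩ G ⟨g, hg, hgG⟩ a b ha hb hab
    refine ⟨a • f + b • g, hconv hf hg ha hb hab, ?_⟩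
    filter_upwards [hfF, hgG, Lp.coeFn_add (a • F) (b • G), Lp.coeFn_smul a F, Lp.coeFn_smul b G]
      with x h1 h2 h3 h4 h5
    refine Eq.trans ?_ h3.symm
    simp only [Pi.add_apply, Pi.smul_apply, h4, h5, h1, h2]
  have hdisj : Disjoint s t := by
    refine Set.disjoint_left.2 ?_
    rintro F hF ⟨f, hf, hfF⟩
    obtain ⟨C, hC⟩ := hbdd f hf
    obtain ⟨n, hn⟩ := exists_nat_ge (C / r)
    obtain ⟨k, -, hk⟩ := hp n f hf (by
      filter_upwards [hC] with x hx
      rw [div_le_iff₀ hr] at hn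
      nlinarith)
    exact hk (by rw [eLpNorm_congr_ae hfF]; exact hF k)
  have htne : t.Nonempty := by
    obtain ⟨f, hf⟩ := hne
    exact ⟨(hL f hf).toLp f, f, hf, (MemLp.coeFn_toLp _).symm⟩
  obtain ⟨φ, u, hφ0, hφs, hφt⟩ := geometric_hahn_banach_of_nonempty_interior hsconv htconv
    (hdisj.mono_left interior_subset) ⟨0, hint⟩ htne
  have hu : 0 < u := by
    obtain ⟨F, hF⟩ : ∃ F, 0 < φ F := by
      by_contra! hcon
      refine hφ0 (ContinuousLinearMap.ext fun F => le_antisymm (hcon F) ?_)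
      have := hcon (-F)
      rw [map_neg] at this
      simpa using this
    have hF0 : 0 < ‖F‖ := norm_pos_iff.2 fun h => by simp [h] at hF
    have := hφs ((r / (2 * ‖F‖)) • F) (hball (by
      rw [mem_ball_zero_iff, norm_smul, Real.norm_of_nonneg (by positivity)]
      field_simp
      norm_num))
    rw [map_smul, smul_eq_mul] at this
    exact (by positivity : 0 < r / (2 * ‖F‖) * φ F).trans_le this
  -- If φ F were negative, adding large multiples of F to a member of 𝒞 would stay in 𝒞 by solidity
  -- and push φ below u.
  have hpos : ∀ F : Lp ℝ ∞ m, 0 ≤ᵐ[m] F → 0 ≤ φ F := by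
    intro F hF
    obtain ⟨f, hf⟩ := hne
    by_contra! hneg
    obtain ⟨n, hn⟩ := exists_nat_gt ((φ ((hL f hf).toLp f) - u) / (-φ F))
    rw [div_lt_iff₀ (by linarith)] at hn
    have hmem : (hL f hf).toLp f + (n : ℝ) • F ∈ t := by
      refine ⟨f + (n : ℝ) • ⇑F, hsolid f hf _ ?_ ?_ ?_, ?_⟩
      · exact (hmeas f hf).add ((Lp.stronglyMeasurable F).measurable.const_smul _)
      · have h1 : MemLp (f + (n : ℝ) • ⇑F) ∞ m := (hL f hf).add ((Lp.memLp F).const_smul _)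
        refine ⟨(eLpNorm (f + (n : ℝ) • ⇑F) ∞ m).toReal, ?_⟩
        filter_upwards [enorm_ae_le_eLpNormEssSup (f + (n : ℝ) • ⇑F) m] with x hx
        rw [← Real.norm_eq_abs, ← toReal_enorm]
        exact ENNReal.toReal_mono h1.2.ne (by rwa [eLpNorm_exponent_top])
      · filter_upwards [hF] with x hx
        have : 0 ≤ (n : ℝ) * F x := mul_nonneg n.cast_nonneg hx
        simpa using this
      · filter_upwards [Lp.coeFn_add ((hL f hf).toLp f) ((n : ℝ) • F), (hL f hf).coeFn_toLp,
          Lp.coeFn_smul (n : ℝ) F] with x h1 h2 h3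
        refine Eq.trans ?_ h1.symm
        simp only [Pi.add_apply, h2, h3]
    have := hφt _ hmem
    rw [map_add, map_smul, smul_eq_mul] at this
    linarith
  have hcont : ∀ (E : ℕ → Set S) (hE : ∀ n, MeasurableSet (E n)), Antitone E → ⋂ n, E n = ∅ →
      Tendsto (fun n => φ (indicatorConstLp ∞ (hE n) (measure_ne_top m _) 1)) atTop (𝓝 0) := by
    intro E hE hanti hempty
    have hm0 : Tendsto (fun n => m (E n)) atTop (𝓝 0) := by
      have := tendsto_measure_iInter_atTop (μ := m) (fun n => (hE n).nullMeasurableSet) hanti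
        ⟨0, measure_ne_top m _⟩
      rwa [hempty, measure_empty] at this
    rw [Metric.tendsto_atTop]
    intro ε hε
    -- With this factor, φ(c 1_{E n}) ≤ u reads φ(1_{E n}) ≤ ε/2. For c 1_{E n} to lie in `s`, the
    -- supremum norm c < rK settles all indices k ≥ K, and the finitely many other norms are small
    -- because m(E n) → 0.
    set c : ℝ := 2 * u / ε with hc
    have hc0 : 0 < c := by positivity
    obtain ⟨K, hK⟩ := exists_nat_gt (c / r)
    rw [div_lt_iff₀ hr] at hK
    have hev : ∀ k, ∀ᶠ n in atTop, ENNReal.ofReal c * m (E n) ^ (1 / ((p k + 1 : ℕ) : ℝ)) ≤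
        ENNReal.ofReal (r * (k + 1)) := by
      intro k
      have h1 : Tendsto (fun n => ENNReal.ofReal c * m (E n) ^ (1 / ((p k + 1 : ℕ) : ℝ))) atTop
          (𝓝 (ENNReal.ofReal c * 0 ^ (1 / ((p k + 1 : ℕ) : ℝ)))) := by
        refine ENNReal.Tendsto.const_mul (hm0.ennrpow_const _) (Or.inr ENNReal.ofReal_ne_top)
      rw [ENNReal.zero_rpow_of_pos (by positivity), mul_zero] at h1
      exact (h1.eventually (gt_mem_nhds (ENNReal.ofReal_pos.2 (by positivity)))).mono
        fun n hn => hn.le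
    obtain ⟨N, hN⟩ := eventually_atTop.1
      ((Finset.range K).eventually_all.2 fun k _ => hev k)
    refine ⟨N, fun n hn => ?_⟩
    set F : Lp ℝ ∞ m := indicatorConstLp ∞ (hE n) (measure_ne_top m _) 1 with hF
    have hFpos : 0 ≤ φ F := hpos _ (by
      filter_upwards [indicatorConstLp_coeFn (p := ∞) (hs := hE n) (hμs := measure_ne_top m (E n))
        (c := (1 : ℝ))] with x hx
      rw [hF, hx]
      exact Set.indicator_nonneg (fun _ _ => zero_le_one) x)
    have hmem : c • F ∈ s := by
      intro k
      by_cases hk : k < K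
      · rw [eLpNorm_congr_ae (Lp.coeFn_smul c F), eLpNorm_const_smul,
          eLpNorm_congr_ae (indicatorConstLp_coeFn (p := ∞)), Real.enorm_of_nonneg hc0.le,
          eLpNorm_indicator_const (hE n) (by positivity) (ENNReal.natCast_ne_top _)]
        rw [enorm_one, one_mul, ENNReal.toReal_natCast]
        exact hN n hn k (Finset.mem_range.2 hk)
      · refine (hnorm _ k).trans (ENNReal.ofReal_le_ofReal ?_)
        have h1 : ‖F‖ ≤ 1 := by
          refine Lp.norm_le_of_ae_bound zero_le_one ?_ |>.trans ?_
          · filter_upwards [indicatorConstLp_coeFn (p := ∞) (hs := hE n)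
              (hμs := measure_ne_top m (E n)) (c := (1 : ℝ))] with x hx
            rw [hF, hx]
            by_cases h : x ∈ E n <;> simp [h]
          · simp
        rw [norm_smul, Real.norm_of_nonneg hc0.le]
        have h2 : (K : ℝ) ≤ k := by exact_mod_cast not_lt.1 hk
        nlinarith
    have h1 := hφs _ hmem
    rw [map_smul, smul_eq_mul, hc, div_mul_eq_mul_div, div_le_iff₀ hε] at h1
    rw [Real.dist_eq, sub_zero, abs_of_nonneg hFpos]
    nlinarith
  obtain ⟨ν, hν, hac, hνφ⟩ := exists_measure_of_functional φ hpos hcont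
  refine ⟨ENNReal.ofReal u⁻¹ • ν, ?_, ?_, fun f hf => ?_⟩
  · exact Measure.smul_finite ν ENNReal.ofReal_ne_top
  · exact Measure.AbsolutelyContinuous.smul_left hac _
  · rw [integral_smul_measure, hνφ f (hL f hf) (hmeas f hf),
      ENNReal.toReal_ofReal (inv_nonneg.2 hu.le), smul_eq_mul, ← div_eq_inv_mul, one_le_div₀ hu]
    exact hφt _ ⟨f, hf, (MemLp.coeFn_toLp _).symm⟩

end Separation

/-! ### Extension of consistent probability measures along a regular filtration -/

section Extension

variable {Ω : Type*}

/-- Each ω determines the family `U ω` of Borel sets whose preimage under the isomorphism contains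
ω. It is an ultrafilter of Borel sets closed under countable intersections. On a countably separated
space such a family is concentrated at one point, and this point is π ω. -/
theorem IsSigmaIsomorphicToPolish.exists_coding {m : MeasurableSpace Ω} [Nonempty Ω]
    (h : IsSigmaIsomorphicToPolish m) :
    ∃ (E : Type) (mE : MeasurableSpace E) (_ : StandardBorelSpace E) (_ : Nonempty E)
      (π : Ω → E), Function.Surjective π ∧ m = mE.comap π := by
  obtain ⟨E, tE, hE, ⟨e⟩⟩ := h
  let mE : MeasurableSpace E := borel E
  have : BorelSpace E := ⟨rfl⟩
  have : StandardBorelSpace E := inferInstance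
  let U : Ω → {B : Set E // MeasurableSet[borel E] B} → Prop := fun ω B => ω ∈ (e.symm B).1
  have hUmono : ∀ ω B B', B.1 ⊆ B'.1 → U ω B → U ω B' := fun ω B B' hBB' hB =>
    (show (e.symm B).1 ⊆ (e.symm B').1 from e.symm.monotone hBB') hB
  have hUinter : ∀ ω (B : ℕ → {B : Set E // MeasurableSet[borel E] B}), (∀ n, U ω (B n)) →
      U ω ⟨⋂ n, (B n).1, MeasurableSet.iInter fun n => (B n).2⟩ := by
    intro ω B hB
    let A : {A : Set Ω // MeasurableSet[m] A} :=
      ⟨⋂ n, (e.symm (B n)).1, MeasurableSet.iInter fun n => (e.symm (B n)).2⟩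
    have h1 : e A ≤ ⟨⋂ n, (B n).1, MeasurableSet.iInter fun n => (B n).2⟩ := by
      refine Set.subset_iInter fun n => ?_
      have : e A ≤ e (e.symm (B n)) := e.monotone (Set.iInter_subset _ n)
      rwa [e.apply_symm_apply] at this
    have h2 : A ≤ e.symm ⟨⋂ n, (B n).1, MeasurableSet.iInter fun n => (B n).2⟩ :=
      (e.le_symm_apply).2 h1
    exact h2 (Set.mem_iInter.2 hB)
  have hUempty : ∀ ω, ¬ U ω ⟨∅, MeasurableSet.empty⟩ := by
    intro ω hω
    have h1 : e.symm ⟨∅, MeasurableSet.empty⟩ ≤ ⟨∅, MeasurableSet.empty⟩ :=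
      (e.symm_apply_le).2 (Set.empty_subset _)
    exact h1 hω
  have hUcompl : ∀ ω B, U ω B ∨ U ω ⟨B.1ᶜ, B.2.compl⟩ := by
    intro ω B
    let A : {A : Set Ω // MeasurableSet[m] A} :=
      ⟨(e.symm B).1 ∪ (e.symm ⟨B.1ᶜ, B.2.compl⟩).1, (e.symm _).2.union (e.symm _).2⟩
    have h1 : B ≤ e A := (e.symm_apply_le).1 (show (e.symm B).1 ⊆ A.1 from Set.subset_union_left)
    have h2 : (⟨B.1ᶜ, B.2.compl⟩ : {B : Set E // MeasurableSet[borel E] B}) ≤ e A :=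
      (e.symm_apply_le).1 
      (show (e.symm ⟨B.1ᶜ, B.2.compl⟩).1 ⊆ A.1 from Set.subset_union_right)
    have h3 : e ⟨Set.univ, MeasurableSet.univ⟩ ≤ e A := fun x _ =>
      (em (x ∈ B.1)).elim (fun h => h1 h) fun h => h2 h
    have h4 : (⟨Set.univ, MeasurableSet.univ⟩ : {A : Set Ω // MeasurableSet[m] A}) ≤ A :=
      e.le_iff_le.1 h3
    exact h4 (Set.mem_univ ω)
  have hUinter2 : ∀ ω B B', B.1 ∩ B'.1 = ∅ → U ω B → U ω B' → False := by
    intro ω B B' hBB' hB hB'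
    refine hUempty ω (hUmono ω _ _ ?_ (hUinter ω (fun n => if n = 0 then B else B') fun n => ?_))
    · intro x hx
      have hx' := Set.mem_iInter.1 hx
      have hmem : x ∈ B.1 ∩ B'.1 := ⟨by simpa using hx' 0, by simpa using hx' 1⟩
      rwa [hBB'] at hmem
    · split_ifs <;> assumption
  have hex : ∀ ω, ∃ x, U ω ⟨{x}, measurableSet_singleton x⟩ := by
    intro ω
    obtain ⟨B, hBm, hBs⟩ := exists_seq_separating E (p := MeasurableSet) MeasurableSet.empty
      Set.univ
    classical
    -- Of each separating set and its complement, one belongs to `U ω`. The intersection of these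
    -- choices belongs to `U ω` and has at most one point.
    let B' : ℕ → {B : Set E // MeasurableSet[borel E] B} := fun n =>
      if U ω ⟨B n, hBm n⟩ then ⟨B n, hBm n⟩ else ⟨(B n)ᶜ, (hBm n).compl⟩
    have hB' : ∀ n, U ω (B' n) := fun n => by
      dsimp only [B']
      split_ifs with h
      · exact h
      · exact (hUcompl ω ⟨B n, hBm n⟩).resolve_left h
    have hC := hUinter ω B' hB'
    have hsub : ∀ x ∈ ⋂ n, (B' n).1, ∀ y ∈ ⋂ n, (B' n).1, x = y := by
      intro x hx y hy
      refine hBs x (Set.mem_univ _) y (Set.mem_univ _) fun n => ?_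
      have hx' := Set.mem_iInter.1 hx n
      have hy' := Set.mem_iInter.1 hy n
      dsimp only [B'] at hx' hy'
      split_ifs at hx' hy'
      · exact ⟨fun _ => hy', fun _ => hx'⟩
      · exact ⟨fun h => absurd h hx', fun h => absurd h hy'⟩
    rcases (⋂ n, (B' n).1).eq_empty_or_nonempty with h0 | ⟨x, hx⟩
    · exact absurd (hUmono ω _ _ h0.subset hC) (hUempty ω)
    · exact ⟨x, hUmono ω _ _ (fun y hy => (hsub y hy x hx)) hC⟩
  choose π hπ using hex
  have hπU : ∀ ω B, U ω B ↔ π ω ∈ B.1 := by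
    intro ω B
    constructor
    · intro hB
      by_contra hn
      exact hUinter2 ω _ _ (Set.inter_singleton_eq_empty.2 hn) hB (hπ ω)
    · intro hB
      exact hUmono ω _ _ (Set.singleton_subset_iff.2 hB) (hπ ω)
  refine ⟨E, mE, inferInstance, ⟨π (Classical.arbitrary Ω)⟩, π, ?_, ?_⟩
  · intro x
    by_contra! hx
    have h1 : e.symm ⟨{x}, measurableSet_singleton x⟩ ≤ e.symm ⟨∅, MeasurableSet.empty⟩ :=
      fun ω hω => absurd ((hπU ω _).1 hω) (hx ω)
    exact (e.symm.le_iff_le.1 h1) (Set.mem_singleton x)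
  · ext A
    constructor
    · intro hA
      refine ⟨(e ⟨A, hA⟩).1, (e ⟨A, hA⟩).2, ?_⟩
      ext ω
      rw [Set.mem_preimage, ← hπU]
      change ω ∈ (e.symm (e ⟨A, hA⟩)).1 ↔ ω ∈ A
      rw [e.symm_apply_apply]
    · rintro ⟨B, hB, rfl⟩
      have : π ⁻¹' B = (e.symm ⟨B, hB⟩).1 := by
        ext ω
        rw [Set.mem_preimage]
        exact (hπU ω ⟨B, hB⟩).symm
      rw [this]
      exact (e.symm _).2

theorem isSigmaAtom_preimage_singleton {E : Type*} {mE : MeasurableSpace E}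
    [MeasurableSingletonClass E] {π : Ω → E} (hπ : Function.Surjective π) (x : E) :
    IsSigmaAtom (mE.comap π) (π ⁻¹' {x}) := by
  refine ⟨⟨{x}, measurableSet_singleton x, rfl⟩, ?_, ?_⟩
  · obtain ⟨ω, rfl⟩ := hπ x
    exact ⟨ω, rfl⟩
  · rintro B ⟨C, -, rfl⟩ hC
    rw [hπ.preimage_subset_preimage_iff, Set.subset_singleton_iff_eq] at hC
    rcases hC with rfl | rfl
    · exact Or.inl rfl
    · exact Or.inr rfl

theorem map_compProd_comap {A B C : Type*} {mA : MeasurableSpace A} {mB : MeasurableSpace B}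
    {mC : MeasurableSpace C} (ν : Measure A) [SFinite ν] (κ : Kernel B C) [IsSFiniteKernel κ]
    {g : A → B} (hg : Measurable g) :
    (ν ⊗ₘ κ.comap g hg).map (Prod.map g id) = (ν.map g) ⊗ₘ κ := by
  ext s hs
  rw [Measure.map_apply (by fun_prop) hs, Measure.compProd_apply (hs.preimage (by fun_prop)),
    Measure.compProd_apply hs, lintegral_map (Kernel.measurable_kernel_prodMk_left hs) hg]
  rfl

theorem map_eval_zero_trajMeasure {X : ℕ → Type*} [∀ n, MeasurableSpace (X n)] (μ₀ : Measure (X 0))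
    [IsProbabilityMeasure μ₀] (κ : (n : ℕ) → Kernel (Π i : Finset.Iic n, X i) (X (n + 1)))
    [∀ n, IsMarkovKernel (κ n)] :
    (Kernel.trajMeasure μ₀ κ).map (fun x => x 0) = μ₀ := by
  have h1 : (Kernel.trajMeasure μ₀ κ).map (Preorder.frestrictLe 0) =
      μ₀.map (MeasurableEquiv.piUnique (fun i : Finset.Iic 0 => X i)).symm := by
    rw [Kernel.trajMeasure, Measure.map_comp _ _ (by fun_prop), Kernel.traj_map_frestrictLe,
      Kernel.partialTraj_self]
    exact Measure.id_comp
  have h2 : (fun x : Π n, X n => x 0) =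
      (fun y : Π i : Finset.Iic 0, X i => y ⟨0, by simp⟩) ∘ Preorder.frestrictLe 0 := rfl
  rw [h2, ← Measure.map_map (by fun_prop) (by fun_prop), h1]
  exact (Measure.map_map (measurable_pi_apply _) (MeasurableEquiv.measurable _)).trans Measure.map_id

variable [mΩ : MeasurableSpace Ω]

/-- Consistent probability measures on a regular filtration extend to the generated σ-field. -/
theorem IsRegularFiltration.exists_extension {ℱ : Filtration ℕ mΩ} (hℱ : IsRegularFiltration ℱ)
    (htop : ⨆ n, ℱ n = mΩ) (Q : ℕ → Measure Ω) [∀ n, IsProbabilityMeasure (Q n)]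
    (hQ : ∀ n A, MeasurableSet[ℱ n] A → Q (n + 1) A = Q n A) :
    ∃ R : Measure Ω, IsProbabilityMeasure R ∧ ∀ n A, MeasurableSet[ℱ n] A → R A = Q n A := by
  have : Nonempty Ω := (inferInstance : NeZero (Q 0)).out |> fun h => by
    by_contra hne
    rw [not_nonempty_iff] at hne
    exact h (Measure.eq_zero_of_isEmpty _)
  choose E mE hE hEne π hπ hcomap using fun n => (hℱ.1 n).exists_coding
  have hπm : ∀ n, Measurable[ℱ n] (π n) := fun n => by
    rw [measurable_iff_comap_le, hcomap n]
  have hπm' : ∀ n, Measurable (π n) := fun n => (hπm n).mono (ℱ.le n) le_rfl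
  have hlift : ∀ n (B : Set (E n)), MeasurableSet B → ∃ C : Set (E (n + 1)), MeasurableSet C ∧
      π (n + 1) ⁻¹' C = π n ⁻¹' B := by
    intro n B hB
    have h1 : MeasurableSet[ℱ (n + 1)] (π n ⁻¹' B) := ℱ.mono (Nat.le_succ n) _ (hπm n hB)
    rw [hcomap (n + 1)] at h1
    exact h1
  -- Fibres of π n are unions of fibres of π (n + 1), because ℱ n ≤ ℱ (n + 1). Hence any section of
  -- π (n + 1) produces the factor map.
  let f : ∀ n, E (n + 1) → E n := fun n x => π n (Function.surjInv (hπ (n + 1)) x)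
  have hinv : ∀ n x, π (n + 1) (Function.surjInv (hπ (n + 1)) x) = x := fun n x =>
    Function.surjInv_eq (hπ (n + 1)) x
  have hf : ∀ n ω, f n (π (n + 1) ω) = π n ω := by
    intro n ω
    obtain ⟨C, -, hC⟩ := hlift n {π n ω} (measurableSet_singleton _)
    have h1 : ω ∈ π (n + 1) ⁻¹' C := by rw [hC]; rfl
    have h2 : Function.surjInv (hπ (n + 1)) (π (n + 1) ω) ∈ π (n + 1) ⁻¹' C := by
      rw [Set.mem_preimage, hinv]
      exact h1
    rw [hC] at h2
    exact h2
  have hfm : ∀ n, Measurable (f n) := by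
    intro n B hB
    obtain ⟨C, hCm, hC⟩ := hlift n B hB
    have : f n ⁻¹' B = C := by
      ext x
      change Function.surjInv (hπ (n + 1)) x ∈ π n ⁻¹' B ↔ x ∈ C
      rw [← hC, Set.mem_preimage, hinv]
    rwa [this]
  -- The kernel is the conditional law of π (n + 1) given π n under `Q (n + 1)`, depending on the
  -- last coordinate only. By consistency (x n, x (n + 1)) then has the law of (π n, π (n + 1))
  -- under `Q (n + 1)`, and almost every trajectory is a compatible sequence.
  let κ : (n : ℕ) → Kernel (Π i : Finset.Iic n, E i) (E (n + 1)) := fun n =>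
    (condDistrib (π (n + 1)) (π n) (Q (n + 1))).comap (fun x => x ⟨n, by simp⟩)
      (measurable_pi_apply _)
  have : ∀ n, IsMarkovKernel (κ n) := fun n => by dsimp only [κ]; infer_instance
  have hprob0 : IsProbabilityMeasure ((Q 0).map (π 0)) :=
    Measure.isProbabilityMeasure_map (hπm' 0).aemeasurable
  let τ := Kernel.trajMeasure ((Q 0).map (π 0)) κ
  have hQmap : ∀ n, (Q (n + 1)).map (π n) = (Q n).map (π n) := by
    intro n
    ext B hB
    rw [Measure.map_apply (hπm' n) hB, Measure.map_apply (hπm' n) hB]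
    exact hQ n _ (hπm n hB)
  have hpair : ∀ n, τ.map (fun x => x n) = (Q n).map (π n) →
      τ.map (fun x => (x n, x (n + 1))) = (Q (n + 1)).map (fun ω => (π n ω, π (n + 1) ω)) := by
    intro n hn
    have h1 := Kernel.map_frestrictLe_trajMeasure_compProd_eq_map_trajMeasure
      (μ₀ := (Q 0).map (π 0)) (κ := κ) (a := n)
    have h2 := congrArg (fun ν => ν.map (Prod.map
      (fun y : Π i : Finset.Iic n, E i => y ⟨n, by simp⟩) (id : E (n + 1) → E (n + 1)))) h1
    dsimp only at h2
    rw [map_compProd_comap _ _ (measurable_pi_apply _), Measure.map_map (by fun_prop) (by fun_prop),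
      Measure.map_map (by fun_prop) (by fun_prop)] at h2
    have h3 : τ.map ((fun y : Π i : Finset.Iic n, E i => y ⟨n, by simp⟩) ∘
        Preorder.frestrictLe n) = (Q (n + 1)).map (π n) := hn.trans (hQmap n).symm
    rw [h3, compProd_map_condDistrib (hπm' (n + 1)).aemeasurable] at h2
    exact h2.symm
  have hmarg : ∀ n, τ.map (fun x => x n) = (Q n).map (π n) := by
    intro n
    induction n with
    | zero => exact map_eval_zero_trajMeasure _ _
    | succ n ih =>
      have h1 := congrArg (Measure.map Prod.snd) (hpair n ih)
      rw [Measure.map_map (by fun_prop) (by fun_prop),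
        Measure.map_map (by fun_prop) ((hπm' n).prodMk (hπm' (n + 1)))] at h1
      exact h1
  let S : Set (Π n, E n) := {x | ∀ n, f n (x (n + 1)) = x n}
  have hSm : MeasurableSet S := by
    have : S = ⋂ n, {x | f n (x (n + 1)) = x n} := by ext; simp [S]
    rw [this]
    exact MeasurableSet.iInter fun n => measurableSet_eq_fun
      ((hfm n).comp (measurable_pi_apply _)) (measurable_pi_apply _)
  have hS : ∀ᵐ x ∂τ, x ∈ S := by
    refine ae_all_iff.2 fun n => ?_
    have hm : MeasurableSet {q : E n × E (n + 1) | f n q.2 = q.1} :=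
      measurableSet_eq_fun ((hfm n).comp measurable_snd) measurable_fst
    have h1 : ∀ᵐ q ∂(τ.map (fun x => (x n, x (n + 1)))), f n q.2 = q.1 := by
      rw [hpair n (hmarg n), ae_map_iff ((hπm' n).prodMk (hπm' (n + 1))).aemeasurable hm]
      exact ae_of_all _ fun ω => hf n ω
    rwa [ae_map_iff (by fun_prop) hm] at h1
  -- The fibres over a compatible sequence are decreasing atoms. The atom condition supplies a
  -- common point, which brings the measure from the inverse limit back to Ω.
  have hSex : ∀ x ∈ S, ∃ ω, ∀ n, π n ω = x n := by
    intro x hx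
    have hanti : Antitone fun n => π n ⁻¹' {x n} := by
      refine antitone_nat_of_succ_le fun n ω hω => ?_
      change π n ω = x n
      rw [← hf n ω, show π (n + 1) ω = x (n + 1) from hω, hx n]
    obtain ⟨ω, hω⟩ := hℱ.2 (fun n => π n ⁻¹' {x n}) hanti fun n => by
      have := isSigmaAtom_preimage_singleton (hπ n) (x n)
      rwa [← hcomap n] at this
    exact ⟨ω, fun n => Set.mem_iInter.1 hω n⟩
  classical
  let g : (Π n, E n) → Ω := fun x =>
    if h : x ∈ S then (hSex x h).choose else Classical.arbitrary Ω
  have hgS : ∀ x ∈ S, ∀ n, π n (g x) = x n := fun x hx n => by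
    dsimp only [g]
    rw [dif_pos hx]
    exact (hSex x hx).choose_spec n
  have hgm : Measurable g := by
    rw [measurable_iff_comap_le, ← htop, MeasurableSpace.comap_iSup]
    refine iSup_le fun n => ?_
    rintro _ ⟨A, hA, rfl⟩
    rw [hcomap n] at hA
    obtain ⟨B, hB, rfl⟩ := hA
    have : g ⁻¹' (π n ⁻¹' B) = (S ∩ (fun x => x n) ⁻¹' B) ∪
        (Sᶜ ∩ {_x | Classical.arbitrary Ω ∈ π n ⁻¹' B}) := by
      ext x
      by_cases hx : x ∈ S
      · simp [hx, hgS x hx]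
      · have : g x = Classical.arbitrary Ω := dif_neg hx
        simp [hx, this]
    rw [this]
    exact (hSm.inter (measurable_pi_apply n hB)).union (hSm.compl.inter (MeasurableSet.const _))
  refine ⟨τ.map g, Measure.isProbabilityMeasure_map hgm.aemeasurable, fun n A hA => ?_⟩
  have hA' := hA
  rw [hcomap n] at hA'
  obtain ⟨B, hB, rfl⟩ := hA'
  rw [Measure.map_apply hgm (ℱ.le n _ hA), ← Measure.map_apply (hπm' n) hB, ← hmarg n,
    Measure.map_apply (measurable_pi_apply n) hB]
  refine measure_congr ?_
  filter_upwards [hS] with x hx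
  change (π n (g x) ∈ B) = (x n ∈ B)
  rw [hgS x hx]

end Extension

/-! ### The product space with the optional σ-field -/

section Optional

variable {Ω : Type*} [mΩ : MeasurableSpace Ω] {𝕋 : Set ℕ∞} {ℱ : Filtration ℕ mΩ}

theorem sigmaAt_le (ℱ : Filtration ℕ mΩ) (t : ℕ∞) : sigmaAt ℱ t ≤ mΩ := by
  induction t using ENat.recTopCoe with
  | top => exact iSup_le ℱ.le
  | coe n => exact ℱ.le n

theorem sigmaAt_mono (ℱ : Filtration ℕ mΩ) : Monotone (sigmaAt ℱ) := by
  intro s t hst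
  induction t using ENat.recTopCoe with
  | top =>
    induction s using ENat.recTopCoe with
    | top => exact le_rfl
    | coe n => exact le_iSup (fun n => ℱ n) n
  | coe k =>
    induction s using ENat.recTopCoe with
    | top => simp at hst
    | coe n => exact ℱ.mono (by exact_mod_cast hst)

theorem IsTimeSet.mem_of_le (h𝕋 : IsTimeSet 𝕋) {s t : ℕ∞} (hst : s ≤ t) (ht : t ∈ 𝕋) : s ∈ 𝕋 := by
  rcases h𝕋 with ⟨T, rfl⟩ | rfl | rfl
  · exact hst.trans ht
  · exact lt_of_le_of_lt hst ht
  · trivial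

theorem measurable_mk_sigmaAt (t : 𝕋) :
    Measurable[sigmaAt ℱ t] (fun ω => (⟨ω, t⟩ : OptionalSpace 𝕋 ℱ)) := by
  refine @measurable_generateFrom _ _ (sigmaAt ℱ t) _ _ ?_
  rintro _ ⟨s, A, hA, rfl⟩
  by_cases hst : t = s
  · subst hst
    simpa using hA
  · simp [hst]

theorem measurable_mk (t : 𝕋) : Measurable (fun ω => (⟨ω, t⟩ : OptionalSpace 𝕋 ℱ)) :=
  (measurable_mk_sigmaAt t).mono (sigmaAt_le ℱ t) le_rfl

/-- `𝕋` is countable, so a set is a countable union of its time slices, and measurable slices are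
generators. -/
theorem measurableSet_optional_iff {B : Set (OptionalSpace 𝕋 ℱ)} :
    MeasurableSet B ↔
      ∀ t : 𝕋, MeasurableSet[sigmaAt ℱ t] {ω | (⟨ω, t⟩ : OptionalSpace 𝕋 ℱ) ∈ B} := by
  constructor
  · exact fun h t => measurable_mk_sigmaAt t h
  · intro h
    have : B = ⋃ t : 𝕋, {p : OptionalSpace 𝕋 ℱ |
        p.state ∈ {ω | (⟨ω, t⟩ : OptionalSpace 𝕋 ℱ) ∈ B} ∧ p.time = t} := by
      ext ⟨ω, t⟩
      refine ⟨fun hp => Set.mem_iUnion.2 ⟨t, hp, rfl⟩, fun hp => ?_⟩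
      obtain ⟨s, hs, rfl⟩ := Set.mem_iUnion.1 hp
      exact hs
    rw [this]
    exact MeasurableSet.iUnion fun t => MeasurableSpace.measurableSet_generateFrom ⟨t, _, h t, rfl⟩

theorem measurable_optional_iff {β : Type*} [MeasurableSpace β] {f : OptionalSpace 𝕋 ℱ → β} :
    Measurable f ↔ ∀ t : 𝕋, Measurable[sigmaAt ℱ t] fun ω => f ⟨ω, t⟩ := by
  constructor
  · exact fun h t => h.comp (measurable_mk_sigmaAt t)
  · exact fun h B hB => measurableSet_optional_iff.2 fun t => h t hB

theorem refMeasure_apply {ν : Measure Ω} {g : ℕ∞ → Ω → ℝ} {B : Set (OptionalSpace 𝕋 ℱ)}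
    (hB : MeasurableSet B) :
    refMeasure ν 𝕋 ℱ g B =
      ∑' t : 𝕋, ∫⁻ ω in {ω | (⟨ω, t⟩ : OptionalSpace 𝕋 ℱ) ∈ B}, ENNReal.ofReal (g t ω) ∂ν := by
  rw [refMeasure, Measure.sum_apply _ hB]
  refine tsum_congr fun t => ?_
  rw [Measure.map_apply (measurable_mk t) hB, withDensity_apply _ (measurable_mk t hB)]
  rfl

theorem lintegral_refMeasure {ν : Measure Ω} {g : ℕ∞ → Ω → ℝ}
    (hg : ∀ t ∈ 𝕋, Measurable (g t)) {F : OptionalSpace 𝕋 ℱ → ℝ≥0∞} (hF : Measurable F) :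
    ∫⁻ p, F p ∂(refMeasure ν 𝕋 ℱ g) =
      ∑' t : 𝕋, ∫⁻ ω, ENNReal.ofReal (g t ω) * F ⟨ω, t⟩ ∂ν := by
  rw [refMeasure, lintegral_sum_measure]
  refine tsum_congr fun t => ?_
  rw [lintegral_map hF (measurable_mk t)]
  exact lintegral_withDensity_eq_lintegral_mul _ (hg t t.2).ennreal_ofReal
    (hF.comp (measurable_mk t))

theorem ae_refMeasure_iff {ν : Measure Ω} {g : ℕ∞ → Ω → ℝ} (hg : ∀ t ∈ 𝕋, Measurable (g t))
    {q : OptionalSpace 𝕋 ℱ → Prop} (hq : MeasurableSet {p | q p}) :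
    (∀ᵐ p ∂(refMeasure ν 𝕋 ℱ g), q p) ↔
      ∀ t : 𝕋, ∀ᵐ ω ∂ν, 0 < g t ω → q ⟨ω, t⟩ := by
  rw [refMeasure, Measure.ae_sum_iff]
  refine forall_congr' fun t => ?_
  rw [ae_map_iff (measurable_mk t).aemeasurable hq,
    ae_withDensity_iff (hg t t.2).ennreal_ofReal]
  simp

theorem IsReferenceProcess.measurable {P : Measure Ω} {μ : ℕ∞ → Ω → ℝ}
    (hμ : IsReferenceProcess P 𝕋 ℱ μ) : ∀ t ∈ 𝕋, Measurable (μ t) :=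
  fun t ht => (hμ.adapted t ht).mono (sigmaAt_le ℱ t) le_rfl

theorem IsReferenceProcess.ae_refMeasure_iff {P : Measure Ω} {μ : ℕ∞ → Ω → ℝ}
    (hμ : IsReferenceProcess P 𝕋 ℱ μ)
    {q : OptionalSpace 𝕋 ℱ → Prop} (hq : MeasurableSet {p | q p}) :
    (∀ᵐ p ∂(refMeasure P 𝕋 ℱ μ), q p) ↔ ∀ t : 𝕋, ∀ᵐ ω ∂P, q ⟨ω, t⟩ := by
  rw [ProcessRisk.ae_refMeasure_iff hμ.measurable hq]
  refine forall_congr' fun t => ?_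
  constructor
  · intro h
    filter_upwards [h, hμ.pos t t.2] with ω h1 h2 using h1 h2
  · intro h
    filter_upwards [h] with ω h1 _ using h1

theorem IsReferenceProcess.isProbabilityMeasure {P : Measure Ω} [IsProbabilityMeasure P]
    {μ : ℕ∞ → Ω → ℝ} (hμ : IsReferenceProcess P 𝕋 ℱ μ) :
    IsProbabilityMeasure (refMeasure P 𝕋 ℱ μ) := by
  constructor
  rw [refMeasure_apply MeasurableSet.univ]
  simp only [Set.mem_univ, Set.ofPred_true, Measure.restrict_univ]
  rw [← lintegral_tsum fun t : 𝕋 => (hμ.measurable t t.2).ennreal_ofReal.aemeasurable]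
  have : ∀ᵐ ω ∂P, ∑' t : 𝕋, ENNReal.ofReal (μ t ω) = 1 := by
    filter_upwards [hμ.sum_eq_one, ae_all_iff.2 fun t : 𝕋 => hμ.pos t t.2] with ω h1 h2
    have hs : Summable fun t : 𝕋 => μ t ω := by
      by_contra hs
      rw [tsum_eq_zero_of_not_summable hs] at h1
      exact zero_ne_one h1
    rw [← ENNReal.ofReal_tsum_of_nonneg (fun t => (h2 t).le) hs, h1, ENNReal.ofReal_one]
  rw [lintegral_congr_ae this]
  simp

/-- A finite measure which is absolutely continuous with respect to `P ⊗ μ` has an optional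
density. -/
theorem IsReferenceProcess.exists_density {P : Measure Ω} [IsProbabilityMeasure P]
    {μ : ℕ∞ → Ω → ℝ} (hμ : IsReferenceProcess P 𝕋 ℱ μ) {R : Measure (OptionalSpace 𝕋 ℱ)}
    [IsFiniteMeasure R] (hR : R ≪ refMeasure P 𝕋 ℱ μ) :
    ∃ a : ℕ∞ → Ω → ℝ≥0∞, (∀ t ∈ 𝕋, Measurable[sigmaAt ℱ t] (a t)) ∧ (∀ t ∉ 𝕋, a t = 0) ∧
      ∀ B, MeasurableSet B → R B =
        ∑' t : 𝕋, ∫⁻ ω in {ω | (⟨ω, t⟩ : OptionalSpace 𝕋 ℱ) ∈ B}, a t ω ∂P := by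
  classical
  have := hμ.isProbabilityMeasure
  let Z := R.rnDeriv (refMeasure P 𝕋 ℱ μ)
  have hZ : Measurable Z := Measure.measurable_rnDeriv _ _
  refine ⟨fun t ω => if h : t ∈ 𝕋 then ENNReal.ofReal (μ t ω) * Z ⟨ω, ⟨t, h⟩⟩ else 0, ?_, ?_, ?_⟩
  · intro t ht
    simp only [ht, dite_true]
    exact (hμ.adapted t ht).ennreal_ofReal.mul (measurable_optional_iff.1 hZ ⟨t, ht⟩)
  · intro t ht
    simp only [ht, dite_false]
    rfl
  · intro B hB
    conv_lhs => rw [← Measure.withDensity_rnDeriv_eq _ _ hR, withDensity_apply _ hB,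
      ← lintegral_indicator hB, lintegral_refMeasure hμ.measurable (hZ.indicator hB)]
    refine tsum_congr fun t => ?_
    refine Eq.trans ?_ (lintegral_indicator (measurable_mk t hB) _)
    refine lintegral_congr fun ω => ?_
    change _ = Set.indicator {ω | (⟨ω, t⟩ : OptionalSpace 𝕋 ℱ) ∈ B} _ ω
    by_cases h : (⟨ω, t⟩ : OptionalSpace 𝕋 ℱ) ∈ B <;> simp [Set.indicator, h]

theorem integrable_onOptional_iff {ν : Measure Ω} {g : ℕ∞ → Ω → ℝ}
    (hg : ∀ t ∈ 𝕋, Measurable (g t)) {X : ℕ∞ → Ω → ℝ}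
    (hX : ∀ t ∈ 𝕋, Measurable[sigmaAt ℱ t] (X t)) :
    Integrable (onOptional 𝕋 ℱ X) (refMeasure ν 𝕋 ℱ g) ↔
      ∑' t : 𝕋, ∫⁻ ω, ENNReal.ofReal (g t ω) * ‖X t ω‖ₑ ∂ν ≠ ∞ := by
  have hm : Measurable (onOptional 𝕋 ℱ X) := measurable_optional_iff.2 fun t => hX t t.2
  have h1 := lintegral_refMeasure (ν := ν) (F := fun p => ‖onOptional 𝕋 ℱ X p‖ₑ) hg hm.enorm
  change _ ↔ (∑' t : 𝕋, ∫⁻ ω, ENNReal.ofReal (g t ω) * ‖onOptional 𝕋 ℱ X ⟨ω, t⟩‖ₑ ∂ν) ≠ ∞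
  rw [← h1]
  exact ⟨fun h => h.2.ne, fun h => ⟨hm.aestronglyMeasurable, h.lt_top⟩⟩

/-- Integration with respect to `ν ⊗ g`. -/
theorem integral_refMeasure {ν : Measure Ω} {g : ℕ∞ → Ω → ℝ}
    (hg : ∀ t ∈ 𝕋, Measurable (g t)) (hg0 : ∀ t ∈ 𝕋, ∀ᵐ ω ∂ν, 0 ≤ g t ω) {X : ℕ∞ → Ω → ℝ}
    (hX : ∀ t ∈ 𝕋, Measurable[sigmaAt ℱ t] (X t))
    (hint : Integrable (onOptional 𝕋 ℱ X) (refMeasure ν 𝕋 ℱ g)) :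
    ∫ p, onOptional 𝕋 ℱ X p ∂(refMeasure ν 𝕋 ℱ g) = ∫ ω, ∑' t : 𝕋, g t ω * X t ω ∂ν := by
  have hm : Measurable (onOptional 𝕋 ℱ X) := measurable_optional_iff.2 fun t => hX t t.2
  have hXm : ∀ t ∈ 𝕋, Measurable (X t) := fun t ht => (hX t ht).mono (sigmaAt_le ℱ t) le_rfl
  have h1 := (integrable_onOptional_iff hg hX).1 hint
  rw [refMeasure] at hint ⊢
  rw [integral_sum_measure hint, integral_tsum]
  · refine tsum_congr fun t => ?_
    rw [integral_map (measurable_mk t).aemeasurable hm.aestronglyMeasurable,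
      integral_withDensity_eq_integral_toReal_smul (hg t t.2).ennreal_ofReal
        (ae_of_all _ fun _ => ENNReal.ofReal_lt_top)]
    refine integral_congr_ae ?_
    filter_upwards [hg0 t t.2] with ω hω
    rw [ENNReal.toReal_ofReal hω]
    rfl
  · exact fun t => ((hg t t.2).mul (hXm t t.2)).aestronglyMeasurable
  · refine (Eq.trans_ne ?_ h1)
    refine tsum_congr fun t => lintegral_congr_ae ?_
    filter_upwards [hg0 t t.2] with ω hω
    rw [enorm_mul, Real.enorm_of_nonneg hω]

end Optional

/-! ### Multiplicative decomposition of densities on the product space -/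

section Multiplicative

theorem measurable_indicator_one {Ω : Type*} {m : MeasurableSpace Ω} {A : Set Ω}
    (hA : MeasurableSet A) : Measurable (A.indicator (1 : Ω → ℝ≥0∞)) :=
  measurable_one.indicator hA

/-- The measures with densities `X` and `P⁻[X|m]` agree on `m`, so they give every nonnegative
`m`-measurable `g` the same integral, without any integrability. -/
theorem lintegral_mul_condLExp {Ω : Type*} {m mΩ : MeasurableSpace Ω} {P : Measure Ω}
    [IsFiniteMeasure P] (hm : m ≤ mΩ) {X : Ω → ℝ≥0∞}
    (hX : Measurable X) {g : Ω → ℝ≥0∞} (hg : Measurable[m] g) :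
    ∫⁻ ω, g ω * P⁻[X|m] ω ∂P = ∫⁻ ω, g ω * X ω ∂P := by
  have hg' : Measurable g := hg.mono hm le_rfl
  have h1 : (P.withDensity X).trim hm = (P.withDensity P⁻[X|m]).trim hm := by
    refine @Measure.ext _ m _ _ fun s hs => ?_
    rw [trim_measurableSet_eq hm hs, trim_measurableSet_eq hm hs, withDensity_apply _ (hm s hs),
      withDensity_apply _ (hm s hs), setLIntegral_condLExp hm P X hs]
  have h2 : ∫⁻ ω, g ω ∂(P.withDensity X) = ∫⁻ ω, g ω ∂(P.withDensity P⁻[X|m]) := by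
    rw [← lintegral_trim hm hg, ← lintegral_trim hm hg, h1]
  rw [lintegral_withDensity_eq_lintegral_mul _ hX hg',
    lintegral_withDensity_eq_lintegral_mul _ (measurable_condLExp' _ _ _) hg'] at h2
  simp only [Pi.mul_apply] at h2
  simp only [mul_comm (g _)]
  exact h2.symm

variable {Ω : Type*} [mΩ : MeasurableSpace Ω] {P : Measure Ω}

/-- The mass of the density `a` from time `n` on. -/
noncomputable def tailMass (a : ℕ∞ → Ω → ℝ≥0∞) (n : ℕ) (ω : Ω) : ℝ≥0∞ :=
  (∑' k : ℕ, a ((n + k : ℕ) : ℕ∞) ω) + a ⊤ ω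

/-- The supermartingale of conditional tail masses. -/
noncomputable def condTail (P : Measure Ω) (ℱ : Filtration ℕ mΩ) (a : ℕ∞ → Ω → ℝ≥0∞) (n : ℕ) :
    Ω → ℝ≥0∞ :=
  P⁻[tailMass a n|ℱ n]

/-- The predictable projection of the conditional tail mass. -/
noncomputable def predTail (P : Measure Ω) (ℱ : Filtration ℕ mΩ) (a : ℕ∞ → Ω → ℝ≥0∞) (n : ℕ) :
    Ω → ℝ≥0∞ :=
  P⁻[tailMass a (n + 1)|ℱ n]

/-- The martingale factor of the conditional tail mass. -/
noncomputable def massMartingale (P : Measure Ω) (ℱ : Filtration ℕ mΩ) (a : ℕ∞ → Ω → ℝ≥0∞) :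
    ℕ → Ω → ℝ≥0∞
  | 0 => fun _ => 1
  -- The factor 1 on {predTail = 0} preserves the martingale property. It does no harm to the
  -- product, since there `massDiscount` vanishes from n + 1 on.
  | n + 1 => fun ω => massMartingale P ℱ a n ω *
      if predTail P ℱ a n ω = 0 then 1 else condTail P ℱ a (n + 1) ω * (predTail P ℱ a n ω)⁻¹

/-- The predictable decreasing factor of the conditional tail mass. -/
noncomputable def massDiscount (P : Measure Ω) (ℱ : Filtration ℕ mΩ) (a : ℕ∞ → Ω → ℝ≥0∞) :
    ℕ → Ω → ℝ≥0∞
  | 0 => fun _ => 1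
  -- The ratio is at most 1 almost surely; the minimum makes the process decrease at every ω.
  | n + 1 => fun ω => massDiscount P ℱ a n ω * min 1 (predTail P ℱ a n ω / condTail P ℱ a n ω)

variable {ℱ : Filtration ℕ mΩ} {a : ℕ∞ → Ω → ℝ≥0∞}

theorem measurable_condTail (n : ℕ) : Measurable[ℱ n] (condTail P ℱ a n) :=
  measurable_condLExp _ _ _

theorem measurable_predTail (n : ℕ) : Measurable[ℱ n] (predTail P ℱ a n) :=
  measurable_condLExp _ _ _

theorem measurable_massMartingale (n : ℕ) : Measurable[ℱ n] (massMartingale P ℱ a n) := by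
  induction n with
  | zero => exact measurable_const
  | succ n ih =>
    have hle : ℱ n ≤ ℱ (n + 1) := ℱ.mono (Nat.le_succ n)
    have h1 : Measurable[ℱ (n + 1)] (predTail P ℱ a n) := (measurable_predTail n).mono hle le_rfl
    refine (ih.mono hle le_rfl).mul (Measurable.ite (h1 (measurableSet_singleton 0))
      measurable_const ((measurable_condTail (n + 1)).mul h1.inv))

theorem measurable_massDiscount_succ (n : ℕ) :
    Measurable[ℱ n] (massDiscount P ℱ a n) ∧ Measurable[ℱ n] (massDiscount P ℱ a (n + 1)) := by
  have hstep : ∀ n, Measurable[ℱ n] (massDiscount P ℱ a n) →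
      Measurable[ℱ n] (massDiscount P ℱ a (n + 1)) := fun n h =>
    h.mul (measurable_const.min ((measurable_predTail n).div (measurable_condTail n)))
  induction n with
  | zero => exact ⟨measurable_const, hstep 0 measurable_const⟩
  | succ n ih =>
    have h1 := ih.2.mono (ℱ.mono (Nat.le_succ n)) le_rfl
    exact ⟨h1, hstep _ h1⟩

theorem massDiscount_antitone (ω : Ω) : Antitone fun n => massDiscount P ℱ a n ω :=
  antitone_nat_of_succ_le fun n => by
    change massDiscount P ℱ a n ω * _ ≤ _
    exact mul_le_of_le_one_right' (min_le_left _ _)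

theorem massDiscount_le_one (n : ℕ) (ω : Ω) : massDiscount P ℱ a n ω ≤ 1 :=
  massDiscount_antitone ω (Nat.zero_le n)


theorem measurable_tailMass (ha : ∀ t, Measurable[sigmaAt ℱ t] (a t))
    (n : ℕ) : Measurable (tailMass a n) :=
  (Measurable.tsum fun _ => (ha _).mono (sigmaAt_le ℱ _) le_rfl).add
    ((ha _).mono (sigmaAt_le ℱ _) le_rfl)

theorem tailMass_eq (n : ℕ) (ω : Ω) : tailMass a n ω = a n ω + tailMass a (n + 1) ω := by
  have h1 := tsum_eq_zero_add' (f := fun k : ℕ => a ((n + k : ℕ) : ℕ∞) ω) ENNReal.summable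
  have h2 : ∀ k : ℕ, a ((n + (k + 1) : ℕ) : ℕ∞) ω = a ((n + 1 + k : ℕ) : ℕ∞) ω := fun k => by
    rw [show n + (k + 1) = n + 1 + k by omega]
  rw [tailMass, tailMass, h1, tsum_congr h2, add_assoc, add_zero]

theorem tailMass_le (n : ℕ) (ω : Ω) : tailMass a n ω ≤ tailMass a 0 ω := by
  induction n with
  | zero => exact le_rfl
  | succ n ih => exact le_trans (by rw [tailMass_eq n]; exact le_add_self) ih

theorem lintegral_tailMass_ne_top (hmass : ∫⁻ ω, tailMass a 0 ω ∂P = 1)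
    (n : ℕ) : ∫⁻ ω, tailMass a n ω ∂P ≠ ∞ :=
  ne_top_of_le_ne_top (by rw [hmass]; exact ENNReal.one_ne_top)
    (lintegral_mono fun ω => tailMass_le n ω)

theorem condTail_eq [IsProbabilityMeasure P] (ha : ∀ t, Measurable[sigmaAt ℱ t] (a t))
    (n : ℕ) : ∀ᵐ ω ∂P, condTail P ℱ a n ω = a n ω + predTail P ℱ a n ω := by
  have h1 : tailMass a n = a n + tailMass a (n + 1) := funext fun ω => tailMass_eq n ω
  have h2 := condLExp_add_left (mΩ := ℱ n) (P := P) (tailMass a (n + 1))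
    ((ha n).mono (sigmaAt_le ℱ n) le_rfl).aemeasurable
  rw [← h1, condLExp_eq_self (ℱ.le n) P (X := a n) (ha n)] at h2
  exact h2

theorem predTail_ne_top (hmass : ∫⁻ ω, tailMass a 0 ω ∂P = 1)
    (n : ℕ) : ∀ᵐ ω ∂P, predTail P ℱ a n ω ≠ ∞ :=
  condLExp_ne_top (lintegral_tailMass_ne_top hmass (n + 1))

theorem condTail_ne_top (hmass : ∫⁻ ω, tailMass a 0 ω ∂P = 1)
    (n : ℕ) : ∀ᵐ ω ∂P, condTail P ℱ a n ω ≠ ∞ :=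
  condLExp_ne_top (lintegral_tailMass_ne_top hmass n)

theorem lintegral_mul_condTail_succ [IsProbabilityMeasure P] (ha : ∀ t, Measurable[sigmaAt ℱ t] (a t))
    (n : ℕ) {g : Ω → ℝ≥0∞} (hg : Measurable[ℱ n] g) :
    ∫⁻ ω, g ω * condTail P ℱ a (n + 1) ω ∂P = ∫⁻ ω, g ω * predTail P ℱ a n ω ∂P := by
  rw [condTail, predTail, lintegral_mul_condLExp (ℱ.le n) (measurable_tailMass ha (n + 1)) hg,
    lintegral_mul_condLExp (ℱ.le (n + 1)) (measurable_tailMass ha (n + 1))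
      (hg.mono (ℱ.mono (Nat.le_succ n)) le_rfl)]

/-- On the ℱ n-event {predTail = 0} the integral of `condTail` at n + 1 equals that of `predTail` at
n, which is 0. -/
theorem condTail_succ_eq_zero [IsProbabilityMeasure P] (ha : ∀ t, Measurable[sigmaAt ℱ t] (a t))
    (n : ℕ) :
    ∀ᵐ ω ∂P, predTail P ℱ a n ω = 0 → condTail P ℱ a (n + 1) ω = 0 := by
  have hA : MeasurableSet[ℱ n] {ω | predTail P ℱ a n ω = 0} :=
    measurable_predTail n (measurableSet_singleton 0)
  have h1 := lintegral_mul_condTail_succ (P := P) ha n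
    (g := Set.indicator {ω | predTail P ℱ a n ω = 0} 1) (measurable_indicator_one hA)
  have h2 : ∫⁻ ω, Set.indicator {ω | predTail P ℱ a n ω = 0} 1 ω * predTail P ℱ a n ω ∂P = 0 := by
    rw [← lintegral_zero]
    refine lintegral_congr fun ω => ?_
    by_cases h : predTail P ℱ a n ω = 0 <;> simp [Set.indicator, h]
  rw [h2, lintegral_eq_zero_iff] at h1
  · filter_upwards [h1] with ω hω h
    simpa [Set.indicator, h] using hω
  · exact (measurable_indicator_one (ℱ.le n _ hA)).mul (measurable_condLExp' _ _ _)

/-- Martingale property in integrated form. Where `predTail` is positive, the new factor has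
conditional expectation 1 given ℱ n, `predTail` being the conditional expectation of the next
`condTail`; elsewhere the new factor is 1. -/
theorem lintegral_mul_massMartingale_succ [IsProbabilityMeasure P] (ha : ∀ t, Measurable[sigmaAt ℱ t] (a t))
    (hmass : ∫⁻ ω, tailMass a 0 ω ∂P = 1)
    (n : ℕ) {g : Ω → ℝ≥0∞} (hg : Measurable[ℱ n] g) :
    ∫⁻ ω, g ω * massMartingale P ℱ a (n + 1) ω ∂P = ∫⁻ ω, g ω * massMartingale P ℱ a n ω ∂P := by
  set h : Ω → ℝ≥0∞ := fun ω => g ω * massMartingale P ℱ a n ω with hh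
  have hhm : Measurable[ℱ n] h := hg.mul (measurable_massMartingale n)
  set A : Set Ω := {ω | predTail P ℱ a n ω = 0} with hA'
  have hA : MeasurableSet[ℱ n] A := measurable_predTail n (measurableSet_singleton 0)
  set k : Ω → ℝ≥0∞ := fun ω => Set.indicator Aᶜ h ω * (predTail P ℱ a n ω)⁻¹ with hk
  have hkm : Measurable[ℱ n] k := (hhm.indicator hA.compl).mul (measurable_predTail n).inv
  have h1 : ∀ ω, g ω * massMartingale P ℱ a (n + 1) ω =
      Set.indicator A h ω + k ω * condTail P ℱ a (n + 1) ω := by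
    intro ω
    rw [massMartingale]
    by_cases hω : ω ∈ A
    · have hω' : predTail P ℱ a n ω = 0 := hω
      simp [hk, hω, hω', hh]
    · have hω' : predTail P ℱ a n ω ≠ 0 := hω
      simp [hk, hω, hω', hh]
      ring
  have h2 : ∀ᵐ ω ∂P, Set.indicator A h ω + k ω * predTail P ℱ a n ω = h ω := by
    filter_upwards [predTail_ne_top (ℱ := ℱ) hmass n] with ω hω
    by_cases hωA : ω ∈ A
    · simp [hk, hωA]
    · have hω' : predTail P ℱ a n ω ≠ 0 := hωA
      simp [hk, hωA, mul_assoc, ENNReal.inv_mul_cancel hω' hω]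
  rw [lintegral_congr h1, ← lintegral_congr_ae h2,
    lintegral_add_left ((hhm.indicator hA).mono (ℱ.le n) le_rfl),
    lintegral_add_left ((hhm.indicator hA).mono (ℱ.le n) le_rfl),
    lintegral_mul_condTail_succ ha n hkm]

/-- With U for `condTail` and V for `predTail`, the new factors U_{n+1}/V_n and V_n/U_n multiply to
U_{n+1}/U_n, so the product telescopes. It starts at U_0 = 1 because ℱ 0 is trivial and the total
mass is 1. Where V_n = 0 both sides vanish at n + 1. -/
theorem massMartingale_mul_massDiscount [IsProbabilityMeasure P] (ha : ∀ t, Measurable[sigmaAt ℱ t] (a t))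
    (hmass : ∫⁻ ω, tailMass a 0 ω ∂P = 1)
    (hzero : ℱ 0 = ⊥) (n : ℕ) :
    ∀ᵐ ω ∂P, massMartingale P ℱ a n ω * massDiscount P ℱ a n ω = condTail P ℱ a n ω := by
  induction n with
  | zero =>
    have : condTail P ℱ a 0 = fun _ => 1 := by
      rw [condTail, hzero, condLExp_bot, hmass]
    simp [massMartingale, massDiscount, this]
  | succ n ih =>
    filter_upwards [ih, condTail_eq (P := P) (ℱ := ℱ) ha n, predTail_ne_top (ℱ := ℱ) hmass n,
      condTail_ne_top (ℱ := ℱ) hmass n, condTail_succ_eq_zero (P := P) (ℱ := ℱ) ha n]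
      with ω h1 h2 h3 h4 h5
    rw [massMartingale, massDiscount]
    by_cases hV : predTail P ℱ a n ω = 0
    · simp [hV, h5 hV]
    · have hU : condTail P ℱ a n ω ≠ 0 := by
        rw [h2]
        exact fun h => hV (add_eq_zero.1 h).2
      have hle : predTail P ℱ a n ω / condTail P ℱ a n ω ≤ 1 := by
        refine ENNReal.div_le_of_le_mul ?_
        rw [one_mul, h2]
        exact le_add_self
      dsimp only
      rw [if_neg hV, min_eq_right hle]
      calc massMartingale P ℱ a n ω *
            (condTail P ℱ a (n + 1) ω * (predTail P ℱ a n ω)⁻¹) *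
            (massDiscount P ℱ a n ω * (predTail P ℱ a n ω / condTail P ℱ a n ω))
          = (massMartingale P ℱ a n ω * massDiscount P ℱ a n ω) * (condTail P ℱ a n ω)⁻¹ *
            ((predTail P ℱ a n ω)⁻¹ * predTail P ℱ a n ω) * condTail P ℱ a (n + 1) ω := by
            rw [div_eq_mul_inv]; ring
        _ = condTail P ℱ a (n + 1) ω := by
          rw [h1, ENNReal.mul_inv_cancel hU h4, ENNReal.inv_mul_cancel hV h3, one_mul, one_mul]

/-- `M_n D_{n+1} = V_n`, so that `M_n (D_n - D_{n+1}) = a_n`. -/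
theorem massMartingale_mul_massDiscount_succ [IsProbabilityMeasure P] (ha : ∀ t, Measurable[sigmaAt ℱ t] (a t))
    (hmass : ∫⁻ ω, tailMass a 0 ω ∂P = 1)
    (hzero : ℱ 0 = ⊥) (n : ℕ) :
    ∀ᵐ ω ∂P, massMartingale P ℱ a n ω * massDiscount P ℱ a (n + 1) ω = predTail P ℱ a n ω := by
  filter_upwards [massMartingale_mul_massDiscount ha hmass hzero n,
    condTail_eq (P := P) (ℱ := ℱ) ha n, condTail_ne_top (ℱ := ℱ) hmass n] with ω h1 h2 h3
  rw [massDiscount, ← mul_assoc, h1]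
  by_cases hU : condTail P ℱ a n ω = 0
  · have : predTail P ℱ a n ω = 0 := (add_eq_zero.1 (h2.symm.trans hU)).2
    rw [hU, this, zero_mul]
  · have hle : predTail P ℱ a n ω / condTail P ℱ a n ω ≤ 1 := by
      refine ENNReal.div_le_of_le_mul ?_
      rw [one_mul, h2]
      exact le_add_self
    rw [min_eq_right hle, ENNReal.mul_div_cancel hU h3]

theorem lintegral_massMartingale [IsProbabilityMeasure P] (ha : ∀ t, Measurable[sigmaAt ℱ t] (a t))
    (hmass : ∫⁻ ω, tailMass a 0 ω ∂P = 1)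
    (n : ℕ) : ∫⁻ ω, massMartingale P ℱ a n ω ∂P = 1 := by
  induction n with
  | zero => simp [massMartingale]
  | succ n ih =>
    have := lintegral_mul_massMartingale_succ (P := P) ha hmass n (g := fun _ => 1) measurable_const
    simpa [ih] using this

theorem setLIntegral_massMartingale_succ [IsProbabilityMeasure P] (ha : ∀ t, Measurable[sigmaAt ℱ t] (a t))
    (hmass : ∫⁻ ω, tailMass a 0 ω ∂P = 1)
    (n : ℕ) {A : Set Ω} (hA : MeasurableSet[ℱ n] A) :
    ∫⁻ ω in A, massMartingale P ℱ a (n + 1) ω ∂P = ∫⁻ ω in A, massMartingale P ℱ a n ω ∂P := by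
  have := lintegral_mul_massMartingale_succ (P := P) ha hmass n (g := A.indicator 1)
    (measurable_indicator_one hA)
  rw [← lintegral_indicator (ℱ.le n _ hA), ← lintegral_indicator (ℱ.le n _ hA)]
  simpa [Set.indicator, ite_mul] using this

/-- The measure with density process `massMartingale`. -/
theorem exists_measure_massMartingale [IsProbabilityMeasure P] (ha : ∀ t, Measurable[sigmaAt ℱ t] (a t))
    (hmass : ∫⁻ ω, tailMass a 0 ω ∂P = 1)
    {𝕋 : Set ℕ∞} (h𝕋 : IsTimeSet 𝕋)
    (htop : ⨆ (n : ℕ) (_ : (n : ℕ∞) ∈ 𝕋), ℱ n = mΩ)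
    (hreg : InfiniteHorizon 𝕋 → IsRegularFiltration ℱ) :
    ∃ Q : Measure Ω, IsProbabilityMeasure Q ∧ ∀ n : ℕ, (n : ℕ∞) ∈ 𝕋 →
      ∀ A, MeasurableSet[ℱ n] A → Q A = ∫⁻ ω in A, massMartingale P ℱ a n ω ∂P := by
  have hprob : ∀ n, IsProbabilityMeasure (P.withDensity (massMartingale P ℱ a n)) := fun n =>
    ⟨by rw [withDensity_apply _ MeasurableSet.univ, Measure.restrict_univ,
          lintegral_massMartingale ha hmass]⟩
  have hstep : ∀ n A, MeasurableSet[ℱ n] A → P.withDensity (massMartingale P ℱ a (n + 1)) A =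
      P.withDensity (massMartingale P ℱ a n) A := fun n A hA => by
    rw [withDensity_apply _ (ℱ.le n _ hA), withDensity_apply _ (ℱ.le n _ hA),
      setLIntegral_massMartingale_succ ha hmass n hA]
  by_cases hinf : InfiniteHorizon 𝕋
  · have htop' : ⨆ n, ℱ n = mΩ := (iSup_congr fun n => (iSup_pos (hinf n)).symm).trans htop
    obtain ⟨Q, hQ, hQA⟩ := (hreg hinf).exists_extension htop'
      (fun n => P.withDensity (massMartingale P ℱ a n)) hstep
    exact ⟨Q, hQ, fun n _ A hA => by rw [hQA n A hA, withDensity_apply _ (ℱ.le n _ hA)]⟩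
  · obtain ⟨T, rfl⟩ : ∃ T : ℕ, 𝕋 = Set.Iic (T : ℕ∞) := by
      rcases h𝕋 with h | rfl | rfl
      · exact h
      · exact absurd (fun n => ENat.natCast_lt_top n) hinf
      · exact absurd (fun n => trivial) hinf
    have hle : ∀ n A, MeasurableSet[ℱ n] A → ∀ k, n ≤ k →
        P.withDensity (massMartingale P ℱ a k) A = P.withDensity (massMartingale P ℱ a n) A := by
      intro n A hA k hk
      induction k, hk using Nat.le_induction with
      | base => rfl
      | succ k hk ih => rw [hstep k A (ℱ.mono hk _ hA), ih]
    -- With a finite horizon no extension is needed: the terminal value of the martingale is a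
    -- density on all of Ω.
    refine ⟨P.withDensity (massMartingale P ℱ a T), hprob T, fun n hn A hA => ?_⟩
    rw [← withDensity_apply _ (ℱ.le n _ hA)]
    exact hle n A hA T (Nat.cast_le.1 (Set.mem_Iic.1 hn))

end Multiplicative

/-! ### Existence of decompositions -/

section SumENat

theorem hasSum_enat {M : Type*} [AddCommMonoid M] [TopologicalSpace M] [ContinuousAdd M]
    {f : ℕ∞ → M} {x : M} (h : HasSum (fun n : ℕ => f n) x) : HasSum f (x + f ⊤) := by
  have hinj : Function.Injective (fun n : ℕ => (n : ℕ∞)) := fun a b hab => ENat.natCast_inj.1 hab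
  have h1 : HasSum (f ∘ ((↑) : Set.range (fun n : ℕ => (n : ℕ∞)) → ℕ∞)) x :=
    hinj.hasSum_range_iff.2 h
  have h2 : HasSum (f ∘ ((↑) : ({⊤} : Set ℕ∞) → ℕ∞)) (f ⊤) := by
    have := hasSum_fintype (f ∘ ((↑) : ({⊤} : Set ℕ∞) → ℕ∞))
    simpa using this
  refine h1.add_isCompl ?_ h2
  refine ⟨?_, ?_⟩
  · rw [Set.disjoint_singleton_right]
    rintro ⟨n, hn⟩
    exact ENat.natCast_ne_top n hn
  · rw [codisjoint_iff_le_sup]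
    rintro t -
    induction t using ENat.recTopCoe with
    | top => exact Or.inr rfl
    | coe n => exact Or.inl ⟨n, rfl⟩

theorem tsum_enat (f : ℕ∞ → ℝ≥0∞) : ∑' t, f t = (∑' n : ℕ, f n) + f ⊤ :=
  (hasSum_enat ENNReal.summable.hasSum).tsum_eq

end SumENat

/-! ### Convergence of the density process under the reference measure -/

section Density

variable {Ω : Type*} [mΩ : MeasurableSpace Ω] {P : Measure Ω} {𝕋 : Set ℕ∞}
  {ℱ : Filtration ℕ mΩ} {Q : Measure Ω}

theorem measurable_densityProcess (n : ℕ) : Measurable[ℱ n] (densityProcess P ℱ Q n) :=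
  Measure.measurable_rnDeriv _ _

theorem setLIntegral_densityProcess [IsProbabilityMeasure P] (hQ : IsLocAC P 𝕋 ℱ Q) {n : ℕ}
    (hn : (n : ℕ∞) ∈ 𝕋) {A : Set Ω} (hA : MeasurableSet[ℱ n] A) :
    ∫⁻ ω in A, densityProcess P ℱ Q n ω ∂P = Q A := by
  have := hQ.1
  rw [← trim_measurableSet_eq (ℱ.le n) hA, ← Measure.setLIntegral_rnDeriv (hQ.2 n hn) A,
    ← setLIntegral_trim (ℱ.le n) (measurable_densityProcess n) hA]
  rfl

/-- The terminal value of the density process is finite under the reference measure. -/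
theorem ae_densityLimit_lt_top [IsProbabilityMeasure P] (hQ : IsLocAC P 𝕋 ℱ Q)
    (hinf : InfiniteHorizon 𝕋) : ∀ᵐ ω ∂P, densityLimit P ℱ Q ω < ⊤ := by
  have := hQ.1
  set f : ℕ → Ω → ℝ := fun n ω => (densityProcess P ℱ Q n ω).toReal with hf
  have hd : ∀ n A, MeasurableSet[ℱ n] A → ∫⁻ ω in A, densityProcess P ℱ Q n ω ∂P = Q A :=
    fun n A hA => setLIntegral_densityProcess hQ (hinf n) hA
  have hm : ∀ n, Measurable (densityProcess P ℱ Q n) := fun n =>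
    (measurable_densityProcess n).mono (ℱ.le n) le_rfl
  have hint : ∀ n, ∫⁻ ω, densityProcess P ℱ Q n ω ∂P = 1 := fun n => by
    rw [← setLIntegral_univ, hd n _ MeasurableSet.univ, measure_univ]
  have hfin : ∀ᵐ ω ∂P, ∀ n, densityProcess P ℱ Q n ω < ∞ := ae_all_iff.2 fun n =>
    ae_lt_top (hm n) (by rw [hint]; exact ENNReal.one_ne_top)
  have hfi : ∀ n, Integrable (f n) P := fun n =>
    integrable_toReal_of_lintegral_ne_top (hm n).aemeasurable (by rw [hint]; exact ENNReal.one_ne_top)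
  have hset : ∀ n A, MeasurableSet[ℱ n] A → ∫ ω in A, f n ω ∂P = (Q A).toReal := fun n A hA => by
    rw [integral_toReal (hm n).aemeasurable (ae_restrict_of_ae (hfin.mono fun ω h => h n)), hd n A hA]
  -- The density process is an L¹-bounded P-martingale, so it has a finite limit P-a.s., which is
  -- then its limsup.
  have hmart : Martingale f ℱ P := by
    refine martingale_of_setIntegral_eq_succ (fun n => ?_) hfi fun n A hA => ?_
    · exact (measurable_densityProcess n).ennreal_toReal.stronglyMeasurable
    · rw [hset n A hA, hset (n + 1) A (ℱ.mono (Nat.le_succ n) _ hA)]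
  have hbdd : ∀ n, eLpNorm (f n) 1 P ≤ (1 : NNReal) := fun n => by
    rw [eLpNorm_one_eq_lintegral_enorm, ENNReal.coe_one, ← hint n]
    refine lintegral_mono fun ω => ?_
    rw [hf, Real.enorm_of_nonneg ENNReal.toReal_nonneg]
    exact ENNReal.ofReal_toReal_le
  filter_upwards [hmart.submartingale.exists_ae_tendsto_of_bdd hbdd, hfin] with ω ⟨c, hc⟩ hω
  have h1 : Tendsto (fun n => densityProcess P ℱ Q n ω) atTop (𝓝 (ENNReal.ofReal c)) := by
    refine (ENNReal.tendsto_ofReal hc).congr fun n => ?_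
    rw [hf, ENNReal.ofReal_toReal (hω n).ne]
  rw [densityLimit, h1.limsup_eq]
  exact ENNReal.ofReal_lt_top

end Density

/-! ### Bounded processes as integrable functions on the product space -/

section BddProcess

variable {Ω : Type*} [mΩ : MeasurableSpace Ω] {P : Measure Ω} {𝕋 : Set ℕ∞}
  {ℱ : Filtration ℕ mΩ} {μ : ℕ∞ → Ω → ℝ}

theorem measurable_onOptional {X : ℕ∞ → Ω → ℝ} (hX : X ∈ BddProcess P 𝕋 ℱ) :
    Measurable (onOptional 𝕋 ℱ X) :=
  measurable_optional_iff.2 fun t => hX.1 t t.2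

theorem ae_bdd_onOptional (hμ : IsReferenceProcess P 𝕋 ℱ μ) {X : ℕ∞ → Ω → ℝ}
    (hX : X ∈ BddProcess P 𝕋 ℱ) :
    ∃ C, ∀ᵐ p ∂(refMeasure P 𝕋 ℱ μ), |onOptional 𝕋 ℱ X p| ≤ C := by
  obtain ⟨C, hC⟩ := hX.2
  refine ⟨C, (hμ.ae_refMeasure_iff ?_).2 fun t => hC t t.2⟩
  exact measurableSet_le (measurable_onOptional hX).abs measurable_const

theorem integrable_onOptional (hμ : IsReferenceProcess P 𝕋 ℱ μ)
    {R : Measure (OptionalSpace 𝕋 ℱ)} [IsFiniteMeasure R] (hR : R ≪ refMeasure P 𝕋 ℱ μ)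
    {X : ℕ∞ → Ω → ℝ} (hX : X ∈ BddProcess P 𝕋 ℱ) : Integrable (onOptional 𝕋 ℱ X) R := by
  obtain ⟨C, hC⟩ := ae_bdd_onOptional hμ hX
  exact Integrable.of_bound (measurable_onOptional hX).aestronglyMeasurable C (hR.ae_le hC)

end BddProcess

/-! ### Assembling Q and D from the martingale and the discount factor -/

section Existence

variable {Ω : Type*} [mΩ : MeasurableSpace Ω] {P : Measure Ω} {ℱ : Filtration ℕ mΩ}
  {a : ℕ∞ → Ω → ℝ≥0∞}

/-- The discounting process `massDiscount`, extended by its limit. -/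
noncomputable def massDiscountReal (P : Measure Ω) (ℱ : Filtration ℕ mΩ) (a : ℕ∞ → Ω → ℝ≥0∞) :
    ℕ∞ → Ω → ℝ
  | (n : ℕ) => fun ω => (massDiscount P ℱ a n ω).toReal
  | ⊤ => fun ω => (⨅ n, massDiscount P ℱ a n ω).toReal

theorem massDiscount_ne_top (n : ℕ) (ω : Ω) : massDiscount P ℱ a n ω ≠ ∞ :=
  ne_top_of_le_ne_top ENNReal.one_ne_top (massDiscount_le_one n ω)

theorem iInf_massDiscount_ne_top (ω : Ω) : ⨅ n, massDiscount P ℱ a n ω ≠ ∞ :=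
  ne_top_of_le_ne_top (massDiscount_ne_top 0 ω) (iInf_le _ 0)

theorem measurable_massDiscount (n : ℕ) : Measurable (massDiscount P ℱ a n) :=
  (measurable_massDiscount_succ n).1.mono (ℱ.le n) le_rfl

theorem massDiscountReal_antitone (ω : Ω) : Antitone fun t => massDiscountReal P ℱ a t ω := by
  intro s t hst
  induction t using ENat.recTopCoe with
  | top =>
    induction s using ENat.recTopCoe with
    | top => exact le_rfl
    | coe n => exact ENNReal.toReal_mono (massDiscount_ne_top n ω) (iInf_le _ n)
  | coe k =>
    induction s using ENat.recTopCoe with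
    | top => simp at hst
    | coe n =>
      exact ENNReal.toReal_mono (massDiscount_ne_top n ω)
        (massDiscount_antitone ω (by exact_mod_cast hst))

theorem massDiscountReal_nonneg (t : ℕ∞) (ω : Ω) : 0 ≤ massDiscountReal P ℱ a t ω := by
  induction t using ENat.recTopCoe <;> exact ENNReal.toReal_nonneg

theorem tendsto_massDiscountReal (ω : Ω) :
    Tendsto (fun n : ℕ => massDiscountReal P ℱ a n ω) atTop (𝓝 (massDiscountReal P ℱ a ⊤ ω)) :=
  (ENNReal.tendsto_toReal (iInf_massDiscount_ne_top ω)).comp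
    (tendsto_atTop_iInf (massDiscount_antitone ω))

section Measure

variable {Q : Measure Ω} {𝕋 : Set ℕ∞}

theorem lintegral_eq_lintegral_mul_massMartingale
    (hQ : ∀ n : ℕ, (n : ℕ∞) ∈ 𝕋 →
      ∀ A, MeasurableSet[ℱ n] A → Q A = ∫⁻ ω in A, massMartingale P ℱ a n ω ∂P)
    {n : ℕ} (hn : (n : ℕ∞) ∈ 𝕋) {g : Ω → ℝ≥0∞} (hg : Measurable[ℱ n] g) :
    ∫⁻ ω, g ω ∂Q = ∫⁻ ω, g ω * massMartingale P ℱ a n ω ∂P := by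
  have h1 : Q.trim (ℱ.le n) = (P.withDensity (massMartingale P ℱ a n)).trim (ℱ.le n) := by
    refine @Measure.ext _ (ℱ n) _ _ fun s hs => ?_
    rw [trim_measurableSet_eq _ hs, trim_measurableSet_eq _ hs, withDensity_apply _ (ℱ.le n _ hs),
      hQ n hn s hs]
  rw [← lintegral_trim (ℱ.le n) hg, h1, lintegral_trim (ℱ.le n) hg,
    lintegral_withDensity_eq_lintegral_mul _ ((measurable_massMartingale n).mono (ℱ.le n) le_rfl)
      (hg.mono (ℱ.le n) le_rfl)]
  simp only [Pi.mul_apply, mul_comm]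

/-- On ℱ n the density of Q is the martingale factor, and its product with the discount is the
conditional tail mass. -/
theorem setLIntegral_massDiscount [IsProbabilityMeasure P]
    (ha : ∀ t, Measurable[sigmaAt ℱ t] (a t)) (hmass : ∫⁻ ω, tailMass a 0 ω ∂P = 1)
    (hzero : ℱ 0 = ⊥)
    (hQ : ∀ n : ℕ, (n : ℕ∞) ∈ 𝕋 →
      ∀ A, MeasurableSet[ℱ n] A → Q A = ∫⁻ ω in A, massMartingale P ℱ a n ω ∂P)
    {n : ℕ} (hn : (n : ℕ∞) ∈ 𝕋) {B : Set Ω} (hB : MeasurableSet[ℱ n] B) :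
    ∫⁻ ω in B, massDiscount P ℱ a n ω ∂Q = ∫⁻ ω in B, tailMass a n ω ∂P := by
  rw [← setLIntegral_condLExp (ℱ.le n) P (tailMass a n) hB,
    ← lintegral_indicator (ℱ.le n _ hB), ← lintegral_indicator (ℱ.le n _ hB),
    lintegral_eq_lintegral_mul_massMartingale hQ hn
      ((measurable_massDiscount_succ n).1.indicator hB)]
  refine lintegral_congr_ae ?_
  filter_upwards [massMartingale_mul_massDiscount ha hmass hzero n] with ω hω
  by_cases h : ω ∈ B
  · simp only [Set.indicator_of_mem h]
    rw [mul_comm, hω]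
    rfl
  · simp [h]

/-- The discount at n + 1 is ℱ n-measurable, so the density of Q on ℱ n suffices here too;
subtraction then identifies the weight at time n. -/
theorem setLIntegral_massDiscount_succ [IsProbabilityMeasure P]
    (ha : ∀ t, Measurable[sigmaAt ℱ t] (a t)) (hmass : ∫⁻ ω, tailMass a 0 ω ∂P = 1)
    (hzero : ℱ 0 = ⊥)
    (hQ : ∀ n : ℕ, (n : ℕ∞) ∈ 𝕋 →
      ∀ A, MeasurableSet[ℱ n] A → Q A = ∫⁻ ω in A, massMartingale P ℱ a n ω ∂P)
    {n : ℕ} (hn : (n : ℕ∞) ∈ 𝕋) {B : Set Ω} (hB : MeasurableSet[ℱ n] B) :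
    ∫⁻ ω in B, massDiscount P ℱ a (n + 1) ω ∂Q = ∫⁻ ω in B, tailMass a (n + 1) ω ∂P := by
  rw [← setLIntegral_condLExp (ℱ.le n) P (tailMass a (n + 1)) hB,
    ← lintegral_indicator (ℱ.le n _ hB), ← lintegral_indicator (ℱ.le n _ hB),
    lintegral_eq_lintegral_mul_massMartingale hQ hn
      ((measurable_massDiscount_succ n).2.indicator hB)]
  refine lintegral_congr_ae ?_
  filter_upwards [massMartingale_mul_massDiscount_succ ha hmass hzero n] with ω hω
  by_cases h : ω ∈ B
  · simp only [Set.indicator_of_mem h]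
    rw [mul_comm, hω]
    rfl
  · simp [h]

theorem setLIntegral_massDiscount_sub [IsProbabilityMeasure P] [IsProbabilityMeasure Q]
    (ha : ∀ t, Measurable[sigmaAt ℱ t] (a t)) (hmass : ∫⁻ ω, tailMass a 0 ω ∂P = 1)
    (hzero : ℱ 0 = ⊥)
    (hQ : ∀ n : ℕ, (n : ℕ∞) ∈ 𝕋 →
      ∀ A, MeasurableSet[ℱ n] A → Q A = ∫⁻ ω in A, massMartingale P ℱ a n ω ∂P)
    {n : ℕ} (hn : (n : ℕ∞) ∈ 𝕋) {B : Set Ω} (hB : MeasurableSet[ℱ n] B) :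
    ∫⁻ ω in B, (massDiscount P ℱ a n ω - massDiscount P ℱ a (n + 1) ω) ∂Q =
      ∫⁻ ω in B, a n ω ∂P := by
  have h1 := setLIntegral_massDiscount_succ ha hmass hzero hQ hn hB
  have h3 : ∫⁻ ω in B, tailMass a (n + 1) ω ∂P ≠ ∞ :=
    ne_top_of_le_ne_top (lintegral_tailMass_ne_top hmass (n + 1)) (setLIntegral_le_lintegral _ _)
  rw [lintegral_sub (measurable_massDiscount (n + 1)) (by rw [h1]; exact h3)
    (ae_of_all _ fun ω => massDiscount_antitone ω (Nat.le_succ n)),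
    setLIntegral_massDiscount ha hmass hzero hQ hn hB, h1]
  have h2 : ∫⁻ ω in B, tailMass a n ω ∂P =
      ∫⁻ ω in B, a n ω ∂P + ∫⁻ ω in B, tailMass a (n + 1) ω ∂P := by
    rw [← lintegral_add_left ((ha n).mono (sigmaAt_le ℱ n) le_rfl)]
    exact lintegral_congr fun ω => tailMass_eq n ω
  rw [h2]
  exact ENNReal.add_sub_cancel_right h3

/-- For an event of ℱ n and k ≥ n, the Q-integral of the discount at k is the P-mass that `a`
carries from time k on. As k → ∞ the discounts decrease to their infimum, while the finite-time
masses are tails of a convergent series, so only `a ⊤` remains. These events form a generating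
π-system. Although Q may be singular to P, this shows that the limiting discount is carried by the
part of Q that is absolutely continuous. -/
theorem withDensity_iInf_massDiscount [IsProbabilityMeasure P] [IsProbabilityMeasure Q]
    (ha : ∀ t, Measurable[sigmaAt ℱ t] (a t)) (hmass : ∫⁻ ω, tailMass a 0 ω ∂P = 1)
    (hzero : ℱ 0 = ⊥) (hinf : InfiniteHorizon 𝕋) (htop : ⨆ n, ℱ n = mΩ)
    (hQ : ∀ n : ℕ, (n : ℕ∞) ∈ 𝕋 →
      ∀ A, MeasurableSet[ℱ n] A → Q A = ∫⁻ ω in A, massMartingale P ℱ a n ω ∂P) :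
    Q.withDensity (fun ω => ⨅ n, massDiscount P ℱ a n ω) = P.withDensity (a ⊤) := by
  have ham : ∀ t, Measurable (a t) := fun t => (ha t).mono (sigmaAt_le ℱ t) le_rfl
  have key : ∀ n B, MeasurableSet[ℱ n] B → ∫⁻ ω in B, ⨅ n, massDiscount P ℱ a n ω ∂Q =
      ∫⁻ ω in B, a ⊤ ω ∂P := by
    intro n B hB
    have h1 : Tendsto (fun k => ∫⁻ ω in B, massDiscount P ℱ a k ω ∂Q) atTop
        (𝓝 (∫⁻ ω in B, ⨅ n, massDiscount P ℱ a n ω ∂Q)) := by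
      rw [lintegral_iInf (fun k => measurable_massDiscount k)
        (fun i j hij ω => massDiscount_antitone ω hij)]
      · exact tendsto_atTop_iInf fun i j hij =>
          lintegral_mono fun ω => massDiscount_antitone ω hij
      · simp [massDiscount]
    have h2 : Tendsto (fun k => ∫⁻ ω in B, tailMass a k ω ∂P) atTop
        (𝓝 (∫⁻ ω in B, a ⊤ ω ∂P)) := by
      have h3 : ∀ k, ∫⁻ ω in B, tailMass a k ω ∂P =
          (∑' j : ℕ, ∫⁻ ω in B, a ((j + k : ℕ) : ℕ∞) ω ∂P) + ∫⁻ ω in B, a ⊤ ω ∂P := by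
        intro k
        rw [← lintegral_tsum fun j => (ham _).aemeasurable, ← lintegral_add_right _ (ham _)]
        simp only [tailMass, add_comm]
      simp only [h3]
      have h4 : ∑' j : ℕ, ∫⁻ ω in B, a (j : ℕ∞) ω ∂P ≠ ∞ := by
        refine ne_top_of_le_ne_top (lintegral_tailMass_ne_top hmass 0)
          (le_trans ?_ (setLIntegral_le_lintegral B _))
        rw [h3 0]
        exact le_self_add
      simpa using (ENNReal.tendsto_sum_nat_add _ h4).add_const (∫⁻ ω in B, a ⊤ ω ∂P)
    refine tendsto_nhds_unique (h1.congr' ?_) h2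
    filter_upwards [eventually_ge_atTop n] with k hk
    exact setLIntegral_massDiscount ha hmass hzero hQ (hinf k) (ℱ.mono hk _ hB)
  have hfin : IsFiniteMeasure (Q.withDensity fun ω => ⨅ n, massDiscount P ℱ a n ω) := by
    refine isFiniteMeasure_withDensity (ne_top_of_le_ne_top ENNReal.one_ne_top ?_)
    calc ∫⁻ ω, ⨅ n, massDiscount P ℱ a n ω ∂Q ≤ ∫⁻ ω, 1 ∂Q :=
          lintegral_mono fun ω => iInf_le_of_le 0 (massDiscount_le_one 0 ω)
      _ = 1 := by simp
  refine ext_of_generate_finite (⋃ n, {s | MeasurableSet[ℱ n] s}) ?_ ?_ ?_ ?_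
  · exact htop.symm.trans (MeasurableSpace.generateFrom_iUnion_measurableSet fun n => ℱ n).symm
  · exact isPiSystem_iUnion_of_monotone _ (fun n => (ℱ n).isPiSystem_measurableSet)
      fun i j hij s hs => ℱ.mono hij s hs
  · intro s hs
    obtain ⟨n, hn⟩ := Set.mem_iUnion.1 hs
    rw [withDensity_apply _ (ℱ.le n _ hn), withDensity_apply _ (ℱ.le n _ hn), key n s hn]
  · rw [withDensity_apply _ MeasurableSet.univ, withDensity_apply _ MeasurableSet.univ,
      key 0 _ MeasurableSet.univ]

end Measure

theorem gammaOf_massDiscountReal_nonneg (𝕋 : Set ℕ∞) (t : ℕ∞) (ω : Ω) :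
    0 ≤ gammaOf 𝕋 (massDiscountReal P ℱ a) t ω := by
  unfold gammaOf
  split_ifs
  · exact sub_nonneg.2 (massDiscountReal_antitone ω le_self_add)
  · exact massDiscountReal_nonneg t ω

/-- Every probability measure which is absolutely continuous with respect to `P ⊗ μ` has a
decomposition. -/
theorem IsReferenceProcess.exists_isDecomposition [IsProbabilityMeasure P] {𝕋 : Set ℕ∞}
    (h𝕋 : IsTimeSet 𝕋) (hzero : ℱ 0 = ⊥)
    (htop : ⨆ (n : ℕ) (_ : (n : ℕ∞) ∈ 𝕋), ℱ n = mΩ)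
    (hreg : InfiniteHorizon 𝕋 → IsRegularFiltration ℱ)
    {μ : ℕ∞ → Ω → ℝ} (hμ : IsReferenceProcess P 𝕋 ℱ μ)
    {R : Measure (OptionalSpace 𝕋 ℱ)} [IsProbabilityMeasure R] (hR : R ≪ refMeasure P 𝕋 ℱ μ) :
    ∃ Q D, IsDecomposition P 𝕋 ℱ μ R Q D := by
  obtain ⟨a, ha', ha0, hRa⟩ := hμ.exists_density hR
  have ha : ∀ t, Measurable[sigmaAt ℱ t] (a t) := fun t => by
    by_cases ht : t ∈ 𝕋
    · exact ha' t ht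
    · rw [ha0 t ht]
      exact @measurable_const _ _ _ (sigmaAt ℱ t) 0
  have ham : ∀ t, Measurable (a t) := fun t => (ha t).mono (sigmaAt_le ℱ t) le_rfl
  have hmass : ∫⁻ ω, tailMass a 0 ω ∂P = 1 := by
    have h1 := hRa _ MeasurableSet.univ
    simp only [measure_univ, Set.mem_univ, Set.ofPred_true, Measure.restrict_univ] at h1
    have h2 : ∑' t : 𝕋, ∫⁻ ω, a t ω ∂P = ∑' t, ∫⁻ ω, a t ω ∂P := by
      refine tsum_subtype_eq_of_support_subset (f := fun t => ∫⁻ ω, a t ω ∂P) fun t ht => ?_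
      by_contra h
      exact ht (by simp [ha0 t h])
    rw [h1, h2, tsum_enat]
    simp only [tailMass, zero_add]
    rw [lintegral_add_right _ (ham ⊤), lintegral_tsum fun n => (ham _).aemeasurable]
  obtain ⟨Q, hQp, hQ⟩ := exists_measure_massMartingale ha hmass h𝕋 htop hreg
  have htop' : InfiniteHorizon 𝕋 → ⨆ n, ℱ n = mΩ := fun hinf =>
    (iSup_congr fun n => (iSup_pos (hinf n)).symm).trans htop
  have hinf : ⊤ ∈ 𝕋 → InfiniteHorizon 𝕋 := fun h n => h𝕋.mem_of_le le_top h
  have hlim : InfiniteHorizon 𝕋 →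
      Q.withDensity (fun ω => ⨅ n, massDiscount P ℱ a n ω) = P.withDensity (a ⊤) := fun h =>
    withDensity_iInf_massDiscount ha hmass hzero h (htop' h) hQ
  have hDinf : Measurable fun ω => ⨅ n, massDiscount P ℱ a n ω :=
    Measurable.iInf fun n => measurable_massDiscount n
  have hloc : IsLocAC P 𝕋 ℱ Q := by
    refine ⟨hQp, fun n hn => ?_⟩
    refine Measure.AbsolutelyContinuous.mk fun s hs h => ?_
    rw [trim_measurableSet_eq _ hs] at h ⊢
    rw [hQ n hn s hs]
    exact setLIntegral_measure_zero _ _ h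
  set D := massDiscountReal P ℱ a with hD
  have hDm : ∀ t ∈ 𝕋, Measurable[sigmaAt ℱ t] (D t) := by
    intro t ht
    induction t using ENat.recTopCoe with
    | top =>
      change Measurable[⨆ n, ℱ n] (fun ω => (⨅ n, massDiscount P ℱ a n ω).toReal)
      rw [htop' (hinf ht)]
      exact hDinf.ennreal_toReal
    | coe n => exact (measurable_massDiscount_succ n).1.ennreal_toReal
  have hdisc : IsDiscounting P 𝕋 ℱ Q D :=
    { measurable_zero := (measurable_massDiscount_succ 0).1.ennreal_toReal
      predictable := fun n _ => (measurable_massDiscount_succ n).2.ennreal_toReal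
      measurable_top := fun h => hDm ⊤ h
      zero := ae_of_all _ fun ω => by
        change (massDiscount P ℱ a 0 ω).toReal = 1
        simp [massDiscount]
      nonneg := fun t _ => ae_of_all _ fun ω => massDiscountReal_nonneg t ω
      nonincreasing := fun s _ t _ hst => ae_of_all _ fun ω => massDiscountReal_antitone ω hst
      -- With ∞ outside 𝕋 the density at ⊤ is zero, so Q weighted with the limiting discount is the
      -- zero measure.
      tendsto_zero := by
        intro h htop
        have h1 := hlim h
        rw [ha0 ⊤ htop, withDensity_zero] at h1
        have h2 := (withDensity_eq_zero_iff hDinf.aemeasurable).1 h1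
        filter_upwards [h2] with ω hω
        have h3 := tendsto_massDiscountReal (P := P) (ℱ := ℱ) (a := a) ω
        have h4 : massDiscountReal P ℱ a ⊤ ω = 0 := by
          change (⨅ n, massDiscount P ℱ a n ω).toReal = 0
          rw [hω]; rfl
        rwa [h4] at h3
      tendsto_top := fun _ => ae_of_all _ fun ω => tendsto_massDiscountReal ω
      -- The event {densityLimit = ⊤} is P-null, hence null for `P.withDensity (a ⊤)`, which is Q
      -- weighted with `D ⊤`. So `D ⊤` vanishes Q-a.s. on it.
      singular := by
        intro h
        have hS : MeasurableSet {ω | densityLimit P ℱ Q ω = ⊤} :=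
          (Measurable.limsup fun n => (measurable_densityProcess n).mono (ℱ.le n) le_rfl)
            (measurableSet_singleton ⊤)
        have h1 : P {ω | densityLimit P ℱ Q ω = ⊤} = 0 := by
          have := ae_densityLimit_lt_top (P := P) hloc (hinf h)
          rw [ae_iff] at this
          simpa using this
        have h2 : ∫⁻ ω in {ω | densityLimit P ℱ Q ω = ⊤}, ⨅ n, massDiscount P ℱ a n ω ∂Q = 0 := by
          rw [← withDensity_apply _ hS, hlim (hinf h), withDensity_apply _ hS]
          exact setLIntegral_measure_zero _ _ h1
        rw [setLIntegral_eq_zero_iff hS hDinf] at h2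
        filter_upwards [h2] with ω hω hωS
        change (⨅ n, massDiscount P ℱ a n ω).toReal = 0
        rw [hω hωS]; rfl }
  have hgm : ∀ t ∈ 𝕋, Measurable (gammaOf 𝕋 D t) := by
    intro t ht
    have h1 : ∀ t ∈ 𝕋, Measurable (D t) := fun t ht => (hDm t ht).mono (sigmaAt_le ℱ t) le_rfl
    by_cases h : t ≠ ⊤ ∧ t + 1 ∈ 𝕋
    · have : gammaOf 𝕋 D t = fun ω => D t ω - D (t + 1) ω := by
        funext ω; rw [gammaOf, if_pos h]
      rw [this]
      exact (h1 t ht).sub (h1 _ h.2)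
    · have : gammaOf 𝕋 D t = D t := by
        funext ω; rw [gammaOf, if_neg h]
      rw [this]
      exact h1 t ht
  -- Time slices of optional sets are `sigmaAt ℱ t`-measurable, so it is enough to compare γ_t under
  -- Q with a_t under P on that σ-field.
  have hg : ∀ t ∈ 𝕋, ∀ B, MeasurableSet[sigmaAt ℱ t] B →
      ∫⁻ ω in B, ENNReal.ofReal (gammaOf 𝕋 D t ω) ∂Q = ∫⁻ ω in B, a t ω ∂P := by
    intro t ht B hB
    induction t using ENat.recTopCoe with
    | top =>
      have h1 : ∀ ω, ENNReal.ofReal (gammaOf 𝕋 D ⊤ ω) = ⨅ n, massDiscount P ℱ a n ω := fun ω => by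
        rw [gammaOf, if_neg (by simp)]
        exact ENNReal.ofReal_toReal (iInf_massDiscount_ne_top ω)
      have hB' := sigmaAt_le ℱ ⊤ _ hB
      simp only [h1]
      rw [← withDensity_apply _ hB', hlim (hinf ht), withDensity_apply _ hB']
    | coe n =>
      by_cases h : (n : ℕ∞) + 1 ∈ 𝕋
      · rw [← setLIntegral_massDiscount_sub ha hmass hzero hQ ht hB]
        refine lintegral_congr fun ω => ?_
        rw [gammaOf, if_pos ⟨ENat.natCast_ne_top n, h⟩, ENNReal.ofReal_sub _ (massDiscountReal_nonneg _ ω)]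
        congr 1
        · exact ENNReal.ofReal_toReal (massDiscount_ne_top n ω)
        · exact ENNReal.ofReal_toReal (massDiscount_ne_top (n + 1) ω)
      · have h1 : tailMass a n = a n := by
          funext ω
          have h2 : ∀ s : ℕ∞, (n : ℕ∞) + 1 ≤ s → a s ω = 0 := fun s hs => by
            rw [ha0 s fun hs' => h (h𝕋.mem_of_le hs hs')]; rfl
          rw [tailMass_eq, tailMass, h2 ⊤ le_top, add_zero]
          simp only [fun k : ℕ => h2 ((n + 1 + k : ℕ) : ℕ∞) (by push_cast; exact le_self_add),
            tsum_zero, add_zero]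
        rw [← h1, ← setLIntegral_massDiscount ha hmass hzero hQ ht hB]
        refine lintegral_congr fun ω => ?_
        rw [gammaOf, if_neg (by simp [h])]
        exact ENNReal.ofReal_toReal (massDiscount_ne_top n ω)
  have hRQ : R = refMeasure Q 𝕋 ℱ (gammaOf 𝕋 D) := by
    ext B hB
    rw [hRa B hB, refMeasure_apply hB]
    exact tsum_congr fun t => (hg t t.2 _ (measurable_mk_sigmaAt t hB)).symm
  refine ⟨Q, D, inferInstance, hR, hloc, hdisc, fun X hX => ?_⟩
  have h1 := integrable_onOptional hμ hR hX
  rw [hRQ] at h1 ⊢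
  exact integral_refMeasure hgm
    (fun t _ => ae_of_all _ fun ω => gammaOf_massDiscountReal_nonneg 𝕋 t ω) hX.1 h1

end Existence

/-! ### The tail sums of a decomposition -/

section Tail

variable {Ω : Type*} [mΩ : MeasurableSpace Ω] {P : Measure Ω} {𝕋 : Set ℕ∞}
  {ℱ : Filtration ℕ mΩ} {μ : ℕ∞ → Ω → ℝ} {Qbar : Measure (OptionalSpace 𝕋 ℱ)} {Q : Measure Ω}
  {D : ℕ∞ → Ω → ℝ}

theorem proj_top (t : ℕ∞) (X : ℕ∞ → Ω → ℝ) (s : ℕ∞) (ω : Ω) :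
    proj t ⊤ X s ω = if t ≤ s then X s ω else 0 := by
  simp [proj]

theorem proj_top_mem {X : ℕ∞ → Ω → ℝ} (hX : X ∈ BddProcess P 𝕋 ℱ) (t : ℕ∞) :
    proj t ⊤ X ∈ BddProcess P 𝕋 ℱ := by
  obtain ⟨hm, C, hC⟩ := hX
  refine ⟨fun s hs => ?_, C, fun s hs => ?_⟩
  · by_cases h : t ≤ s
    · have : proj t ⊤ X s = X s := funext fun ω => by simp [proj_top, h]
      rw [this]
      exact hm s hs
    · have : proj t ⊤ X s = fun _ => 0 := funext fun ω => by simp [proj_top, h]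
      rw [this]
      exact measurable_const
  · filter_upwards [hC s hs] with ω hω
    rw [proj_top]
    split_ifs
    · exact hω
    · simpa using (abs_nonneg _).trans hω

theorem proj_top_mem_from {X : ℕ∞ → Ω → ℝ} (hX : X ∈ BddProcess P 𝕋 ℱ) (t : ℕ∞) :
    proj t ⊤ X ∈ BddProcessFrom P 𝕋 ℱ t :=
  ⟨proj_top_mem hX t, fun s _ => ae_of_all _ fun ω => by
    simp only [proj_top]; split_ifs <;> rfl⟩

/-- Q may be singular to P on the whole σ-field. Almost sure statements pass from P to Q only for
events observable at a finite time, which is why measurability with respect to ℱ n has to be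
tracked. -/
theorem IsLocAC.ae_of_ae (hQ : IsLocAC P 𝕋 ℱ Q) {n : ℕ} (hn : (n : ℕ∞) ∈ 𝕋) {q : Ω → Prop}
    (hq : MeasurableSet[ℱ n] {ω | q ω}) (h : ∀ᵐ ω ∂P, q ω) : ∀ᵐ ω ∂Q, q ω := by
  rw [ae_iff] at h ⊢
  rw [← Set.compl_ofPred] at h ⊢
  have h1 : P.trim (ℱ.le n) {ω | q ω}ᶜ = 0 := by rwa [trim_measurableSet_eq _ hq.compl]
  have h2 := hQ.2 n hn h1
  rwa [trim_measurableSet_eq _ hq.compl] at h2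

theorem IsDecomposition.isProbabilityMeasure_left (h : IsDecomposition P 𝕋 ℱ μ Qbar Q D) :
    IsProbabilityMeasure Q := h.locAC.1

theorem IsDecomposition.measurable_discount (h : IsDecomposition P 𝕋 ℱ μ Qbar Q D) {t : ℕ∞}
    (ht : t ∈ 𝕋) : Measurable[sigmaAt ℱ t] (D t) := by
  induction t using ENat.recTopCoe with
  | top => exact h.discounting.measurable_top ht
  | coe n =>
    cases n with
    | zero => exact h.discounting.measurable_zero
    | succ n => exact (h.discounting.predictable n ht).mono (ℱ.mono (Nat.le_succ n)) le_rfl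

theorem IsDecomposition.measurable_gamma (h : IsDecomposition P 𝕋 ℱ μ Qbar Q D) {t : ℕ∞}
    (ht : t ∈ 𝕋) : Measurable[sigmaAt ℱ t] (gammaOf 𝕋 D t) := by
  by_cases h1 : t ≠ ⊤ ∧ t + 1 ∈ 𝕋
  · have : gammaOf 𝕋 D t = fun ω => D t ω - D (t + 1) ω := by
      funext ω; rw [gammaOf, if_pos h1]
    rw [this]
    refine (h.measurable_discount ht).sub ?_
    obtain ⟨n, rfl⟩ := ENat.ne_top_iff_exists.1 h1.1
    exact h.discounting.predictable n h1.2
  · have : gammaOf 𝕋 D t = D t := by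
      funext ω; rw [gammaOf, if_neg h1]
    rw [this]
    exact h.measurable_discount ht

theorem IsDecomposition.measurable_gamma' (h : IsDecomposition P 𝕋 ℱ μ Qbar Q D) :
    ∀ t ∈ 𝕋, Measurable (gammaOf 𝕋 D t) := fun t ht =>
  (h.measurable_gamma ht).mono (sigmaAt_le ℱ t) le_rfl

theorem IsDecomposition.ae_nonneg (h : IsDecomposition P 𝕋 ℱ μ Qbar Q D) :
    ∀ᵐ ω ∂Q, ∀ t ∈ 𝕋, 0 ≤ D t ω :=
  (ae_ball_iff (Set.to_countable 𝕋)).2 h.discounting.nonneg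

theorem IsDecomposition.ae_antitone (h : IsDecomposition P 𝕋 ℱ μ Qbar Q D) :
    ∀ᵐ ω ∂Q, ∀ s ∈ 𝕋, ∀ t ∈ 𝕋, s ≤ t → D t ω ≤ D s ω := by
  refine (ae_ball_iff (Set.to_countable 𝕋)).2 fun s hs =>
    (ae_ball_iff (Set.to_countable 𝕋)).2 fun t ht => ?_
  by_cases hst : s ≤ t
  · filter_upwards [h.discounting.nonincreasing s hs t ht hst] with ω hω _ using hω
  · exact ae_of_all _ fun ω h => absurd h hst

theorem IsDecomposition.ae_gamma_nonneg (h : IsDecomposition P 𝕋 ℱ μ Qbar Q D) :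
    ∀ᵐ ω ∂Q, ∀ t ∈ 𝕋, 0 ≤ gammaOf 𝕋 D t ω := by
  filter_upwards [h.ae_nonneg, h.ae_antitone] with ω h1 h2 t ht
  unfold gammaOf
  split_ifs with hc
  · exact sub_nonneg.2 (h2 t ht _ hc.2 le_self_add)
  · exact h1 t ht

theorem IsDecomposition.ae_le_one (h𝕋 : IsTimeSet 𝕋) (h : IsDecomposition P 𝕋 ℱ μ Qbar Q D) :
    ∀ᵐ ω ∂Q, ∀ t ∈ 𝕋, D t ω ≤ 1 := by
  filter_upwards [h.discounting.zero, h.ae_antitone] with ω h1 h2 t ht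
  exact h1 ▸ h2 0 (h𝕋.mem_of_le zero_le ht) t ht zero_le

-- Telescoping, with D set to 0 outside 𝕋. The partial sums from t on are D_t − D_{t+N}, and the
-- conditions defining discounting processes give the limit of the subtracted term. If ∞ ∈ 𝕋 this
-- limit is D_∞, and γ_∞ restores it.
open Classical in
theorem IsDecomposition.hasSum_gamma (h𝕋 : IsTimeSet 𝕋)
    (h : IsDecomposition P 𝕋 ℱ μ Qbar Q D) :
    ∀ᵐ ω ∂Q, ∀ t : ℕ, (t : ℕ∞) ∈ 𝕋 →
      HasSum (fun s : 𝕋 => if (t : ℕ∞) ≤ s then gammaOf 𝕋 D s ω else 0) (D t ω) := by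
  have hlim : ∀ᵐ ω ∂Q, Tendsto (fun n : ℕ => if (n : ℕ∞) ∈ 𝕋 then D n ω else 0) atTop
      (𝓝 (if ⊤ ∈ 𝕋 then D ⊤ ω else 0)) := by
    rcases h𝕋 with ⟨T, rfl⟩ | rfl | rfl
    · refine ae_of_all _ fun ω => ?_
      rw [if_neg (by simp)]
      refine tendsto_const_nhds.congr' ?_
      filter_upwards [eventually_gt_atTop T] with n hn
      rw [if_neg]
      simpa using hn
    · have h1 : ∀ n : ℕ, (n : ℕ∞) ∈ Set.Iio (⊤ : ℕ∞) := fun n => ENat.natCast_lt_top n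
      filter_upwards [h.discounting.tendsto_zero h1 (by simp)] with ω hω
      simpa [h1] using hω
    · filter_upwards [h.discounting.tendsto_top trivial] with ω hω
      simpa using hω
  filter_upwards [hlim, h.ae_gamma_nonneg] with ω hω hnn t ht
  have h1 : ∀ n : ℕ, (if (n : ℕ∞) ∈ 𝕋 then gammaOf 𝕋 D n ω else 0) =
      (if (n : ℕ∞) ∈ 𝕋 then D n ω else 0) -
        (if ((n + 1 : ℕ) : ℕ∞) ∈ 𝕋 then D ((n + 1 : ℕ) : ℕ∞) ω else 0) := by
    intro n
    by_cases hn : (n : ℕ∞) ∈ 𝕋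
    · by_cases hn' : ((n + 1 : ℕ) : ℕ∞) ∈ 𝕋
      · have hn'' : (n : ℕ∞) + 1 ∈ 𝕋 := hn'
        simp [hn, hn'', gammaOf]
      · have hn'' : (n : ℕ∞) + 1 ∉ 𝕋 := hn'
        simp [hn, hn'', gammaOf]
    · have hn' : ((n + 1 : ℕ) : ℕ∞) ∉ 𝕋 := fun hn' =>
        hn (h𝕋.mem_of_le (by exact_mod_cast Nat.le_succ n) hn')
      rw [if_neg hn, if_neg hn, if_neg hn', sub_zero]
  set f : ℕ∞ → ℝ := fun s => if s ∈ 𝕋 then (if (t : ℕ∞) ≤ s then gammaOf 𝕋 D s ω else 0) else 0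
    with hf
  have hf0 : ∀ s, 0 ≤ f s := fun s => by
    simp only [hf]
    split_ifs with h2 h3
    exacts [hnn s h2, le_rfl, le_rfl]
  have hsum : ∀ N, ∑ n ∈ Finset.range (t + N), f (n : ℕ) =
      D t ω - if ((t + N : ℕ) : ℕ∞) ∈ 𝕋 then D ((t + N : ℕ) : ℕ∞) ω else 0 := by
    intro N
    induction N with
    | zero =>
      rw [Finset.sum_eq_zero]
      · simp [ht]
      · intro n hn
        have hn' : n < t := by simpa using hn
        simp only [hf]
        rw [if_neg (c := (t : ℕ∞) ≤ n) (by exact_mod_cast not_le.2 hn'), ite_self]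
    | succ N ih =>
      rw [← add_assoc, Finset.sum_range_succ, ih]
      simp only [hf]
      rw [if_pos (c := (t : ℕ∞) ≤ ((t + N : ℕ) : ℕ∞)) (by exact_mod_cast Nat.le_add_right t N), h1]
      ring
  have htend : Tendsto (fun N => ∑ n ∈ Finset.range N, f (n : ℕ)) atTop
      (𝓝 (D t ω - if ⊤ ∈ 𝕋 then D ⊤ ω else 0)) := by
    have h2 : Tendsto (fun N => ∑ n ∈ Finset.range (N + t), f (n : ℕ)) atTop
        (𝓝 (D t ω - if ⊤ ∈ 𝕋 then D ⊤ ω else 0)) := by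
      simp only [add_comm _ t, hsum]
      simp only [add_comm t]
      exact tendsto_const_nhds.sub ((tendsto_add_atTop_iff_nat t).2 hω)
    exact (tendsto_add_atTop_iff_nat t).1 h2
  have h3 : HasSum f (D t ω) := by
    have h4 := hasSum_enat ((hasSum_iff_tendsto_nat_of_nonneg (fun n : ℕ => hf0 n) _).2 htend)
    have h5 : f ⊤ = if ⊤ ∈ 𝕋 then D ⊤ ω else 0 := by
      simp [hf, gammaOf]
    rwa [h5, sub_add_cancel] at h4
  have h6 := hasSum_subtype_iff_indicator (f := fun s => if (t : ℕ∞) ≤ s then gammaOf 𝕋 D s ω else 0)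
    (s := 𝕋) (a := D t ω)
  exact h6.2 h3

theorem IsDecomposition.summable_gamma (h𝕋 : IsTimeSet 𝕋)
    (h : IsDecomposition P 𝕋 ℱ μ Qbar Q D) :
    ∀ᵐ ω ∂Q, HasSum (fun s : 𝕋 => gammaOf 𝕋 D s ω) (D 0 ω) := by
  have h0 : ((0 : ℕ) : ℕ∞) ∈ 𝕋 := by
    rcases h𝕋 with ⟨T, rfl⟩ | rfl | rfl <;> simp
  filter_upwards [h.hasSum_gamma h𝕋] with ω hω
  simpa using hω 0 h0

/-- A decomposed measure is the product of its factors. -/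
theorem IsDecomposition.eq_refMeasure (h𝕋 : IsTimeSet 𝕋)
    (h : IsDecomposition P 𝕋 ℱ μ Qbar Q D) : Qbar = refMeasure Q 𝕋 ℱ (gammaOf 𝕋 D) := by
  classical
  have := h.isProbabilityMeasure
  have := h.isProbabilityMeasure_left
  have huniv : refMeasure Q 𝕋 ℱ (gammaOf 𝕋 D) Set.univ = 1 := by
    rw [refMeasure_apply MeasurableSet.univ]
    simp only [Set.mem_univ, Set.ofPred_true, Measure.restrict_univ]
    rw [← lintegral_tsum fun t : 𝕋 => (h.measurable_gamma' t t.2).ennreal_ofReal.aemeasurable]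
    have : ∀ᵐ ω ∂Q, ∑' t : 𝕋, ENNReal.ofReal (gammaOf 𝕋 D t ω) = 1 := by
      filter_upwards [h.summable_gamma h𝕋, h.ae_gamma_nonneg, h.discounting.zero] with ω h1 h2 h3
      rw [← ENNReal.ofReal_tsum_of_nonneg (fun t : 𝕋 => h2 t t.2) h1.summable, h1.tsum_eq, h3,
        ENNReal.ofReal_one]
    rw [lintegral_congr_ae this]
    simp
  have hfin : IsFiniteMeasure (refMeasure Q 𝕋 ℱ (gammaOf 𝕋 D)) :=
    ⟨by rw [huniv]; exact ENNReal.one_lt_top⟩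
  ext B hB
  set X : ℕ∞ → Ω → ℝ := fun t ω =>
    if ht : t ∈ 𝕋 then Set.indicator B 1 (⟨ω, ⟨t, ht⟩⟩ : OptionalSpace 𝕋 ℱ) else 0 with hX
  have hXB : onOptional 𝕋 ℱ X = B.indicator 1 := by
    funext p
    simp [onOptional, hX]
  have hXm : X ∈ BddProcess P 𝕋 ℱ := by
    refine ⟨fun t ht => ?_, 1, fun t ht => ae_of_all _ fun ω => ?_⟩
    · simp only [hX, ht, dite_true]
      have h1 : Measurable (B.indicator (1 : OptionalSpace 𝕋 ℱ → ℝ)) :=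
        measurable_one.indicator hB
      exact measurable_optional_iff.1 h1 ⟨t, ht⟩
    · simp only [hX, ht, dite_true]
      by_cases hp : (⟨ω, ⟨t, ht⟩⟩ : OptionalSpace 𝕋 ℱ) ∈ B <;> simp [hp]
  have h1 := h.integral_eq X hXm
  have h2 : Integrable (onOptional 𝕋 ℱ X) (refMeasure Q 𝕋 ℱ (gammaOf 𝕋 D)) := by
    rw [hXB]
    exact (integrable_const 1).indicator hB
  rw [← integral_refMeasure h.measurable_gamma'
    (fun t ht => h.ae_gamma_nonneg.mono fun ω hω => hω t ht) hXm.1 h2, hXB,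
    integral_indicator_one hB, integral_indicator_one hB] at h1
  exact (ENNReal.toReal_eq_toReal_iff' (measure_ne_top _ _) (measure_ne_top _ _)).1 h1

/-- At time ∞ a P-a.s. property need not hold Q-a.s. It does hold where γ_t > 0, which is enough for
quantities weighted with γ. -/
theorem IsDecomposition.ae_of_ae_refMeasure (h𝕋 : IsTimeSet 𝕋)
    (h : IsDecomposition P 𝕋 ℱ μ Qbar Q D)
    {q : OptionalSpace 𝕋 ℱ → Prop} (hq : MeasurableSet {p | q p})
    (hae : ∀ᵐ p ∂(refMeasure P 𝕋 ℱ μ), q p) :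
    ∀ᵐ ω ∂Q, ∀ t : 𝕋, 0 < gammaOf 𝕋 D t ω → q ⟨ω, t⟩ := by
  refine ae_all_iff.2 fun t => ?_
  have h1 := h.absolutelyContinuous.ae_le hae
  rw [h.eq_refMeasure h𝕋] at h1
  exact (ae_refMeasure_iff h.measurable_gamma' hq).1 h1 t

theorem IsDecomposition.ae_bdd (h𝕋 : IsTimeSet 𝕋) (hμ : IsReferenceProcess P 𝕋 ℱ μ)
    (h : IsDecomposition P 𝕋 ℱ μ Qbar Q D) {X : ℕ∞ → Ω → ℝ} (hX : ∀ t ∈ 𝕋, Measurable[sigmaAt ℱ t] (X t))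
    {C : ℝ} (hC : ∀ t ∈ 𝕋, ∀ᵐ ω ∂P, |X t ω| ≤ C) :
    ∀ᵐ ω ∂Q, ∀ t ∈ 𝕋, |gammaOf 𝕋 D t ω * X t ω| ≤ C * gammaOf 𝕋 D t ω := by
  have hm : MeasurableSet {p : OptionalSpace 𝕋 ℱ | |onOptional 𝕋 ℱ X p| ≤ C} :=
    measurableSet_le (measurable_optional_iff.2 fun t => hX t t.2).abs measurable_const
  filter_upwards [h.ae_of_ae_refMeasure h𝕋 hm ((hμ.ae_refMeasure_iff hm).2 fun t => hC t t.2),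
    h.ae_gamma_nonneg] with ω h1 h2 t ht
  rcases (h2 t ht).eq_or_lt with h0 | h0
  · simp [← h0]
  · rw [abs_mul, abs_of_pos h0, mul_comm]
    exact mul_le_mul_of_nonneg_right (h1 ⟨t, ht⟩ h0) h0.le

/-- `∑_{s ≥ t} γ_s X_s`. -/
noncomputable def tailSum (𝕋 : Set ℕ∞) (D : ℕ∞ → Ω → ℝ) (t : ℕ) (X : ℕ∞ → Ω → ℝ) (ω : Ω) : ℝ :=
  ∑' s : 𝕋, gammaOf 𝕋 D s ω * proj t ⊤ X s ω

theorem IsDecomposition.summable_tailSum (h𝕋 : IsTimeSet 𝕋) (hμ : IsReferenceProcess P 𝕋 ℱ μ)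
    (h : IsDecomposition P 𝕋 ℱ μ Qbar Q D) {X : ℕ∞ → Ω → ℝ} (hX : X ∈ BddProcess P 𝕋 ℱ) :
    ∀ᵐ ω ∂Q, ∀ t : ℕ, Summable fun s : 𝕋 => gammaOf 𝕋 D s ω * proj t ⊤ X s ω := by
  obtain ⟨hm, C, hC⟩ := hX
  filter_upwards [h.ae_bdd h𝕋 hμ hm hC, h.summable_gamma h𝕋] with ω h1 h2 t
  refine Summable.of_norm_bounded ((h2.summable).mul_left C) fun s => ?_
  rw [proj_top, Real.norm_eq_abs]
  split_ifs
  · exact h1 s s.2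
  · have := (abs_nonneg _).trans (h1 s s.2)
    simpa using this

theorem IsDecomposition.abs_tailSum_le (h𝕋 : IsTimeSet 𝕋) (hμ : IsReferenceProcess P 𝕋 ℱ μ)
    (h : IsDecomposition P 𝕋 ℱ μ Qbar Q D) {X : ℕ∞ → Ω → ℝ}
    (hX : ∀ t ∈ 𝕋, Measurable[sigmaAt ℱ t] (X t))
    {C : ℝ} (hC : ∀ t ∈ 𝕋, ∀ᵐ ω ∂P, |X t ω| ≤ C) {t : ℕ} (ht : (t : ℕ∞) ∈ 𝕋) :
    ∀ᵐ ω ∂Q, |tailSum 𝕋 D t X ω| ≤ C * D t ω := by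
  filter_upwards [h.ae_bdd h𝕋 hμ hX hC, h.hasSum_gamma h𝕋] with ω h1 h2
  rw [← Real.norm_eq_abs]
  refine tsum_of_norm_bounded ((h2 t ht).mul_left C) fun s => ?_
  rw [proj_top, Real.norm_eq_abs]
  split_ifs
  · exact h1 s s.2
  · simp

theorem IsDecomposition.measurable_tailSum (h : IsDecomposition P 𝕋 ℱ μ Qbar Q D)
    {X : ℕ∞ → Ω → ℝ} (hX : X ∈ BddProcess P 𝕋 ℱ) (t : ℕ) : Measurable (tailSum 𝕋 D t X) := by
  have h1 := (proj_top_mem hX t).1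
  exact Measurable.tsum fun s : 𝕋 =>
    (h.measurable_gamma' s s.2).mul ((h1 s s.2).mono (sigmaAt_le ℱ s) le_rfl)

theorem IsDecomposition.integrable_tailSum (h𝕋 : IsTimeSet 𝕋) (hμ : IsReferenceProcess P 𝕋 ℱ μ)
    (h : IsDecomposition P 𝕋 ℱ μ Qbar Q D) {X : ℕ∞ → Ω → ℝ} (hX : X ∈ BddProcess P 𝕋 ℱ)
    {t : ℕ} (ht : (t : ℕ∞) ∈ 𝕋) : Integrable (tailSum 𝕋 D t X) Q := by
  have := h.isProbabilityMeasure_left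
  obtain ⟨C, hC⟩ := hX.2
  refine Integrable.of_bound (h.measurable_tailSum hX t).aestronglyMeasurable |C| ?_
  filter_upwards [h.abs_tailSum_le h𝕋 hμ hX.1 hC ht, h.ae_le_one h𝕋, h.ae_nonneg] with ω h1 h2 h3
  rw [Real.norm_eq_abs]
  nlinarith [h2 t ht, h3 t ht, le_abs_self C, abs_nonneg C]

theorem IsDecomposition.tailSum_const_mul_add (h𝕋 : IsTimeSet 𝕋) (hμ : IsReferenceProcess P 𝕋 ℱ μ)
    (h : IsDecomposition P 𝕋 ℱ μ Qbar Q D) {X Y : ℕ∞ → Ω → ℝ} (hX : X ∈ BddProcess P 𝕋 ℱ)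
    (hY : Y ∈ BddProcess P 𝕋 ℱ) (u v : Ω → ℝ) (t : ℕ) :
    ∀ᵐ ω ∂Q, tailSum 𝕋 D t (fun s ω => u ω * X s ω + v ω * Y s ω) ω =
      u ω * tailSum 𝕋 D t X ω + v ω * tailSum 𝕋 D t Y ω := by
  filter_upwards [h.summable_tailSum h𝕋 hμ hX, h.summable_tailSum h𝕋 hμ hY] with ω h1 h2
  rw [tailSum, tailSum, tailSum, ← tsum_mul_left, ← tsum_mul_left,
    ← ((h1 t).mul_left _).tsum_add ((h2 t).mul_left _)]
  refine tsum_congr fun s => ?_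
  simp only [proj_top]
  split_ifs <;> ring

theorem IsDecomposition.tailSum_add (h𝕋 : IsTimeSet 𝕋) (hμ : IsReferenceProcess P 𝕋 ℱ μ)
    (h : IsDecomposition P 𝕋 ℱ μ Qbar Q D) {X Y : ℕ∞ → Ω → ℝ} (hX : X ∈ BddProcess P 𝕋 ℱ)
    (hY : Y ∈ BddProcess P 𝕋 ℱ) (t : ℕ) :
    ∀ᵐ ω ∂Q, tailSum 𝕋 D t (X + Y) ω = tailSum 𝕋 D t X ω + tailSum 𝕋 D t Y ω := by
  filter_upwards [h.tailSum_const_mul_add h𝕋 hμ hX hY 1 1 t] with ω hω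
  simp only [Pi.one_apply, one_mul] at hω
  exact hω

theorem IsDecomposition.tailSum_cash (h𝕋 : IsTimeSet 𝕋)
    (h : IsDecomposition P 𝕋 ℱ μ Qbar Q D) (V : Ω → ℝ) {t : ℕ} (ht : (t : ℕ∞) ∈ 𝕋) :
    ∀ᵐ ω ∂Q, tailSum 𝕋 D t (fun s ω => if (t : ℕ∞) ≤ s then V ω else 0) ω = D t ω * V ω := by
  filter_upwards [h.hasSum_gamma h𝕋] with ω h1
  rw [tailSum, ← (h1 t ht).tsum_eq, ← tsum_mul_right]
  refine tsum_congr fun s => ?_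
  simp only [proj_top]
  split_ifs <;> ring

theorem IsDecomposition.tailSum_eq_add (h𝕋 : IsTimeSet 𝕋) (hμ : IsReferenceProcess P 𝕋 ℱ μ)
    (h : IsDecomposition P 𝕋 ℱ μ Qbar Q D) {X : ℕ∞ → Ω → ℝ} (hX : X ∈ BddProcess P 𝕋 ℱ)
    {t : ℕ} (ht : (t : ℕ∞) ∈ 𝕋) :
    ∀ᵐ ω ∂Q, tailSum 𝕋 D t X ω = gammaOf 𝕋 D t ω * X t ω + tailSum 𝕋 D (t + 1) X ω := by
  filter_upwards [h.summable_tailSum h𝕋 hμ hX] with ω h1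
  have h2 : HasSum (fun s : 𝕋 => if s = ⟨t, ht⟩ then gammaOf 𝕋 D t ω * X t ω else 0)
      (gammaOf 𝕋 D t ω * X t ω) := by
    classical
    convert hasSum_ite_eq (⟨t, ht⟩ : 𝕋) (gammaOf 𝕋 D t ω * X t ω) using 1
  rw [tailSum, tailSum]
  refine Eq.trans (tsum_congr fun s => ?_)
    ((h2.add (h1 (t + 1)).hasSum).tsum_eq)
  simp only [proj_top]
  by_cases hs : s = ⟨t, ht⟩
  · subst hs
    have : ¬ ((t + 1 : ℕ) : ℕ∞) ≤ (t : ℕ∞) := by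
      rw [Nat.cast_le]; omega
    rw [if_pos rfl, if_pos le_rfl, if_neg this]
    ring
  · have h3 : ((t + 1 : ℕ) : ℕ∞) ≤ s ↔ (t : ℕ∞) ≤ s := by
      have h4 : (t : ℕ∞) ≠ s := fun h => hs (Subtype.ext h.symm)
      push_cast
      rw [ENat.add_one_le_iff (ENat.natCast_ne_top t)]
      exact ⟨le_of_lt, fun h => lt_of_le_of_ne h h4⟩
    rw [if_neg hs, zero_add]
    simp only [h3]

/-- Processes which agree almost surely have the same tail sums. -/
theorem IsDecomposition.tailSum_congr (h𝕋 : IsTimeSet 𝕋) (hμ : IsReferenceProcess P 𝕋 ℱ μ)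
    (h : IsDecomposition P 𝕋 ℱ μ Qbar Q D) {X Y : ℕ∞ → Ω → ℝ} (hX : X ∈ BddProcess P 𝕋 ℱ)
    (hY : Y ∈ BddProcess P 𝕋 ℱ) (t : ℕ)
    (hXY : ∀ s ∈ 𝕋, (t : ℕ∞) ≤ s → X s =ᵐ[P] Y s) :
    ∀ᵐ ω ∂Q, tailSum 𝕋 D t X ω = tailSum 𝕋 D t Y ω := by
  have hX' := proj_top_mem hX t
  have hY' := proj_top_mem hY t
  have hm : MeasurableSet {p : OptionalSpace 𝕋 ℱ |
      onOptional 𝕋 ℱ (proj t ⊤ X) p = onOptional 𝕋 ℱ (proj t ⊤ Y) p} :=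
    measurableSet_eq_fun (measurable_onOptional hX') (measurable_onOptional hY')
  have hae : ∀ᵐ p ∂(refMeasure P 𝕋 ℱ μ),
      onOptional 𝕋 ℱ (proj t ⊤ X) p = onOptional 𝕋 ℱ (proj t ⊤ Y) p := by
    refine (hμ.ae_refMeasure_iff hm).2 fun s => ?_
    by_cases hs : (t : ℕ∞) ≤ s
    · filter_upwards [hXY s s.2 hs] with ω hω
      simp [onOptional, proj_top, hω]
    · simp [onOptional, proj_top, hs]
  filter_upwards [h.ae_of_ae_refMeasure h𝕋 hm hae, h.ae_gamma_nonneg] with ω h1 h2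
  refine _root_.tsum_congr fun s => ?_
  rcases (h2 s s.2).eq_or_lt with h0 | h0
  · simp [← h0]
  · have := h1 s h0
    simp only [onOptional] at this
    rw [this]

theorem measurable_indicator_one_real {m : MeasurableSpace Ω} {A : Set Ω} (hA : MeasurableSet A) :
    Measurable (A.indicator (1 : Ω → ℝ)) :=
  measurable_one.indicator hA

theorem mul_indicator_mem {X : ℕ∞ → Ω → ℝ} (hX : X ∈ BddProcess P 𝕋 ℱ) {t : ℕ} {A : Set Ω}
    (hA : MeasurableSet[ℱ t] A) :
    (fun s ω => A.indicator 1 ω * proj t ⊤ X s ω) ∈ BddProcess P 𝕋 ℱ := by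
  have h1 := proj_top_mem hX t
  obtain ⟨C, hC⟩ := h1.2
  refine ⟨fun s hs => ?_, C, fun s hs => ?_⟩
  · by_cases hst : (t : ℕ∞) ≤ s
    · exact ((measurable_indicator_one_real hA).mono (sigmaAt_mono ℱ hst) le_rfl).mul (h1.1 s hs)
    · have : (fun ω => A.indicator 1 ω * proj t ⊤ X s ω) = fun _ => (0 : ℝ) := by
        funext ω; simp [proj_top, hst]
      change Measurable[sigmaAt ℱ s] (fun ω => A.indicator 1 ω * proj t ⊤ X s ω)
      rw [this]
      exact measurable_const
  · filter_upwards [hC s hs] with ω hω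
    by_cases hωA : ω ∈ A
    · simpa [hωA] using hω
    · simpa [hωA] using (abs_nonneg _).trans hω

theorem measurableSet_time_state {t : ℕ} {A : Set Ω} (hA : MeasurableSet[ℱ t] A) :
    MeasurableSet {p : OptionalSpace 𝕋 ℱ | (t : ℕ∞) ≤ p.time ∧ p.state ∈ A} := by
  refine measurableSet_optional_iff.2 fun s => ?_
  by_cases hst : (t : ℕ∞) ≤ s
  · simpa [hst] using sigmaAt_mono ℱ hst _ hA
  · simp [hst]

/-- Links conditional losses to `Qbar`: tested on ℱ t-events, they are integrals over the part of
the product space from time t on. -/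
theorem IsDecomposition.setIntegral_tailSum (h : IsDecomposition P 𝕋 ℱ μ Qbar Q D)
    {X : ℕ∞ → Ω → ℝ} (hX : X ∈ BddProcess P 𝕋 ℱ) {t : ℕ} {A : Set Ω} (hA : MeasurableSet[ℱ t] A) :
    ∫ ω in A, tailSum 𝕋 D t X ω ∂Q =
      ∫ p in {p | (t : ℕ∞) ≤ p.time ∧ p.state ∈ A}, onOptional 𝕋 ℱ X p ∂Qbar := by
  rw [← integral_indicator (measurableSet_time_state hA), ← integral_indicator (ℱ.le t _ hA)]
  have h1 := h.integral_eq _ (mul_indicator_mem hX hA)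
  have h2 : onOptional 𝕋 ℱ (fun s ω => A.indicator 1 ω * proj t ⊤ X s ω) =
      Set.indicator {p | (t : ℕ∞) ≤ p.time ∧ p.state ∈ A} (onOptional 𝕋 ℱ X) := by
    funext p
    by_cases h3 : (t : ℕ∞) ≤ p.time <;> by_cases h4 : p.state ∈ A <;>
      simp [onOptional, proj_top, Set.indicator, h3, h4]
  rw [h2] at h1
  rw [h1]
  refine integral_congr_ae (ae_of_all _ fun ω => ?_)
  by_cases h4 : ω ∈ A <;> simp [Set.indicator, h4, tailSum]

end Tail

/-! ### Attaining essential suprema, and extended conditional expectations -/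

section EssSup

variable {Ω : Type*} {m mΩ : MeasurableSpace Ω}

theorem integrable_arctan {ν : Measure Ω} [IsFiniteMeasure ν] {f : Ω → ℝ} (hf : Measurable f) :
    Integrable (fun ω => Real.arctan (f ω)) ν :=
  Integrable.of_bound (Real.measurable_arctan.comp hf).aestronglyMeasurable (Real.pi / 2)
    (ae_of_all _ fun _ => abs_le.2 ⟨(Real.neg_pi_div_two_lt_arctan _).le,
      (Real.arctan_lt_pi_div_two _).le⟩)

/-- The essential supremum of an upwards directed family is the limit of an increasing sequence. -/
theorem IsEssSup.exists_seq {ν : Measure Ω} [IsFiniteMeasure ν] (hm : m ≤ mΩ) {ι : Type*}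
    {𝒮 : Set ι} {l : ι → Ω → ℝ} (hl : ∀ i ∈ 𝒮, Measurable[m] (l i)) {i₀ : ι} (hi₀ : i₀ ∈ 𝒮)
    (hmax : ∀ i ∈ 𝒮, ∀ j ∈ 𝒮, ∃ k ∈ 𝒮, ∀ᵐ ω ∂ν, l k ω = max (l i ω) (l j ω)) {Z : Ω → EReal}
    (hZ : IsEssSup ν m {f | ∃ i ∈ 𝒮, f = fun ω => (l i ω : EReal)} Z) :
    ∃ u : ℕ → ι, (∀ n, u n ∈ 𝒮) ∧ ∀ᵐ ω ∂ν, (∀ n, l i₀ ω ≤ l (u n) ω) ∧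
      Monotone (fun n => l (u n) ω) ∧ Tendsto (fun n => (l (u n) ω : EReal)) atTop (𝓝 (Z ω)) := by
  have hl' : ∀ i ∈ 𝒮, Measurable (l i) := fun i hi => (hl i hi).mono hm le_rfl
  -- The arctangent makes arbitrary measurable functions integrable and keeps their order.
  set I : ι → ℝ := fun i => ∫ ω, Real.arctan (l i ω) ∂ν with hI
  have hbdd : BddAbove (I '' 𝒮) := by
    refine ⟨∫ _, Real.pi / 2 ∂ν, ?_⟩
    rintro _ ⟨i, hi, rfl⟩
    exact integral_mono (integrable_arctan (hl' i hi)) (integrable_const _)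
      fun ω => (Real.arctan_lt_pi_div_two _).le
  obtain ⟨v, -, hv, hvS⟩ := exists_seq_tendsto_sSup (S := I '' 𝒮) ⟨I i₀, i₀, hi₀, rfl⟩ hbdd
  choose x hxS hxv using hvS
  choose! j hjS hj using hmax
  set u : ℕ → ι := fun n => Nat.rec (j i₀ (x 0)) (fun k w => j w (x (k + 1))) n with hu
  have hu0 : u 0 = j i₀ (x 0) := rfl
  have hus : ∀ n, u (n + 1) = j (u n) (x (n + 1)) := fun n => rfl
  have huS : ∀ n, u n ∈ 𝒮 := fun n => by
    induction n with
    | zero => exact hjS _ hi₀ _ (hxS 0)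
    | succ n ih => rw [hus]; exact hjS _ ih _ (hxS _)
  have hstep : ∀ᵐ ω ∂ν, l (u 0) ω = max (l i₀ ω) (l (x 0) ω) ∧
      ∀ n, l (u (n + 1)) ω = max (l (u n) ω) (l (x (n + 1)) ω) := by
    refine (hj _ hi₀ _ (hxS 0)).and (ae_all_iff.2 fun n => ?_)
    rw [hus]
    exact hj _ (huS n) _ (hxS _)
  have hmono : ∀ᵐ ω ∂ν, Monotone fun n => l (u n) ω := by
    filter_upwards [hstep] with ω hω
    exact monotone_nat_of_le_succ fun n => by rw [hω.2]; exact le_max_left _ _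
  have hx_le : ∀ n, ∀ᵐ ω ∂ν, l (x n) ω ≤ l (u n) ω := fun n => by
    filter_upwards [hstep] with ω hω
    cases n with
    | zero => rw [hω.1]; exact le_max_right _ _
    | succ n => rw [hω.2]; exact le_max_right _ _
  have hIu : Tendsto (fun n => I (u n)) atTop (𝓝 (sSup (I '' 𝒮))) := by
    refine tendsto_of_tendsto_of_tendsto_of_le_of_le hv tendsto_const_nhds (fun n => ?_)
      (fun n => le_csSup hbdd ⟨_, huS n, rfl⟩)
    simp only [← hxv]
    refine integral_mono_ae (integrable_arctan (hl' _ (hxS n))) (integrable_arctan (hl' _ (huS n))) ?_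
    filter_upwards [hx_le n] with ω hω
    exact Real.arctan_strictMono.monotone hω
  set Y : Ω → EReal := fun ω => ⨆ n, (l (u n) ω : EReal) with hY
  have hYm : Measurable[m] Y := Measurable.iSup fun n => (hl _ (huS n)).coe_real_ereal
  -- The maximum of `u n` and `i` is realized in the family, so its integral cannot exceed the
  -- supremum, to which `I (u n)` tends. Hence `l i` can exceed the limit on a null set only.
  have hub : ∀ i ∈ 𝒮, ∀ᵐ ω ∂ν, (l i ω : EReal) ≤ Y ω := by
    intro i hi
    set g : ℕ → Ω → ℝ := fun n ω =>
      Real.arctan (max (l (u n) ω) (l i ω)) - Real.arctan (l (u n) ω) with hg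
    have hgm : ∀ n, Measurable (fun ω => max (l (u n) ω) (l i ω)) := fun n =>
      (hl' _ (huS n)).max (hl' i hi)
    have hg0 : ∀ n ω, 0 ≤ g n ω := fun n ω =>
      sub_nonneg.2 (Real.arctan_strictMono.monotone (le_max_left _ _))
    have hgi : ∀ n, Integrable (g n) ν := fun n =>
      (integrable_arctan (hgm n)).sub (integrable_arctan (hl' _ (huS n)))
    have hgint : ∀ n, ∫ ω, g n ω ∂ν ≤ sSup (I '' 𝒮) - I (u n) := fun n => by
      rw [hg, integral_sub (integrable_arctan (hgm n)) (integrable_arctan (hl' _ (huS n)))]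
      refine sub_le_sub_right (le_csSup hbdd ⟨_, hjS _ (huS n) _ hi, ?_⟩) _
      refine integral_congr_ae ?_
      filter_upwards [hj _ (huS n) _ hi] with ω hω
      rw [hω]
    have h1 : ∫⁻ ω, ⨅ n, ENNReal.ofReal (g n ω) ∂ν = 0 := by
      have h2 : Tendsto (fun n => ENNReal.ofReal (sSup (I '' 𝒮) - I (u n))) atTop (𝓝 0) := by
        have := ENNReal.tendsto_ofReal (tendsto_const_nhds (x := sSup (I '' 𝒮)).sub hIu)
        simpa using this
      refine le_antisymm (ge_of_tendsto' h2 fun n => ?_) zero_le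
      calc ∫⁻ ω, ⨅ n, ENNReal.ofReal (g n ω) ∂ν ≤ ∫⁻ ω, ENNReal.ofReal (g n ω) ∂ν :=
            lintegral_mono fun ω => iInf_le _ n
        _ = ENNReal.ofReal (∫ ω, g n ω ∂ν) :=
            (ofReal_integral_eq_lintegral_ofReal (hgi n) (ae_of_all _ (hg0 n))).symm
        _ ≤ _ := ENNReal.ofReal_le_ofReal (hgint n)
    rw [lintegral_eq_zero_iff] at h1
    · filter_upwards [h1] with ω hω
      by_contra hlt
      rw [not_le] at hlt
      have hYb : Y ω ≠ ⊥ := fun h => by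
        have := le_iSup (fun n => (l (u n) ω : EReal)) 0
        change _ ≤ Y ω at this
        rw [h, le_bot_iff] at this
        exact EReal.coe_ne_bot _ this
      lift Y ω to ℝ using ⟨hlt.ne_top, hYb⟩ with y hy
      have hy1 : ∀ n, l (u n) ω ≤ y := fun n => by
        have := le_iSup (fun n => (l (u n) ω : EReal)) n
        change _ ≤ Y ω at this
        rw [← hy] at this
        exact_mod_cast this
      have hy2 : y < l i ω := by exact_mod_cast hlt
      have h3 : ENNReal.ofReal (Real.arctan (l i ω) - Real.arctan y) ≤
          ⨅ n, ENNReal.ofReal (g n ω) := by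
        refine le_iInf fun n => ENNReal.ofReal_le_ofReal ?_
        exact sub_le_sub (Real.arctan_strictMono.monotone (le_max_right _ _))
          (Real.arctan_strictMono.monotone (hy1 n))
      have h4 : (⨅ n, ENNReal.ofReal (g n ω)) = 0 := hω
      rw [h4, nonpos_iff_eq_zero, ENNReal.ofReal_eq_zero] at h3
      linarith [Real.arctan_strictMono hy2]
    · exact Measurable.iInf fun n => ((Real.measurable_arctan.comp (hgm n)).sub
        (Real.measurable_arctan.comp (hl' _ (huS n)))).ennreal_ofReal
  have hZY : ∀ᵐ ω ∂ν, Z ω ≤ Y ω := hZ.least Y hYm (by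
    rintro _ ⟨i, hi, rfl⟩
    exact hub i hi)
  have hYZ : ∀ᵐ ω ∂ν, Y ω ≤ Z ω := by
    have : ∀ᵐ ω ∂ν, ∀ n, (l (u n) ω : EReal) ≤ Z ω :=
      ae_all_iff.2 fun n => hZ.le _ ⟨_, huS n, rfl⟩
    filter_upwards [this] with ω hω
    exact iSup_le hω
  refine ⟨u, huS, ?_⟩
  filter_upwards [hmono, hstep, hZY, hYZ] with ω h1 h2 h3 h4
  refine ⟨fun n => ?_, h1, ?_⟩
  · refine le_trans ?_ (h1 (Nat.zero_le n))
    simp only [h2.1]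
    exact le_max_left _ _
  · rw [le_antisymm h3 h4]
    exact tendsto_atTop_iSup fun a b hab => EReal.coe_le_coe_iff.2 (h1 hab)

end EssSup

section CondExpE

variable {Ω : Type*} {m mΩ : MeasurableSpace Ω} {ν : Measure Ω}

theorem condExpE_of_nonneg {B : Ω → EReal} (hB : ∀ᵐ ω ∂ν, 0 ≤ B ω) :
    ∀ᵐ ω ∂ν, condExpE ν m B ω = ((ν⁻[fun ω => (B ω).toENNReal|m] ω : ℝ≥0∞) : EReal) := by
  have h1 : (fun ω => (-B ω).toENNReal) =ᵐ[ν] 0 := by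
    filter_upwards [hB] with ω hω
    exact EReal.toENNReal_of_nonpos (by simpa using hω)
  filter_upwards [condLExp_congr_ae (mΩ := m) h1] with ω hω
  rw [condExpE, hω, condLExp_zero]
  simp

/-- Monotone convergence for extended conditional expectations. -/
theorem tendsto_condExpE [IsFiniteMeasure ν] (hm : m ≤ mΩ) {f : ℕ → Ω → ℝ} {B : Ω → EReal}
    (hf : ∀ n, Integrable (f n) ν)
    (hfB : ∀ᵐ ω ∂ν, (∀ n, 0 ≤ f n ω) ∧ Monotone (fun n => f n ω) ∧
      Tendsto (fun n => (f n ω : EReal)) atTop (𝓝 (B ω))) :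
    ∀ᵐ ω ∂ν, (∀ n, 0 ≤ ν[f n|m] ω) ∧ Monotone (fun n => ν[f n|m] ω) ∧
      Tendsto (fun n => (ν[f n|m] ω : EReal)) atTop (𝓝 (condExpE ν m B ω)) := by
  have h0 : ∀ᵐ ω ∂ν, ∀ n, 0 ≤ ν[f n|m] ω := ae_all_iff.2 fun n =>
    condExp_nonneg (hfB.mono fun ω h => h.1 n)
  have hmono : ∀ᵐ ω ∂ν, Monotone fun n => ν[f n|m] ω := by
    have : ∀ᵐ ω ∂ν, ∀ n, ν[f n|m] ω ≤ ν[f (n + 1)|m] ω := ae_all_iff.2 fun n =>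
      condExp_mono (hf n) (hf (n + 1)) (hfB.mono fun ω h => h.2.1 (Nat.le_succ n))
    filter_upwards [this] with ω hω using monotone_nat_of_le_succ hω
  have hB0 : ∀ᵐ ω ∂ν, 0 ≤ B ω := by
    filter_upwards [hfB] with ω h
    exact ge_of_tendsto' h.2.2 fun n => EReal.coe_nonneg.2 (h.1 n)
  have hsup : (fun ω => ⨆ n, ENNReal.ofReal (ν[f n|m] ω)) =ᵐ[ν]
      ν⁻[fun ω => (B ω).toENNReal|m] := by
    refine ae_eq_condLExp hm _ _ (Measurable.iSup fun n =>
      (stronglyMeasurable_condExp.measurable).ennreal_ofReal) fun s hs => ?_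
    have h1 : ∫⁻ ω in s, ⨆ n, ENNReal.ofReal (ν[f n|m] ω) ∂ν =
        ⨆ n, ∫⁻ ω in s, ENNReal.ofReal (ν[f n|m] ω) ∂ν := by
      refine lintegral_iSup' (fun n => ((stronglyMeasurable_condExp.measurable.mono hm
        le_rfl).ennreal_ofReal).aemeasurable) (ae_restrict_of_ae ?_)
      filter_upwards [hmono] with ω hω
      exact fun a b hab => ENNReal.ofReal_le_ofReal (hω hab)
    have h2 : ∫⁻ ω in s, (B ω).toENNReal ∂ν = ⨆ n, ∫⁻ ω in s, ENNReal.ofReal (f n ω) ∂ν := by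
      rw [← lintegral_iSup' (fun n => (hf n).aemeasurable.ennreal_ofReal.restrict)]
      · refine lintegral_congr_ae (ae_restrict_of_ae ?_)
        filter_upwards [hfB] with ω hω
        have h3 : Tendsto (fun n => ENNReal.ofReal (f n ω)) atTop (𝓝 (B ω).toENNReal) := by
          have := (EReal.continuous_toENNReal.tendsto (B ω)).comp hω.2.2
          simpa [Function.comp_def] using this
        exact tendsto_nhds_unique h3
          (tendsto_atTop_iSup fun a b hab => ENNReal.ofReal_le_ofReal (hω.2.1 hab))
      · refine ae_restrict_of_ae ?_
        filter_upwards [hfB] with ω hω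
        exact fun a b hab => ENNReal.ofReal_le_ofReal (hω.2.1 hab)
    rw [h1, h2]
    refine iSup_congr fun n => ?_
    rw [← setLIntegral_condLExp hm ν (fun ω => ENNReal.ofReal (f n ω)) hs]
    refine lintegral_congr_ae (ae_restrict_of_ae ?_)
    filter_upwards [condLExp_ofReal m (hf n) (hfB.mono fun ω h => h.1 n)] with ω hω
    exact hω.symm
  filter_upwards [h0, hmono, hsup, condExpE_of_nonneg (m := m) hB0] with ω h1 h2 h3 h4
  refine ⟨h1, h2, ?_⟩
  rw [h4, ← h3]
  have h5 : Tendsto (fun n => ENNReal.ofReal (ν[f n|m] ω)) atTop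
      (𝓝 (⨆ n, ENNReal.ofReal (ν[f n|m] ω))) :=
    tendsto_atTop_iSup fun a b hab => ENNReal.ofReal_le_ofReal (h2 hab)
  refine ((continuous_coe_ennreal_ereal.tendsto _).comp h5).congr fun n => ?_
  simp [EReal.coe_ennreal_ofReal, h1 n]

/-- The identity between positive and negative parts is arranged without subtraction, so that it
also covers y = ⊤. -/
theorem toENNReal_add_identity (x : ℝ) {y : EReal} (hy : 0 ≤ y) :
    ((x : EReal) + y).toENNReal + ENNReal.ofReal (-x) =
      ENNReal.ofReal x + ((-((x : EReal) + y)).toENNReal + y.toENNReal) := by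
  induction y with
  | bot => simp at hy
  | top => simp
  | coe b =>
    have hb : 0 ≤ b := by exact_mod_cast hy
    rw [← EReal.coe_add, ← EReal.coe_neg]
    simp only [EReal.real_coe_toENNReal, ENNReal.ofReal]
    norm_cast
    refine NNReal.eq ?_
    push_cast
    simp only [Real.coe_toNNReal']
    simp only [max_def]
    split_ifs <;> linarith

/-- The identity `toENNReal_add_identity` is conditioned term by term in [0, ∞]. The two parts of
`f` and the negative part of the sum have finite conditional expectations, so the terms can
afterwards be subtracted. -/
theorem condExpE_add [IsFiniteMeasure ν] {f : Ω → ℝ} (hf : Integrable f ν) {B : Ω → EReal}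
    (hB : AEMeasurable B ν) (hB0 : ∀ᵐ ω ∂ν, 0 ≤ B ω) :
    ∀ᵐ ω ∂ν, condExpE ν m (fun ω => (f ω : EReal) + B ω) ω =
      (ν[f|m] ω : EReal) + condExpE ν m B ω := by
  set Yp : Ω → ℝ≥0∞ := fun ω => ((f ω : EReal) + B ω).toENNReal with hYp
  set Yn : Ω → ℝ≥0∞ := fun ω => (-((f ω : EReal) + B ω)).toENNReal with hYn
  set fp : Ω → ℝ≥0∞ := fun ω => ENNReal.ofReal (f ω) with hfp
  set fn : Ω → ℝ≥0∞ := fun ω => ENNReal.ofReal (-f ω) with hfn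
  set b : Ω → ℝ≥0∞ := fun ω => (B ω).toENNReal with hb
  have hfpm : AEMeasurable fp ν := hf.aemeasurable.ennreal_ofReal
  have hfnm : AEMeasurable fn ν := hf.aemeasurable.neg.ennreal_ofReal
  have hYnm : AEMeasurable Yn ν := by
    refine measurable_ereal_toENNReal.comp_aemeasurable ?_
    exact (hf.aemeasurable.coe_real_ereal.add hB).neg
  have h1 : Yp + fn =ᵐ[ν] fp + (Yn + b) := by
    filter_upwards [hB0] with ω hω
    exact toENNReal_add_identity (f ω) hω
  have hfpi : ∫⁻ ω, fp ω ∂ν ≠ ∞ := hf.lintegral_lt_top.ne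
  have hfni : ∫⁻ ω, fn ω ∂ν ≠ ∞ := hf.neg.lintegral_lt_top.ne
  have hYni : ∫⁻ ω, Yn ω ∂ν ≠ ∞ := by
    refine ne_top_of_le_ne_top hfni (lintegral_mono_ae ?_)
    filter_upwards [hB0] with ω hω
    simp only [hYn, hfn]
    rw [← EReal.real_coe_toENNReal]
    refine EReal.toENNReal_le_toENNReal ?_
    rw [EReal.coe_neg, EReal.neg_le_neg_iff]
    exact le_add_of_nonneg_right hω
  have hfeq : ∀ᵐ ω ∂ν, ν[f|m] ω = (ν⁻[fp|m] ω).toReal - (ν⁻[fn|m] ω).toReal := by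
    have h2 : f = (fun ω => (fp ω).toReal) - fun ω => (fn ω).toReal := by
      funext ω
      simp only [Pi.sub_apply, hfp, hfn, ENNReal.toReal_ofReal']
      simp only [max_def]
      split_ifs <;> linarith
    have h3 := condExp_sub (m := m) (integrable_toReal_of_lintegral_ne_top hfpm hfpi)
      (integrable_toReal_of_lintegral_ne_top hfnm hfni)
    rw [← h2] at h3
    filter_upwards [h3, toReal_condLExp m hfpm hfpi, toReal_condLExp m hfnm hfni] with ω h4 h5 h6
    rw [h4, Pi.sub_apply, ← h5, ← h6]
  filter_upwards [condLExp_congr_ae (mΩ := m) h1, condLExp_add_right (mΩ := m) Yp hfnm,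
    condLExp_add_left (mΩ := m) (Yn + b) hfpm, condLExp_add_left (mΩ := m) b hYnm,
    condLExp_ne_top (mΩ := m) hfpi, condLExp_ne_top (mΩ := m) hfni, condLExp_ne_top (mΩ := m) hYni,
    hfeq, condExpE_of_nonneg (m := m) hB0] with ω e1 e2 e3 e4 n1 n2 n3 e5 e6
  rw [e6, e5]
  rw [e2, e3, Pi.add_apply, Pi.add_apply, e4, Pi.add_apply] at e1
  change ((ν⁻[Yp|m] ω : ℝ≥0∞) : EReal) - ((ν⁻[Yn|m] ω : ℝ≥0∞) : EReal) =
    _ + ((ν⁻[b|m] ω : ℝ≥0∞) : EReal)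
  generalize ν⁻[Yp|m] ω = yp at *
  generalize ν⁻[Yn|m] ω = yn at *
  generalize ν⁻[fp|m] ω = p at *
  generalize ν⁻[fn|m] ω = n at *
  generalize ν⁻[b|m] ω = c at *
  lift yn to NNReal using n3
  lift p to NNReal using n1
  lift n to NNReal using n2
  by_cases hc : c = ⊤
  · subst hc
    have : yp = ⊤ := by
      by_contra h
      have h7 : yp + (n : ℝ≥0∞) ≠ ⊤ := ENNReal.add_ne_top.2 ⟨h, ENNReal.coe_ne_top⟩
      exact h7 (by rw [e1]; simp)
    subst this
    simp only [EReal.coe_ennreal_top]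
    rw [EReal.coe_add_top]
    exact EReal.top_sub_coe _
  · have hyp : yp ≠ ⊤ := by
      rintro rfl
      have : (⊤ : ℝ≥0∞) ≠ ⊤ := by
        conv_lhs => rw [← top_add (n : ℝ≥0∞), e1]
        finiteness
      exact this rfl
    lift c to NNReal using hc
    lift yp to NNReal using hyp
    have e7 : (yp : ℝ) + n = p + (yn + c) := by exact_mod_cast e1
    change ((yp : ℝ) : EReal) - ((yn : ℝ) : EReal) =
      (((p : ℝ) - (n : ℝ) : ℝ) : EReal) + ((c : ℝ) : EReal)
    rw [← EReal.coe_sub, ← EReal.coe_add, EReal.coe_eq_coe_iff]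
    linarith

end CondExpE

/-! ### Conditional losses and their essential suprema -/

section CondLoss

variable {Ω : Type*} [mΩ : MeasurableSpace Ω] {P : Measure Ω} {𝕋 : Set ℕ∞}
  {ℱ : Filtration ℕ mΩ} {μ : ℕ∞ → Ω → ℝ} {Qbar : Measure (OptionalSpace 𝕋 ℱ)} {Q : Measure Ω}
  {D : ℕ∞ → Ω → ℝ}

/-- The comparison passes through the positive part of `f`: for nonnegative `B`, `condExpE` reduces
to one conditional expectation in [0, ∞], which is monotone. -/
theorem le_condExpE {Ω : Type*} {m mΩ : MeasurableSpace Ω} {ν : Measure Ω} {f : Ω → ℝ} (hf : Integrable f ν)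
    {B : Ω → EReal} (hfB : ∀ᵐ ω ∂ν, (f ω : EReal) ≤ B ω) (hB0 : ∀ᵐ ω ∂ν, 0 ≤ B ω) :
    ∀ᵐ ω ∂ν, (ν[f|m] ω : EReal) ≤ condExpE ν m B ω := by
  have h1 : ∀ᵐ ω ∂ν, ν[f|m] ω ≤ ν[fun ω => max (f ω) 0|m] ω :=
    condExp_mono hf hf.pos_part (ae_of_all _ fun ω => le_max_left _ _)
  have h2 := condLExp_ofReal m hf.pos_part (ae_of_all _ fun ω => le_max_right (f ω) 0)
  have h3 : ∀ᵐ ω ∂ν, ν⁻[fun ω => ENNReal.ofReal (max (f ω) 0)|m] ω ≤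
      ν⁻[fun ω => (B ω).toENNReal|m] ω := by
    refine condLExp_mono ?_
    filter_upwards [hfB, hB0] with ω h4 h5
    rw [← EReal.real_coe_toENNReal]
    refine EReal.toENNReal_le_toENNReal ?_
    rcases le_total (f ω) 0 with h6 | h6
    · rwa [max_eq_right h6]
    · rwa [max_eq_left h6]
  filter_upwards [h1, h2, h3, condExpE_of_nonneg (m := m) hB0] with ω e1 e2 e3 e4
  rw [e4]
  rw [e2] at e3
  refine le_trans ?_ (EReal.coe_ennreal_le_coe_ennreal_iff.2 e3)
  rw [EReal.coe_ennreal_ofReal]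
  exact EReal.coe_le_coe_iff.2 (e1.trans (le_max_left _ _))

theorem add_mem_bddProcess {X Y : ℕ∞ → Ω → ℝ} (hX : X ∈ BddProcess P 𝕋 ℱ)
    (hY : Y ∈ BddProcess P 𝕋 ℱ) : X + Y ∈ BddProcess P 𝕋 ℱ := by
  obtain ⟨hXm, C, hC⟩ := hX
  obtain ⟨hYm, C', hC'⟩ := hY
  refine ⟨fun t ht => (hXm t ht).add (hYm t ht), C + C', fun t ht => ?_⟩
  filter_upwards [hC t ht, hC' t ht] with ω h1 h2
  exact (abs_add_le _ _).trans (add_le_add h1 h2)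

theorem cash_mem_bddProcess {t : ℕ} {V : Ω → ℝ} (hV : MemLinf P (ℱ t) V) :
    (fun (s : ℕ∞) ω => if (t : ℕ∞) ≤ s then V ω else 0) ∈ BddProcess P 𝕋 ℱ := by
  obtain ⟨hVm, C, hC⟩ := hV
  refine ⟨fun s hs => ?_, C, fun s hs => ?_⟩
  · by_cases hst : (t : ℕ∞) ≤ s
    · simp only [hst, if_true]
      exact hVm.mono (sigmaAt_mono ℱ hst) le_rfl
    · simp only [hst, if_false]
      exact measurable_const
  · filter_upwards [hC] with ω hω
    split_ifs
    · exact hω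
    · simpa using (abs_nonneg _).trans hω

theorem zero_mem_bddProcess : (0 : ℕ∞ → Ω → ℝ) ∈ BddProcess P 𝕋 ℱ :=
  ⟨fun _ _ => measurable_const, 0, fun _ _ => by simp⟩

/-- The convex combination of the parts of two processes from time `t` on. -/
noncomputable def mix (t : ℕ) (l : Ω → ℝ) (X Y : ℕ∞ → Ω → ℝ) : ℕ∞ → Ω → ℝ :=
  fun s ω => l ω * proj t ⊤ X s ω + (1 - l ω) * proj t ⊤ Y s ω

theorem mix_mem_bddProcess {X Y : ℕ∞ → Ω → ℝ} (hX : X ∈ BddProcess P 𝕋 ℱ)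
    (hY : Y ∈ BddProcess P 𝕋 ℱ) {t : ℕ} {l : Ω → ℝ} (hl : Measurable[ℱ t] l)
    (hl01 : ∀ ω, 0 ≤ l ω ∧ l ω ≤ 1) : mix t l X Y ∈ BddProcess P 𝕋 ℱ := by
  have hX' := proj_top_mem hX t
  have hY' := proj_top_mem hY t
  obtain ⟨C, hC⟩ := hX'.2
  obtain ⟨C', hC'⟩ := hY'.2
  refine ⟨fun s hs => ?_, C + C', fun s hs => ?_⟩
  · by_cases hst : (t : ℕ∞) ≤ s
    · have hl' : Measurable[sigmaAt ℱ s] l := hl.mono (sigmaAt_mono ℱ hst) le_rfl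
      exact (hl'.mul (hX'.1 s hs)).add ((measurable_const.sub hl').mul (hY'.1 s hs))
    · have : mix t l X Y s = fun _ => 0 := by
        funext ω; simp [mix, proj_top, hst]
      rw [this]
      exact measurable_const
  · filter_upwards [hC s hs, hC' s hs] with ω h1 h2
    obtain ⟨h3, h4⟩ := hl01 ω
    refine (abs_add_le _ _).trans (add_le_add ?_ ?_)
    · rw [abs_mul, abs_of_nonneg h3]
      exact (mul_le_of_le_one_left (abs_nonneg _) h4).trans h1
    · rw [abs_mul, abs_of_nonneg (sub_nonneg.2 h4)]
      exact (mul_le_of_le_one_left (abs_nonneg _) (by linarith)).trans h2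

theorem tailSum_proj (t : ℕ) (X : ℕ∞ → Ω → ℝ) (ω : Ω) :
    tailSum 𝕋 D t (proj t ⊤ X) ω = tailSum 𝕋 D t X ω := by
  refine tsum_congr fun s => ?_
  simp only [proj_top]
  split_ifs <;> rfl

/-- `E_Q[-∑_{s ≥ t} γ_s X_s | 𝓕_t]`. -/
noncomputable def condLoss (𝕋 : Set ℕ∞) (ℱ : Filtration ℕ mΩ) (Q : Measure Ω) (D : ℕ∞ → Ω → ℝ)
    (t : ℕ) (X : ℕ∞ → Ω → ℝ) : Ω → ℝ :=
  Q[fun ω => -tailSum 𝕋 D t X ω|ℱ t]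

theorem measurable_condLoss (t : ℕ) (X : ℕ∞ → Ω → ℝ) :
    Measurable[ℱ t] (condLoss 𝕋 ℱ Q D t X) :=
  stronglyMeasurable_condExp.measurable

theorem integrable_condLoss (t : ℕ) (X : ℕ∞ → Ω → ℝ) :
    Integrable (condLoss 𝕋 ℱ Q D t X) Q :=
  integrable_condExp

theorem IsDecomposition.condLoss_congr (h𝕋 : IsTimeSet 𝕋) (hμ : IsReferenceProcess P 𝕋 ℱ μ)
    (h : IsDecomposition P 𝕋 ℱ μ Qbar Q D) {X Y : ℕ∞ → Ω → ℝ} (hX : X ∈ BddProcess P 𝕋 ℱ)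
    (hY : Y ∈ BddProcess P 𝕋 ℱ) (t : ℕ)
    (hXY : ∀ s ∈ 𝕋, (t : ℕ∞) ≤ s → X s =ᵐ[P] Y s) :
    ∀ᵐ ω ∂Q, condLoss 𝕋 ℱ Q D t X ω = condLoss 𝕋 ℱ Q D t Y ω := by
  refine condExp_congr_ae ?_
  filter_upwards [h.tailSum_congr h𝕋 hμ hX hY t hXY] with ω hω
  rw [hω]

theorem IsDecomposition.condLoss_add (h𝕋 : IsTimeSet 𝕋) (hμ : IsReferenceProcess P 𝕋 ℱ μ)
    (h : IsDecomposition P 𝕋 ℱ μ Qbar Q D) {X Y : ℕ∞ → Ω → ℝ} (hX : X ∈ BddProcess P 𝕋 ℱ)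
    (hY : Y ∈ BddProcess P 𝕋 ℱ) {t : ℕ} (ht : (t : ℕ∞) ∈ 𝕋) :
    ∀ᵐ ω ∂Q, condLoss 𝕋 ℱ Q D t (X + Y) ω =
      condLoss 𝕋 ℱ Q D t X ω + condLoss 𝕋 ℱ Q D t Y ω := by
  have h1 := condExp_add (m := ℱ t) (h.integrable_tailSum h𝕋 hμ hX ht).neg
    (h.integrable_tailSum h𝕋 hμ hY ht).neg
  have h2 : (fun ω => -tailSum 𝕋 D t (X + Y) ω) =ᵐ[Q] -tailSum 𝕋 D t X + -tailSum 𝕋 D t Y := by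
    filter_upwards [h.tailSum_add h𝕋 hμ hX hY t] with ω hω
    rw [hω, Pi.add_apply, Pi.neg_apply, Pi.neg_apply]
    ring
  filter_upwards [h1, condExp_congr_ae (m := ℱ t) h2] with ω h3 h4
  rw [condLoss, h4, h3]
  rfl

theorem IsDecomposition.condLoss_mix (h𝕋 : IsTimeSet 𝕋) (hμ : IsReferenceProcess P 𝕋 ℱ μ)
    (h : IsDecomposition P 𝕋 ℱ μ Qbar Q D) {X Y : ℕ∞ → Ω → ℝ} (hX : X ∈ BddProcess P 𝕋 ℱ)
    (hY : Y ∈ BddProcess P 𝕋 ℱ) {t : ℕ} (ht : (t : ℕ∞) ∈ 𝕋) {l : Ω → ℝ} (hl : Measurable[ℱ t] l)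
    (hl01 : ∀ ω, 0 ≤ l ω ∧ l ω ≤ 1) :
    ∀ᵐ ω ∂Q, condLoss 𝕋 ℱ Q D t (mix t l X Y) ω =
      l ω * condLoss 𝕋 ℱ Q D t X ω + (1 - l ω) * condLoss 𝕋 ℱ Q D t Y ω := by
  have hl' : Measurable l := hl.mono (ℱ.le t) le_rfl
  have hNX := (h.integrable_tailSum h𝕋 hμ hX ht).neg
  have hNY := (h.integrable_tailSum h𝕋 hμ hY ht).neg
  have hi1 : Integrable (l * -tailSum 𝕋 D t X) Q := hNX.bdd_mul (c := 1) hl'.aestronglyMeasurable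
    (ae_of_all _ fun ω => by
      rw [Real.norm_eq_abs, abs_of_nonneg (hl01 ω).1]; exact (hl01 ω).2)
  have hi2 : Integrable ((fun ω => 1 - l ω) * -tailSum 𝕋 D t Y) Q :=
    hNY.bdd_mul (c := 1) (measurable_const.sub hl').aestronglyMeasurable
      (ae_of_all _ fun ω => by
        rw [Real.norm_eq_abs, abs_of_nonneg (sub_nonneg.2 (hl01 ω).2)]; linarith [(hl01 ω).1])
  have h1 := condExp_add (m := ℱ t) hi1 hi2
  have h2 : (fun ω => -tailSum 𝕋 D t (mix t l X Y) ω) =ᵐ[Q]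
      l * -tailSum 𝕋 D t X + (fun ω => 1 - l ω) * -tailSum 𝕋 D t Y := by
    filter_upwards [h.tailSum_const_mul_add h𝕋 hμ (proj_top_mem hX t) (proj_top_mem hY t) l
      (fun ω => 1 - l ω) t] with ω hω
    rw [tailSum_proj, tailSum_proj] at hω
    change -tailSum 𝕋 D t (mix t l X Y) ω = l ω * -tailSum 𝕋 D t X ω +
      (1 - l ω) * -tailSum 𝕋 D t Y ω
    rw [show tailSum 𝕋 D t (mix t l X Y) ω = _ from hω]
    ring
  have h3 := condExp_mul_of_stronglyMeasurable_left (m := ℱ t) hl.stronglyMeasurable hi1 hNX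
  have h4 := condExp_mul_of_stronglyMeasurable_left (m := ℱ t)
    (f := fun ω => 1 - l ω) (measurable_const.sub hl).stronglyMeasurable hi2 hNY
  filter_upwards [h1, condExp_congr_ae (m := ℱ t) h2, h3, h4] with ω e1 e2 e3 e4
  rw [condLoss, e2, e1, Pi.add_apply, e3, e4]
  rfl

theorem IsLocAC.ae_bdd_of_memLinf (hQ : IsLocAC P 𝕋 ℱ Q) {t : ℕ} (ht : (t : ℕ∞) ∈ 𝕋) {V : Ω → ℝ}
    (hV : MemLinf P (ℱ t) V) : ∃ C : ℝ, 0 ≤ C ∧ ∀ᵐ ω ∂Q, |V ω| ≤ C := by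
  obtain ⟨hVm, C, hC⟩ := hV
  have := hQ.1
  have h1 : ∀ᵐ ω ∂Q, |V ω| ≤ C :=
    hQ.ae_of_ae ht ((measurable_abs.comp hVm) measurableSet_Iic) hC
  obtain ⟨ω, hω⟩ := h1.exists
  exact ⟨C, (abs_nonneg _).trans hω, h1⟩

theorem IsDecomposition.integrable_discount_mul (h𝕋 : IsTimeSet 𝕋)
    (h : IsDecomposition P 𝕋 ℱ μ Qbar Q D) {t : ℕ} (ht : (t : ℕ∞) ∈ 𝕋) {V : Ω → ℝ}
    (hV : MemLinf P (ℱ t) V) : Integrable (fun ω => D t ω * V ω) Q := by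
  have := h.isProbabilityMeasure_left
  obtain ⟨C, hC0, hC⟩ := h.locAC.ae_bdd_of_memLinf ht hV
  refine Integrable.of_bound (((h.measurable_discount ht).mul hV.1).mono (ℱ.le t)
    le_rfl).aestronglyMeasurable C ?_
  filter_upwards [hC, h.ae_nonneg, h.ae_le_one h𝕋] with ω h1 h2 h3
  rw [Real.norm_eq_abs, abs_mul, abs_of_nonneg (h2 t ht)]
  exact (mul_le_of_le_one_left (abs_nonneg _) (h3 t ht)).trans h1

theorem IsDecomposition.condLoss_add_cash (h𝕋 : IsTimeSet 𝕋) (hμ : IsReferenceProcess P 𝕋 ℱ μ)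
    (h : IsDecomposition P 𝕋 ℱ μ Qbar Q D) {X : ℕ∞ → Ω → ℝ} (hX : X ∈ BddProcess P 𝕋 ℱ)
    {t : ℕ} (ht : (t : ℕ∞) ∈ 𝕋) {V : Ω → ℝ} (hV : MemLinf P (ℱ t) V) :
    ∀ᵐ ω ∂Q, condLoss 𝕋 ℱ Q D t (fun s ω => X s ω + if (t : ℕ∞) ≤ s then V ω else 0) ω =
      condLoss 𝕋 ℱ Q D t X ω - D t ω * V ω := by
  have h1 := h.condLoss_add h𝕋 hμ hX (cash_mem_bddProcess hV) ht
  have := h.isProbabilityMeasure_left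
  have h2 : ∀ᵐ ω ∂Q, condLoss 𝕋 ℱ Q D t (fun s ω => if (t : ℕ∞) ≤ s then V ω else 0) ω =
      -(D t ω * V ω) := by
    have h3 : (fun ω => -tailSum 𝕋 D t (fun s ω => if (t : ℕ∞) ≤ s then V ω else 0) ω) =ᵐ[Q]
        fun ω => -(D t ω * V ω) := by
      filter_upwards [h.tailSum_cash h𝕋 V ht] with ω hω
      rw [hω]
    have h4 : Measurable[ℱ t] (fun ω => -(D t ω * V ω)) :=
      ((h.measurable_discount ht).mul hV.1).neg
    have h5 := condExp_of_stronglyMeasurable (ℱ.le t) h4.stronglyMeasurable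
      (h.integrable_discount_mul h𝕋 ht hV).neg
    filter_upwards [condExp_congr_ae (m := ℱ t) h3] with ω hω
    rw [condLoss, hω, h5]
  filter_upwards [h1, h2] with ω e1 e2
  change condLoss 𝕋 ℱ Q D t (X + fun s ω => if (t : ℕ∞) ≤ s then V ω else 0) ω = _
  rw [e1, e2, sub_eq_add_neg]

theorem discountedLoss_integrand (t : ℕ) (X : ℕ∞ → Ω → ℝ) (ω : Ω) :
    (∑' s : {s : ℕ∞ // s ∈ 𝕋 ∧ (t : ℕ∞) ≤ s}, gammaOf 𝕋 D s ω / D t ω * X s ω) =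
      (D t ω)⁻¹ * tailSum 𝕋 D t X ω := by
  rw [tailSum, ← tsum_mul_left]
  have h1 := tsum_subtype {s : ℕ∞ | s ∈ 𝕋 ∧ (t : ℕ∞) ≤ s}
    (fun s => gammaOf 𝕋 D s ω / D t ω * X s ω)
  have h2 := tsum_subtype 𝕋 (fun s => (D t ω)⁻¹ * (gammaOf 𝕋 D s ω * proj t ⊤ X s ω))
  refine h1.trans (Eq.trans (tsum_congr fun s => ?_) h2.symm)
  by_cases hs : s ∈ 𝕋 <;> by_cases hst : (t : ℕ∞) ≤ s <;> simp [Set.indicator, hs, hst, proj_top]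
  ring

theorem IsDecomposition.integrable_inv_mul_tailSum (h𝕋 : IsTimeSet 𝕋)
    (hμ : IsReferenceProcess P 𝕋 ℱ μ) (h : IsDecomposition P 𝕋 ℱ μ Qbar Q D) {X : ℕ∞ → Ω → ℝ}
    (hX : X ∈ BddProcess P 𝕋 ℱ) {t : ℕ} (ht : (t : ℕ∞) ∈ 𝕋) :
    Integrable (fun ω => (D t ω)⁻¹ * -tailSum 𝕋 D t X ω) Q := by
  have := h.isProbabilityMeasure_left
  obtain ⟨C, hC⟩ := hX.2
  have hDm : Measurable (D t) := (h.measurable_discount ht).mono (sigmaAt_le ℱ t) le_rfl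
  refine Integrable.of_bound (hDm.inv.mul (h.measurable_tailSum hX t).neg).aestronglyMeasurable |C| ?_
  filter_upwards [h.abs_tailSum_le h𝕋 hμ hX.1 hC ht, h.ae_nonneg] with ω h1 h2
  rw [Real.norm_eq_abs, abs_mul, abs_neg, abs_inv, abs_of_nonneg (h2 t ht)]
  rcases (h2 t ht).eq_or_lt with h3 | h3
  · simp [← h3]
  · rw [inv_mul_le_iff₀ h3, mul_comm]
    exact h1.trans (mul_le_mul_of_nonneg_right (le_abs_self C) h3.le)

theorem IsDecomposition.discountedLoss_eq (h𝕋 : IsTimeSet 𝕋) (hμ : IsReferenceProcess P 𝕋 ℱ μ)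
    (h : IsDecomposition P 𝕋 ℱ μ Qbar Q D) {X : ℕ∞ → Ω → ℝ} (hX : X ∈ BddProcess P 𝕋 ℱ)
    {t : ℕ} (ht : (t : ℕ∞) ∈ 𝕋) :
    ∀ᵐ ω ∂Q, discountedLoss 𝕋 ℱ Q D t X ω = (D t ω)⁻¹ * condLoss 𝕋 ℱ Q D t X ω := by
  have h1 : (fun ω => -∑' s : {s : ℕ∞ // s ∈ 𝕋 ∧ (t : ℕ∞) ≤ s}, gammaOf 𝕋 D s ω / D t ω * X s ω) =
      (fun ω => (D t ω)⁻¹) * (fun ω => -tailSum 𝕋 D t X ω) := by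
    funext ω
    rw [discountedLoss_integrand, Pi.mul_apply, mul_neg]
  have h2 := condExp_mul_of_stronglyMeasurable_left (m := ℱ t) (f := fun ω => (D t ω)⁻¹)
    (g := fun ω => -tailSum 𝕋 D t X ω) (h.measurable_discount ht).inv.stronglyMeasurable
    (h.integrable_inv_mul_tailSum h𝕋 hμ hX ht) (h.integrable_tailSum h𝕋 hμ hX ht).neg
  rw [discountedLoss, h1]
  exact h2

/-- Also valid on {D_t = 0}: the bound |∑ γ_s X_s| ≤ C D_t makes the tail sum vanish there, so
nothing is lost by the convention 0⁻¹ = 0. -/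
theorem IsDecomposition.condLoss_eq (h𝕋 : IsTimeSet 𝕋) (hμ : IsReferenceProcess P 𝕋 ℱ μ)
    (h : IsDecomposition P 𝕋 ℱ μ Qbar Q D) {X : ℕ∞ → Ω → ℝ} (hX : X ∈ BddProcess P 𝕋 ℱ)
    {t : ℕ} (ht : (t : ℕ∞) ∈ 𝕋) :
    ∀ᵐ ω ∂Q, condLoss 𝕋 ℱ Q D t X ω = D t ω * discountedLoss 𝕋 ℱ Q D t X ω := by
  obtain ⟨C, hC⟩ := hX.2
  set g : Ω → ℝ := fun ω => (D t ω)⁻¹ * -tailSum 𝕋 D t X ω with hg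
  have h1 : (fun ω => -tailSum 𝕋 D t X ω) =ᵐ[Q] D t * g := by
    filter_upwards [h.abs_tailSum_le h𝕋 hμ hX.1 hC ht] with ω h2
    rw [Pi.mul_apply, hg]
    by_cases h0 : D t ω = 0
    · rw [h0, mul_zero, abs_nonpos_iff] at h2
      simp [h2]
    · field_simp
  have hgi := h.integrable_inv_mul_tailSum h𝕋 hμ hX ht
  have h2 := condExp_mul_of_stronglyMeasurable_left (m := ℱ t) (f := D t) (g := g)
    (h.measurable_discount ht).stronglyMeasurable
    (((h.integrable_tailSum h𝕋 hμ hX ht).neg).congr h1) hgi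
  have h3 : (fun ω => -∑' s : {s : ℕ∞ // s ∈ 𝕋 ∧ (t : ℕ∞) ≤ s}, gammaOf 𝕋 D s ω / D t ω * X s ω) =
      g := by
    funext ω
    simp only [discountedLoss_integrand, hg, mul_neg]
  filter_upwards [h2, condExp_congr_ae (m := ℱ t) h1] with ω e1 e2
  rw [condLoss, e2, e1, discountedLoss, h3]
  rfl

theorem IsDecomposition.condLoss_succ (h𝕋 : IsTimeSet 𝕋) (hμ : IsReferenceProcess P 𝕋 ℱ μ)
    (h : IsDecomposition P 𝕋 ℱ μ Qbar Q D) {X : ℕ∞ → Ω → ℝ} (hX : X ∈ BddProcess P 𝕋 ℱ)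
    {t : ℕ} (ht : ((t + 1 : ℕ) : ℕ∞) ∈ 𝕋) :
    ∀ᵐ ω ∂Q, condLoss 𝕋 ℱ Q D t X ω =
      -(gammaOf 𝕋 D t ω * X t ω) + Q[condLoss 𝕋 ℱ Q D (t + 1) X|ℱ t] ω := by
  have := h.isProbabilityMeasure_left
  have ht0 : (t : ℕ∞) ∈ 𝕋 := h𝕋.mem_of_le (by exact_mod_cast Nat.le_succ t) ht
  have hi1 : Integrable (fun ω => -(gammaOf 𝕋 D t ω * X t ω)) Q := by
    have h1 := (h.integrable_tailSum h𝕋 hμ hX ht0).neg.sub (h.integrable_tailSum h𝕋 hμ hX ht).neg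
    refine h1.congr ?_
    filter_upwards [h.tailSum_eq_add h𝕋 hμ hX ht0] with ω hω
    rw [Pi.sub_apply, Pi.neg_apply, Pi.neg_apply, hω]
    ring
  have hm : Measurable[ℱ t] (fun ω => -(gammaOf 𝕋 D t ω * X t ω)) :=
    ((h.measurable_gamma ht0).mul (hX.1 t ht0)).neg
  have h2 : (fun ω => -tailSum 𝕋 D t X ω) =ᵐ[Q]
      (fun ω => -(gammaOf 𝕋 D t ω * X t ω)) + fun ω => -tailSum 𝕋 D (t + 1) X ω := by
    filter_upwards [h.tailSum_eq_add h𝕋 hμ hX ht0] with ω hω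
    rw [hω, Pi.add_apply]
    ring
  have h3 := condExp_add (m := ℱ t) hi1 (h.integrable_tailSum h𝕋 hμ hX ht).neg
  have h4 := condExp_of_stronglyMeasurable (ℱ.le t) hm.stronglyMeasurable hi1
  have h5 := condExp_condExp_of_le (μ := Q) (f := fun ω => -tailSum 𝕋 D (t + 1) X ω)
    (ℱ.mono (Nat.le_succ t)) (ℱ.le (t + 1))
  filter_upwards [condExp_congr_ae (m := ℱ t) h2, h3, h5] with ω e1 e2 e3
  rw [condLoss, e1]
  change _ = _ + Q[Q[fun ω => -tailSum 𝕋 D (t + 1) X ω|ℱ (t + 1)]|ℱ t] ω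
  rw [e3]
  refine e2.trans ?_
  rw [Pi.add_apply, h4]
  rfl

theorem IsDecomposition.setIntegral_condLoss (h𝕋 : IsTimeSet 𝕋) (hμ : IsReferenceProcess P 𝕋 ℱ μ)
    (h : IsDecomposition P 𝕋 ℱ μ Qbar Q D) {X : ℕ∞ → Ω → ℝ} (hX : X ∈ BddProcess P 𝕋 ℱ)
    {t : ℕ} (ht : (t : ℕ∞) ∈ 𝕋) {A : Set Ω} (hA : MeasurableSet[ℱ t] A) :
    ∫ ω in A, condLoss 𝕋 ℱ Q D t X ω ∂Q =
      -∫ p in {p | (t : ℕ∞) ≤ p.time ∧ p.state ∈ A}, onOptional 𝕋 ℱ X p ∂Qbar := by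
  have := h.isProbabilityMeasure_left
  rw [condLoss, setIntegral_condExp (f := fun ω => -tailSum 𝕋 D t X ω) (ℱ.le t) (h.integrable_tailSum h𝕋 hμ hX ht).neg hA,
    integral_neg, h.setIntegral_tailSum hX hA]

theorem IsDecomposition.integral_condLoss (h𝕋 : IsTimeSet 𝕋) (hμ : IsReferenceProcess P 𝕋 ℱ μ)
    (h : IsDecomposition P 𝕋 ℱ μ Qbar Q D) {X : ℕ∞ → Ω → ℝ} (hX : X ∈ BddProcess P 𝕋 ℱ)
    {t : ℕ} (ht : (t : ℕ∞) ∈ 𝕋) :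
    ∫ ω, condLoss 𝕋 ℱ Q D t X ω ∂Q =
      -∫ p in {p | (t : ℕ∞) ≤ p.time}, onOptional 𝕋 ℱ X p ∂Qbar := by
  rw [← setIntegral_univ, h.setIntegral_condLoss h𝕋 hμ hX ht MeasurableSet.univ]
  simp

/-- `B` is the essential supremum of the conditional losses of the processes in `𝒮`, attained along
an increasing sequence of nonnegative losses. -/
structure IsLossSup (𝕋 : Set ℕ∞) (ℱ : Filtration ℕ mΩ) (Q : Measure Ω) (D : ℕ∞ → Ω → ℝ) (t : ℕ)
    (𝒮 : Set (ℕ∞ → Ω → ℝ)) (B : Ω → EReal) : Prop where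
  le : ∀ X ∈ 𝒮, ∀ᵐ ω ∂Q, (condLoss 𝕋 ℱ Q D t X ω : EReal) ≤ B ω
  exists_seq : ∃ X : ℕ → ℕ∞ → Ω → ℝ, (∀ n, X n ∈ 𝒮) ∧ ∀ᵐ ω ∂Q,
    (∀ n, 0 ≤ condLoss 𝕋 ℱ Q D t (X n) ω) ∧ Monotone (fun n => condLoss 𝕋 ℱ Q D t (X n) ω) ∧
    Tendsto (fun n => (condLoss 𝕋 ℱ Q D t (X n) ω : EReal)) atTop (𝓝 (B ω))

namespace IsLossSup

variable {t : ℕ} {𝒮 : Set (ℕ∞ → Ω → ℝ)} {B B' : Ω → EReal}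

theorem nonneg (hB : IsLossSup 𝕋 ℱ Q D t 𝒮 B) : ∀ᵐ ω ∂Q, 0 ≤ B ω := by
  obtain ⟨X, -, hX⟩ := hB.exists_seq
  filter_upwards [hX] with ω hω
  exact ge_of_tendsto' hω.2.2 fun n => EReal.coe_nonneg.2 (hω.1 n)

theorem aemeasurable (hB : IsLossSup 𝕋 ℱ Q D t 𝒮 B) : AEMeasurable B Q := by
  obtain ⟨X, -, hX⟩ := hB.exists_seq
  exact aemeasurable_of_tendsto_metrizable_ae atTop (fun n =>
    (((measurable_condLoss (𝕋 := 𝕋) (Q := Q) (D := D) t (X n)).mono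
      (ℱ.le t) le_rfl).coe_real_ereal).aemeasurable) (hX.mono fun ω hω => hω.2.2)

/-- `B'` needs no measurability, because `B` is an a.s. limit of members of the family. -/
theorem le_of_forall (hB : IsLossSup 𝕋 ℱ Q D t 𝒮 B)
    (h : ∀ X ∈ 𝒮, ∀ᵐ ω ∂Q, (condLoss 𝕋 ℱ Q D t X ω : EReal) ≤ B' ω) :
    ∀ᵐ ω ∂Q, B ω ≤ B' ω := by
  obtain ⟨X, hXS, hX⟩ := hB.exists_seq
  filter_upwards [hX, ae_all_iff.2 fun n => h (X n) (hXS n)] with ω hω h1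
  exact le_of_tendsto' hω.2.2 h1

theorem unique (hB : IsLossSup 𝕋 ℱ Q D t 𝒮 B) (hB' : IsLossSup 𝕋 ℱ Q D t 𝒮 B') :
    ∀ᵐ ω ∂Q, B ω = B' ω := by
  filter_upwards [hB.le_of_forall hB'.le, hB'.le_of_forall hB.le] with ω h1 h2
  exact le_antisymm h1 h2

/-- Monotone convergence along the attaining sequence: a uniform bound on expected losses bounds the
expectation of their supremum. -/
theorem lintegral_le (hB : IsLossSup 𝕋 ℱ Q D t 𝒮 B) {b : ℝ}
    (hb : ∀ X ∈ 𝒮, ∫ ω, condLoss 𝕋 ℱ Q D t X ω ∂Q ≤ b) :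
    ∫⁻ ω, (B ω).toENNReal ∂Q ≤ ENNReal.ofReal b := by
  obtain ⟨X, hXS, hX⟩ := hB.exists_seq
  have h1 : ∫⁻ ω, (B ω).toENNReal ∂Q =
      ⨆ n, ∫⁻ ω, ENNReal.ofReal (condLoss 𝕋 ℱ Q D t (X n) ω) ∂Q := by
    rw [← lintegral_iSup' (fun n => (integrable_condLoss t (X n)).aemeasurable.ennreal_ofReal)]
    · refine lintegral_congr_ae ?_
      filter_upwards [hX] with ω hω
      have h3 : Tendsto (fun n => ENNReal.ofReal (condLoss 𝕋 ℱ Q D t (X n) ω)) atTop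
          (𝓝 (B ω).toENNReal) := by
        have := (EReal.continuous_toENNReal.tendsto (B ω)).comp hω.2.2
        simpa [Function.comp_def] using this
      exact tendsto_nhds_unique h3
        (tendsto_atTop_iSup fun a b hab => ENNReal.ofReal_le_ofReal (hω.2.1 hab))
    · filter_upwards [hX] with ω hω
      exact fun a b hab => ENNReal.ofReal_le_ofReal (hω.2.1 hab)
  rw [h1]
  refine iSup_le fun n => ?_
  rw [← ofReal_integral_eq_lintegral_ofReal (integrable_condLoss t (X n))
    (hX.mono fun ω hω => hω.1 n)]
  exact ENNReal.ofReal_le_ofReal (hb _ (hXS n))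

end IsLossSup

theorem indicator_one_mem_unit {Ω : Type*} {A : Set Ω} (ω : Ω) :
    0 ≤ A.indicator (1 : Ω → ℝ) ω ∧ A.indicator (1 : Ω → ℝ) ω ≤ 1 := by
  by_cases h : ω ∈ A <;> simp [h]

/-- Essential suprema of rescaled conditional losses over sets stable under pasting. -/
theorem IsDecomposition.exists_lossSup_seq (h𝕋 : IsTimeSet 𝕋) (hμ : IsReferenceProcess P 𝕋 ℱ μ)
    (h : IsDecomposition P 𝕋 ℱ μ Qbar Q D) {t : ℕ} (ht : (t : ℕ∞) ∈ 𝕋) {𝒮 : Set (ℕ∞ → Ω → ℝ)}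
    (h𝒮 : 𝒮 ⊆ BddProcess P 𝕋 ℱ) (h0 : 0 ∈ 𝒮)
    (hmix : ∀ X ∈ 𝒮, ∀ Y ∈ 𝒮, ∀ A, MeasurableSet[ℱ t] A → mix t (A.indicator 1) X Y ∈ 𝒮)
    {l : (ℕ∞ → Ω → ℝ) → Ω → ℝ} (hlm : ∀ X ∈ 𝒮, Measurable[ℱ t] (l X)) {c : Ω → ℝ}
    (hlc : ∀ X ∈ 𝒮, ∀ᵐ ω ∂Q, l X ω = c ω * condLoss 𝕋 ℱ Q D t X ω) :
    ∃ u : ℕ → ℕ∞ → Ω → ℝ, (∀ n, u n ∈ 𝒮) ∧ ∀ᵐ ω ∂Q, (∀ n, 0 ≤ l (u n) ω) ∧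
      Monotone (fun n => l (u n) ω) ∧
      Tendsto (fun n => (l (u n) ω : EReal)) atTop
        (𝓝 (essSupFamily Q (ℱ t) {f | ∃ X ∈ 𝒮, f = fun ω => (l X ω : EReal)} ω)) := by
  have := h.isProbabilityMeasure_left
  have hZ := isEssSup_essSupFamily Q (ℱ.le t) {f | ∃ X ∈ 𝒮, f = fun ω => (l X ω : EReal)} (by
    rintro _ ⟨X, hX, rfl⟩
    exact (hlm X hX).coe_real_ereal)
  have hmax : ∀ X ∈ 𝒮, ∀ Y ∈ 𝒮, ∃ W ∈ 𝒮, ∀ᵐ ω ∂Q, l W ω = max (l X ω) (l Y ω) := by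
    intro X hX Y hY
    -- Following X where its loss is larger, and Y elsewhere, realizes the maximum of the two
    -- losses.
    have hA : MeasurableSet[ℱ t] {ω | l Y ω ≤ l X ω} := measurableSet_le (hlm Y hY) (hlm X hX)
    refine ⟨_, hmix X hX Y hY _ hA, ?_⟩
    filter_upwards [hlc _ (hmix X hX Y hY _ hA), hlc X hX, hlc Y hY,
      h.condLoss_mix h𝕋 hμ (h𝒮 hX) (h𝒮 hY) ht (measurable_indicator_one_real hA)
        indicator_one_mem_unit] with ω e1 e2 e3 e4
    rw [e1, e4]
    by_cases hω : l Y ω ≤ l X ω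
    · rw [Set.indicator_of_mem (by exact hω), max_eq_left hω, e2]
      simp
    · rw [Set.indicator_of_notMem (by exact hω), max_eq_right (not_le.1 hω).le, e3]
      simp
  obtain ⟨u, huS, hu⟩ := hZ.exists_seq (ℱ.le t) hlm h0 hmax
  refine ⟨u, huS, ?_⟩
  have hl0 : ∀ᵐ ω ∂Q, l 0 ω = 0 := by
    filter_upwards [hlc 0 h0] with ω hω
    have h1 : condLoss 𝕋 ℱ Q D t 0 = 0 := by
      have : (fun ω => -tailSum 𝕋 D t 0 ω) = 0 := by
        funext ω
        simp [tailSum, proj]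
      rw [condLoss, this, condExp_zero]
    rw [hω, h1]
    simp
  filter_upwards [hu, hl0] with ω h1 h2
  exact ⟨fun n => h2 ▸ h1.1 n, h1.2⟩

end CondLoss

/-! ### Conditional convex risk measures -/

section Risk

variable {Ω : Type*} [mΩ : MeasurableSpace Ω] {P : Measure Ω} {𝕋 : Set ℕ∞}
  {ℱ : Filtration ℕ mΩ} {t : ℕ} {r r' : (ℕ∞ → Ω → ℝ) → Ω → ℝ}

theorem mem_bddProcessFrom_iff {X : ℕ∞ → Ω → ℝ} :
    X ∈ BddProcessFrom P 𝕋 ℱ t ↔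
      X ∈ BddProcess P 𝕋 ℱ ∧ ∀ s ∈ 𝕋, s < (t : ℕ∞) → X s =ᵐ[P] 0 := by
  refine and_congr_right fun _ => forall₂_congr fun s _ => ?_
  by_cases hst : (t : ℕ∞) ≤ s
  · have h1 : proj t ⊤ X s = X s := funext fun ω => by simp [proj_top, hst]
    simp [h1, not_lt.2 hst]
  · have h1 : proj t ⊤ X s = 0 := funext fun ω => by simp [proj_top, hst]
    rw [h1]
    simp [not_le.1 hst]

theorem add_mem_bddProcessFrom {X Y : ℕ∞ → Ω → ℝ} (hX : X ∈ BddProcessFrom P 𝕋 ℱ t)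
    (hY : Y ∈ BddProcessFrom P 𝕋 ℱ t) : X + Y ∈ BddProcessFrom P 𝕋 ℱ t := by
  rw [mem_bddProcessFrom_iff] at *
  refine ⟨add_mem_bddProcess hX.1 hY.1, fun s hs hst => ?_⟩
  filter_upwards [hX.2 s hs hst, hY.2 s hs hst] with ω h1 h2
  simp [h1, h2]

theorem cash_mem_bddProcessFrom {V : Ω → ℝ} (hV : MemLinf P (ℱ t) V) :
    (fun (s : ℕ∞) ω => if (t : ℕ∞) ≤ s then V ω else 0) ∈ BddProcessFrom P 𝕋 ℱ t := by
  rw [mem_bddProcessFrom_iff]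
  refine ⟨cash_mem_bddProcess hV, fun s _ hst => ae_of_all _ fun ω => ?_⟩
  simp [not_le.2 hst]

theorem add_cash_mem_bddProcessFrom {X : ℕ∞ → Ω → ℝ} (hX : X ∈ BddProcessFrom P 𝕋 ℱ t)
    {V : Ω → ℝ} (hV : MemLinf P (ℱ t) V) :
    (fun s ω => X s ω + if (t : ℕ∞) ≤ s then V ω else 0) ∈ BddProcessFrom P 𝕋 ℱ t :=
  add_mem_bddProcessFrom hX (cash_mem_bddProcessFrom hV)

theorem mix_mem_bddProcessFrom {X Y : ℕ∞ → Ω → ℝ} (hX : X ∈ BddProcess P 𝕋 ℱ)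
    (hY : Y ∈ BddProcess P 𝕋 ℱ) {l : Ω → ℝ} (hl : Measurable[ℱ t] l)
    (hl01 : ∀ ω, 0 ≤ l ω ∧ l ω ≤ 1) : mix t l X Y ∈ BddProcessFrom P 𝕋 ℱ t := by
  rw [mem_bddProcessFrom_iff]
  refine ⟨mix_mem_bddProcess hX hY hl hl01, fun s _ hst => ae_of_all _ fun ω => ?_⟩
  simp [mix, proj_top, not_le.2 hst]

theorem zero_mem_bddProcessFrom : (0 : ℕ∞ → Ω → ℝ) ∈ BddProcessFrom P 𝕋 ℱ t := by
  rw [mem_bddProcessFrom_iff]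
  exact ⟨zero_mem_bddProcess, fun s _ _ => ae_of_all _ fun ω => rfl⟩

theorem proj_top_ae_eq {X : ℕ∞ → Ω → ℝ} (hX : X ∈ BddProcessFrom P 𝕋 ℱ t) :
    ∀ s ∈ 𝕋, proj t ⊤ X s =ᵐ[P] X s := fun s hs => (hX.2 s hs).symm

theorem proj_top_proj_top {s t : ℕ∞} (hst : s ≤ t) (X : ℕ∞ → Ω → ℝ) :
    proj t ⊤ (proj s ⊤ X) = proj t ⊤ X := by
  funext u ω
  simp only [proj_top]
  by_cases h : t ≤ u
  · simp [h, hst.trans h]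
  · simp [h]

/-- The processes accepted by `r`. -/
def acceptedBy (P : Measure Ω) (𝕋 : Set ℕ∞) (ℱ : Filtration ℕ mΩ) (t : ℕ)
    (r : (ℕ∞ → Ω → ℝ) → Ω → ℝ) : Set (ℕ∞ → Ω → ℝ) :=
  {X | X ∈ BddProcessFrom P 𝕋 ℱ t ∧ ∀ᵐ ω ∂P, r X ω ≤ 0}

theorem MemLinf.neg {Ω : Type*} {m mΩ : MeasurableSpace Ω} {P : Measure Ω} {V : Ω → ℝ} (hV : MemLinf P m V) :
    MemLinf P m (fun ω => -V ω) :=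
  ⟨hV.1.neg, hV.2.imp fun C hC => by simpa using hC⟩

namespace IsCondConvexRiskMeasure

theorem congr (hr : IsCondConvexRiskMeasure P 𝕋 ℱ t r) {X Y : ℕ∞ → Ω → ℝ}
    (hX : X ∈ BddProcessFrom P 𝕋 ℱ t) (hY : Y ∈ BddProcessFrom P 𝕋 ℱ t)
    (hXY : ∀ s ∈ 𝕋, X s =ᵐ[P] Y s) : ∀ᵐ ω ∂P, r X ω = r Y ω := by
  filter_upwards [hr.monotone X hX Y hY fun s hs => (hXY s hs).le,
    hr.monotone Y hY X hX fun s hs => (hXY s hs).symm.le] with ω h1 h2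
  exact le_antisymm h2 h1

theorem proj_eq (hr : IsCondConvexRiskMeasure P 𝕋 ℱ t r) {X : ℕ∞ → Ω → ℝ}
    (hX : X ∈ BddProcessFrom P 𝕋 ℱ t) : ∀ᵐ ω ∂P, r (proj t ⊤ X) ω = r X ω :=
  hr.congr (proj_top_mem_from hX.1 t) hX (proj_top_ae_eq hX)

theorem mix_le (hr : IsCondConvexRiskMeasure P 𝕋 ℱ t r) {X Y : ℕ∞ → Ω → ℝ}
    (hX : X ∈ BddProcessFrom P 𝕋 ℱ t) (hY : Y ∈ BddProcessFrom P 𝕋 ℱ t) {l : Ω → ℝ}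
    (hl : Measurable[ℱ t] l) (hl01 : ∀ ω, 0 ≤ l ω ∧ l ω ≤ 1) :
    ∀ᵐ ω ∂P, r (mix t l X Y) ω ≤ l ω * r X ω + (1 - l ω) * r Y ω := by
  have hl' : MemLinf P (ℱ t) l :=
    ⟨hl, 1, ae_of_all _ fun ω => by rw [abs_of_nonneg (hl01 ω).1]; exact (hl01 ω).2⟩
  filter_upwards [hr.convex _ (proj_top_mem_from hX.1 t) _ (proj_top_mem_from hY.1 t) l hl'
    (ae_of_all _ hl01), hr.proj_eq hX, hr.proj_eq hY] with ω h1 h2 h3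
  rw [← h2, ← h3]
  exact h1

theorem zero_mem (hr : IsCondConvexRiskMeasure P 𝕋 ℱ t r) : 0 ∈ acceptedBy P 𝕋 ℱ t r :=
  ⟨zero_mem_bddProcessFrom, hr.normalized.mono fun _ h => h.le⟩

theorem mix_mem (hr : IsCondConvexRiskMeasure P 𝕋 ℱ t r) {X Y : ℕ∞ → Ω → ℝ}
    (hX : X ∈ acceptedBy P 𝕋 ℱ t r) (hY : Y ∈ acceptedBy P 𝕋 ℱ t r) {l : Ω → ℝ}
    (hl : Measurable[ℱ t] l) (hl01 : ∀ ω, 0 ≤ l ω ∧ l ω ≤ 1) :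
    mix t l X Y ∈ acceptedBy P 𝕋 ℱ t r := by
  refine ⟨mix_mem_bddProcessFrom hX.1.1 hY.1.1 hl hl01, ?_⟩
  filter_upwards [hr.mix_le hX.1 hY.1 hl hl01, hX.2, hY.2] with ω h1 h2 h3
  obtain ⟨h4, h5⟩ := hl01 ω
  nlinarith

theorem add_cash_mem (hr : IsCondConvexRiskMeasure P 𝕋 ℱ t r) {X : ℕ∞ → Ω → ℝ}
    (hX : X ∈ BddProcessFrom P 𝕋 ℱ t) :
    (fun s ω => X s ω + if (t : ℕ∞) ≤ s then r X ω else 0) ∈ acceptedBy P 𝕋 ℱ t r := by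
  have h1 := hr.memLinf X hX
  refine ⟨add_cash_mem_bddProcessFrom hX h1, ?_⟩
  filter_upwards [hr.cashInvariance X hX _ h1] with ω hω
  rw [hω, sub_self]

/-- A risk measure is determined by its acceptance set: X raised by its own risk r(X) is accepted by
r, hence by r'. -/
theorem le_of_subset (hr : IsCondConvexRiskMeasure P 𝕋 ℱ t r)
    (hr' : IsCondConvexRiskMeasure P 𝕋 ℱ t r')
    (h : acceptedBy P 𝕋 ℱ t r ⊆ acceptedBy P 𝕋 ℱ t r') {X : ℕ∞ → Ω → ℝ}
    (hX : X ∈ BddProcessFrom P 𝕋 ℱ t) : ∀ᵐ ω ∂P, r' X ω ≤ r X ω := by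
  filter_upwards [(h (hr.add_cash_mem hX)).2,
    hr'.cashInvariance X hX _ (hr.memLinf X hX)] with ω h1 h2
  rw [h2] at h1
  linarith

end IsCondConvexRiskMeasure

end Risk

/-! ### The penalty functions as essential suprema of conditional losses -/

section Penalty

variable {Ω : Type*} [mΩ : MeasurableSpace Ω] {P : Measure Ω} {𝕋 : Set ℕ∞}
  {ℱ : Filtration ℕ mΩ} {μ : ℕ∞ → Ω → ℝ} {Qbar : Measure (OptionalSpace 𝕋 ℱ)} {Q : Measure Ω}
  {D : ℕ∞ → Ω → ℝ} {t : ℕ} {ρ : ℕ → (ℕ∞ → Ω → ℝ) → Ω → ℝ}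

/-- Multiplication by D_t undoes the division in `discountedLoss` and is continuous where D_t > 0.
On {D_t = 0} the losses vanish, and so does the product, since 0 * ⊤ = 0 in `EReal`. -/
theorem IsDecomposition.isLossSup_penalty (h𝕋 : IsTimeSet 𝕋) (hμ : IsReferenceProcess P 𝕋 ℱ μ)
    (h : IsDecomposition P 𝕋 ℱ μ Qbar Q D) (ht : (t : ℕ∞) ∈ 𝕋)
    (hr : IsCondConvexRiskMeasure P 𝕋 ℱ t (ρ t)) :
    IsLossSup 𝕋 ℱ Q D t (acceptedBy P 𝕋 ℱ t (ρ t))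
      (fun ω => (D t ω : EReal) * penalty P 𝕋 ℱ ρ Q D t ω) := by
  have := h.isProbabilityMeasure_left
  have hsub : acceptedBy P 𝕋 ℱ t (ρ t) ⊆ BddProcess P 𝕋 ℱ := fun X hX => hX.1.1
  have hdm : ∀ X, Measurable[ℱ t] (discountedLoss 𝕋 ℱ Q D t X) := fun X =>
    stronglyMeasurable_condExp.measurable
  constructor
  · intro X hX
    have hZ := (isEssSup_essSupFamily Q (ℱ.le t) {f | ∃ X ∈ acceptance P 𝕋 ℱ ρ t,
      f = fun ω' => (discountedLoss 𝕋 ℱ Q D t X ω' : EReal)} (by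
        rintro _ ⟨X, hX, rfl⟩
        exact (hdm X).coe_real_ereal)).le _ ⟨X, hX, rfl⟩
    filter_upwards [hZ, h.condLoss_eq h𝕋 hμ hX.1.1 ht, h.ae_nonneg] with ω h1 h2 h3
    rw [penalty]
    rcases (h3 t ht).eq_or_lt with h4 | h4
    · rw [h2, ← h4]
      simp
    · rw [if_pos h4, h2, EReal.coe_mul]
      exact mul_le_mul_of_nonneg_left h1 (EReal.coe_nonneg.2 h4.le)
  · obtain ⟨u, huS, hu⟩ := h.exists_lossSup_seq h𝕋 hμ ht hsub hr.zero_mem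
      (fun X hX Y hY A hA => hr.mix_mem hX hY (measurable_indicator_one_real hA)
        indicator_one_mem_unit)
      (l := discountedLoss 𝕋 ℱ Q D t) (fun X _ => hdm X) (c := fun ω => (D t ω)⁻¹)
      (fun X hX => h.discountedLoss_eq h𝕋 hμ (hsub hX) ht)
    refine ⟨u, huS, ?_⟩
    filter_upwards [hu, ae_all_iff.2 fun n => h.condLoss_eq h𝕋 hμ (hsub (huS n)) ht,
      h.ae_nonneg] with ω h1 h2 h3
    have h4 := h3 t ht
    simp only [h2]
    refine ⟨fun n => mul_nonneg h4 (h1.1 n),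
      fun a b hab => mul_le_mul_of_nonneg_left (h1.2.1 hab) h4, ?_⟩
    rw [penalty]
    rcases h4.eq_or_lt with h5 | h5
    · simp [← h5]
    · rw [if_pos h5]
      simp only [EReal.coe_mul]
      exact EReal.Tendsto.const_mul h1.2.2 (Or.inl (EReal.coe_ne_bot _))
        (Or.inl (EReal.coe_ne_top _))

theorem bddProcessBetween_subset_from (t s : ℕ∞) :
    BddProcessBetween P 𝕋 ℱ t s ⊆ BddProcessFrom P 𝕋 ℱ t := by
  intro X hX
  refine ⟨hX.1, fun r hr => ?_⟩
  filter_upwards [hX.2 r hr] with ω hω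
  rw [proj_top]
  split_ifs with h
  · rfl
  · rw [hω, proj, if_neg h]

theorem IsTimeSet.mem_of_succ (h𝕋 : IsTimeSet 𝕋) (ht : ((t + 1 : ℕ) : ℕ∞) ∈ 𝕋) : (t : ℕ∞) ∈ 𝕋 :=
  h𝕋.mem_of_le (by exact_mod_cast Nat.le_succ t) ht

theorem memLinf_of_mem {X : ℕ∞ → Ω → ℝ} (hX : X ∈ BddProcess P 𝕋 ℱ) (ht : (t : ℕ∞) ∈ 𝕋) :
    MemLinf P (ℱ t) (X t) :=
  ⟨hX.1 t ht, hX.2.imp fun _ hC => hC t ht⟩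

theorem between_ae_eq {X : ℕ∞ → Ω → ℝ}
    (hX : X ∈ BddProcessBetween P 𝕋 ℱ t ((t + 1 : ℕ) : ℕ∞)) :
    ∀ s ∈ 𝕋, ((t + 1 : ℕ) : ℕ∞) ≤ s → X s =ᵐ[P] X ((t + 1 : ℕ) : ℕ∞) := by
  intro s hs hst
  have hts : (t : ℕ∞) ≤ s := le_trans (by exact_mod_cast Nat.le_succ t) hst
  filter_upwards [hX.2 s hs] with ω hω
  rw [hω, proj, if_pos hts, min_eq_right hst]

/-- A process stopped at t + 1 is constant from there on, so its later part contributes D_{t+1}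
X_{t+1}. -/
theorem IsDecomposition.stepLoss_eq (h𝕋 : IsTimeSet 𝕋) (hμ : IsReferenceProcess P 𝕋 ℱ μ)
    (h : IsDecomposition P 𝕋 ℱ μ Qbar Q D) (ht : ((t + 1 : ℕ) : ℕ∞) ∈ 𝕋) {X : ℕ∞ → Ω → ℝ}
    (hX : X ∈ BddProcessBetween P 𝕋 ℱ t ((t + 1 : ℕ) : ℕ∞)) :
    ∀ᵐ ω ∂Q, Q[fun ω'' => -gammaOf 𝕋 D t ω'' * X t ω''
            - D ((t + 1 : ℕ) : ℕ∞) ω'' * X ((t + 1 : ℕ) : ℕ∞) ω'' | ℱ t] ω =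
      condLoss 𝕋 ℱ Q D t X ω := by
  refine condExp_congr_ae ?_
  have hV := memLinf_of_mem hX.1 ht
  filter_upwards [h.tailSum_eq_add h𝕋 hμ hX.1 (h𝕋.mem_of_succ ht),
    h.tailSum_congr h𝕋 hμ hX.1 (cash_mem_bddProcess hV) (t + 1) (fun s hs hst => by
      filter_upwards [between_ae_eq hX s hs hst] with ω hω
      rw [if_pos hst, hω]), h.tailSum_cash h𝕋 (X ((t + 1 : ℕ) : ℕ∞)) ht] with ω h1 h2 h3
  rw [h1, h2, h3]
  ring

theorem mix_mem_between {X Y : ℕ∞ → Ω → ℝ}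
    (hX : X ∈ BddProcessBetween P 𝕋 ℱ t ((t + 1 : ℕ) : ℕ∞))
    (hY : Y ∈ BddProcessBetween P 𝕋 ℱ t ((t + 1 : ℕ) : ℕ∞)) {l : Ω → ℝ} (hl : Measurable[ℱ t] l)
    (hl01 : ∀ ω, 0 ≤ l ω ∧ l ω ≤ 1) :
    mix t l X Y ∈ BddProcessBetween P 𝕋 ℱ t ((t + 1 : ℕ) : ℕ∞) := by
  refine ⟨mix_mem_bddProcess hX.1 hY.1 hl hl01, fun s hs => ?_⟩
  have hle : (t : ℕ∞) ≤ ((t + 1 : ℕ) : ℕ∞) := by exact_mod_cast Nat.le_succ t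
  filter_upwards [hX.2 s hs, hY.2 s hs] with ω h1 h2
  by_cases hts : (t : ℕ∞) ≤ s
  · have h4 : (t : ℕ∞) ≤ min s ((t + 1 : ℕ) : ℕ∞) := le_min hts hle
    simp only [proj, hts, h4, mix, min_top_right, if_true] at h1 h2 ⊢
    rw [h1, h2]
  · simp [mix, proj, hts]

/-- Here 1/D_t stands outside the essential supremum and is cancelled where D_t > 0; on {D_t = 0}
all conditional losses vanish. -/
theorem IsDecomposition.isLossSup_penaltyStep (h𝕋 : IsTimeSet 𝕋)
    (hμ : IsReferenceProcess P 𝕋 ℱ μ)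
    (h : IsDecomposition P 𝕋 ℱ μ Qbar Q D) (ht : ((t + 1 : ℕ) : ℕ∞) ∈ 𝕋)
    (hr : IsCondConvexRiskMeasure P 𝕋 ℱ t (ρ t)) :
    IsLossSup 𝕋 ℱ Q D t (acceptanceStep P 𝕋 ℱ ρ t)
      (fun ω => (D t ω : EReal) * penaltyStep P 𝕋 ℱ ρ Q D t ω) := by
  have := h.isProbabilityMeasure_left
  have ht0 := h𝕋.mem_of_succ ht
  have hsub : acceptanceStep P 𝕋 ℱ ρ t ⊆ BddProcess P 𝕋 ℱ := fun X hX => hX.1.1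
  have hacc : ∀ X ∈ acceptanceStep P 𝕋 ℱ ρ t, X ∈ acceptedBy P 𝕋 ℱ t (ρ t) := fun X hX =>
    ⟨bddProcessBetween_subset_from _ _ hX.1, hX.2⟩
  have h0 : 0 ∈ acceptanceStep P 𝕋 ℱ ρ t :=
    ⟨⟨zero_mem_bddProcess, fun s _ => ae_of_all _ fun ω => by simp [proj]⟩, hr.zero_mem.2⟩
  set l : (ℕ∞ → Ω → ℝ) → Ω → ℝ := fun X => Q[fun ω'' => -gammaOf 𝕋 D t ω'' * X t ω''
            - D ((t + 1 : ℕ) : ℕ∞) ω'' * X ((t + 1 : ℕ) : ℕ∞) ω'' | ℱ t] with hl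
  have hlm : ∀ X, Measurable[ℱ t] (l X) := fun X => stronglyMeasurable_condExp.measurable
  have hB : ∀ᵐ ω ∂Q, 0 < D t ω → (D t ω : EReal) * penaltyStep P 𝕋 ℱ ρ Q D t ω =
      essSupFamily Q (ℱ t) {f | ∃ X ∈ acceptanceStep P 𝕋 ℱ ρ t, f = fun ω => (l X ω : EReal)} ω := by
    refine ae_of_all _ fun ω hω => ?_
    rw [penaltyStep, if_pos hω, ← mul_assoc, ← EReal.coe_mul, mul_inv_cancel₀ hω.ne',
      EReal.coe_one, one_mul]
  have hD0 : ∀ X ∈ BddProcess P 𝕋 ℱ, ∀ᵐ ω ∂Q, D t ω = 0 → condLoss 𝕋 ℱ Q D t X ω = 0 :=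
    fun X hX => by
      filter_upwards [h.condLoss_eq h𝕋 hμ hX ht0] with ω h1 h2
      rw [h1, h2, zero_mul]
  constructor
  · intro X hX
    have hZ := (isEssSup_essSupFamily Q (ℱ.le t) {f | ∃ X ∈ acceptanceStep P 𝕋 ℱ ρ t,
      f = fun ω' => (l X ω' : EReal)} (by
        rintro _ ⟨X, hX, rfl⟩
        exact (hlm X).coe_real_ereal)).le _ ⟨X, hX, rfl⟩
    filter_upwards [hZ, h.stepLoss_eq h𝕋 hμ ht hX.1, h.ae_nonneg, hB, hD0 X hX.1.1]
      with ω h1 h2 h3 h5 h6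
    rcases (h3 t ht0).eq_or_lt with h4 | h4
    · rw [h6 h4.symm, ← h4]
      simp
    · rw [h5 h4, ← h2]
      exact h1
  · obtain ⟨u, huS, hu⟩ := h.exists_lossSup_seq h𝕋 hμ ht0 hsub h0
      (fun X hX Y hY A hA => ⟨mix_mem_between hX.1 hY.1 (measurable_indicator_one_real hA)
        indicator_one_mem_unit, (hr.mix_mem (hacc X hX) (hacc Y hY)
        (measurable_indicator_one_real hA) indicator_one_mem_unit).2⟩)
      (l := l) (fun X _ => hlm X) (c := fun _ => 1)
      (fun X hX => by
        filter_upwards [h.stepLoss_eq h𝕋 hμ ht hX.1] with ω hω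
        rw [one_mul]
        exact hω)
    refine ⟨u, huS, ?_⟩
    filter_upwards [hu, ae_all_iff.2 fun n => h.stepLoss_eq h𝕋 hμ ht (huS n).1,
      h.ae_nonneg, hB, ae_all_iff.2 fun n => hD0 (u n) (hsub (huS n))] with ω h1 h2 h3 h5 h6
    simp only [← h2]
    refine ⟨h1.1, h1.2.1, ?_⟩
    rcases (h3 t ht0).eq_or_lt with h4 | h4
    · have h7 : ∀ n, l (u n) ω = 0 := fun n => (h2 n).trans (h6 n h4.symm)
      change Tendsto (fun n => (l (u n) ω : EReal)) atTop _
      simp [h7, ← h4]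
    · rw [h5 h4]
      exact h1.2.2

/-- The recursion formula for essential suprema of conditional losses over sums of acceptance
sets. -/
theorem IsDecomposition.isLossSup_add (h𝕋 : IsTimeSet 𝕋) (hμ : IsReferenceProcess P 𝕋 ℱ μ)
    (h : IsDecomposition P 𝕋 ℱ μ Qbar Q D) (ht : ((t + 1 : ℕ) : ℕ∞) ∈ 𝕋)
    {𝒮 𝒮' : Set (ℕ∞ → Ω → ℝ)} (h𝒮 : 𝒮 ⊆ BddProcess P 𝕋 ℱ)
    (h𝒮' : 𝒮' ⊆ BddProcessFrom P 𝕋 ℱ ((t + 1 : ℕ) : ℕ∞)) {B B' : Ω → EReal}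
    (hB : IsLossSup 𝕋 ℱ Q D t 𝒮 B) (hB' : IsLossSup 𝕋 ℱ Q D (t + 1) 𝒮' B') :
    IsLossSup 𝕋 ℱ Q D t (𝒮 + 𝒮') (fun ω => B ω + condExpE Q (ℱ t) B' ω) := by
  have := h.isProbabilityMeasure_left
  have ht0 := h𝕋.mem_of_succ ht
  -- Z vanishes at time t, so nothing but the conditional expectation of its loss at t + 1 remains.
  have hZ : ∀ Z ∈ 𝒮', ∀ᵐ ω ∂Q, condLoss 𝕋 ℱ Q D t Z ω = Q[condLoss 𝕋 ℱ Q D (t + 1) Z|ℱ t] ω := by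
    intro Z hZ
    have h0 : Z t =ᵐ[P] 0 := (mem_bddProcessFrom_iff.1 (h𝒮' hZ)).2 t ht0
      (by exact_mod_cast Nat.lt_succ_self t)
    have h1 : ∀ᵐ ω ∂Q, Z t ω = 0 := h.locAC.ae_of_ae ht0
      (((h𝒮' hZ).1.1 t ht0) (measurableSet_singleton 0)) h0
    filter_upwards [h.condLoss_succ h𝕋 hμ (h𝒮' hZ).1 ht, h1] with ω h2 h3
    rw [h2, h3]
    simp
  constructor
  · rintro _ ⟨X, hX, Z, hZS, rfl⟩
    filter_upwards [h.condLoss_add h𝕋 hμ (h𝒮 hX) (h𝒮' hZS).1 ht0, hB.le X hX, hZ Z hZS,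
      le_condExpE (m := ℱ t) (integrable_condLoss (t + 1) Z) (hB'.le Z hZS) hB'.nonneg]
      with ω h1 h2 h3 h4
    rw [h1, EReal.coe_add, h3]
    exact add_le_add h2 h4
  · obtain ⟨X, hXS, hX⟩ := hB.exists_seq
    obtain ⟨Z, hZS, hZc⟩ := hB'.exists_seq
    refine ⟨fun n => X n + Z n, fun n => Set.add_mem_add (hXS n) (hZS n), ?_⟩
    filter_upwards [hX, tendsto_condExpE (ℱ.le t) (fun n => integrable_condLoss (t + 1) (Z n)) hZc,
      ae_all_iff.2 fun n => hZ (Z n) (hZS n), ae_all_iff.2 fun n =>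
        h.condLoss_add h𝕋 hμ (h𝒮 (hXS n)) (h𝒮' (hZS n)).1 ht0, hB.nonneg] with ω h1 h2 h3 h4 h5
    have h6 : ∀ n, condLoss 𝕋 ℱ Q D t (X n + Z n) ω =
        condLoss 𝕋 ℱ Q D t (X n) ω + Q[condLoss 𝕋 ℱ Q D (t + 1) (Z n)|ℱ t] ω := fun n => by
      rw [h4 n, h3 n]
    simp only [h6]
    have h7 : 0 ≤ condExpE Q (ℱ t) B' ω :=
      ge_of_tendsto' h2.2.2 fun n => EReal.coe_nonneg.2 (h2.1 n)
    refine ⟨fun n => add_nonneg (h1.1 n) (h2.1 n), h1.2.1.add h2.2.1, ?_⟩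
    simp only [EReal.coe_add]
    -- Adding the two attaining sequences attains the sum. Both limits are nonnegative, which
    -- excludes ⊤ + ⊥, the only place where addition is discontinuous.
    exact (EReal.continuousAt_add (p := (B ω, condExpE Q (ℱ t) B' ω))
      (Or.inr (ne_bot_of_gt (lt_of_lt_of_le EReal.bot_lt_zero h7)))
      (Or.inl (ne_bot_of_gt (lt_of_lt_of_le EReal.bot_lt_zero h5)))).tendsto.comp
      (h1.2.2.prodMk_nhds h2.2.2)

end Penalty

/-! ### Composition of a risk measure with its successor -/

section Composed

variable {Ω : Type*} [mΩ : MeasurableSpace Ω] {P : Measure Ω} {𝕋 : Set ℕ∞}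
  {ℱ : Filtration ℕ mΩ} {t : ℕ} {ρ : ℕ → (ℕ∞ → Ω → ℝ) → Ω → ℝ}

theorem succ_le_iff_lt {t : ℕ} {s : ℕ∞} : ((t + 1 : ℕ) : ℕ∞) ≤ s ↔ (t : ℕ∞) < s := by
  push_cast
  exact ENat.add_one_le_iff (ENat.natCast_ne_top t)

/-- The process with value `U` at time `t` and `V` afterwards. -/
noncomputable def stepProc (t : ℕ) (U V : Ω → ℝ) : ℕ∞ → Ω → ℝ :=
  fun s ω => if s = (t : ℕ∞) then U ω else if (t : ℕ∞) < s then V ω else 0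

theorem stepProc_self (U V : Ω → ℝ) : stepProc t U V t = U := by
  funext ω; simp [stepProc]

theorem stepProc_of_gt (U V : Ω → ℝ) {s : ℕ∞} (hs : (t : ℕ∞) < s) : stepProc t U V s = V := by
  funext ω; simp [stepProc, hs, hs.ne']

theorem stepProc_of_lt (U V : Ω → ℝ) {s : ℕ∞} (hs : s < (t : ℕ∞)) : stepProc t U V s = 0 := by
  funext ω; simp [stepProc, hs.ne, hs.le]

theorem stepProc_mem_between {U V : Ω → ℝ} (hU : MemLinf P (ℱ t) U)
    (hV : MemLinf P (ℱ (t + 1)) V) :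
    stepProc t U V ∈ BddProcessBetween P 𝕋 ℱ t ((t + 1 : ℕ) : ℕ∞) := by
  obtain ⟨hUm, C, hC⟩ := hU
  obtain ⟨hVm, C', hC'⟩ := hV
  refine ⟨⟨fun s _ => ?_, max C C', fun s _ => ?_⟩, fun s _ => ae_of_all _ fun ω => ?_⟩
  · rcases lt_trichotomy s (t : ℕ∞) with h | rfl | h
    · rw [stepProc_of_lt U V h]
      exact measurable_const
    · rw [stepProc_self]
      exact hUm
    · rw [stepProc_of_gt U V h]
      exact hVm.mono (sigmaAt_mono ℱ (succ_le_iff_lt.2 h)) le_rfl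
  · filter_upwards [hC, hC'] with ω h1 h2
    rcases lt_trichotomy s (t : ℕ∞) with h | rfl | h
    · rw [stepProc_of_lt U V h]
      simpa using Or.inl ((abs_nonneg _).trans h1)
    · rw [stepProc_self]
      exact h1.trans (le_max_left _ _)
    · rw [stepProc_of_gt U V h]
      exact h2.trans (le_max_right _ _)
  · rcases lt_trichotomy s (t : ℕ∞) with h | rfl | h
    · rw [stepProc_of_lt U V h, proj, if_neg (not_le.2 h)]
      rfl
    · rw [proj, if_pos le_rfl, min_eq_left (by exact_mod_cast Nat.le_succ t)]
    · rw [proj, if_pos h.le, min_eq_right (succ_le_iff_lt.2 h), stepProc_of_gt U V h,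
        stepProc_of_gt U V (by exact_mod_cast Nat.lt_succ_self t)]

theorem stepProc_mem_from {U V : Ω → ℝ} (hU : MemLinf P (ℱ t) U)
    (hV : MemLinf P (ℱ (t + 1)) V) : stepProc t U V ∈ BddProcessFrom P 𝕋 ℱ t :=
  bddProcessBetween_subset_from _ _ (stepProc_mem_between hU hV)

theorem stepProc_ae_le {U V U' V' : Ω → ℝ} (hU : ∀ᵐ ω ∂P, U ω ≤ U' ω) (hV : ∀ᵐ ω ∂P, V ω ≤ V' ω)
    (s : ℕ∞) : ∀ᵐ ω ∂P, stepProc t U V s ω ≤ stepProc t U' V' s ω := by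
  rcases lt_trichotomy s (t : ℕ∞) with h | rfl | h
  · simp only [stepProc_of_lt _ _ h]
    exact ae_of_all _ fun ω => le_rfl
  · simpa only [stepProc_self] using hU
  · simpa only [stepProc_of_gt _ _ h] using hV

/-- The risk measure `X ↦ ρ_t(X_t 1_{t} - ρ_{t+1}(X) 1_{s > t})`. -/
noncomputable def composed (ρ : ℕ → (ℕ∞ → Ω → ℝ) → Ω → ℝ) (t : ℕ) (X : ℕ∞ → Ω → ℝ) : Ω → ℝ :=
  ρ t (stepProc t (X t) fun ω => -riskAt ρ (t + 1) X ω)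

theorem memLinf_riskAt (hr : IsCondConvexRiskMeasure P 𝕋 ℱ t (ρ t)) {X : ℕ∞ → Ω → ℝ}
    (hX : X ∈ BddProcess P 𝕋 ℱ) : MemLinf P (ℱ t) (riskAt ρ t X) :=
  hr.memLinf _ (proj_top_mem_from hX t)

theorem riskAt_eq (hr : IsCondConvexRiskMeasure P 𝕋 ℱ t (ρ t)) {X : ℕ∞ → Ω → ℝ}
    (hX : X ∈ BddProcessFrom P 𝕋 ℱ t) : ∀ᵐ ω ∂P, riskAt ρ t X ω = ρ t X ω :=
  hr.proj_eq hX

theorem riskAt_mono (hr : IsCondConvexRiskMeasure P 𝕋 ℱ t (ρ t)) {X Y : ℕ∞ → Ω → ℝ}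
    (hX : X ∈ BddProcess P 𝕋 ℱ) (hY : Y ∈ BddProcess P 𝕋 ℱ)
    (hXY : ∀ s ∈ 𝕋, (t : ℕ∞) ≤ s → ∀ᵐ ω ∂P, X s ω ≤ Y s ω) :
    ∀ᵐ ω ∂P, riskAt ρ t Y ω ≤ riskAt ρ t X ω := by
  refine hr.monotone _ (proj_top_mem_from hX t) _ (proj_top_mem_from hY t) fun s hs => ?_
  by_cases hst : (t : ℕ∞) ≤ s
  · filter_upwards [hXY s hs hst] with ω hω
    simpa [proj_top, hst] using hω
  · simp [proj_top, hst]

theorem riskAt_congr (hr : IsCondConvexRiskMeasure P 𝕋 ℱ t (ρ t)) {X Y : ℕ∞ → Ω → ℝ}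
    (hX : X ∈ BddProcess P 𝕋 ℱ) (hY : Y ∈ BddProcess P 𝕋 ℱ)
    (hXY : ∀ s ∈ 𝕋, (t : ℕ∞) ≤ s → X s =ᵐ[P] Y s) :
    ∀ᵐ ω ∂P, riskAt ρ t X ω = riskAt ρ t Y ω := by
  filter_upwards [riskAt_mono hr hX hY fun s hs hst => (hXY s hs hst).le,
    riskAt_mono hr hY hX fun s hs hst => (hXY s hs hst).symm.le] with ω h1 h2
  exact le_antisymm h2 h1

theorem riskAt_add_cash (hr : IsCondConvexRiskMeasure P 𝕋 ℱ t (ρ t)) {X : ℕ∞ → Ω → ℝ}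
    (hX : X ∈ BddProcess P 𝕋 ℱ) {V : Ω → ℝ} (hV : MemLinf P (ℱ t) V) {s : ℕ} (hst : s ≤ t) :
    ∀ᵐ ω ∂P, riskAt ρ t (fun u ω => X u ω + if (s : ℕ∞) ≤ u then V ω else 0) ω =
      riskAt ρ t X ω - V ω := by
  have h1 : proj t ⊤ (fun u ω => X u ω + if (s : ℕ∞) ≤ u then V ω else 0) =
      fun u ω => proj t ⊤ X u ω + if (t : ℕ∞) ≤ u then V ω else 0 := by
    funext u ω
    simp only [proj_top]
    by_cases h : (t : ℕ∞) ≤ u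
    · have h2 : (s : ℕ∞) ≤ u := le_trans (by exact_mod_cast hst) h
      simp [h, h2]
    · simp [h]
  rw [riskAt, h1]
  exact hr.cashInvariance _ (proj_top_mem_from hX t) _ hV

theorem riskAt_cash (hr : IsCondConvexRiskMeasure P 𝕋 ℱ t (ρ t)) {V : Ω → ℝ}
    (hV : MemLinf P (ℱ t) V) {X : ℕ∞ → Ω → ℝ} (hX : X ∈ BddProcess P 𝕋 ℱ)
    (hXV : ∀ s ∈ 𝕋, (t : ℕ∞) ≤ s → X s =ᵐ[P] V) :
    ∀ᵐ ω ∂P, riskAt ρ t X ω = -V ω := by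
  have h1 := riskAt_congr hr hX (add_mem_bddProcess zero_mem_bddProcess
    (cash_mem_bddProcess (𝕋 := 𝕋) hV)) (fun s hs hst => by
      filter_upwards [hXV s hs hst] with ω hω
      simp [hω, hst])
  have h2 := riskAt_add_cash hr (zero_mem_bddProcess (P := P) (𝕋 := 𝕋) (ℱ := ℱ)) hV le_rfl
  have h3 : proj t ⊤ (0 : ℕ∞ → Ω → ℝ) = 0 := by
    funext s ω; simp [proj_top]
  filter_upwards [h1, h2, hr.normalized] with ω e1 e2 e3
  rw [e1]
  refine e2.trans ?_
  rw [riskAt, h3, e3, zero_sub]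

theorem memLinf_mul_proj_mem {X : ℕ∞ → Ω → ℝ} (hX : X ∈ BddProcess P 𝕋 ℱ) {u : Ω → ℝ}
    (hu : MemLinf P (ℱ t) u) : (fun s ω => u ω * proj t ⊤ X s ω) ∈ BddProcess P 𝕋 ℱ := by
  have h1 := proj_top_mem hX t
  obtain ⟨C, hC⟩ := h1.2
  obtain ⟨hum, C', hC'⟩ := hu
  refine ⟨fun s hs => ?_, C' * C, fun s hs => ?_⟩
  · by_cases hst : (t : ℕ∞) ≤ s
    · exact (hum.mono (sigmaAt_mono ℱ hst) le_rfl).mul (h1.1 s hs)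
    · have : (fun ω => u ω * proj t ⊤ X s ω) = fun _ => (0 : ℝ) := by
        funext ω; simp [proj_top, hst]
      change Measurable[sigmaAt ℱ s] (fun ω => u ω * proj t ⊤ X s ω)
      rw [this]
      exact measurable_const
  · filter_upwards [hC s hs, hC'] with ω h2 h3
    rw [abs_mul]
    exact mul_le_mul h3 h2 (abs_nonneg _) ((abs_nonneg _).trans h3)

theorem MemLinf.one_sub {Ω : Type*} {m mΩ : MeasurableSpace Ω} {P : Measure Ω} {l : Ω → ℝ}
    (hl : MemLinf P m l) : MemLinf P m (fun ω => 1 - l ω) := by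
  obtain ⟨hm, C, hC⟩ := hl
  refine ⟨measurable_const.sub hm, 1 + C, ?_⟩
  filter_upwards [hC] with ω hω
  refine (abs_sub _ _).trans ?_
  simpa using hω

theorem MemLinf.mono {Ω : Type*} {m m' mΩ : MeasurableSpace Ω} {P : Measure Ω} {l : Ω → ℝ}
    (hl : MemLinf P m l) (h : m ≤ m') : MemLinf P m' l :=
  ⟨hl.1.mono h le_rfl, hl.2⟩

theorem MemLinf.lin_comb {Ω : Type*} {m mΩ : MeasurableSpace Ω} {P : Measure Ω} {l U V : Ω → ℝ}
    (hl : MemLinf P m l) (hU : MemLinf P m U) (hV : MemLinf P m V) :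
    MemLinf P m (fun ω => l ω * U ω + (1 - l ω) * V ω) := by
  obtain ⟨hm', C', hC'⟩ := hl.one_sub
  obtain ⟨hm, C, hC⟩ := hl
  obtain ⟨hUm, a, ha⟩ := hU
  obtain ⟨hVm, b, hb⟩ := hV
  refine ⟨(hm.mul hUm).add (hm'.mul hVm), C * a + C' * b, ?_⟩
  filter_upwards [hC, hC', ha, hb] with ω h1 h2 h3 h4
  refine (abs_add_le _ _).trans (add_le_add ?_ ?_) <;> rw [abs_mul]
  · exact mul_le_mul h1 h3 (abs_nonneg _) ((abs_nonneg _).trans h1)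
  · exact mul_le_mul h2 h4 (abs_nonneg _) ((abs_nonneg _).trans h2)

theorem riskAt_convex (hr : IsCondConvexRiskMeasure P 𝕋 ℱ t (ρ t)) {X Y : ℕ∞ → Ω → ℝ}
    (hX : X ∈ BddProcess P 𝕋 ℱ) (hY : Y ∈ BddProcess P 𝕋 ℱ) {l : Ω → ℝ} (hl : MemLinf P (ℱ t) l)
    (hl01 : ∀ᵐ ω ∂P, 0 ≤ l ω ∧ l ω ≤ 1) :
    MemLinf P (ℱ t) (riskAt ρ t fun s ω => l ω * X s ω + (1 - l ω) * Y s ω) ∧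
    ∀ᵐ ω ∂P, riskAt ρ t (fun s ω => l ω * X s ω + (1 - l ω) * Y s ω) ω ≤
      l ω * riskAt ρ t X ω + (1 - l ω) * riskAt ρ t Y ω := by
  have h1 : proj t ⊤ (fun s ω => l ω * X s ω + (1 - l ω) * Y s ω) =
      fun s ω => l ω * proj t ⊤ X s ω + (1 - l ω) * proj t ⊤ Y s ω := by
    funext s ω
    simp only [proj_top]
    split_ifs <;> ring
  have h2 : (fun s ω => l ω * proj t ⊤ X s ω + (1 - l ω) * proj t ⊤ Y s ω) ∈
      BddProcess P 𝕋 ℱ :=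
    add_mem_bddProcess (memLinf_mul_proj_mem hX hl) (memLinf_mul_proj_mem hY hl.one_sub)
  have h3 : (fun s ω => l ω * proj t ⊤ X s ω + (1 - l ω) * proj t ⊤ Y s ω) ∈
      BddProcessFrom P 𝕋 ℱ t := by
    have := proj_top_mem_from h2 t
    rw [← h1, proj_top_proj_top le_rfl, h1] at this
    exact this
  rw [riskAt, h1]
  exact ⟨hr.memLinf _ h3, hr.convex _ (proj_top_mem_from hX t) _ (proj_top_mem_from hY t) l hl hl01⟩

theorem composed_proj (X : ℕ∞ → Ω → ℝ) : composed ρ t (proj t ⊤ X) = composed ρ t X := by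
  have h1 : proj t ⊤ X t = X t := funext fun ω => by simp [proj_top]
  rw [composed, composed, h1]
  simp only [riskAt]
  rw [proj_top_proj_top (by exact_mod_cast Nat.le_succ t)]

theorem proj_stepProc (U V : Ω → ℝ) : proj t ⊤ (stepProc t U V) = stepProc t U V := by
  funext s ω
  rw [proj_top]
  split_ifs with h
  · rfl
  · rw [stepProc_of_lt U V (not_le.1 h)]; rfl

theorem stepProc_risk_mem (h𝕋 : IsTimeSet 𝕋) (ht : ((t + 1 : ℕ) : ℕ∞) ∈ 𝕋)
    (hr' : IsCondConvexRiskMeasure P 𝕋 ℱ (t + 1) (ρ (t + 1))) {X : ℕ∞ → Ω → ℝ}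
    (hX : X ∈ BddProcess P 𝕋 ℱ) :
    stepProc t (X t) (fun ω => -riskAt ρ (t + 1) X ω) ∈
      BddProcessBetween P 𝕋 ℱ t ((t + 1 : ℕ) : ℕ∞) :=
  stepProc_mem_between (memLinf_of_mem hX (h𝕋.mem_of_succ ht)) (memLinf_riskAt hr' hX).neg

/-- ρ_{t+1} enters ρ_t with a minus sign in the position, and risk decreases in the position, so the
two signs cancel. In particular the convexity inequality for ρ_{t+1} passes through the monotonicity
of ρ_t. -/
theorem isCondConvexRiskMeasure_composed (h𝕋 : IsTimeSet 𝕋) (ht : ((t + 1 : ℕ) : ℕ∞) ∈ 𝕋)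
    (hr : IsCondConvexRiskMeasure P 𝕋 ℱ t (ρ t))
    (hr' : IsCondConvexRiskMeasure P 𝕋 ℱ (t + 1) (ρ (t + 1))) :
    IsCondConvexRiskMeasure P 𝕋 ℱ t (composed ρ t) := by
  have ht0 := h𝕋.mem_of_succ ht
  have hle : ℱ t ≤ ℱ (t + 1) := ℱ.mono (Nat.le_succ t)
  have hmem : ∀ X ∈ BddProcess P 𝕋 ℱ, stepProc t (X t) (fun ω => -riskAt ρ (t + 1) X ω) ∈
      BddProcessFrom P 𝕋 ℱ t := fun X hX =>
    bddProcessBetween_subset_from _ _ (stepProc_risk_mem h𝕋 ht hr' hX)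
  constructor
  · exact fun X hX => hr.memLinf _ (hmem X hX.1)
  · intro X hX m hm
    have h1 := riskAt_add_cash hr' hX.1 (hm.mono hle) (Nat.le_succ t)
    have hX' := (add_cash_mem_bddProcessFrom hX hm).1
    have h2 := hr.congr (hmem _ hX') (add_cash_mem_bddProcessFrom (hmem X hX.1) hm) (fun s hs => by
      filter_upwards [h1] with ω hω
      rcases lt_trichotomy s (t : ℕ∞) with h | rfl | h
      · simp [stepProc_of_lt _ _ h, not_le.2 h]
      · simp [stepProc_self]
      · simp only [stepProc_of_gt _ _ h, h.le, if_true]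
        rw [hω]
        ring)
    filter_upwards [h2, hr.cashInvariance _ (hmem X hX.1) m hm] with ω e1 e2
    exact e1.trans e2
  · intro X hX Y hY hXY
    refine hr.monotone _ (hmem X hX.1) _ (hmem Y hY.1) fun s _ =>
      stepProc_ae_le (hXY t ht0) ?_ s
    filter_upwards [riskAt_mono hr' hX.1 hY.1 fun s hs _ => hXY s hs] with ω hω
    exact neg_le_neg hω
  · intro X hX Y hY l hl hl01
    obtain ⟨h1, h2⟩ := riskAt_convex hr' hX.1 hY.1 (hl.mono hle) hl01
    have h3 := hr.convex _ (hmem X hX.1) _ (hmem Y hY.1) l hl hl01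
    have h4 : stepProc t (fun ω => l ω * X t ω + (1 - l ω) * Y t ω) (fun ω =>
        -riskAt ρ (t + 1) (fun s ω => l ω * X s ω + (1 - l ω) * Y s ω) ω) ∈
        BddProcessFrom P 𝕋 ℱ t :=
      stepProc_mem_from (hl.lin_comb (memLinf_of_mem hX.1 ht0) (memLinf_of_mem hY.1 ht0)) h1.neg
    have h5 : (fun s ω => l ω * stepProc t (X t) (fun ω => -riskAt ρ (t + 1) X ω) s ω +
        (1 - l ω) * stepProc t (Y t) (fun ω => -riskAt ρ (t + 1) Y ω) s ω) =
        stepProc t (fun ω => l ω * X t ω + (1 - l ω) * Y t ω) (fun ω =>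
          l ω * -riskAt ρ (t + 1) X ω + (1 - l ω) * -riskAt ρ (t + 1) Y ω) := by
      funext s ω
      rcases lt_trichotomy s (t : ℕ∞) with h | rfl | h
      · simp [stepProc_of_lt _ _ h]
      · simp [stepProc_self]
      · simp [stepProc_of_gt _ _ h]
    have h6 := hr.monotone _ (stepProc_mem_from
      (hl.lin_comb (memLinf_of_mem hX.1 ht0) (memLinf_of_mem hY.1 ht0))
      ((hl.mono hle).lin_comb (memLinf_riskAt hr' hX.1).neg (memLinf_riskAt hr' hY.1).neg))
      _ h4 fun s _ => stepProc_ae_le (ae_of_all _ fun ω => le_rfl) (by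
        filter_upwards [h2] with ω hω
        linarith) s
    rw [h5] at h3
    filter_upwards [h3, h6] with ω e3 e6
    exact e6.trans e3
  · have h0 : ∀ᵐ ω ∂P, riskAt ρ (t + 1) 0 ω = 0 := by
      have h3 : proj ((t + 1 : ℕ) : ℕ∞) ⊤ (0 : ℕ∞ → Ω → ℝ) = 0 := by
        funext s ω; simp [proj_top]
      filter_upwards [hr'.normalized] with ω hω
      rw [riskAt, h3, hω]
    have h1 := hr.congr (hmem 0 zero_mem_bddProcess) zero_mem_bddProcessFrom (fun s _ => by
      filter_upwards [h0] with ω hω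
      rcases lt_trichotomy s (t : ℕ∞) with h | rfl | h
      · simp [stepProc_of_lt _ _ h]
      · simp [stepProc_self]
      · simp [stepProc_of_gt _ _ h, hω])
    filter_upwards [h1, hr.normalized] with ω e1 e2
    exact e1.trans e2

/-- As X^n decreases, −ρ_{t+1}(X^n) decreases to −ρ_{t+1}(X), so the step processes decrease as well
and continuity of ρ_t applies. -/
theorem isContinuousFromAbove_composed (h𝕋 : IsTimeSet 𝕋) (ht : ((t + 1 : ℕ) : ℕ∞) ∈ 𝕋)
    (hr' : IsCondConvexRiskMeasure P 𝕋 ℱ (t + 1) (ρ (t + 1)))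
    (hc : IsContinuousFromAbove P 𝕋 ℱ ρ t) (hc' : IsContinuousFromAbove P 𝕋 ℱ ρ (t + 1)) :
    IsContinuousFromAbove P 𝕋 ℱ (fun _ => composed ρ t) t := by
  have ht0 := h𝕋.mem_of_succ ht
  intro Xn X hXn hX hlim
  have h1 := hc' Xn X hXn hX fun s hs hst =>
    hlim s hs (le_trans (by exact_mod_cast Nat.le_succ t) hst)
  have h2 := hc _ _ (fun n => (stepProc_risk_mem h𝕋 ht hr' (hXn n)).1)
    (stepProc_risk_mem h𝕋 ht hr' hX).1 (fun s _ hst => by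
      filter_upwards [h1, hlim t ht0 le_rfl] with ω e1 e2
      rcases hst.eq_or_lt with rfl | h
      · simpa only [stepProc_self] using e2
      · simp only [stepProc_of_gt _ _ h]
        exact ⟨fun a b hab => neg_le_neg (e1.1 hab), e1.2.neg⟩)
  simp only [riskAt, proj_stepProc, composed_proj] at h2 ⊢
  exact h2

/-- If Y is constant from t + 1 on and ρ_{t+1}(Z) ≤ 0, cash invariance gives −ρ_{t+1}(Y + Z) =
Y_{t+1} − ρ_{t+1}(Z) ≥ Y_{t+1}, so the composed risk of Y + Z is at most ρ_t(Y). Conversely, X is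
the sum of its step process and a remainder that starts at t + 1 with risk zero. -/
theorem acceptanceStep_add_acceptance (h𝕋 : IsTimeSet 𝕋) (ht : ((t + 1 : ℕ) : ℕ∞) ∈ 𝕋)
    (hr : IsCondConvexRiskMeasure P 𝕋 ℱ t (ρ t))
    (hr' : IsCondConvexRiskMeasure P 𝕋 ℱ (t + 1) (ρ (t + 1))) :
    acceptanceStep P 𝕋 ℱ ρ t + acceptance P 𝕋 ℱ ρ (t + 1) =
      acceptedBy P 𝕋 ℱ t (composed ρ t) := by
  have ht0 := h𝕋.mem_of_succ ht
  have hlt : (t : ℕ∞) < ((t + 1 : ℕ) : ℕ∞) := by exact_mod_cast Nat.lt_succ_self t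
  ext X
  constructor
  · rintro ⟨Y, hY, Z, hZ, rfl⟩
    have hYf := bddProcessBetween_subset_from _ _ hY.1
    have hZb := mem_bddProcessFrom_iff.1 hZ.1
    have hYZ : Y + Z ∈ BddProcessFrom P 𝕋 ℱ t := by
      refine add_mem_bddProcessFrom hYf (mem_bddProcessFrom_iff.2 ⟨hZb.1, fun s hs hst => ?_⟩)
      exact hZb.2 s hs (hst.trans hlt)
    have hV := memLinf_of_mem hY.1.1 ht
    have h1 := riskAt_add_cash hr' hZ.1.1 hV le_rfl
    have h2 := riskAt_congr hr' hYZ.1 (add_cash_mem_bddProcessFrom hZ.1 hV).1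
      (fun s hs hst => by
        filter_upwards [between_ae_eq hY.1 s hs hst] with ω hω
        rw [if_pos hst, ← hω, add_comm]
        rfl)
    refine ⟨hYZ, ?_⟩
    have h3 := hr.monotone Y hYf _
      (bddProcessBetween_subset_from _ _ (stepProc_risk_mem h𝕋 ht hr' hYZ.1)) (fun s hs => by
        rcases lt_trichotomy s (t : ℕ∞) with h | rfl | h
        · filter_upwards [(mem_bddProcessFrom_iff.1 hYf).2 s hs h] with ω hω
          simp [stepProc_of_lt _ _ h, hω]
        · filter_upwards [hZb.2 t hs hlt] with ω hω
          simp [stepProc_self, hω]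
        · filter_upwards [h1, h2, between_ae_eq hY.1 s hs (succ_le_iff_lt.2 h),
            riskAt_eq hr' hZ.1, hZ.2] with ω e1 e2 e3 e4 e5
          rw [stepProc_of_gt _ _ h, e2, e1, e3, e4]
          linarith)
    filter_upwards [h3, hY.2] with ω e1 e2 using e1.trans e2
  · rintro ⟨hX, hXr⟩
    have hY := stepProc_risk_mem h𝕋 ht hr' hX.1
    set Y := stepProc t (X t) (fun ω => -riskAt ρ (t + 1) X ω) with hYdef
    have hXb := mem_bddProcessFrom_iff.1 hX
    have hnegY : (fun s ω => -Y s ω) ∈ BddProcess P 𝕋 ℱ :=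
      ⟨fun s hs => (hY.1.1 s hs).neg, hY.1.2.imp fun C hC => by simpa using hC⟩
    have hZ : X + (fun s ω => -Y s ω) ∈ BddProcess P 𝕋 ℱ := add_mem_bddProcess hX.1 hnegY
    have hZf : X + (fun s ω => -Y s ω) ∈ BddProcessFrom P 𝕋 ℱ ((t + 1 : ℕ) : ℕ∞) := by
      refine mem_bddProcessFrom_iff.2 ⟨hZ, fun s hs hst => ?_⟩
      rcases lt_trichotomy s (t : ℕ∞) with h | rfl | h
      · filter_upwards [hXb.2 s hs h] with ω hω
        simp [hYdef, stepProc_of_lt _ _ h, hω]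
      · exact ae_of_all _ fun ω => by simp [hYdef, stepProc_self]
      · exact absurd (succ_le_iff_lt.2 h) (not_le.2 hst)
    refine ⟨Y, ⟨hY, hXr⟩, X + (fun s ω => -Y s ω), ⟨hZf, ?_⟩, ?_⟩
    · have h1 := riskAt_add_cash hr' hX.1 (memLinf_riskAt hr' hX.1) le_rfl
      have h2 := riskAt_congr hr' hZ (add_mem_bddProcess hX.1
        (cash_mem_bddProcess (𝕋 := 𝕋) (memLinf_riskAt hr' hX.1)))
        (fun s hs hst => ae_of_all _ fun ω => by
          simp only [hYdef, Pi.add_apply, stepProc_of_gt _ _ (succ_le_iff_lt.1 hst), if_pos hst,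
            neg_neg])
      filter_upwards [h1, h2, riskAt_eq hr' hZf] with ω e1 e2 e3
      rw [← e3, e2]
      exact (e1.trans (sub_self _)).le
    · funext s ω
      simp

/-- The step process of X shares with X the value at t and the risk at t + 1; time consistency in
both directions therefore equates their risks at t. Conversely, the composed risk depends on X
through X_t and ρ_{t+1}(X) only, and monotonically on the latter. -/
theorem isTimeConsistent_iff (h𝕋 : IsTimeSet 𝕋) (hρ : IsDynamicConvexRiskMeasure P 𝕋 ℱ ρ) :
    IsTimeConsistent P 𝕋 ℱ ρ ↔ ∀ t : ℕ, ((t + 1 : ℕ) : ℕ∞) ∈ 𝕋 → ∀ X ∈ BddProcessFrom P 𝕋 ℱ t,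
      ∀ᵐ ω ∂P, ρ t X ω = composed ρ t X ω := by
  constructor
  · intro h t ht X hX
    have hr := hρ t (h𝕋.mem_of_succ ht)
    have hr' := hρ (t + 1) ht
    have hY := stepProc_risk_mem h𝕋 ht hr' hX.1
    have h1 := riskAt_cash hr' (memLinf_riskAt hr' hX.1).neg hY.1 (fun s hs hst => by
      rw [stepProc_of_gt _ _ (succ_le_iff_lt.1 hst)])
    have h2 : X t = stepProc t (X t) (fun ω => -riskAt ρ (t + 1) X ω) t := (stepProc_self _ _).symm
    have h3 := h t ht X hX.1 _ hY.1 (ae_of_all _ fun ω => congrFun h2 ω) (by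
      filter_upwards [h1] with ω hω
      rw [hω, neg_neg])
    have h4 := h t ht _ hY.1 X hX.1 (ae_of_all _ fun ω => congrFun h2.symm ω) (by
      filter_upwards [h1] with ω hω
      rw [hω, neg_neg])
    filter_upwards [h3, h4, riskAt_eq hr hX,
      riskAt_eq hr (bddProcessBetween_subset_from _ _ hY)] with ω e1 e2 e3 e4
    rw [e3, e4] at e1
    rw [e3, e4] at e2
    exact le_antisymm e1 e2
  · intro h t ht X hX Y hY hXY hXY'
    have hr := hρ t (h𝕋.mem_of_succ ht)
    have hr' := hρ (t + 1) ht
    have h1 := hr.monotone _ (bddProcessBetween_subset_from _ _ (stepProc_risk_mem h𝕋 ht hr' hY))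
      _ (bddProcessBetween_subset_from _ _ (stepProc_risk_mem h𝕋 ht hr' hX))
      fun s _ => stepProc_ae_le (hXY.mono fun ω e => e.symm.le) (by
        filter_upwards [hXY'] with ω hω
        exact neg_le_neg hω) s
    filter_upwards [h1, h t ht _ (proj_top_mem_from hX t), h t ht _ (proj_top_mem_from hY t)]
      with ω e1 e2 e3
    rw [riskAt, riskAt, e2, e3, composed_proj, composed_proj]
    exact e1

/-- The sum of the two sets is the acceptance set of `composed ρ t`, and acceptance sets determine
risk measures. -/
theorem acceptanceSplitting_iff (h𝕋 : IsTimeSet 𝕋) (hρ : IsDynamicConvexRiskMeasure P 𝕋 ℱ ρ) :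
    AcceptanceSplitting P 𝕋 ℱ ρ ↔
      ∀ t : ℕ, ((t + 1 : ℕ) : ℕ∞) ∈ 𝕋 → ∀ X ∈ BddProcessFrom P 𝕋 ℱ t,
        ∀ᵐ ω ∂P, ρ t X ω = composed ρ t X ω := by
  refine forall₂_congr fun t ht => ?_
  have hr := hρ t (h𝕋.mem_of_succ ht)
  have hr' := hρ (t + 1) ht
  have hrc := isCondConvexRiskMeasure_composed h𝕋 ht hr hr'
  rw [acceptanceStep_add_acceptance h𝕋 ht hr hr']
  constructor
  · intro h X hX
    filter_upwards [hr.le_of_subset hrc h.le hX, hrc.le_of_subset hr h.ge hX] with ω h1 h2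
    exact le_antisymm h2 h1
  · intro h
    ext X
    refine and_congr_right fun hX => ?_
    constructor <;> intro h1 <;> filter_upwards [h1, h X hX] with ω e1 e2
    · rwa [← e2]
    · rwa [e2]

end Composed

/-! ### Separation of a position from the acceptance set -/

section Separate

variable {Ω : Type*} [mΩ : MeasurableSpace Ω] {P : Measure Ω} {𝕋 : Set ℕ∞}
  {ℱ : Filtration ℕ mΩ} {μ : ℕ∞ → Ω → ℝ} {t : ℕ} {r : (ℕ∞ → Ω → ℝ) → Ω → ℝ}
  {Qs : Measure (OptionalSpace 𝕋 ℱ)}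

open Classical in
/-- A function on the product space regarded as a process. -/
noncomputable def toProcess (f : OptionalSpace 𝕋 ℱ → ℝ) : ℕ∞ → Ω → ℝ :=
  fun t ω => if ht : t ∈ 𝕋 then f ⟨ω, ⟨t, ht⟩⟩ else 0

theorem toProcess_apply (f : OptionalSpace 𝕋 ℱ → ℝ) {s : ℕ∞} (hs : s ∈ 𝕋) (ω : Ω) :
    toProcess f s ω = f ⟨ω, ⟨s, hs⟩⟩ := by
  simp [toProcess, hs]

theorem toProcess_mem (hμ : IsReferenceProcess P 𝕋 ℱ μ) {f : OptionalSpace 𝕋 ℱ → ℝ}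
    (hf : Measurable f) {C : ℝ} (hC : ∀ᵐ p ∂(refMeasure P 𝕋 ℱ μ), |f p| ≤ C) :
    toProcess f ∈ BddProcess P 𝕋 ℱ := by
  refine ⟨fun s hs => ?_, C, fun s hs => ?_⟩
  · have : toProcess f s = fun ω => f ⟨ω, ⟨s, hs⟩⟩ := funext fun ω => toProcess_apply f hs ω
    rw [this]
    exact measurable_optional_iff.1 hf ⟨s, hs⟩
  · filter_upwards [(hμ.ae_refMeasure_iff (measurableSet_le hf.abs measurable_const)).1 hC ⟨s, hs⟩]
      with ω hω
    rw [toProcess_apply f hs]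
    exact hω

/-- The function `V` on the part of the product space from time `t` on. -/
noncomputable def onTail (𝕋 : Set ℕ∞) (ℱ : Filtration ℕ mΩ) (t : ℕ) (V : Ω → ℝ)
    (p : OptionalSpace 𝕋 ℱ) : ℝ :=
  onOptional 𝕋 ℱ (fun (s : ℕ∞) ω => if (t : ℕ∞) ≤ s then V ω else 0) p

theorem onTail_apply (V : Ω → ℝ) (p : OptionalSpace 𝕋 ℱ) :
    onTail 𝕋 ℱ t V p = if (t : ℕ∞) ≤ p.time then V p.state else 0 := rfl

theorem measurable_onTail {V : Ω → ℝ} (hV : MemLinf P (ℱ t) V) :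
    Measurable (onTail 𝕋 ℱ t V) :=
  measurable_onOptional (cash_mem_bddProcess hV)

theorem ae_refMeasure_of_ae (hμ : IsReferenceProcess P 𝕋 ℱ μ) {q : Ω → Prop}
    (hq : MeasurableSet[ℱ t] {ω | q ω}) (h : ∀ᵐ ω ∂P, q ω) :
    ∀ᵐ p ∂(refMeasure P 𝕋 ℱ μ), (t : ℕ∞) ≤ p.time → q p.state := by
  have hm : MeasurableSet {p : OptionalSpace 𝕋 ℱ | (t : ℕ∞) ≤ p.time → q p.state} := by
    refine measurableSet_optional_iff.2 fun s => ?_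
    by_cases hst : (t : ℕ∞) ≤ s
    · simpa [hst] using sigmaAt_mono ℱ hst _ hq
    · simp [hst]
  exact (hμ.ae_refMeasure_iff hm).2 fun s => h.mono fun ω hω _ => hω

theorem ae_of_ae_refMeasure_time (hμ : IsReferenceProcess P 𝕋 ℱ μ) (ht : (t : ℕ∞) ∈ 𝕋) {q : Ω → Prop}
    (hq : MeasurableSet[ℱ t] {ω | q ω})
    (h : ∀ᵐ p ∂(refMeasure P 𝕋 ℱ μ), (t : ℕ∞) ≤ p.time → q p.state) : ∀ᵐ ω ∂P, q ω := by
  have hm : MeasurableSet {p : OptionalSpace 𝕋 ℱ | (t : ℕ∞) ≤ p.time → q p.state} := by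
    refine measurableSet_optional_iff.2 fun s => ?_
    by_cases hst : (t : ℕ∞) ≤ s
    · simpa [hst] using sigmaAt_mono ℱ hst _ hq
    · simp [hst]
  filter_upwards [(hμ.ae_refMeasure_iff hm).1 h ⟨t, ht⟩] with ω hω
  exact hω le_rfl

theorem integrable_onTail (hμ : IsReferenceProcess P 𝕋 ℱ μ) [IsFiniteMeasure Qs]
    (hQs : Qs ≪ refMeasure P 𝕋 ℱ μ) {V : Ω → ℝ} (hV : MemLinf P (ℱ t) V) :
    Integrable (onTail 𝕋 ℱ t V) Qs :=
  integrable_onOptional hμ hQs (cash_mem_bddProcess hV)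

theorem integral_onTail_mono (hμ : IsReferenceProcess P 𝕋 ℱ μ) [IsFiniteMeasure Qs]
    (hQs : Qs ≪ refMeasure P 𝕋 ℱ μ) {U V : Ω → ℝ} (hU : MemLinf P (ℱ t) U)
    (hV : MemLinf P (ℱ t) V) (h : ∀ᵐ ω ∂P, U ω ≤ V ω) :
    ∫ p, onTail 𝕋 ℱ t U p ∂Qs ≤ ∫ p, onTail 𝕋 ℱ t V p ∂Qs := by
  refine integral_mono_ae (integrable_onTail hμ hQs hU) (integrable_onTail hμ hQs hV) ?_
  filter_upwards [hQs.ae_le (ae_refMeasure_of_ae hμ (measurableSet_le hU.1 hV.1) h)] with p hp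
  rw [onTail_apply, onTail_apply]
  split_ifs with hc
  exacts [hp hc, le_rfl]

/-- Fatou property of the integrated risk measure: lower semicontinuity along bounded sequences
converging almost everywhere. -/
theorem integral_riskAt_le_of_tendsto (hμ : IsReferenceProcess P 𝕋 ℱ μ)
    (hr : IsCondConvexRiskMeasure P 𝕋 ℱ t r)
    (hc : IsContinuousFromAbove P 𝕋 ℱ (fun _ => r) t) [IsFiniteMeasure Qs]
    (hQs : Qs ≪ refMeasure P 𝕋 ℱ μ) {f : ℕ → OptionalSpace 𝕋 ℱ → ℝ} {g : OptionalSpace 𝕋 ℱ → ℝ}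
    (hf : ∀ n, Measurable (f n)) (hg : Measurable g) {C : ℝ}
    (hC : ∀ n, ∀ᵐ p ∂(refMeasure P 𝕋 ℱ μ), |f n p| ≤ C)
    (hlim : ∀ᵐ p ∂(refMeasure P 𝕋 ℱ μ), Tendsto (fun n => f n p) atTop (𝓝 (g p)))
    (hle : ∀ n, ∫ p, onTail 𝕋 ℱ t (riskAt (fun _ => r) t (toProcess (f n))) p ∂Qs ≤ 0) :
    ∫ p, onTail 𝕋 ℱ t (riskAt (fun _ => r) t (toProcess g)) p ∂Qs ≤ 0 := by
  have hgC : ∀ᵐ p ∂(refMeasure P 𝕋 ℱ μ), |g p| ≤ C := by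
    filter_upwards [hlim, ae_all_iff.2 hC] with p h1 h2
    exact le_of_tendsto' h1.abs h2
  -- The suprema of the later terms decrease to g, so continuity from above applies to them; as they
  -- dominate `f n`, their risks inherit the bound. Truncation at ±C makes the suprema finite at
  -- every point.
  set f' : ℕ → OptionalSpace 𝕋 ℱ → ℝ := fun n p => max (-C) (min C (f n p)) with hf'
  set h : ℕ → OptionalSpace 𝕋 ℱ → ℝ := fun n p => ⨆ k, f' (n + k) p with hh
  have hf'm : ∀ n, Measurable (f' n) := fun n =>
    measurable_const.max (measurable_const.min (hf n))
  have hhm : ∀ n, Measurable (h n) := fun n => Measurable.iSup fun k => hf'm (n + k)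
  have hub : ∀ n p, f' n p ≤ max (-C) C := fun n p => max_le_max le_rfl (min_le_left _ _)
  have hlb : ∀ n p, -C ≤ f' n p := fun n p => le_max_left _ _
  have hbdd : ∀ n p, BddAbove (Set.range fun k => f' (n + k) p) := fun n p =>
    ⟨max (-C) C, by rintro _ ⟨k, rfl⟩; exact hub _ _⟩
  have hanti : ∀ p, Antitone fun n => h n p := fun p => antitone_nat_of_succ_le fun n => by
    refine ciSup_le fun k => ?_
    have : n + 1 + k = n + (k + 1) := by omega
    rw [this]
    exact le_ciSup (hbdd n p) (k + 1)
  have hfh : ∀ n p, f' n p ≤ h n p := fun n p => le_ciSup (hbdd n p) 0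
  have hhb : ∀ n p, |h n p| ≤ |C| := fun n p => by
    refine abs_le.2 ⟨?_, ciSup_le fun k => (hub _ p).trans (max_le (neg_le_abs C) (le_abs_self C))⟩
    exact (neg_le_neg (le_abs_self C)).trans ((hlb n p).trans (hfh n p))
  have hff' : ∀ᵐ p ∂(refMeasure P 𝕋 ℱ μ), ∀ n, f' n p = f n p := by
    filter_upwards [ae_all_iff.2 hC] with p hp n
    obtain ⟨h1, h2⟩ := abs_le.1 (hp n)
    rw [hf']
    simp only
    rw [min_eq_right h2, max_eq_right h1]
  have hhlim : ∀ᵐ p ∂(refMeasure P 𝕋 ℱ μ), Tendsto (fun n => h n p) atTop (𝓝 (g p)) := by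
    filter_upwards [hlim, hff'] with p h1 h2
    refine tendsto_order.2 ⟨fun a ha => ?_, fun a ha => ?_⟩
    · filter_upwards [(tendsto_order.1 h1).1 a ha] with n hn
      exact hn.trans_le ((h2 n).ge.trans (hfh n p))
    · obtain ⟨a', ha', ha''⟩ := exists_between ha
      obtain ⟨N, hN⟩ := eventually_atTop.1 ((tendsto_order.1 h1).2 a' ha')
      filter_upwards [eventually_ge_atTop N] with n hn
      refine lt_of_le_of_lt (ciSup_le fun k => ?_) ha''
      rw [h2]
      exact (hN _ (by omega)).le
  have hfmem : ∀ n, toProcess (f n) ∈ BddProcess P 𝕋 ℱ := fun n => toProcess_mem hμ (hf n) (hC n)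
  have hhmem : ∀ n, toProcess (h n) ∈ BddProcess P 𝕋 ℱ := fun n =>
    toProcess_mem hμ (hhm n) (ae_of_all _ (hhb n))
  have hgmem : toProcess g ∈ BddProcess P 𝕋 ℱ := toProcess_mem hμ hg hgC
  have hr' : IsCondConvexRiskMeasure P 𝕋 ℱ t ((fun _ => r : ℕ → (ℕ∞ → Ω → ℝ) → Ω → ℝ) t) := hr
  have hMem : ∀ X ∈ BddProcess P 𝕋 ℱ, MemLinf P (ℱ t) (riskAt (fun _ => r) t X) := fun X hX =>
    memLinf_riskAt hr' hX
  have hconv := hc (fun n => toProcess (h n)) (toProcess g) hhmem hgmem (fun s hs _ => by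
    have hm : MeasurableSet {p | Tendsto (fun n => h n p) atTop (𝓝 (g p))} :=
      measurableSet_tendsto_fun hhm hg
    filter_upwards [(hμ.ae_refMeasure_iff hm).1 hhlim ⟨s, hs⟩] with ω hω
    simp only [toProcess_apply _ hs]
    exact ⟨hanti _, hω⟩)
  have hle' : ∀ n, ∫ p, onTail 𝕋 ℱ t (riskAt (fun _ => r) t (toProcess (h n))) p ∂Qs ≤ 0 := by
    intro n
    refine (integral_onTail_mono hμ hQs (hMem _ (hhmem n)) (hMem _ (hfmem n)) ?_).trans (hle n)
    refine riskAt_mono hr' (hfmem n) (hhmem n) fun s hs _ => ?_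
    have hm : MeasurableSet {p | f n p ≤ h n p} := measurableSet_le (hf n) (hhm n)
    have hae : ∀ᵐ p ∂(refMeasure P 𝕋 ℱ μ), f n p ≤ h n p := by
      filter_upwards [hff'] with p hp
      rw [← hp n]
      exact hfh n p
    filter_upwards [(hμ.ae_refMeasure_iff hm).1 hae ⟨s, hs⟩] with ω hω
    simpa only [toProcess_apply _ hs] using hω
  have hmono : Measurable[ℱ t] (riskAt (fun _ => r) t (toProcess g)) := (hMem _ hgmem).1
  obtain ⟨K₀, hK₀⟩ := (hMem _ (hhmem 0)).2
  obtain ⟨K, hK⟩ := (hMem _ hgmem).2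
  have hbound : ∀ᵐ ω ∂P, (∀ n, |riskAt (fun _ => r) t (toProcess (h n)) ω| ≤ max K₀ K) ∧
      Tendsto (fun n => riskAt (fun _ => r) t (toProcess (h n)) ω) atTop
        (𝓝 (riskAt (fun _ => r) t (toProcess g) ω)) := by
    filter_upwards [hconv, hK₀, hK] with ω h1 h2 h3
    refine ⟨fun n => abs_le.2 ⟨?_, ?_⟩, h1.2⟩
    · have : riskAt (fun _ => r) t (toProcess (h 0)) ω ≤ riskAt (fun _ => r) t (toProcess (h n)) ω :=
        h1.1 (Nat.zero_le n)
      have h4 := (abs_le.1 h2).1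
      have h5 := le_max_left K₀ K
      linarith
    · have : riskAt (fun _ => r) t (toProcess (h n)) ω ≤ riskAt (fun _ => r) t (toProcess g) ω :=
        h1.1.ge_of_tendsto h1.2 n
      have h4 := (abs_le.1 h3).2
      have h5 := le_max_right K₀ K
      linarith
  have hbm : MeasurableSet[ℱ t] {ω | (∀ n, |riskAt (fun _ => r) t (toProcess (h n)) ω| ≤ max K₀ K) ∧
      Tendsto (fun n => riskAt (fun _ => r) t (toProcess (h n)) ω) atTop
        (𝓝 (riskAt (fun _ => r) t (toProcess g) ω))} := by
    refine MeasurableSet.inter ?_ ?_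
    · have : {ω | ∀ n, |riskAt (fun _ => r) t (toProcess (h n)) ω| ≤ max K₀ K} =
          ⋂ n, {ω | |riskAt (fun _ => r) t (toProcess (h n)) ω| ≤ max K₀ K} := by
        ext ω; simp
      change MeasurableSet[ℱ t] {ω | ∀ n, |riskAt (fun _ => r) t (toProcess (h n)) ω| ≤ max K₀ K}
      rw [this]
      exact MeasurableSet.iInter fun n =>
        (measurable_abs.comp (hMem _ (hhmem n)).1) measurableSet_Iic
    · exact @measurableSet_tendsto_fun _ _ _ (ℱ t) _ _ _ _ _ _ _ _ _
        (fun n => (hMem _ (hhmem n)).1) _ hmono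
  have hbae := hQs.ae_le (ae_refMeasure_of_ae hμ hbm hbound)
  have htend : Tendsto (fun n => ∫ p, onTail 𝕋 ℱ t (riskAt (fun _ => r) t (toProcess (h n))) p ∂Qs)
      atTop (𝓝 (∫ p, onTail 𝕋 ℱ t (riskAt (fun _ => r) t (toProcess g)) p ∂Qs)) := by
    refine tendsto_integral_of_dominated_convergence (fun _ => |max K₀ K|)
      (fun n => (measurable_onTail (hMem _ (hhmem n))).aestronglyMeasurable) (integrable_const _)
      (fun n => ?_) ?_
    · filter_upwards [hbae] with p hp
      rw [onTail_apply]
      split_ifs with hc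
      · exact ((hp hc).1 n).trans (le_abs_self _)
      · simp
    · filter_upwards [hbae] with p hp
      simp only [onTail_apply]
      split_ifs with hc
      · exact (hp hc).2
      · exact tendsto_const_nhds
  exact le_of_tendsto' htend hle'

end Separate

/-! ### A separating measure for the integrated risk measure -/

section Separate

variable {Ω : Type*} [mΩ : MeasurableSpace Ω] {P : Measure Ω} {𝕋 : Set ℕ∞}
  {ℱ : Filtration ℕ mΩ} {μ : ℕ∞ → Ω → ℝ} {t : ℕ} {r : (ℕ∞ → Ω → ℝ) → Ω → ℝ}
  {Qs : Measure (OptionalSpace 𝕋 ℱ)}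

theorem onOptional_mem_congr (hμ : IsReferenceProcess P 𝕋 ℱ μ) {X : ℕ∞ → Ω → ℝ}
    (hX : X ∈ BddProcess P 𝕋 ℱ) : toProcess (onOptional 𝕋 ℱ X) ∈ BddProcess P 𝕋 ℱ := by
  obtain ⟨C, hC⟩ := ae_bdd_onOptional hμ hX
  exact toProcess_mem hμ (measurable_onOptional hX) hC

/-- An affine function bounded below on ℝ has slope zero. Thus a separating measure annihilates
every direction whose real multiples are all acceptable. -/
theorem eq_zero_of_forall_one_le {a c : ℝ} (h : ∀ k : ℝ, 1 ≤ k * a + c) : a = 0 := by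
  by_contra ha
  have := h (-c / a)
  rw [div_mul_cancel₀ _ ha] at this
  linarith

/-- The integrated risk measure. -/
noncomputable def integratedRisk (Qs : Measure (OptionalSpace 𝕋 ℱ)) (t : ℕ)
    (r : (ℕ∞ → Ω → ℝ) → Ω → ℝ) (f : OptionalSpace 𝕋 ℱ → ℝ) : ℝ :=
  ∫ p, onTail 𝕋 ℱ t (riskAt (fun _ => r) t (toProcess f)) p ∂Qs

theorem onTail_add (U V : Ω → ℝ) (p : OptionalSpace 𝕋 ℱ) :
    onTail 𝕋 ℱ t (fun ω => U ω + V ω) p = onTail 𝕋 ℱ t U p + onTail 𝕋 ℱ t V p := by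
  simp only [onTail_apply]
  split_ifs <;> simp

theorem onTail_mul (a : ℝ) (V : Ω → ℝ) (p : OptionalSpace 𝕋 ℱ) :
    onTail 𝕋 ℱ t (fun ω => a * V ω) p = a * onTail 𝕋 ℱ t V p := by
  simp only [onTail_apply]
  split_ifs <;> simp

theorem MemLinf.const {Ω : Type*} {m mΩ : MeasurableSpace Ω} (P : Measure Ω) (a : ℝ) :
    MemLinf P m (fun _ => a) :=
  ⟨measurable_const, |a|, ae_of_all _ fun _ => le_rfl⟩

theorem MemLinf.const_mul {Ω : Type*} {m mΩ : MeasurableSpace Ω} {P : Measure Ω} {V : Ω → ℝ}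
    (hV : MemLinf P m V) (a : ℝ) : MemLinf P m (fun ω => a * V ω) := by
  obtain ⟨h, C, hC⟩ := hV
  refine ⟨h.const_mul a, |a| * C, hC.mono fun ω hω => ?_⟩
  rw [abs_mul]
  exact mul_le_mul_of_nonneg_left hω (abs_nonneg a)

theorem MemLinf.add {Ω : Type*} {m mΩ : MeasurableSpace Ω} {P : Measure Ω} {U V : Ω → ℝ}
    (hU : MemLinf P m U) (hV : MemLinf P m V) : MemLinf P m (fun ω => U ω + V ω) := by
  obtain ⟨h, C, hC⟩ := hU
  obtain ⟨h', C', hC'⟩ := hV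
  refine ⟨h.add h', C + C', ?_⟩
  filter_upwards [hC, hC'] with ω h1 h2
  exact (abs_add_le _ _).trans (add_le_add h1 h2)

theorem integratedRisk_mono (hμ : IsReferenceProcess P 𝕋 ℱ μ)
    (hr : IsCondConvexRiskMeasure P 𝕋 ℱ t r) [IsFiniteMeasure Qs] (hQs : Qs ≪ refMeasure P 𝕋 ℱ μ)
    {f g : OptionalSpace 𝕋 ℱ → ℝ} (hf : toProcess f ∈ BddProcess P 𝕋 ℱ)
    (hg : toProcess g ∈ BddProcess P 𝕋 ℱ) (hfm : Measurable f) (hgm : Measurable g)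
    (hfg : ∀ᵐ p ∂(refMeasure P 𝕋 ℱ μ), f p ≤ g p) :
    integratedRisk Qs t r g ≤ integratedRisk Qs t r f := by
  have hr' : IsCondConvexRiskMeasure P 𝕋 ℱ t ((fun _ => r : ℕ → (ℕ∞ → Ω → ℝ) → Ω → ℝ) t) := hr
  refine integral_onTail_mono hμ hQs (memLinf_riskAt (ρ := fun _ => r) hr' hg) (memLinf_riskAt (ρ := fun _ => r) hr' hf)
    (riskAt_mono (ρ := fun _ => r) hr' hf hg fun s hs _ => ?_)
  filter_upwards [(hμ.ae_refMeasure_iff (measurableSet_le hfm hgm)).1 hfg ⟨s, hs⟩] with ω hω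
  rwa [toProcess_apply _ hs, toProcess_apply _ hs]

theorem integratedRisk_convex (hμ : IsReferenceProcess P 𝕋 ℱ μ)
    (hr : IsCondConvexRiskMeasure P 𝕋 ℱ t r) [IsFiniteMeasure Qs] (hQs : Qs ≪ refMeasure P 𝕋 ℱ μ)
    {f g : OptionalSpace 𝕋 ℱ → ℝ} (hf : toProcess f ∈ BddProcess P 𝕋 ℱ)
    (hg : toProcess g ∈ BddProcess P 𝕋 ℱ) {a b : ℝ} (ha : 0 ≤ a) (hb : 0 ≤ b) (hab : a + b = 1) :
    integratedRisk Qs t r (a • f + b • g) ≤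
      a * integratedRisk Qs t r f + b * integratedRisk Qs t r g := by
  have hr' : IsCondConvexRiskMeasure P 𝕋 ℱ t ((fun _ => r : ℕ → (ℕ∞ → Ω → ℝ) → Ω → ℝ) t) := hr
  obtain ⟨hm, hle⟩ := riskAt_convex (ρ := fun _ => r) hr' hf hg (MemLinf.const P a)
    (ae_of_all _ fun _ => ⟨ha, by linarith⟩)
  have hb' : 1 - a = b := by linarith
  rw [hb'] at hle hm
  have heq : toProcess (a • f + b • g) =
      fun s ω => a * toProcess f s ω + b * toProcess g s ω := by
    funext s ω
    unfold toProcess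
    split_ifs
    · simp
    · simp
  have hF := memLinf_riskAt (ρ := fun _ => r) hr' hf
  have hG := memLinf_riskAt (ρ := fun _ => r) hr' hg
  unfold integratedRisk
  rw [heq, ← integral_const_mul, ← integral_const_mul,
    ← integral_add ((integrable_onTail hμ hQs hF).const_mul a)
      ((integrable_onTail hμ hQs hG).const_mul b)]
  simp only [← onTail_mul, ← onTail_add]
  refine integral_onTail_mono hμ hQs hm ((hF.const_mul a).add (hG.const_mul b)) hle

/-- Separation of a position with nonnegative, nonzero risk from the acceptance set of the
integrated risk measure. -/
theorem exists_measure_separating [IsProbabilityMeasure P] (hμ : IsReferenceProcess P 𝕋 ℱ μ)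
    (hr : IsCondConvexRiskMeasure P 𝕋 ℱ t r)
    (hc : IsContinuousFromAbove P 𝕋 ℱ (fun _ => r) t) (ht : (t : ℕ∞) ∈ 𝕋) [IsProbabilityMeasure Qs]
    (hQs : Qs ≪ refMeasure P 𝕋 ℱ μ) (hQs' : refMeasure P 𝕋 ℱ μ ≪ Qs) {Z : ℕ∞ → Ω → ℝ}
    (hZ : Z ∈ BddProcess P 𝕋 ℱ) (hZ0 : ∀ᵐ ω ∂P, 0 ≤ riskAt (fun _ => r) t Z ω)
    (hZpos : ¬ ∀ᵐ ω ∂P, riskAt (fun _ => r) t Z ω ≤ 0) :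
    ∃ ν : Measure (OptionalSpace 𝕋 ℱ), IsFiniteMeasure ν ∧ ν ≪ refMeasure P 𝕋 ℱ μ ∧
      ∀ Y ∈ BddProcess P 𝕋 ℱ, integratedRisk Qs t r (onOptional 𝕋 ℱ Y) ≤ 0 →
        1 ≤ ∫ p, onOptional 𝕋 ℱ Y p ∂ν - ∫ p, onOptional 𝕋 ℱ Z p ∂ν := by
  have hr' : IsCondConvexRiskMeasure P 𝕋 ℱ t ((fun _ => r : ℕ → (ℕ∞ → Ω → ℝ) → Ω → ℝ) t) := hr
  have := hμ.isProbabilityMeasure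
  set m₀ := refMeasure P 𝕋 ℱ μ with hm₀
  set z := onOptional 𝕋 ℱ Z with hz
  have hzm : Measurable z := measurable_onOptional hZ
  obtain ⟨Cz, hCz⟩ := ae_bdd_onOptional hμ hZ
  have hadd : ∀ {f g : OptionalSpace 𝕋 ℱ → ℝ}, (∃ C : ℝ, ∀ᵐ p ∂m₀, |f p| ≤ C) →
      (∃ C : ℝ, ∀ᵐ p ∂m₀, |g p| ≤ C) → ∃ C : ℝ, ∀ᵐ p ∂m₀, |(f + g) p| ≤ C := by
    rintro f g ⟨C, hC⟩ ⟨C', hC'⟩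
    refine ⟨C + C', ?_⟩
    filter_upwards [hC, hC'] with p h1 h2
    exact (abs_add_le _ _).trans (add_le_add h1 h2)
  have hmem : ∀ f : OptionalSpace 𝕋 ℱ → ℝ, Measurable f → (∃ C : ℝ, ∀ᵐ p ∂m₀, |f p| ≤ C) →
      toProcess (f + z) ∈ BddProcess P 𝕋 ℱ := fun f hf hb => by
    obtain ⟨C, hC⟩ := hadd hb ⟨Cz, hCz⟩
    exact toProcess_mem hμ (hf.add hzm) hC
  -- The acceptance set of the integrated risk, shifted by −z. It misses 0: otherwise the
  -- nonnegative risk of Z would have nonpositive Qs-integral and vanish P-a.s., by equivalence of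
  -- Qs and P ⊗ μ.
  set 𝒞 : Set (OptionalSpace 𝕋 ℱ → ℝ) :=
    {f | Measurable f ∧ (∃ C : ℝ, ∀ᵐ p ∂m₀, |f p| ≤ C) ∧ integratedRisk Qs t r (f + z) ≤ 0} with h𝒞
  have key : ∃ ν : Measure (OptionalSpace 𝕋 ℱ), IsFiniteMeasure ν ∧ ν ≪ m₀ ∧
      ∀ f ∈ 𝒞, 1 ≤ ∫ p, f p ∂ν := by
    refine exists_measure_one_le_integral (fun f hf => hf.1) (fun f hf => hf.2.1) ?_ ?_ ?_ ?_ ?_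
    · intro f hf g hg a b ha hb hab
      refine ⟨(hf.1.const_smul a).add (hg.1.const_smul b), ?_, ?_⟩
      · obtain ⟨C, hC⟩ := hf.2.1
        obtain ⟨C', hC'⟩ := hg.2.1
        refine hadd ⟨|a| * C, hC.mono fun p hp => ?_⟩ ⟨|b| * C', hC'.mono fun p hp => ?_⟩
        · simpa [abs_mul] using mul_le_mul_of_nonneg_left hp (abs_nonneg a)
        · simpa [abs_mul] using mul_le_mul_of_nonneg_left hp (abs_nonneg b)
      · have heq : a • f + b • g + z = a • (f + z) + b • (g + z) := by
          rw [smul_add, smul_add]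
          have : z = a • z + b • z := by rw [← add_smul, hab, one_smul]
          nth_rewrite 1 [this]
          abel
        rw [heq]
        refine (integratedRisk_convex hμ hr hQs (hmem f hf.1 hf.2.1) (hmem g hg.1 hg.2.1) ha hb
          hab).trans ?_
        have h1 := mul_nonpos_of_nonneg_of_nonpos ha hf.2.2
        have h2 := mul_nonpos_of_nonneg_of_nonpos hb hg.2.2
        linarith
    · intro f hf g hg hgb hfg
      refine ⟨hg, hgb, le_trans ?_ hf.2.2⟩
      refine integratedRisk_mono hμ hr hQs (hmem f hf.1 hf.2.1) (hmem g hg hgb) (hf.1.add hzm)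
        (hg.add hzm) (hfg.mono fun p hp => ?_)
      simpa using hp
    · intro f g C hf hC hg hlim
      refine ⟨hg, ⟨C, ?_⟩, ?_⟩
      · filter_upwards [hlim, ae_all_iff.2 hC] with p h1 h2
        exact le_of_tendsto' h1.abs h2
      · refine integral_riskAt_le_of_tendsto hμ hr hc hQs (f := fun n => f n + z) (C := C + Cz)
          (fun n => (hf n).1.add hzm) (hg.add hzm) (fun n => ?_) ?_ fun n => (hf n).2.2
        · filter_upwards [hC n, hCz] with p h1 h2
          exact (abs_add_le _ _).trans (add_le_add h1 h2)
        · filter_upwards [hlim] with p hp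
          exact hp.add_const _
    · refine ⟨-z, hzm.neg, ⟨Cz, by simpa only [Pi.neg_apply, abs_neg] using hCz⟩, ?_⟩
      rw [neg_add_cancel]
      refine (integral_onTail_mono hμ hQs (memLinf_riskAt (ρ := fun _ => r) hr' ?_) (MemLinf.const P 0) ?_).trans ?_
      · exact toProcess_mem hμ measurable_const (C := 0) (by simp)
      · filter_upwards [riskAt_cash (ρ := fun _ => r) hr' (MemLinf.const P 0)
          (toProcess_mem hμ (f := 0) measurable_const (C := 0) (by simp)) fun s hs _ => by
            filter_upwards with ω
            simp [toProcess_apply _ hs]] with ω hω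
        simp [hω]
      · simp [onTail_apply]
    · rintro ⟨-, -, h⟩
      rw [zero_add] at h
      refine hZpos ?_
      have hZ' := onOptional_mem_congr hμ hZ
      have heq : ∀ᵐ ω ∂P, riskAt (fun _ => r) t (toProcess z) ω = riskAt (fun _ => r) t Z ω :=
        riskAt_congr (ρ := fun _ => r) hr' hZ' hZ fun s hs _ => by
          filter_upwards with ω
          rw [toProcess_apply _ hs]
          rfl
      have hL := memLinf_riskAt (ρ := fun _ => r) hr' hZ'
      have hnn : 0 ≤ᵐ[Qs] onTail 𝕋 ℱ t (riskAt (fun _ => r) t (toProcess z)) := by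
        filter_upwards [hQs.ae_le (ae_refMeasure_of_ae hμ (t := t)
          (q := fun ω => 0 ≤ riskAt (fun _ => r) t (toProcess z) ω)
          (measurableSet_le measurable_const hL.1) (by
            filter_upwards [heq, hZ0] with ω h1 h2
            rwa [h1]))] with p hp
        rw [onTail_apply]
        split_ifs with hc
        exacts [hp hc, le_rfl]
      have h0 := (integral_eq_zero_iff_of_nonneg_ae hnn (integrable_onTail hμ hQs hL)).1
        (le_antisymm h (integral_nonneg_of_ae hnn))
      have := ae_of_ae_refMeasure_time hμ ht
        (q := fun ω => riskAt (fun _ => r) t (toProcess z) ω ≤ 0)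
        (measurableSet_le hL.1 measurable_const) (by
          filter_upwards [hQs'.ae_le h0] with p hp hpt
          rw [onTail_apply, if_pos hpt] at hp
          exact hp.le)
      filter_upwards [this, heq] with ω h1 h2
      rwa [← h2]
  obtain ⟨ν, hν, hνR, hsep⟩ := key
  refine ⟨ν, hν, hνR, fun Y hY hY0 => ?_⟩
  have h := hsep (onOptional 𝕋 ℱ Y - z) ⟨(measurable_onOptional hY).sub hzm, ?_, ?_⟩
  · rwa [integral_sub' (integrable_onOptional hμ hνR hY) (integrable_onOptional hμ hνR hZ)] at h
  · rw [sub_eq_add_neg]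
    refine hadd (ae_bdd_onOptional hμ hY) ⟨Cz, ?_⟩
    simpa only [Pi.neg_apply, abs_neg] using hCz
  · rwa [sub_add_cancel]

end Separate

/-! ### Normalizing the separating measure and localizing the position -/

section Separate

variable {Ω : Type*} [mΩ : MeasurableSpace Ω] {P : Measure Ω} {𝕋 : Set ℕ∞}
  {ℱ : Filtration ℕ mΩ} {μ : ℕ∞ → Ω → ℝ} {t : ℕ} {r : (ℕ∞ → Ω → ℝ) → Ω → ℝ}
  {Qs : Measure (OptionalSpace 𝕋 ℱ)}

theorem integral_onTail_congr (hμ : IsReferenceProcess P 𝕋 ℱ μ) [IsFiniteMeasure Qs]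
    (hQs : Qs ≪ refMeasure P 𝕋 ℱ μ) {U V : Ω → ℝ} (hU : MemLinf P (ℱ t) U)
    (hV : MemLinf P (ℱ t) V) (h : ∀ᵐ ω ∂P, U ω = V ω) :
    ∫ p, onTail 𝕋 ℱ t U p ∂Qs = ∫ p, onTail 𝕋 ℱ t V p ∂Qs :=
  le_antisymm (integral_onTail_mono hμ hQs hU hV (h.mono fun _ h => h.le))
    (integral_onTail_mono hμ hQs hV hU (h.mono fun _ h => h.ge))

theorem integratedRisk_onOptional [IsProbabilityMeasure P] (hμ : IsReferenceProcess P 𝕋 ℱ μ)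
    (hr : IsCondConvexRiskMeasure P 𝕋 ℱ t r) [IsFiniteMeasure Qs]
    (hQs : Qs ≪ refMeasure P 𝕋 ℱ μ) {Y : ℕ∞ → Ω → ℝ} (hY : Y ∈ BddProcess P 𝕋 ℱ) :
    integratedRisk Qs t r (onOptional 𝕋 ℱ Y) =
      ∫ p, onTail 𝕋 ℱ t (riskAt (fun _ => r) t Y) p ∂Qs := by
  have hY' := onOptional_mem_congr hμ hY
  refine integral_onTail_congr hμ hQs (memLinf_riskAt (ρ := fun _ => r) hr hY')
    (memLinf_riskAt (ρ := fun _ => r) hr hY) (riskAt_congr (ρ := fun _ => r) hr hY' hY fun s hs _ => ?_)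
  filter_upwards with ω
  rw [toProcess_apply _ hs]
  rfl

theorem integral_onTail_indicator {ν : Measure (OptionalSpace 𝕋 ℱ)} {A : Set Ω}
    (hA : MeasurableSet[ℱ t] A) :
    ∫ p, onTail 𝕋 ℱ t (A.indicator 1) p ∂ν = ν.real {p | (t : ℕ∞) ≤ p.time ∧ p.state ∈ A} := by
  rw [← integral_indicator_one (measurableSet_time_state hA)]
  refine integral_congr_ae (ae_of_all _ fun p => ?_)
  rw [onTail_apply]
  by_cases h1 : (t : ℕ∞) ≤ p.time <;> by_cases h2 : p.state ∈ A <;> simp [h1, h2]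

theorem memLinf_indicator {A : Set Ω} (hA : MeasurableSet[ℱ t] A) :
    MemLinf P (ℱ t) (A.indicator (1 : Ω → ℝ)) := by
  refine ⟨measurable_indicator_one_real hA, 1, ae_of_all _ fun ω => ?_⟩
  by_cases h : ω ∈ A <;> simp [h]

/-- Processes living before t, and cash amounts at t of zero Qs-integral, stay acceptable under all
real multiples, so ν annihilates them. Hence ν is carried by the times from t on, and its marginal
on ℱ t there is proportional to that of Qs; scaling makes the marginals equal. -/
theorem exists_normalized_separating [IsProbabilityMeasure P] (hμ : IsReferenceProcess P 𝕋 ℱ μ)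
    (hr : IsCondConvexRiskMeasure P 𝕋 ℱ t r)
    (hc : IsContinuousFromAbove P 𝕋 ℱ (fun _ => r) t) (ht : (t : ℕ∞) ∈ 𝕋) [IsProbabilityMeasure Qs]
    (hQs : Qs ≪ refMeasure P 𝕋 ℱ μ) (hQs' : refMeasure P 𝕋 ℱ μ ≪ Qs) {Z : ℕ∞ → Ω → ℝ}
    (hZ : Z ∈ BddProcess P 𝕋 ℱ) (hZ0 : ∀ᵐ ω ∂P, 0 ≤ riskAt (fun _ => r) t Z ω)
    (hZpos : ¬ ∀ᵐ ω ∂P, riskAt (fun _ => r) t Z ω ≤ 0) :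
    ∃ Q₀ : Measure (OptionalSpace 𝕋 ℱ), IsFiniteMeasure Q₀ ∧ Q₀ ≪ refMeasure P 𝕋 ℱ μ ∧
      Q₀ {p | ¬ (t : ℕ∞) ≤ p.time} = 0 ∧
      (∀ A, MeasurableSet[ℱ t] A → Q₀ {p | (t : ℕ∞) ≤ p.time ∧ p.state ∈ A} =
        Qs {p | (t : ℕ∞) ≤ p.time ∧ p.state ∈ A}) ∧
      ∃ b c : ℝ, 0 < c ∧ (∀ Y ∈ acceptedBy P 𝕋 ℱ t r, -∫ p, onOptional 𝕋 ℱ Y p ∂Q₀ ≤ b) ∧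
        b + c ≤ -∫ p, onOptional 𝕋 ℱ Z p ∂Q₀ := by
  obtain ⟨ν, hν, hνR, hsep⟩ := exists_measure_separating hμ hr hc ht hQs hQs' hZ hZ0 hZpos
  have hcash : ∀ V, MemLinf P (ℱ t) V → 0 ≤ ∫ p, onTail 𝕋 ℱ t V p ∂Qs →
      1 ≤ ∫ p, onTail 𝕋 ℱ t V p ∂ν - ∫ p, onOptional 𝕋 ℱ Z p ∂ν := by
    intro V hV h0
    refine hsep _ (cash_mem_bddProcess hV) ?_
    rw [integratedRisk_onOptional hμ hr hQs (cash_mem_bddProcess hV),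
      integral_onTail_congr hμ hQs (memLinf_riskAt (ρ := fun _ => r) hr (cash_mem_bddProcess hV))
        (hV.const_mul (-1)) ?_]
    · simp only [onTail_mul, integral_const_mul]
      linarith
    · filter_upwards [riskAt_cash (ρ := fun _ => r) hr hV (cash_mem_bddProcess hV) fun s hs hst => by
        filter_upwards with ω
        rw [if_pos hst]] with ω hω
      rw [hω]
      ring
  have hcash0 : ∀ V, MemLinf P (ℱ t) V → ∫ p, onTail 𝕋 ℱ t V p ∂Qs = 0 →
      ∫ p, onTail 𝕋 ℱ t V p ∂ν = 0 := by
    intro V hV h0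
    refine eq_zero_of_forall_one_le (c := -∫ p, onOptional 𝕋 ℱ Z p ∂ν) fun k => ?_
    have h := hcash _ (hV.const_mul k) (by
      simp only [onTail_mul, integral_const_mul, h0, mul_zero, le_refl])
    simp only [onTail_mul, integral_const_mul] at h
    linarith
  have hSt : MeasurableSet {p : OptionalSpace 𝕋 ℱ | (t : ℕ∞) ≤ p.time} := by
    simpa using measurableSet_time_state (𝕋 := 𝕋) (ℱ := ℱ) (t := t) MeasurableSet.univ
  have hν0 : ν {p | ¬ (t : ℕ∞) ≤ p.time} = 0 := by
    have hk : ∀ k : ℝ, (fun (s : ℕ∞) (_ : Ω) => if (t : ℕ∞) ≤ s then 0 else k) ∈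
        BddProcess P 𝕋 ℱ := fun k =>
      ⟨fun s _ => measurable_const, |k|, fun s _ => ae_of_all _ fun ω => by
        dsimp only
        split_ifs <;> simp⟩
    have hi : ∀ k : ℝ, ∫ p, onOptional 𝕋 ℱ (fun (s : ℕ∞) (_ : Ω) => if (t : ℕ∞) ≤ s then 0 else k) p ∂ν =
        k * ν.real {p | ¬ (t : ℕ∞) ≤ p.time} := fun k => by
      have hcompl : MeasurableSet {p : OptionalSpace 𝕋 ℱ | ¬ (t : ℕ∞) ≤ p.time} := hSt.compl
      rw [← integral_indicator_one hcompl, ← integral_const_mul]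
      refine integral_congr_ae (ae_of_all _ fun p => ?_)
      by_cases h1 : (t : ℕ∞) ≤ p.time <;> simp [h1, onOptional, Set.indicator]
    have := eq_zero_of_forall_one_le (a := ν.real {p | ¬ (t : ℕ∞) ≤ p.time})
      (c := -∫ p, onOptional 𝕋 ℱ Z p ∂ν) fun k => by
        have h := hsep _ (hk k) (by
          rw [integratedRisk_onOptional hμ hr hQs (hk k), integral_onTail_congr hμ hQs
            (memLinf_riskAt (ρ := fun _ => r) hr (hk k)) (MemLinf.const P 0) ?_]
          · simp [onTail_apply]
          · filter_upwards [riskAt_cash (ρ := fun _ => r) hr (MemLinf.const P 0) (hk k)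
              fun s hs hst => by
                filter_upwards with ω
                rw [if_pos hst]] with ω hω
            rw [hω, neg_zero])
        rw [hi] at h
        linarith
    exact (measureReal_eq_zero_iff).1 this
  have huniv : {p : OptionalSpace 𝕋 ℱ | (t : ℕ∞) ≤ p.time ∧ p.state ∈ Set.univ} =
      {p | (t : ℕ∞) ≤ p.time} := by simp
  set a := Qs.real {p | (t : ℕ∞) ≤ p.time} with ha
  -- Obtained from the cash amount a 1_A − Qs(A from t on), which has zero Qs-integral.
  have hprop : ∀ A, MeasurableSet[ℱ t] A →
      a * ν.real {p | (t : ℕ∞) ≤ p.time ∧ p.state ∈ A} =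
        Qs.real {p | (t : ℕ∞) ≤ p.time ∧ p.state ∈ A} * ν.real {p | (t : ℕ∞) ≤ p.time} := by
    intro A hA
    have h1 := (memLinf_indicator (P := P) hA).const_mul a
    have h2 := (memLinf_indicator (P := P) (ℱ := ℱ) (t := t) MeasurableSet.univ).const_mul
      (-Qs.real {p | (t : ℕ∞) ≤ p.time ∧ p.state ∈ A})
    have hval : ∀ (ν' : Measure (OptionalSpace 𝕋 ℱ)) [IsFiniteMeasure ν'],
        ν' ≪ refMeasure P 𝕋 ℱ μ →
        ∫ p, onTail 𝕋 ℱ t (fun ω => a * A.indicator 1 ω +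
          -Qs.real {p | (t : ℕ∞) ≤ p.time ∧ p.state ∈ A} * Set.univ.indicator 1 ω) p ∂ν' =
          a * ν'.real {p | (t : ℕ∞) ≤ p.time ∧ p.state ∈ A} -
            Qs.real {p | (t : ℕ∞) ≤ p.time ∧ p.state ∈ A} * ν'.real {p | (t : ℕ∞) ≤ p.time} := by
      intro ν' _ hν'
      simp only [onTail_add, onTail_mul]
      rw [integral_add ((integrable_onTail hμ hν' (memLinf_indicator hA)).const_mul _)
        ((integrable_onTail hμ hν' (memLinf_indicator MeasurableSet.univ)).const_mul _),
        integral_const_mul, integral_const_mul, integral_onTail_indicator hA,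
        integral_onTail_indicator MeasurableSet.univ, huniv]
      ring
    have h := hcash0 _ (h1.add h2) (by rw [hval Qs hQs, ← ha]; ring)
    rw [hval ν hνR] at h
    linarith
  have hapos : 0 < a := by
    refine (measureReal_nonneg).lt_of_ne' fun h => ?_
    have h0 : Qs {p | (t : ℕ∞) ≤ p.time} = 0 := (measureReal_eq_zero_iff).1 h
    have := ae_of_ae_refMeasure_time (P := P) (ℱ := ℱ) hμ ht (q := fun _ => False)
      (@MeasurableSet.const _ (ℱ t) False) (by
        filter_upwards [measure_eq_zero_iff_ae_notMem.1 (hQs' h0)] with p hp hpt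
        exact hp hpt)
    exact IsProbabilityMeasure.ne_zero P (by simpa using this)
  set v := ν.real {p | (t : ℕ∞) ≤ p.time} with hv
  -- For ν = 0 the separating inequality at the zero cash amount would read 1 ≤ 0.
  have hvpos : 0 < v := by
    refine (measureReal_nonneg).lt_of_ne' fun h => ?_
    have h0 : ν {p | (t : ℕ∞) ≤ p.time} = 0 := (measureReal_eq_zero_iff).1 h
    have hzero : ν = 0 := by
      rw [← Measure.measure_univ_eq_zero, ← Set.union_compl_self {p : OptionalSpace 𝕋 ℱ | (t : ℕ∞) ≤ p.time}]
      exact measure_union_null h0 hν0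
    have h1 := hcash 0 (MemLinf.const P 0) (by simp [onTail_apply])
    simp [hzero] at h1
    linarith
  have hlpos : 0 < a / v := div_pos hapos hvpos
  have hint : ∀ f : OptionalSpace 𝕋 ℱ → ℝ, ∫ p, f p ∂(ENNReal.ofReal (a / v) • ν) =
      (a / v) * ∫ p, f p ∂ν := fun f => by
    rw [integral_smul_measure, ENNReal.toReal_ofReal hlpos.le, smul_eq_mul]
  -- c = a/v is the gap 1 after scaling, and b is chosen so that b + c is exactly the loss of Z.
  refine ⟨ENNReal.ofReal (a / v) • ν, ν.smul_finite ENNReal.ofReal_ne_top,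
    Measure.smul_absolutelyContinuous.trans hνR, by rw [Measure.smul_apply, hν0, smul_zero], fun A hA => ?_,
    -(a / v * ∫ p, onOptional 𝕋 ℱ Z p ∂ν) - a / v, a / v, hlpos, fun Y hY => ?_, ?_⟩
  · rw [Measure.smul_apply, smul_eq_mul, ← ENNReal.ofReal_toReal (measure_ne_top ν _),
      ← ENNReal.ofReal_toReal (measure_ne_top Qs _), ← ENNReal.ofReal_mul hlpos.le]
    congr 1
    have h := hprop A hA
    change a / v * ν.real _ = Qs.real _
    field_simp
    linarith
  · rw [hint]
    have hYm : Y ∈ BddProcess P 𝕋 ℱ := hY.1.1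
    have h := hsep Y hYm (by
      rw [integratedRisk_onOptional hμ hr hQs hYm]
      refine (integral_onTail_mono hμ hQs (memLinf_riskAt (ρ := fun _ => r) hr hYm)
        (MemLinf.const P 0) ?_).trans (by simp [onTail_apply])
      filter_upwards [riskAt_eq (ρ := fun _ => r) hr hY.1, hY.2] with ω h1 h2
      rwa [h1])
    nlinarith
  · rw [hint]
    linarith

/-- Separation of the part of `X` on `{r(X) > V}` from the acceptance set. -/
theorem exists_separating [IsProbabilityMeasure P] (hμ : IsReferenceProcess P 𝕋 ℱ μ)
    (hr : IsCondConvexRiskMeasure P 𝕋 ℱ t r)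
    (hc : IsContinuousFromAbove P 𝕋 ℱ (fun _ => r) t) (ht : (t : ℕ∞) ∈ 𝕋) [IsProbabilityMeasure Qs]
    (hQs : Qs ≪ refMeasure P 𝕋 ℱ μ) (hQs' : refMeasure P 𝕋 ℱ μ ≪ Qs) {X : ℕ∞ → Ω → ℝ}
    (hX : X ∈ BddProcessFrom P 𝕋 ℱ t) {V : Ω → ℝ} (hV : MemLinf P (ℱ t) V)
    (hXV : ¬ ∀ᵐ ω ∂P, r X ω ≤ V ω) :
    ∃ A, MeasurableSet[ℱ t] A ∧
    ∃ Q₀ : Measure (OptionalSpace 𝕋 ℱ), IsFiniteMeasure Q₀ ∧ Q₀ ≪ refMeasure P 𝕋 ℱ μ ∧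
      Q₀ {p | ¬ (t : ℕ∞) ≤ p.time} = 0 ∧
      (∀ A, MeasurableSet[ℱ t] A → Q₀ {p | (t : ℕ∞) ≤ p.time ∧ p.state ∈ A} =
        Qs {p | (t : ℕ∞) ≤ p.time ∧ p.state ∈ A}) ∧
      ∃ b c : ℝ, 0 < c ∧ (∀ Y ∈ acceptedBy P 𝕋 ℱ t r, -∫ p, onOptional 𝕋 ℱ Y p ∂Q₀ ≤ b) ∧
        b + c ≤ -∫ p in {p | (t : ℕ∞) ≤ p.time ∧ p.state ∈ A},
          onOptional 𝕋 ℱ (fun s ω => X s ω + if (t : ℕ∞) ≤ s then V ω else 0) p ∂Q₀ := by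
  set W : ℕ∞ → Ω → ℝ := fun s ω => X s ω + if (t : ℕ∞) ≤ s then V ω else 0 with hW
  have hWf : W ∈ BddProcessFrom P 𝕋 ℱ t := add_cash_mem_bddProcessFrom hX hV
  set A : Set Ω := {ω | V ω < r X ω} with hA
  have hAm : MeasurableSet[ℱ t] A := measurableSet_lt hV.1 (hr.memLinf X hX).1
  have hlm : Measurable[ℱ t] (A.indicator (1 : Ω → ℝ)) := measurable_indicator_one_real hAm
  set Z : ℕ∞ → Ω → ℝ := fun s ω => A.indicator 1 ω * proj t ⊤ W s ω with hZdef
  have hZ : Z ∈ BddProcess P 𝕋 ℱ := mul_indicator_mem hWf.1 hAm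
  have hZf : Z ∈ BddProcessFrom P 𝕋 ℱ t := by
    refine mem_bddProcessFrom_iff.2 ⟨hZ, fun s hs hst => ?_⟩
    filter_upwards with ω
    simp [hZdef, proj_top, not_le.2 hst]
  have hrW : ∀ᵐ ω ∂P, r W ω = r X ω - V ω := hr.cashInvariance X hX V hV
  -- Convexity with weight 1_A yields locality. Mixing Z with W gives back W, so r(W) ≤ r(Z) on A;
  -- mixing 0 with Z gives back 0, so 0 ≤ r(Z) off A.
  have h1 := hr.mix_le hZf hWf hlm fun ω => indicator_one_mem_unit ω
  have h2 := hr.mix_le zero_mem_bddProcessFrom hZf hlm fun ω => indicator_one_mem_unit ω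
  have e1 : ∀ᵐ ω ∂P, r (mix t (A.indicator 1) Z W) ω = r W ω := by
    refine hr.congr (mix_mem_bddProcessFrom hZf.1 hWf.1 hlm fun ω => indicator_one_mem_unit ω) hWf
      fun s hs => ?_
    filter_upwards [proj_top_ae_eq hWf s hs] with ω hω
    rw [← hω]
    by_cases hωA : ω ∈ A <;> by_cases hts : (t : ℕ∞) ≤ s <;>
      simp [mix, hZdef, proj_top, hωA, hts]
  have e2 : ∀ᵐ ω ∂P, r (mix t (A.indicator 1) 0 Z) ω = r 0 ω := by
    refine hr.congr (mix_mem_bddProcessFrom zero_mem_bddProcess hZf.1 hlm fun ω =>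
      indicator_one_mem_unit ω) zero_mem_bddProcessFrom fun s hs => ?_
    filter_upwards with ω
    by_cases hωA : ω ∈ A <;> by_cases hts : (t : ℕ∞) ≤ s <;>
      simp [mix, hZdef, proj_top, hωA, hts]
  have hZr := riskAt_eq (ρ := fun _ => r) hr hZf
  have hZge : ∀ᵐ ω ∂P, A.indicator (fun ω => r X ω - V ω) ω ≤ riskAt (fun _ => r) t Z ω := by
    filter_upwards [hrW, h1, h2, e1, e2, hZr, hr.normalized] with ω h3 h4 h5 h6 h7 h8 h9
    rw [h8]
    by_cases hωA : ω ∈ A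
    · simp only [hωA, Set.indicator_of_mem, Pi.one_apply, one_mul, sub_self, zero_mul, add_zero]
        at h4 ⊢
      linarith
    · simp only [hωA, not_false_eq_true, Set.indicator_of_notMem, zero_mul, sub_zero, one_mul,
        zero_add] at h5 ⊢
      linarith
  obtain ⟨Q₀, hfin, hac, h0, hmarg, b, c, hcpos, hb, hbc⟩ :=
    exists_normalized_separating hμ hr hc ht hQs hQs' hZ (by
      filter_upwards [hZge] with ω hω
      refine le_trans ?_ hω
      by_cases hωA : ω ∈ A
      · rw [Set.indicator_of_mem hωA]
        exact sub_nonneg.2 (le_of_lt hωA)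
      · rw [Set.indicator_of_notMem hωA]) (fun h => hXV (by
      filter_upwards [hZge, h] with ω h3 h4
      by_contra hlt
      have hωA : ω ∈ A := not_le.1 hlt
      rw [Set.indicator_of_mem hωA] at h3
      linarith))
  refine ⟨A, hAm, Q₀, hfin, hac, h0, hmarg, b, c, hcpos, hb, hbc.trans_eq ?_⟩
  rw [← integral_indicator (measurableSet_time_state hAm)]
  congr 1
  refine integral_congr_ae (ae_of_all _ fun p => ?_)
  by_cases hωA : p.state ∈ A <;> by_cases hts : (t : ℕ∞) ≤ p.time <;>
    simp [onOptional, hZdef, proj_top, hωA, hts, Set.indicator]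

/-- Replacing a fraction `h` of `Qs` on the part of the product space from time `t` on. -/
noncomputable def pasted (t : ℕ) (h : ℝ) (Qs Q₀ : Measure (OptionalSpace 𝕋 ℱ)) :
    Measure (OptionalSpace 𝕋 ℱ) :=
  Qs.restrict {p | (t : ℕ∞) ≤ p.time}ᶜ +
    (ENNReal.ofReal (1 - h) • Qs.restrict {p | (t : ℕ∞) ≤ p.time} + ENNReal.ofReal h • Q₀)

end Separate

/-! ### Pasting at time t, and duality over all decompositions -/

section Dominate

variable {Ω : Type*} [mΩ : MeasurableSpace Ω] {P : Measure Ω} {𝕋 : Set ℕ∞}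
  {ℱ : Filtration ℕ mΩ} {μ : ℕ∞ → Ω → ℝ} {t : ℕ} {r : (ℕ∞ → Ω → ℝ) → Ω → ℝ}
  {Qs Q₀ Qbar : Measure (OptionalSpace 𝕋 ℱ)} {Q : Measure Ω} {D : ℕ∞ → Ω → ℝ}

/-- The bound on expected losses bounds the expectation of B. As B is nonnegative, it also bounds
the integral over any set of any u ≤ B. -/
theorem IsLossSup.setIntegral_le {𝒮 : Set (ℕ∞ → Ω → ℝ)} {B : Ω → EReal}
    (hB : IsLossSup 𝕋 ℱ Q D t 𝒮 B) {b : ℝ} (hb0 : 0 ≤ b)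
    (hb : ∀ X ∈ 𝒮, ∫ ω, condLoss 𝕋 ℱ Q D t X ω ∂Q ≤ b) {u : Ω → ℝ} (hu : Integrable u Q)
    (huB : ∀ᵐ ω ∂Q, (u ω : EReal) ≤ B ω) (A : Set Ω) : ∫ ω in A, u ω ∂Q ≤ b := by
  have h1 : ∫ ω in A, u ω ∂Q ≤ ∫ ω in A, max (u ω) 0 ∂Q :=
    integral_mono hu.integrableOn (hu.pos_part).integrableOn fun ω => le_max_left _ _
  have h2 : ENNReal.ofReal (∫ ω in A, max (u ω) 0 ∂Q) ≤ ENNReal.ofReal b := by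
    rw [ofReal_integral_eq_lintegral_ofReal hu.pos_part.integrableOn
      (ae_of_all _ fun ω => le_max_right _ _)]
    refine (setLIntegral_le_lintegral A _).trans (le_trans (lintegral_mono_ae ?_) (hB.lintegral_le hb))
    filter_upwards [huB, hB.nonneg] with ω h3 h4
    have h5 : ENNReal.ofReal (max (u ω) 0) = ((max (u ω) 0 : ℝ) : EReal).toENNReal := by
      rw [EReal.toENNReal_of_ne_top (EReal.coe_ne_top _), EReal.toReal_coe]
    rw [h5]
    refine EReal.toENNReal_le_toENNReal ?_
    rcases le_total (u ω) 0 with h | h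
    · rw [max_eq_right h]
      exact h4
    · rwa [max_eq_left h]
  exact h1.trans ((ENNReal.ofReal_le_ofReal_iff hb0).1 h2)

/-- Domination by D_t V + B says that the loss of X + V is at most B, so its integral over every
event is at most b. The event A violates this. -/
theorem IsDecomposition.not_dominated (h𝕋 : IsTimeSet 𝕋) (hμ : IsReferenceProcess P 𝕋 ℱ μ)
    (h : IsDecomposition P 𝕋 ℱ μ Qbar Q D) (ht : (t : ℕ∞) ∈ 𝕋) {𝒮 : Set (ℕ∞ → Ω → ℝ)}
    (h𝒮 : 𝒮 ⊆ BddProcess P 𝕋 ℱ) (h0 : 0 ∈ 𝒮) {B : Ω → EReal} (hB : IsLossSup 𝕋 ℱ Q D t 𝒮 B) {b : ℝ}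
    (hb : ∀ Y ∈ 𝒮, -∫ p in {p | (t : ℕ∞) ≤ p.time}, onOptional 𝕋 ℱ Y p ∂Qbar ≤ b)
    {X : ℕ∞ → Ω → ℝ} (hX : X ∈ BddProcess P 𝕋 ℱ) {V : Ω → ℝ} (hV : MemLinf P (ℱ t) V)
    {A : Set Ω} (hA : MeasurableSet[ℱ t] A)
    (hbA : b < -∫ p in {p | (t : ℕ∞) ≤ p.time ∧ p.state ∈ A},
      onOptional 𝕋 ℱ (fun s ω => X s ω + if (t : ℕ∞) ≤ s then V ω else 0) p ∂Qbar) :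
    ¬ ∀ᵐ ω ∂Q, (condLoss 𝕋 ℱ Q D t X ω : EReal) ≤ (D t ω : EReal) * (V ω : EReal) + B ω := by
  intro hdom
  have hW : (fun s ω => X s ω + if (t : ℕ∞) ≤ s then V ω else 0) ∈ BddProcess P 𝕋 ℱ :=
    add_mem_bddProcess hX (cash_mem_bddProcess hV)
  rw [← h.setIntegral_condLoss h𝕋 hμ hW ht hA] at hbA
  refine absurd hbA (not_lt.2 (hB.setIntegral_le ?_ (fun Y hY => ?_) (integrable_condLoss _ _) ?_ A))
  · simpa [onOptional] using hb 0 h0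
  · rw [h.integral_condLoss h𝕋 hμ (h𝒮 hY) ht]
    exact hb Y hY
  · filter_upwards [hdom, h.condLoss_add_cash h𝕋 hμ hX ht hV] with ω h1 h2
    rw [h2, EReal.coe_sub, EReal.coe_mul]
    rw [← EReal.coe_mul] at h1 ⊢
    exact EReal.sub_le_of_le_add' h1

section Paste

theorem measurableSet_time : MeasurableSet {p : OptionalSpace 𝕋 ℱ | (t : ℕ∞) ≤ p.time} := by
  simpa using measurableSet_time_state (𝕋 := 𝕋) (ℱ := ℱ) (t := t) MeasurableSet.univ

theorem pasted_apply (h : ℝ) (S : Set (OptionalSpace 𝕋 ℱ)) (hS : MeasurableSet S) :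
    pasted t h Qs Q₀ S = Qs (S ∩ {p | (t : ℕ∞) ≤ p.time}ᶜ) +
      (ENNReal.ofReal (1 - h) * Qs (S ∩ {p | (t : ℕ∞) ≤ p.time}) + ENNReal.ofReal h * Q₀ S) := by
  simp [pasted, Measure.restrict_apply hS]

theorem isProbabilityMeasure_pasted [IsProbabilityMeasure Qs] {h : ℝ} (h0 : 0 ≤ h) (h1 : h ≤ 1)
    (hQ₀ : Q₀ {p | ¬ (t : ℕ∞) ≤ p.time} = 0)
    (hQ₀' : Q₀ {p | (t : ℕ∞) ≤ p.time} = Qs {p | (t : ℕ∞) ≤ p.time}) :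
    IsProbabilityMeasure (pasted t h Qs Q₀) := by
  constructor
  have hu : Q₀ Set.univ = Qs {p | (t : ℕ∞) ≤ p.time} := by
    rw [← hQ₀', ← measure_add_measure_compl (μ := Q₀) (measurableSet_time (t := t))]
    change _ + Q₀ {p | ¬ (t : ℕ∞) ≤ p.time} = _
    rw [hQ₀, add_zero]
  rw [pasted_apply h _ MeasurableSet.univ, Set.univ_inter, Set.univ_inter, hu, ← add_mul,
    ← ENNReal.ofReal_add (by linarith) h0, sub_add_cancel, ENNReal.ofReal_one, one_mul, add_comm,
    measure_add_measure_compl measurableSet_time, measure_univ]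

theorem pasted_absolutelyContinuous {m : Measure (OptionalSpace 𝕋 ℱ)} (hQs : Qs ≪ m) (hQ₀ : Q₀ ≪ m)
    (h : ℝ) : pasted t h Qs Q₀ ≪ m := by
  refine Measure.AbsolutelyContinuous.add_left (Measure.restrict_le_self.absolutelyContinuous.trans hQs)
    (Measure.AbsolutelyContinuous.add_left (Measure.smul_absolutelyContinuous.trans
      (Measure.restrict_le_self.absolutelyContinuous.trans hQs))
      (Measure.smul_absolutelyContinuous.trans hQ₀))

/-- The positive fraction 1 − h of `Qs` survives after t, whatever `Q₀` is. -/
theorem absolutelyContinuous_pasted {m : Measure (OptionalSpace 𝕋 ℱ)} (hQs : m ≪ Qs) {h : ℝ}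
    (h1 : h < 1) : m ≪ pasted t h Qs Q₀ := by
  refine hQs.trans (Measure.AbsolutelyContinuous.mk fun S hS hS0 => ?_)
  rw [pasted_apply h S hS] at hS0
  simp only [add_eq_zero, mul_eq_zero, ENNReal.ofReal_eq_zero, sub_nonpos] at hS0
  rw [← measure_inter_add_sdiff S (measurableSet_time (t := t)), Set.sdiff_eq, hS0.1,
    hS0.2.1.resolve_left (not_le.2 h1), add_zero]

theorem setIntegral_pasted {h : ℝ} (h0 : 0 ≤ h) (h1 : h ≤ 1) {S : Set (OptionalSpace 𝕋 ℱ)}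
    (hS : MeasurableSet S) (hSt : S ⊆ {p | (t : ℕ∞) ≤ p.time}) {f : OptionalSpace 𝕋 ℱ → ℝ}
    (hf : Integrable f Qs) (hf₀ : Integrable f Q₀) :
    ∫ p in S, f p ∂(pasted t h Qs Q₀) = (1 - h) * ∫ p in S, f p ∂Qs + h * ∫ p in S, f p ∂Q₀ := by
  have e1 : (Qs.restrict {p | (t : ℕ∞) ≤ p.time}ᶜ).restrict S = 0 := by
    rw [Measure.restrict_restrict hS, Measure.restrict_eq_zero]
    have : S ∩ {p | (t : ℕ∞) ≤ p.time}ᶜ = ∅ := by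
      rw [← Set.sdiff_eq]
      exact Set.sdiff_eq_empty.2 hSt
    rw [this, measure_empty]
  have e2 : (Qs.restrict {p | (t : ℕ∞) ≤ p.time}).restrict S = Qs.restrict S := by
    rw [Measure.restrict_restrict hS, Set.inter_eq_left.2 hSt]
  unfold pasted
  rw [Measure.restrict_add, Measure.restrict_add, Measure.restrict_smul, Measure.restrict_smul, e1,
    e2, zero_add, integral_add_measure, integral_smul_measure, integral_smul_measure,
    ENNReal.toReal_ofReal h0, ENNReal.toReal_ofReal (by linarith), smul_eq_mul, smul_eq_mul]
  · exact (hf.restrict).smul_measure ENNReal.ofReal_ne_top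
  · exact (hf₀.restrict).smul_measure ENNReal.ofReal_ne_top

theorem setIntegral_pasted_compl (h : ℝ) (hQ₀ : Q₀ {p | ¬ (t : ℕ∞) ≤ p.time} = 0)
    {f : OptionalSpace 𝕋 ℱ → ℝ} :
    ∫ p in {p | (t : ℕ∞) ≤ p.time}ᶜ, f p ∂(pasted t h Qs Q₀) =
      ∫ p in {p | (t : ℕ∞) ≤ p.time}ᶜ, f p ∂Qs := by
  have hm : MeasurableSet {p : OptionalSpace 𝕋 ℱ | (t : ℕ∞) ≤ p.time}ᶜ := measurableSet_time.compl
  have e0 : Q₀.restrict {p | (t : ℕ∞) ≤ p.time}ᶜ = 0 := Measure.restrict_eq_zero.2 hQ₀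
  unfold pasted
  rw [Measure.restrict_add, Measure.restrict_add, Measure.restrict_smul, Measure.restrict_smul, e0,
    Measure.restrict_restrict hm, Measure.restrict_restrict hm, Set.inter_self, Set.compl_inter_self,
    Measure.restrict_empty, smul_zero, smul_zero, add_zero, add_zero]

end Paste

/-- A position whose losses are dominated, under every decomposition, by `V` and the penalty has
risk at most `V`. -/
theorem ae_le_of_forall_isDecomposition [IsProbabilityMeasure P] (h𝕋 : IsTimeSet 𝕋)
    (hzero : ℱ 0 = ⊥) (htop : ⨆ (n : ℕ) (_ : (n : ℕ∞) ∈ 𝕋), ℱ n = mΩ)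
    (hreg : InfiniteHorizon 𝕋 → IsRegularFiltration ℱ) (hμ : IsReferenceProcess P 𝕋 ℱ μ)
    (hr : IsCondConvexRiskMeasure P 𝕋 ℱ t r)
    (hc : IsContinuousFromAbove P 𝕋 ℱ (fun _ => r) t) (ht : (t : ℕ∞) ∈ 𝕋) {X : ℕ∞ → Ω → ℝ}
    (hX : X ∈ BddProcessFrom P 𝕋 ℱ t) {V : Ω → ℝ} (hV : MemLinf P (ℱ t) V)
    (H : ∀ Qbar Q D, IsDecomposition P 𝕋 ℱ μ Qbar Q D → ∃ B, IsLossSup 𝕋 ℱ Q D t (acceptedBy P 𝕋 ℱ t r) B ∧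
      ∀ᵐ ω ∂Q, (condLoss 𝕋 ℱ Q D t X ω : EReal) ≤ (D t ω : EReal) * (V ω : EReal) + B ω) :
    ∀ᵐ ω ∂P, r X ω ≤ V ω := by
  by_contra hXV
  have := hμ.isProbabilityMeasure
  -- The pasted measure need not be equivalent here, so P ⊗ μ serves as base measure and is replaced
  -- entirely by Q₀ from t on (h = 1).
  obtain ⟨A, hA, Q₀, hfin, hac, h0, hmarg, b, c, hcpos, hb, hbc⟩ :=
    exists_separating hμ hr hc ht (Measure.AbsolutelyContinuous.refl _)
      (Measure.AbsolutelyContinuous.refl _) hX hV hXV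
  have hmt := hmarg Set.univ MeasurableSet.univ
  simp only [Set.mem_univ, and_true] at hmt
  have := isProbabilityMeasure_pasted (zero_le_one' ℝ) le_rfl h0 hmt
  have hRac : pasted t 1 (refMeasure P 𝕋 ℱ μ) Q₀ ≪ refMeasure P 𝕋 ℱ μ :=
    pasted_absolutelyContinuous (Measure.AbsolutelyContinuous.refl _) hac 1
  obtain ⟨Q, D, hD⟩ := hμ.exists_isDecomposition h𝕋 hzero htop hreg hRac
  obtain ⟨B, hB, hdom⟩ := H _ _ _ hD
  have hint : ∀ Y ∈ BddProcess P 𝕋 ℱ, ∀ S : Set (OptionalSpace 𝕋 ℱ), MeasurableSet S →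
      S ⊆ {p | (t : ℕ∞) ≤ p.time} → ∫ p in S, onOptional 𝕋 ℱ Y p ∂(pasted t 1 (refMeasure P 𝕋 ℱ μ) Q₀) =
        ∫ p in S, onOptional 𝕋 ℱ Y p ∂Q₀ := fun Y hY S hS hSt => by
    rw [setIntegral_pasted zero_le_one le_rfl hS hSt
      (integrable_onOptional hμ (Measure.AbsolutelyContinuous.refl _) hY)
      (integrable_onOptional hμ hac hY)]
    ring
  refine hD.not_dominated h𝕋 hμ ht (fun _ hY => hY.1.1) hr.zero_mem hB (b := b) (fun Y hY => ?_)
    hX.1 hV hA ?_ hdom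
  · rw [hint Y hY.1.1 _ measurableSet_time subset_rfl, setIntegral_eq_integral_of_ae_compl_eq_zero]
    · exact hb Y hY
    · filter_upwards [measure_eq_zero_iff_ae_notMem.1 h0] with p hp hp'
      exact absurd hp' hp
  · have hW : (fun s ω => X s ω + if (t : ℕ∞) ≤ s then V ω else 0) ∈ BddProcess P 𝕋 ℱ :=
      add_mem_bddProcess hX.1 (cash_mem_bddProcess hV)
    rw [hint _ hW _ (measurableSet_time_state hA)
      fun p hp => hp.1]
    linarith

end Dominate

/-! ### The supermartingale inequality in terms of conditional losses -/

section Equivalences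

variable {Ω : Type*} [mΩ : MeasurableSpace Ω] {P : Measure Ω} {𝕋 : Set ℕ∞}
  {ℱ : Filtration ℕ mΩ} {μ : ℕ∞ → Ω → ℝ} {t : ℕ} {ρ : ℕ → (ℕ∞ → Ω → ℝ) → Ω → ℝ}
  {Qbar : Measure (OptionalSpace 𝕋 ℱ)} {Q : Measure Ω} {D : ℕ∞ → Ω → ℝ}

theorem coe_mul_add_add {d : ℝ} (hd : 0 ≤ d) (a b : ℝ) (x : EReal) :
    (d : EReal) * ((a : EReal) + (b : EReal) + x) = ((d * (a + b) : ℝ) : EReal) + d * x := by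
  rw [← EReal.coe_add, EReal.left_distrib_of_nonneg_of_ne_top (EReal.coe_nonneg.2 hd)
    (EReal.coe_ne_top d), EReal.coe_mul]

theorem condExpE_congr {Ω : Type*} {m mΩ : MeasurableSpace Ω} {ν : Measure Ω} {B B' : Ω → EReal}
    (h : ∀ᵐ ω ∂ν, B ω = B' ω) : ∀ᵐ ω ∂ν, condExpE ν m B ω = condExpE ν m B' ω := by
  have h1 := condLExp_congr_ae (mΩ := m) (P := ν) (X := fun ω => (B ω).toENNReal)
    (Y := fun ω => (B' ω).toENNReal) (by filter_upwards [h] with ω hω; rw [hω])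
  have h2 := condLExp_congr_ae (mΩ := m) (P := ν) (X := fun ω => (-B ω).toENNReal)
    (Y := fun ω => (-B' ω).toENNReal) (by filter_upwards [h] with ω hω; rw [hω])
  filter_upwards [h1, h2] with ω e1 e2
  rw [condExpE, condExpE, e1, e2]

theorem gammaOf_of_succ_mem (ht : ((t + 1 : ℕ) : ℕ∞) ∈ 𝕋) (ω : Ω) :
    gammaOf 𝕋 D t ω = D t ω - D ((t + 1 : ℕ) : ℕ∞) ω := by
  have : (t : ℕ∞) + 1 = ((t + 1 : ℕ) : ℕ∞) := by push_cast; rfl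
  rw [gammaOf, this, if_pos ⟨ENat.natCast_ne_top t, ht⟩]

/-- X raised by its own risk is accepted, and its loss is that of X less D_t r(X). -/
theorem IsLossSup.condLoss_le (h𝕋 : IsTimeSet 𝕋) (hμ : IsReferenceProcess P 𝕋 ℱ μ)
    (h : IsDecomposition P 𝕋 ℱ μ Qbar Q D) (ht : (t : ℕ∞) ∈ 𝕋) {r : (ℕ∞ → Ω → ℝ) → Ω → ℝ}
    (hr : IsCondConvexRiskMeasure P 𝕋 ℱ t r) {B : Ω → EReal}
    (hB : IsLossSup 𝕋 ℱ Q D t (acceptedBy P 𝕋 ℱ t r) B) {X : ℕ∞ → Ω → ℝ} (hX : X ∈ BddProcess P 𝕋 ℱ) :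
    ∀ᵐ ω ∂Q, (condLoss 𝕋 ℱ Q D t X ω : EReal) ≤
      (D t ω : EReal) * (r (proj t ⊤ X) ω : EReal) + B ω := by
  have hp := proj_top_mem_from hX (t : ℕ∞)
  filter_upwards [hB.le _ (hr.add_cash_mem hp), h.condLoss_add_cash h𝕋 hμ hp.1 ht (hr.memLinf _ hp),
    h.condLoss_congr h𝕋 hμ hp.1 hX t fun s _ hst => by
      filter_upwards with ω
      rw [proj_top, if_pos hst]] with ω h1 h2 h3
  rw [h2, h3, EReal.coe_sub, EReal.coe_mul] at h1
  rw [← EReal.coe_mul] at h1 ⊢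
  rw [add_comm]
  exact (EReal.sub_le_iff_le_add (Or.inl (EReal.coe_ne_bot _)) (Or.inl (EReal.coe_ne_top _))).1 h1

/-- Predictability makes D_{t+1} U measurable at time t, so it leaves the conditional expectation.
-/
theorem IsDecomposition.condExp_discount_succ (h𝕋 : IsTimeSet 𝕋)
    (h : IsDecomposition P 𝕋 ℱ μ Qbar Q D) (ht : ((t + 1 : ℕ) : ℕ∞) ∈ 𝕋) {U W : Ω → ℝ}
    (hU : MemLinf P (ℱ t) U) (hW : MemLinf P (ℱ (t + 1)) W) :
    ∀ᵐ ω ∂Q, Q[fun ω => D ((t + 1 : ℕ) : ℕ∞) ω * (U ω + W ω)|ℱ t] ω =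
      D ((t + 1 : ℕ) : ℕ∞) ω * U ω + Q[fun ω => D ((t + 1 : ℕ) : ℕ∞) ω * W ω|ℱ t] ω := by
  have := h.isProbabilityMeasure_left
  have i1 := h.integrable_discount_mul h𝕋 ht (hU.mono (ℱ.mono (Nat.le_succ t)))
  have i2 := h.integrable_discount_mul h𝕋 ht hW
  have hm : Measurable[ℱ t] (fun ω => D ((t + 1 : ℕ) : ℕ∞) ω * U ω) :=
    (h.discounting.predictable t ht).mul hU.1
  have e : (fun ω => D ((t + 1 : ℕ) : ℕ∞) ω * (U ω + W ω)) =
      (fun ω => D ((t + 1 : ℕ) : ℕ∞) ω * U ω) + fun ω => D ((t + 1 : ℕ) : ℕ∞) ω * W ω := by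
    funext ω
    simp [mul_add]
  rw [e]
  filter_upwards [condExp_add i1 i2 (ℱ t)] with ω hω
  rw [hω, Pi.add_apply, condExp_of_stronglyMeasurable (ℱ.le t) hm.stronglyMeasurable i1]

/-- Splits off the integrable part, so that only the nonnegative product of D and the penalty can be
infinite. -/
theorem IsDecomposition.supermartingale_iff (h𝕋 : IsTimeSet 𝕋) (hμ : IsReferenceProcess P 𝕋 ℱ μ)
    (h : IsDecomposition P 𝕋 ℱ μ Qbar Q D) (ht : ((t + 1 : ℕ) : ℕ∞) ∈ 𝕋)
    (hr' : IsCondConvexRiskMeasure P 𝕋 ℱ (t + 1) (ρ (t + 1))) {X : ℕ∞ → Ω → ℝ}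
    (hX : X ∈ BddProcess P 𝕋 ℱ) :
    (∀ᵐ ω ∂Q, condExpE Q (ℱ t)
      (fun ω' => (D ((t + 1 : ℕ) : ℕ∞) ω' : EReal) *
        ((X t ω' : EReal) + (riskAt ρ (t + 1) X ω' : EReal) + penalty P 𝕋 ℱ ρ Q D (t + 1) ω')) ω
      ≤ (D t ω : EReal) *
        ((X t ω : EReal) + (riskAt ρ t X ω : EReal) + penalty P 𝕋 ℱ ρ Q D t ω)) ↔
    ∀ᵐ ω ∂Q, (Q[fun ω => D ((t + 1 : ℕ) : ℕ∞) ω * (X t ω + riskAt ρ (t + 1) X ω)|ℱ t] ω : EReal) +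
      condExpE Q (ℱ t) (fun ω => (D ((t + 1 : ℕ) : ℕ∞) ω : EReal) * penalty P 𝕋 ℱ ρ Q D (t + 1) ω) ω
      ≤ ((D t ω * (X t ω + riskAt ρ t X ω) : ℝ) : EReal) +
        (D t ω : EReal) * penalty P 𝕋 ℱ ρ Q D t ω := by
  have := h.isProbabilityMeasure_left
  have htt := h𝕋.mem_of_succ ht
  have hB := h.isLossSup_penalty h𝕋 hμ ht hr'
  have i := h.integrable_discount_mul h𝕋 ht
    (((memLinf_of_mem hX htt).mono (ℱ.mono (Nat.le_succ t))).add (memLinf_riskAt hr' hX))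
  have e1 : ∀ᵐ ω ∂Q, (D ((t + 1 : ℕ) : ℕ∞) ω : EReal) *
        ((X t ω : EReal) + (riskAt ρ (t + 1) X ω : EReal) + penalty P 𝕋 ℱ ρ Q D (t + 1) ω) =
      ((D ((t + 1 : ℕ) : ℕ∞) ω * (X t ω + riskAt ρ (t + 1) X ω) : ℝ) : EReal) +
        (D ((t + 1 : ℕ) : ℕ∞) ω : EReal) * penalty P 𝕋 ℱ ρ Q D (t + 1) ω := by
    filter_upwards [h.ae_nonneg] with ω hω
    exact coe_mul_add_add (hω _ ht) _ _ _
  have e2 := condExpE_congr (m := ℱ t) e1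
  have e3 := condExpE_add (m := ℱ t) i hB.aemeasurable hB.nonneg
  have e4 : ∀ᵐ ω ∂Q, (D t ω : EReal) *
        ((X t ω : EReal) + (riskAt ρ t X ω : EReal) + penalty P 𝕋 ℱ ρ Q D t ω) =
      ((D t ω * (X t ω + riskAt ρ t X ω) : ℝ) : EReal) +
        (D t ω : EReal) * penalty P 𝕋 ℱ ρ Q D t ω := by
    filter_upwards [h.ae_nonneg] with ω hω
    exact coe_mul_add_add (hω _ htt) _ _ _
  constructor
  · intro H
    filter_upwards [H, e2, e3, e4] with ω h1 h2 h3 h4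
    rwa [h2, h3, h4] at h1
  · intro H
    filter_upwards [H, e2, e3, e4] with ω h1 h2 h3 h4
    rwa [h2, h3, h4]

/-- The losses of `X` are dominated by the risk of `Y` and the penalty whenever `Y` is riskier
than `X` at the next time. -/
theorem IsDecomposition.condLoss_le_of_supermartingale (h𝕋 : IsTimeSet 𝕋)
    (hμ : IsReferenceProcess P 𝕋 ℱ μ) (h : IsDecomposition P 𝕋 ℱ μ Qbar Q D)
    (H : SupermartingaleInequality P 𝕋 ℱ ρ Q D) (ht : ((t + 1 : ℕ) : ℕ∞) ∈ 𝕋)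
    (hr' : IsCondConvexRiskMeasure P 𝕋 ℱ (t + 1) (ρ (t + 1)))
    {X Y : ℕ∞ → Ω → ℝ} (hX : X ∈ BddProcess P 𝕋 ℱ) (hY : Y ∈ BddProcess P 𝕋 ℱ)
    (hXY : ∀ᵐ ω ∂P, X t ω = Y t ω)
    (hXY' : ∀ᵐ ω ∂P, riskAt ρ (t + 1) X ω ≤ riskAt ρ (t + 1) Y ω) :
    ∀ᵐ ω ∂Q, (condLoss 𝕋 ℱ Q D t X ω : EReal) ≤
      (D t ω : EReal) * (riskAt ρ t Y ω : EReal) +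
        (D t ω : EReal) * penalty P 𝕋 ℱ ρ Q D t ω := by
  have := h.isProbabilityMeasure_left
  have htt := h𝕋.mem_of_succ ht
  have hB := h.isLossSup_penalty h𝕋 hμ ht hr'
  have hVX := memLinf_riskAt hr' hX
  have hVY := memLinf_riskAt hr' hY
  have hUX := memLinf_of_mem hX htt
  have hUY := memLinf_of_mem hY htt
  have iY := h.integrable_discount_mul h𝕋 ht hVY
  have i1 : Integrable (fun ω => condLoss 𝕋 ℱ Q D (t + 1) X ω -
      D ((t + 1 : ℕ) : ℕ∞) ω * riskAt ρ (t + 1) Y ω) Q := (integrable_condLoss _ _).sub iY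
  -- The loss of X at t + 1 is at most D_{t+1}(ρ_{t+1}(X) + α_{t+1}), and the risk of X there is at
  -- most that of Y.
  have hle : ∀ᵐ ω ∂Q, ((condLoss 𝕋 ℱ Q D (t + 1) X ω -
      D ((t + 1 : ℕ) : ℕ∞) ω * riskAt ρ (t + 1) Y ω : ℝ) : EReal) ≤
      (D ((t + 1 : ℕ) : ℕ∞) ω : EReal) * penalty P 𝕋 ℱ ρ Q D (t + 1) ω := by
    filter_upwards [hB.condLoss_le h𝕋 hμ h ht hr' hX, h.ae_nonneg,
      h.locAC.ae_of_ae ht (measurableSet_le hVX.1 hVY.1) hXY'] with ω h1 h2 h3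
    rw [EReal.coe_sub, EReal.sub_le_iff_le_add (Or.inl (EReal.coe_ne_bot _))
      (Or.inl (EReal.coe_ne_top _))]
    refine (h1.trans ?_).trans (add_comm _ _).le
    gcongr
    rw [← EReal.coe_mul, EReal.coe_le_coe_iff]
    exact mul_le_mul_of_nonneg_left h3 (h2 _ ht)
  have e1 : ∀ᵐ ω ∂Q, Q[condLoss 𝕋 ℱ Q D (t + 1) X|ℱ t] ω =
      Q[fun ω => condLoss 𝕋 ℱ Q D (t + 1) X ω -
        D ((t + 1 : ℕ) : ℕ∞) ω * riskAt ρ (t + 1) Y ω|ℱ t] ω +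
      Q[fun ω => D ((t + 1 : ℕ) : ℕ∞) ω * riskAt ρ (t + 1) Y ω|ℱ t] ω := by
    have e : condLoss 𝕋 ℱ Q D (t + 1) X = (fun ω => condLoss 𝕋 ℱ Q D (t + 1) X ω -
        D ((t + 1 : ℕ) : ℕ∞) ω * riskAt ρ (t + 1) Y ω) +
        fun ω => D ((t + 1 : ℕ) : ℕ∞) ω * riskAt ρ (t + 1) Y ω := by
      funext ω
      simp
    filter_upwards [condExp_add i1 iY (ℱ t)] with ω hω
    rw [← Pi.add_apply, ← hω, ← e]
  filter_upwards [h.condLoss_succ h𝕋 hμ hX ht, e1, le_condExpE (m := ℱ t) i1 hle hB.nonneg,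
    (h.supermartingale_iff h𝕋 hμ ht hr' hY).1 (H Y hY t ht), h.condExp_discount_succ h𝕋 ht hUY hVY,
    h.locAC.ae_of_ae htt (measurableSet_eq_fun hUX.1 hUY.1) hXY] with ω h1 h2 h3 h4 h5 h6
  rw [h5] at h4
  set c : EReal := condExpE Q (ℱ t) _ ω
  set b : EReal := (D t ω : EReal) * penalty P 𝕋 ℱ ρ Q D t ω
  set q := Q[fun ω => condLoss 𝕋 ℱ Q D (t + 1) X ω -
        D ((t + 1 : ℕ) : ℕ∞) ω * riskAt ρ (t + 1) Y ω|ℱ t] ω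
  set q' := Q[fun ω => D ((t + 1 : ℕ) : ℕ∞) ω * riskAt ρ (t + 1) Y ω|ℱ t] ω
  rw [h1, h2, h6, gammaOf_of_succ_mem ht]
  have h7 : ((D ((t + 1 : ℕ) : ℕ∞) ω * Y t ω + q' : ℝ) : EReal) + (q : EReal) ≤
      ((D t ω * (Y t ω + riskAt ρ t Y ω) : ℝ) : EReal) + b :=
    (add_le_add le_rfl h3).trans h4
  -- Since −γ_t Y_t = D_{t+1} Y_t − D_t Y_t, subtracting D_t Y_t from the inequality for Y turns its
  -- left side into a bound for the loss of X, as X_t = Y_t.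
  have h8 : ((-((D t ω - D ((t + 1 : ℕ) : ℕ∞) ω) * Y t ω) + (q + q') : ℝ) : EReal) =
      ((D ((t + 1 : ℕ) : ℕ∞) ω * Y t ω + q' : ℝ) : EReal) + (q : EReal) +
        ((-(D t ω * Y t ω) : ℝ) : EReal) := by
    rw [← EReal.coe_add, ← EReal.coe_add, EReal.coe_eq_coe_iff]
    ring
  have h9 : (D t ω : EReal) * (riskAt ρ t Y ω : EReal) + b =
      ((D t ω * (Y t ω + riskAt ρ t Y ω) : ℝ) : EReal) + b + ((-(D t ω * Y t ω) : ℝ) : EReal) := by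
    rw [add_right_comm, ← EReal.coe_add, ← EReal.coe_mul]
    congr 2
    ring
  rw [h8, h9]
  exact add_le_add h7 le_rfl

end Equivalences

/-! ### Equivalence of the four conditions -/

section Equivalences

variable {Ω : Type*} [mΩ : MeasurableSpace Ω] {P : Measure Ω} {𝕋 : Set ℕ∞}
  {ℱ : Filtration ℕ mΩ} {μ : ℕ∞ → Ω → ℝ} {t : ℕ} {ρ : ℕ → (ℕ∞ → Ω → ℝ) → Ω → ℝ}
  {Qbar : Measure (OptionalSpace 𝕋 ℱ)} {Q : Measure Ω} {D : ℕ∞ → Ω → ℝ}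

/-- The penalty belonging to the composition of two consecutive risk measures. -/
theorem IsDecomposition.isLossSup_composed (h𝕋 : IsTimeSet 𝕋) (hμ : IsReferenceProcess P 𝕋 ℱ μ)
    (h : IsDecomposition P 𝕋 ℱ μ Qbar Q D) (ht : ((t + 1 : ℕ) : ℕ∞) ∈ 𝕋)
    (hρ : IsDynamicConvexRiskMeasure P 𝕋 ℱ ρ) :
    IsLossSup 𝕋 ℱ Q D t (acceptedBy P 𝕋 ℱ t (composed ρ t)) (fun ω =>
      (D t ω : EReal) * penaltyStep P 𝕋 ℱ ρ Q D t ω +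
        condExpE Q (ℱ t) (fun ω => (D ((t + 1 : ℕ) : ℕ∞) ω : EReal) *
          penalty P 𝕋 ℱ ρ Q D (t + 1) ω) ω) := by
  have hr := hρ t (h𝕋.mem_of_succ ht)
  have hr' := hρ (t + 1) ht
  rw [← acceptanceStep_add_acceptance h𝕋 ht hr hr']
  exact h.isLossSup_add h𝕋 hμ ht (fun _ hX => hX.1.1) (fun _ hX => hX.1)
    (h.isLossSup_penaltyStep h𝕋 hμ ht hr) (h.isLossSup_penalty h𝕋 hμ ht hr')

theorem IsLossSup.congr {𝒮 : Set (ℕ∞ → Ω → ℝ)} {B B' : Ω → EReal} (hB : IsLossSup 𝕋 ℱ Q D t 𝒮 B)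
    (h : ∀ᵐ ω ∂Q, B ω = B' ω) : IsLossSup 𝕋 ℱ Q D t 𝒮 B' := by
  obtain ⟨X, hX, hX'⟩ := hB.exists_seq
  refine ⟨fun Y hY => ?_, X, hX, ?_⟩
  · filter_upwards [hB.le Y hY, h] with ω h1 h2
    rwa [← h2]
  · filter_upwards [hX', h] with ω h1 h2
    rwa [← h2]

theorem acceptedBy_congr {r r' : (ℕ∞ → Ω → ℝ) → Ω → ℝ}
    (h : ∀ X ∈ BddProcessFrom P 𝕋 ℱ t, ∀ᵐ ω ∂P, r X ω = r' X ω) :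
    acceptedBy P 𝕋 ℱ t r = acceptedBy P 𝕋 ℱ t r' := by
  ext X
  refine ⟨fun hX => ⟨hX.1, ?_⟩, fun hX => ⟨hX.1, ?_⟩⟩
  · filter_upwards [h X hX.1, hX.2] with ω h1 h2
    rwa [← h1]
  · filter_upwards [h X hX.1, hX.2] with ω h1 h2
    rwa [h1]

theorem IsDecomposition.penaltyRecursion (h𝕋 : IsTimeSet 𝕋) (hμ : IsReferenceProcess P 𝕋 ℱ μ)
    (h : IsDecomposition P 𝕋 ℱ μ Qbar Q D) (hρ : IsDynamicConvexRiskMeasure P 𝕋 ℱ ρ)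
    (hE : ∀ t : ℕ, ((t + 1 : ℕ) : ℕ∞) ∈ 𝕋 → ∀ X ∈ BddProcessFrom P 𝕋 ℱ t,
      ∀ᵐ ω ∂P, ρ t X ω = composed ρ t X ω) : PenaltyRecursion P 𝕋 ℱ ρ Q D := by
  intro t ht
  have h1 := h.isLossSup_penalty h𝕋 hμ (h𝕋.mem_of_succ ht) (hρ t (h𝕋.mem_of_succ ht))
  rw [acceptedBy_congr (hE t ht)] at h1
  exact h1.unique (h.isLossSup_composed h𝕋 hμ ht hρ)

/-- By the penalty recursion the term with α_{t+1} cancels, leaving a one-step inequality. The step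
process Y of X satisfies ρ_t(Y) = ρ_t(X), and Y raised by ρ_t(Y) lies in 𝓐_{t,t+1}. That its loss is
at most D_t α_{t,t+1} is the remaining inequality. -/
theorem IsDecomposition.supermartingaleInequality (h𝕋 : IsTimeSet 𝕋)
    (hμ : IsReferenceProcess P 𝕋 ℱ μ) (h : IsDecomposition P 𝕋 ℱ μ Qbar Q D)
    (hρ : IsDynamicConvexRiskMeasure P 𝕋 ℱ ρ)
    (hE : ∀ t : ℕ, ((t + 1 : ℕ) : ℕ∞) ∈ 𝕋 → ∀ X ∈ BddProcessFrom P 𝕋 ℱ t,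
      ∀ᵐ ω ∂P, ρ t X ω = composed ρ t X ω) : SupermartingaleInequality P 𝕋 ℱ ρ Q D := by
  intro X hX t ht
  have := h.isProbabilityMeasure_left
  have htt := h𝕋.mem_of_succ ht
  have hr := hρ t htt
  have hr' := hρ (t + 1) ht
  refine (h.supermartingale_iff h𝕋 hμ ht hr' hX).2 ?_
  set Y := stepProc t (X t) (fun ω => -riskAt ρ (t + 1) X ω) with hY
  have hYb : Y ∈ BddProcessBetween P 𝕋 ℱ t ((t + 1 : ℕ) : ℕ∞) := stepProc_risk_mem h𝕋 ht hr' hX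
  have hYf : Y ∈ BddProcessFrom P 𝕋 ℱ t := bddProcessBetween_subset_from _ _ hYb
  have hV := memLinf_riskAt hr' hX
  have hU := memLinf_of_mem hX htt
  have hρY : ∀ᵐ ω ∂P, riskAt ρ t X ω = ρ t Y ω := by
    filter_upwards [hE t ht _ (proj_top_mem_from hX t)] with ω hω
    rw [composed_proj] at hω
    exact hω
  have hacc : (fun (s : ℕ∞) ω => Y s ω + if (t : ℕ∞) ≤ s then ρ t Y ω else 0) ∈
      acceptanceStep P 𝕋 ℱ ρ t := by
    have h1 := hr.add_cash_mem hYf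
    refine ⟨⟨h1.1.1, fun s hs => ?_⟩, h1.2⟩
    filter_upwards [hYb.2 s hs] with ω hω
    rw [hω]
    by_cases hts : (t : ℕ∞) ≤ s
    · have h2 : (t : ℕ∞) ≤ min s ((t + 1 : ℕ) : ℕ∞) :=
        le_min hts (by exact_mod_cast Nat.le_succ t)
      simp only [proj, hts, if_true, h2]
    · simp [proj, hts]
  have hstep := (h.isLossSup_penaltyStep h𝕋 hμ ht hr).le _ hacc
  have hYt : Y t = X t := stepProc_self _ _
  have hYt' : Y ((t + 1 : ℕ) : ℕ∞) = fun ω => -riskAt ρ (t + 1) X ω :=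
    stepProc_of_gt _ _ (by exact_mod_cast Nat.lt_succ_self t)
  have hloss := h.stepLoss_eq h𝕋 hμ ht hYb
  rw [hYt, hYt'] at hloss
  have hD : Integrable (fun ω => D t ω * X t ω) Q := h.integrable_discount_mul h𝕋 htt hU
  have hDV := h.integrable_discount_mul h𝕋 ht
    ((hU.mono (ℱ.mono (Nat.le_succ t))).add hV)
  have e1 : ∀ᵐ ω ∂Q, Q[fun ω'' => -gammaOf 𝕋 D t ω'' * X t ω'' -
      D ((t + 1 : ℕ) : ℕ∞) ω'' * -riskAt ρ (t + 1) X ω''|ℱ t] ω =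
      Q[fun ω => D ((t + 1 : ℕ) : ℕ∞) ω * (X t ω + riskAt ρ (t + 1) X ω)|ℱ t] ω - D t ω * X t ω := by
    have e : (fun ω'' => -gammaOf 𝕋 D t ω'' * X t ω'' -
      D ((t + 1 : ℕ) : ℕ∞) ω'' * -riskAt ρ (t + 1) X ω'') =
      (fun ω => D ((t + 1 : ℕ) : ℕ∞) ω * (X t ω + riskAt ρ (t + 1) X ω)) -
        fun ω => D t ω * X t ω := by
      funext ω
      rw [Pi.sub_apply, gammaOf_of_succ_mem ht]
      ring
    have hm : Measurable[ℱ t] (fun ω => D t ω * X t ω) :=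
      (h.measurable_discount htt : Measurable[ℱ t] _).mul hU.1
    rw [e]
    filter_upwards [condExp_sub hDV hD (ℱ t)] with ω hω
    rw [hω, Pi.sub_apply, condExp_of_stronglyMeasurable (ℱ.le t) hm.stronglyMeasurable hD]
  filter_upwards [h.penaltyRecursion h𝕋 hμ hρ hE t ht, hstep,
    h.condLoss_add_cash h𝕋 hμ hYf.1 htt (hr.memLinf _ hYf), hloss, e1,
    h.locAC.ae_of_ae htt (measurableSet_eq_fun (memLinf_riskAt hr hX).1 (hr.memLinf _ hYf).1) hρY]
    with ω h1 h2 h3 h4 h5 h6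
  rw [h1, ← add_assoc]
  gcongr
  rw [h3, ← h4, h5, ← h6, EReal.coe_sub, EReal.sub_le_iff_le_add (Or.inl (EReal.coe_ne_bot _))
    (Or.inl (EReal.coe_ne_top _))] at h2
  rw [EReal.coe_sub, EReal.sub_le_iff_le_add (Or.inl (EReal.coe_ne_bot _))
    (Or.inl (EReal.coe_ne_top _))] at h2
  refine h2.trans_eq ?_
  rw [add_assoc, ← EReal.coe_add, add_comm]
  congr 2
  ring

/-- The equivalent characterizations of time consistency. -/
theorem isTimeConsistent_tfae [IsProbabilityMeasure P] (h𝕋 : IsTimeSet 𝕋)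
    (hzero : ℱ 0 = ⊥) (htop : ⨆ (n : ℕ) (_ : (n : ℕ∞) ∈ 𝕋), ℱ n = mΩ)
    (hreg : InfiniteHorizon 𝕋 → IsRegularFiltration ℱ) (hμ : IsReferenceProcess P 𝕋 ℱ μ)
    (hρ : IsDynamicConvexRiskMeasure P 𝕋 ℱ ρ)
    (hc : ∀ t : ℕ, (t : ℕ∞) ∈ 𝕋 → IsContinuousFromAbove P 𝕋 ℱ ρ t) :
    List.TFAE [
      IsTimeConsistent P 𝕋 ℱ ρ,
      AcceptanceSplitting P 𝕋 ℱ ρ,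
      ∀ Qbar Q D, IsDecomposition P 𝕋 ℱ μ Qbar Q D → PenaltyRecursion P 𝕋 ℱ ρ Q D,
      ∀ Qbar Q D, IsDecomposition P 𝕋 ℱ μ Qbar Q D → SupermartingaleInequality P 𝕋 ℱ ρ Q D] := by
  tfae_have 1 ↔ 2 := (isTimeConsistent_iff h𝕋 hρ).trans (acceptanceSplitting_iff h𝕋 hρ).symm
  tfae_have 1 → 3 := fun H _ _ _ h =>
    h.penaltyRecursion h𝕋 hμ hρ ((isTimeConsistent_iff h𝕋 hρ).1 H)
  tfae_have 1 → 4 := fun H _ _ _ h =>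
    h.supermartingaleInequality h𝕋 hμ hρ ((isTimeConsistent_iff h𝕋 hρ).1 H)
  tfae_have 3 → 1 := by
    intro H
    refine (isTimeConsistent_iff h𝕋 hρ).2 fun t ht X hX => ?_
    have htt := h𝕋.mem_of_succ ht
    have hr := hρ t htt
    have hr' := hρ (t + 1) ht
    have hcr := isCondConvexRiskMeasure_composed h𝕋 ht hr hr'
    have hct := isContinuousFromAbove_composed h𝕋 ht hr' (hc t htt) (hc (t + 1) ht)
    -- Under every decomposition the losses of X are at most D_t r'(X) plus the penalty of r', which
    -- is also that of r. Duality for r then bounds r(X) by r'(X); exchanging the roles gives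
    -- equality.
    have key : ∀ {r r' : (ℕ∞ → Ω → ℝ) → Ω → ℝ}, IsCondConvexRiskMeasure P 𝕋 ℱ t r →
        IsCondConvexRiskMeasure P 𝕋 ℱ t r' → IsContinuousFromAbove P 𝕋 ℱ (fun _ => r) t →
        (∀ Qbar Q D, IsDecomposition P 𝕋 ℱ μ Qbar Q D → ∃ B, IsLossSup 𝕋 ℱ Q D t (acceptedBy P 𝕋 ℱ t r) B ∧
          IsLossSup 𝕋 ℱ Q D t (acceptedBy P 𝕋 ℱ t r') B) →
        ∀ᵐ ω ∂P, r X ω ≤ r' X ω := by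
      intro r r' h1 h2 h3 h4
      refine ae_le_of_forall_isDecomposition h𝕋 hzero htop hreg hμ h1 h3 htt hX (h2.memLinf X hX)
        fun Qbar Q D hQ => ?_
      obtain ⟨B, hB, hB'⟩ := h4 Qbar Q D hQ
      refine ⟨B, hB, ?_⟩
      filter_upwards [hB'.condLoss_le h𝕋 hμ hQ htt h2 hX.1, hQ.locAC.ae_of_ae htt
        (measurableSet_eq_fun (h2.memLinf _ (proj_top_mem_from hX.1 t)).1 (h2.memLinf X hX).1)
        (h2.proj_eq hX)] with ω h5 h6
      rwa [h6] at h5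
    have hall : ∀ Qbar Q D, IsDecomposition P 𝕋 ℱ μ Qbar Q D → ∃ B,
        IsLossSup 𝕋 ℱ Q D t (acceptedBy P 𝕋 ℱ t (ρ t)) B ∧
        IsLossSup 𝕋 ℱ Q D t (acceptedBy P 𝕋 ℱ t (composed ρ t)) B := fun Qbar Q D hQ =>
      ⟨_, (hQ.isLossSup_penalty h𝕋 hμ htt hr).congr (H Qbar Q D hQ t ht),
        hQ.isLossSup_composed h𝕋 hμ ht hρ⟩
    filter_upwards [key hr hcr (hc t htt) hall, key hcr hr hct fun Qbar Q D hQ => by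
      obtain ⟨B, hB, hB'⟩ := hall Qbar Q D hQ
      exact ⟨B, hB', hB⟩] with ω h1 h2
    exact le_antisymm h1 h2
  tfae_have 4 → 1 := by
    intro H t ht X hX Y hY hXY hXY'
    have htt := h𝕋.mem_of_succ ht
    have hr := hρ t htt
    refine ae_le_of_forall_isDecomposition h𝕋 hzero htop hreg hμ hr (hc t htt) htt
      (proj_top_mem_from hX t) (memLinf_riskAt hr hY) fun Qbar Q D hQ =>
        ⟨_, hQ.isLossSup_penalty h𝕋 hμ htt hr, ?_⟩
    filter_upwards [hQ.condLoss_le_of_supermartingale h𝕋 hμ (H Qbar Q D hQ) ht (hρ _ ht) hX hY hXY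
      hXY', hQ.condLoss_congr h𝕋 hμ (proj_top_mem hX t) hX t fun s _ hst => by
        filter_upwards with ω
        rw [proj_top, if_pos hst]] with ω h1 h2
    rwa [h2]
  tfae_finish

end Equivalences

/-! ### Decompositions of the measures equivalent to P ⊗ μ -/

section EquivalentMeasures

variable {Ω : Type*} [mΩ : MeasurableSpace Ω] {P : Measure Ω} {𝕋 : Set ℕ∞}
  {ℱ : Filtration ℕ mΩ} {μ : ℕ∞ → Ω → ℝ} {t : ℕ}
  {Qbar : Measure (OptionalSpace 𝕋 ℱ)} {Q : Measure Ω} {D : ℕ∞ → Ω → ℝ}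

theorem measurableSet_section {s : ℕ∞} {q : Ω → Prop}
    (hq : MeasurableSet[sigmaAt ℱ s] {ω | q ω}) :
    MeasurableSet {p : OptionalSpace 𝕋 ℱ | (p.time : ℕ∞) = s → q p.state} := by
  refine measurableSet_optional_iff.2 fun u => ?_
  by_cases hu : (u : ℕ∞) = s
  · subst hu
    simpa using hq
  · simp [hu]

/-- An event at the single time s is regarded as an optional set. Equivalence of `Qbar` transfers
its nullity, and Q matters only where γ_s > 0. -/
theorem IsDecomposition.ae_of_ae_left (h𝕋 : IsTimeSet 𝕋) (hμ : IsReferenceProcess P 𝕋 ℱ μ)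
    (h : IsDecomposition P 𝕋 ℱ μ Qbar Q D) (hQ : refMeasure P 𝕋 ℱ μ ≪ Qbar) {s : ℕ∞} (hs : s ∈ 𝕋)
    {q : Ω → Prop} (hq : MeasurableSet[sigmaAt ℱ s] {ω | q ω})
    (hae : ∀ᵐ ω ∂Q, 0 < gammaOf 𝕋 D s ω → q ω) : ∀ᵐ ω ∂P, q ω := by
  have hm := measurableSet_section (𝕋 := 𝕋) hq
  have h1 : ∀ᵐ p ∂Qbar, (p.time : ℕ∞) = s → q p.state := by
    rw [h.eq_refMeasure h𝕋, ae_refMeasure_iff h.measurable_gamma' hm]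
    rintro ⟨u, hu⟩
    by_cases hus : u = s
    · subst hus
      filter_upwards [hae] with ω hω h0 _
      exact hω h0
    · exact ae_of_all _ fun ω _ hus' => absurd hus' hus
  filter_upwards [(hμ.ae_refMeasure_iff hm).1 (hQ.ae_le h1) ⟨s, hs⟩] with ω hω
  exact hω rfl

theorem IsLocEquiv.ae_of_ae (hQ : IsLocEquiv P 𝕋 ℱ Q) {n : ℕ} (hn : (n : ℕ∞) ∈ 𝕋) {q : Ω → Prop}
    (hq : MeasurableSet[ℱ n] {ω | q ω}) (h : ∀ᵐ ω ∂Q, q ω) : ∀ᵐ ω ∂P, q ω := by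
  have hq' : MeasurableSet[ℱ n] {ω | ¬ q ω} := hq.compl
  have h0 : Q {ω | ¬ q ω} = 0 := h
  rw [← trim_measurableSet_eq (ℱ.le n) hq'] at h0
  have := hQ.2 n hn h0
  rwa [trim_measurableSet_eq (ℱ.le n) hq'] at this

theorem IsDecomposition.ae_gamma_pos (h𝕋 : IsTimeSet 𝕋) (hμ : IsReferenceProcess P 𝕋 ℱ μ)
    (h : IsDecomposition P 𝕋 ℱ μ Qbar Q D) (hQ : refMeasure P 𝕋 ℱ μ ≪ Qbar) {s : ℕ∞} (hs : s ∈ 𝕋) :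
    ∀ᵐ ω ∂P, 0 < gammaOf 𝕋 D s ω :=
  h.ae_of_ae_left h𝕋 hμ hQ hs
    (h.measurable_gamma hs measurableSet_Ioi)
    (ae_of_all _ fun _ h0 => h0)

theorem IsDecomposition.isLocEquiv (h𝕋 : IsTimeSet 𝕋) (hμ : IsReferenceProcess P 𝕋 ℱ μ)
    (h : IsDecomposition P 𝕋 ℱ μ Qbar Q D) (hQ : refMeasure P 𝕋 ℱ μ ≪ Qbar) :
    IsLocEquiv P 𝕋 ℱ Q := by
  refine ⟨h.locAC, fun n hn => Measure.AbsolutelyContinuous.mk fun A hA hA0 => ?_⟩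
  rw [trim_measurableSet_eq (ℱ.le n) hA] at hA0 ⊢
  have := h.ae_of_ae_left h𝕋 hμ hQ hn (q := fun ω => ω ∉ A) hA.compl
    ((measure_eq_zero_iff_ae_notMem.1 hA0).mono fun ω hω _ => hω)
  exact measure_eq_zero_iff_ae_notMem.2 this

/-- Equivalent measures on the product space in terms of their decompositions. -/
theorem IsDecomposition.absolutelyContinuous_iff (h𝕋 : IsTimeSet 𝕋)
    (htop : ⨆ (n : ℕ) (_ : (n : ℕ∞) ∈ 𝕋), ℱ n = mΩ) (hμ : IsReferenceProcess P 𝕋 ℱ μ)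
    (h : IsDecomposition P 𝕋 ℱ μ Qbar Q D) :
    refMeasure P 𝕋 ℱ μ ≪ Qbar ↔
      IsLocEquiv P 𝕋 ℱ Q ∧ (∀ t ∈ 𝕋, ∀ᵐ ω ∂P, 0 < gammaOf 𝕋 D t ω) ∧ (⊤ ∈ 𝕋 → P ≪ Q) := by
  constructor
  · intro hQ
    refine ⟨h.isLocEquiv h𝕋 hμ hQ, fun t ht => h.ae_gamma_pos h𝕋 hμ hQ ht, fun ht =>
      Measure.AbsolutelyContinuous.mk fun A hA hA0 => ?_⟩
    have hle : mΩ ≤ sigmaAt ℱ ⊤ :=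
      htop.symm.le.trans (iSup₂_le fun n _ => le_iSup (fun n => ℱ n) n)
    have := h.ae_of_ae_left h𝕋 hμ hQ ht (q := fun ω => ω ∉ A) (hle _ hA.compl)
      ((measure_eq_zero_iff_ae_notMem.1 hA0).mono fun ω hω _ => hω)
    exact measure_eq_zero_iff_ae_notMem.2 this
  · rintro ⟨hloc, hpos, hPQ⟩
    refine Measure.AbsolutelyContinuous.mk fun S hS hS0 => ?_
    have hSm : MeasurableSet {p | p ∉ S} := hS.compl
    have h1 : ∀ᵐ p ∂Qbar, p ∉ S := measure_eq_zero_iff_ae_notMem.1 hS0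
    rw [h.eq_refMeasure h𝕋, ae_refMeasure_iff h.measurable_gamma' hSm] at h1
    refine measure_eq_zero_iff_ae_notMem.2 ((hμ.ae_refMeasure_iff hSm).2 fun t => ?_)
    have hq : MeasurableSet[sigmaAt ℱ t] {ω | 0 < gammaOf 𝕋 D t ω → (⟨ω, t⟩ : OptionalSpace 𝕋 ℱ) ∉ S} := by
      have hg : MeasurableSet[sigmaAt ℱ t] {ω | 0 < gammaOf 𝕋 D t ω} :=
        h.measurable_gamma t.2 measurableSet_Ioi
      have hs : MeasurableSet[sigmaAt ℱ t] {ω | (⟨ω, t⟩ : OptionalSpace 𝕋 ℱ) ∉ S} :=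
        measurable_mk_sigmaAt t hSm
      convert hg.compl.union hs using 1
      ext ω
      simp only [Set.mem_ofPred_eq, Set.mem_union, Set.mem_compl_iff]
      tauto
    have h2 : ∀ᵐ ω ∂P, 0 < gammaOf 𝕋 D t ω → (⟨ω, t⟩ : OptionalSpace 𝕋 ℱ) ∉ S := by
      obtain ⟨t, ht⟩ := t
      induction t using ENat.recTopCoe with
      -- Local equivalence says nothing about 𝓕_∞; at time ∞ the relation P ≪ Q is what transfers
      -- null sets.
      | top => exact (hPQ ht).ae_le (h1 ⟨⊤, ht⟩)
      | coe n => exact hloc.ae_of_ae ht hq (h1 ⟨n, ht⟩)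
    filter_upwards [h2, hpos t t.2] with ω h3 h4
    exact h3 h4

end EquivalentMeasures

/-! ### Finite initial penalty and the inequality summed over time -/

section FinitePenalty

variable {Ω : Type*} [mΩ : MeasurableSpace Ω] {P : Measure Ω} {𝕋 : Set ℕ∞}
  {ℱ : Filtration ℕ mΩ} {μ : ℕ∞ → Ω → ℝ} {t : ℕ} {ρ : ℕ → (ℕ∞ → Ω → ℝ) → Ω → ℝ}
  {Qbar Qs Q₀ : Measure (OptionalSpace 𝕋 ℱ)} {Q : Measure Ω} {D : ℕ∞ → Ω → ℝ}

theorem IsTimeSet.zero_mem (h𝕋 : IsTimeSet 𝕋) : ((0 : ℕ) : ℕ∞) ∈ 𝕋 := by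
  rcases h𝕋 with ⟨T, rfl⟩ | rfl | rfl
  · simp
  · simp
  · trivial

theorem exists_condLoss_zero_eq (hzero : ℱ 0 = ⊥) (X : ℕ∞ → Ω → ℝ) :
    ∃ c : ℝ, condLoss 𝕋 ℱ Q D 0 X = fun _ => c := by
  have h := (measurable_condLoss (𝕋 := 𝕋) (ℱ := ℱ) (Q := Q) (D := D) 0 X).stronglyMeasurable
  rw [hzero] at h
  exact stronglyMeasurable_bot_iff.1 h

/-- ℱ 0 is trivial, so conditional losses at time 0 are constants and D_0 = 1; the penalty is the
supremum of these constants. -/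
theorem IsDecomposition.penalty_zero_lt_top_iff (h𝕋 : IsTimeSet 𝕋) (hzero : ℱ 0 = ⊥)
    (hμ : IsReferenceProcess P 𝕋 ℱ μ) (h : IsDecomposition P 𝕋 ℱ μ Qbar Q D)
    (hρ : IsDynamicConvexRiskMeasure P 𝕋 ℱ ρ) :
    (∀ᵐ ω ∂Q, penalty P 𝕋 ℱ ρ Q D 0 ω < ⊤) ↔
      ∃ e : ℝ, ∀ Y ∈ acceptedBy P 𝕋 ℱ 0 (ρ 0), ∫ ω, condLoss 𝕋 ℱ Q D 0 Y ω ∂Q ≤ e := by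
  have := h.isProbabilityMeasure_left
  have hB := h.isLossSup_penalty h𝕋 hμ h𝕋.zero_mem (hρ 0 h𝕋.zero_mem)
  choose c hc using exists_condLoss_zero_eq (𝕋 := 𝕋) (ℱ := ℱ) (Q := Q) (D := D) hzero
  have hint : ∀ Y, ∫ ω, condLoss 𝕋 ℱ Q D 0 Y ω ∂Q = c Y := fun Y => by simp [hc]
  have hB1 : ∀ᵐ ω ∂Q, (D ((0 : ℕ) : ℕ∞) ω : EReal) * penalty P 𝕋 ℱ ρ Q D 0 ω =
      penalty P 𝕋 ℱ ρ Q D 0 ω := by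
    filter_upwards [h.discounting.zero] with ω hω
    rw [Nat.cast_zero, hω, EReal.coe_one, one_mul]
  simp only [hint]
  constructor
  · intro hfin
    obtain ⟨Z, hZ, hZlim⟩ := hB.exists_seq
    simp only [hc] at hZlim
    obtain ⟨ω₀, h1, h2, h3, h4⟩ := (hfin.and (hB1.and (hZlim.and hB.nonneg))).exists
    rw [h2] at h3 h4
    lift penalty P 𝕋 ℱ ρ Q D 0 ω₀ to ℝ using
      ⟨h1.ne, fun hbot => by rw [hbot] at h4; exact absurd h4 (by simp)⟩ with k hk
    refine ⟨k, fun Y hY => ?_⟩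
    obtain ⟨ω, h5, h6⟩ := ((hB.le Y hY).and hZlim).exists
    rw [tendsto_nhds_unique h6.2.2 h3.2.2, hc, EReal.coe_le_coe_iff] at h5
    exact h5
  · rintro ⟨e, he⟩
    filter_upwards [hB.le_of_forall (B' := fun _ => (e : EReal)) fun Y hY =>
      ae_of_all _ fun ω => by rw [hc, EReal.coe_le_coe_iff]; exact he Y hY, hB1] with ω h1 h2
    rw [h2] at h1
    exact h1.trans_lt (EReal.coe_lt_top e)

theorem IsDecomposition.integral_condLoss_zero (h𝕋 : IsTimeSet 𝕋)
    (hμ : IsReferenceProcess P 𝕋 ℱ μ) (h : IsDecomposition P 𝕋 ℱ μ Qbar Q D) {X : ℕ∞ → Ω → ℝ}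
    (hX : X ∈ BddProcess P 𝕋 ℱ) :
    ∫ ω, condLoss 𝕋 ℱ Q D 0 X ω ∂Q = -∫ p, onOptional 𝕋 ℱ X p ∂Qbar := by
  rw [h.integral_condLoss h𝕋 hμ hX h𝕋.zero_mem]
  simp

/-- The integrated supermartingale inequality, summed over time. -/
theorem IsDecomposition.integral_supermartingale (h𝕋 : IsTimeSet 𝕋)
    (hμ : IsReferenceProcess P 𝕋 ℱ μ) (h : IsDecomposition P 𝕋 ℱ μ Qbar Q D)
    (hρ : IsDynamicConvexRiskMeasure P 𝕋 ℱ ρ) (H : SupermartingaleInequality P 𝕋 ℱ ρ Q D) {e : ℝ}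
    (he : ∀ Y ∈ acceptedBy P 𝕋 ℱ 0 (ρ 0), ∫ ω, condLoss 𝕋 ℱ Q D 0 Y ω ∂Q ≤ e)
    {X : ℕ∞ → Ω → ℝ} (hX : X ∈ BddProcess P 𝕋 ℱ) (n : ℕ) (hn : (n : ℕ∞) ∈ 𝕋) :
    ∀ Y ∈ acceptedBy P 𝕋 ℱ n (ρ n),
      ∫ ω, condLoss 𝕋 ℱ Q D 0 X ω ∂Q - ∫ ω, condLoss 𝕋 ℱ Q D n X ω ∂Q +
        ∫ ω, D n ω * riskAt ρ n X ω ∂Q + ∫ ω, condLoss 𝕋 ℱ Q D n Y ω ∂Q ≤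
      ∫ ω, D ((0 : ℕ) : ℕ∞) ω * riskAt ρ 0 X ω ∂Q + e := by
  have := h.isProbabilityMeasure_left
  induction n with
  | zero =>
    intro Y hY
    have := he Y hY
    linarith
  | succ n ih =>
    intro Y hY
    have hnn := h𝕋.mem_of_succ hn
    have hr := hρ n hnn
    have hr' := hρ (n + 1) hn
    have hB := h.isLossSup_penalty h𝕋 hμ hnn hr
    have hB' := h.isLossSup_penalty h𝕋 hμ hn hr'
    have hU := memLinf_of_mem hX hnn
    have hU' := hU.mono (ℱ.mono (Nat.le_succ n))
    have hV := memLinf_riskAt hr hX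
    have hV' := memLinf_riskAt hr' hX
    have iU := h.integrable_discount_mul h𝕋 hnn hU
    have iU' := h.integrable_discount_mul h𝕋 hn hU'
    have iV := h.integrable_discount_mul h𝕋 hnn hV
    have iV' := h.integrable_discount_mul h𝕋 hn hV'
    have iUV := h.integrable_discount_mul h𝕋 hnn (hU.add hV)
    have iUV' := h.integrable_discount_mul h𝕋 hn (hU'.add hV')
    have ih := ih hnn
    -- The induction hypothesis says that all positions accepted at n have expected loss at most β,
    -- which stands for E[D_n α_n] ≤ β without integrating extended values.
    set β := ∫ ω, D ((0 : ℕ) : ℕ∞) ω * riskAt ρ 0 X ω ∂Q + e -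
      (∫ ω, condLoss 𝕋 ℱ Q D 0 X ω ∂Q - ∫ ω, condLoss 𝕋 ℱ Q D n X ω ∂Q +
        ∫ ω, D n ω * riskAt ρ n X ω ∂Q) with hβ
    have hb : ∀ Y ∈ acceptedBy P 𝕋 ℱ n (ρ n), ∫ ω, condLoss 𝕋 ℱ Q D n Y ω ∂Q ≤ β := fun Y hY => by
      have := ih Y hY
      linarith
    have hβ0 : 0 ≤ β := by
      have := hb 0 hr.zero_mem
      rw [h.integral_condLoss h𝕋 hμ zero_mem_bddProcess hnn] at this
      simpa [onOptional] using this
    set f := fun ω => D ((n + 1 : ℕ) : ℕ∞) ω * (X n ω + riskAt ρ (n + 1) X ω) with hf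
    set g := fun ω => D n ω * (X n ω + riskAt ρ n X ω) with hg
    have iu : Integrable (fun ω => Q[f|ℱ n] ω + Q[condLoss 𝕋 ℱ Q D (n + 1) Y|ℱ n] ω - g ω) Q :=
      (integrable_condExp.add integrable_condExp).sub iUV
    -- The inequality at n, with α_{n+1} replaced by the loss of one accepted Y, puts this real
    -- function below D_n α_n, so its integral is at most β.
    have hu := hB.setIntegral_le hβ0 hb iu (by
      filter_upwards [(h.supermartingale_iff h𝕋 hμ hn hr' hX).1 (H X hX n hn),
        le_condExpE (m := ℱ n) (integrable_condLoss (n + 1) Y) (hB'.le Y hY) hB'.nonneg] with ω h1 h2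
      rw [EReal.coe_sub, EReal.sub_le_iff_le_add (Or.inl (EReal.coe_ne_bot _))
        (Or.inl (EReal.coe_ne_top _)), EReal.coe_add]
      exact ((add_le_add le_rfl h2).trans h1).trans (add_comm _ _).le) Set.univ
    have hsucc : ∫ ω, condLoss 𝕋 ℱ Q D n X ω ∂Q =
        -(∫ ω, D n ω * X n ω ∂Q - ∫ ω, D ((n + 1 : ℕ) : ℕ∞) ω * X n ω ∂Q) +
          ∫ ω, condLoss 𝕋 ℱ Q D (n + 1) X ω ∂Q := by
      have i0 : Integrable (fun ω => -(D n ω * X n ω - D ((n + 1 : ℕ) : ℕ∞) ω * X n ω)) Q :=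
        (iU.sub iU').neg
      rw [← integral_sub iU iU', ← integral_neg,
        ← integral_condExp (ℱ.le n) (f := condLoss 𝕋 ℱ Q D (n + 1) X),
        ← integral_add i0 integrable_condExp]
      refine integral_congr_ae ?_
      filter_upwards [h.condLoss_succ h𝕋 hμ hX hn] with ω hω
      rw [hω, gammaOf_of_succ_mem hn, sub_mul]
    have i1 : ∫ ω, (Q[f|ℱ n] ω + Q[condLoss 𝕋 ℱ Q D (n + 1) Y|ℱ n] ω - g ω) ∂Q =
        ∫ ω, f ω ∂Q + ∫ ω, condLoss 𝕋 ℱ Q D (n + 1) Y ω ∂Q - ∫ ω, g ω ∂Q := by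
      have i0 : Integrable (fun ω => Q[f|ℱ n] ω + Q[condLoss 𝕋 ℱ Q D (n + 1) Y|ℱ n] ω) Q :=
        integrable_condExp.add integrable_condExp
      rw [integral_sub i0 iUV,
        integral_add integrable_condExp integrable_condExp, integral_condExp (ℱ.le n),
        integral_condExp (ℱ.le n)]
    have i2 : ∫ ω, f ω ∂Q = ∫ ω, D ((n + 1 : ℕ) : ℕ∞) ω * X n ω ∂Q +
        ∫ ω, D ((n + 1 : ℕ) : ℕ∞) ω * riskAt ρ (n + 1) X ω ∂Q := by
      rw [← integral_add iU' iV']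
      simp only [hf, mul_add]
    have i3 : ∫ ω, g ω ∂Q = ∫ ω, D n ω * X n ω ∂Q + ∫ ω, D n ω * riskAt ρ n X ω ∂Q := by
      rw [← integral_add iU iV]
      simp only [hg, mul_add]
    rw [setIntegral_univ, i1, i2, i3] at hu
    linarith

theorem integral_comp_eq_of_preimage {α β : Type*} [MeasurableSpace α] [MeasurableSpace β]
    {m m' : Measure α} {g : α → β} (hg : Measurable g) {V : β → ℝ} (hV : Measurable V)
    (h : ∀ A, MeasurableSet A → m (g ⁻¹' A) = m' (g ⁻¹' A)) :
    ∫ x, V (g x) ∂m = ∫ x, V (g x) ∂m' := by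
  rw [← integral_map hg.aemeasurable hV.aestronglyMeasurable,
    ← integral_map hg.aemeasurable hV.aestronglyMeasurable]
  congr 1
  ext A hA
  rw [Measure.map_apply hg hA, Measure.map_apply hg hA, h A hA]

theorem integral_onTail_eq_of_marginal [Nonempty Ω] {V : Ω → ℝ} (hV : Measurable[ℱ t] V)
    (hmarg : ∀ A, MeasurableSet[ℱ t] A → Q₀ {p | (t : ℕ∞) ≤ p.time ∧ p.state ∈ A} =
      Qs {p | (t : ℕ∞) ≤ p.time ∧ p.state ∈ A}) :
    ∫ p, onTail 𝕋 ℱ t V p ∂Q₀ = ∫ p, onTail 𝕋 ℱ t V p ∂Qs := by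
  classical
  obtain ⟨ω₀⟩ := ‹Nonempty Ω›
  -- The value ω₀ before t makes the projection to the state measurable into ℱ t.
  set g : OptionalSpace 𝕋 ℱ → Ω := fun p => if (t : ℕ∞) ≤ p.time then p.state else ω₀ with hg
  have hgm : Measurable[_, ℱ t] g := by
    intro A hA
    have : g ⁻¹' A = {p | (t : ℕ∞) ≤ p.time ∧ p.state ∈ A} ∪
        ({p | (t : ℕ∞) ≤ p.time}ᶜ ∩ {_p | ω₀ ∈ A}) := by
      ext p
      by_cases hp : (t : ℕ∞) ≤ p.time <;> simp [hg, hp]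
    rw [this]
    exact (measurableSet_time_state hA).union
      (measurableSet_time.compl.inter (MeasurableSet.const _))
  have hset : ∀ ν : Measure (OptionalSpace 𝕋 ℱ), ∫ p, onTail 𝕋 ℱ t V p ∂ν =
      ∫ p, V (g p) ∂(ν.restrict {p | (t : ℕ∞) ≤ p.time}) := by
    intro ν
    rw [← integral_indicator measurableSet_time]
    refine integral_congr_ae (ae_of_all _ fun p => ?_)
    rw [onTail_apply]
    by_cases hp : (t : ℕ∞) ≤ p.time <;> simp [hg, hp, Set.indicator]
  rw [hset, hset]
  refine @integral_comp_eq_of_preimage _ _ _ (ℱ t) _ _ _ hgm _ hV fun A hA => ?_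
  have hpre : g ⁻¹' A ∩ {p | (t : ℕ∞) ≤ p.time} = {p | (t : ℕ∞) ≤ p.time ∧ p.state ∈ A} := by
    ext p
    by_cases hp : (t : ℕ∞) ≤ p.time <;> simp [hg, hp]
  rw [Measure.restrict_apply (hgm hA), Measure.restrict_apply (hgm hA), hpre, hmarg A hA]

end FinitePenalty

/-! ### Duality within the equivalent measures of finite penalty -/

section FinitePenalty

variable {Ω : Type*} [mΩ : MeasurableSpace Ω] {P : Measure Ω} {𝕋 : Set ℕ∞}
  {ℱ : Filtration ℕ mΩ} {μ : ℕ∞ → Ω → ℝ} {t : ℕ} {ρ : ℕ → (ℕ∞ → Ω → ℝ) → Ω → ℝ}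
  {Qbar Qs Q₀ : Measure (OptionalSpace 𝕋 ℱ)} {Q : Measure Ω} {D : ℕ∞ → Ω → ℝ}

theorem IsDecomposition.integral_onTail (h𝕋 : IsTimeSet 𝕋) (hμ : IsReferenceProcess P 𝕋 ℱ μ)
    (h : IsDecomposition P 𝕋 ℱ μ Qs Q D) (ht : (t : ℕ∞) ∈ 𝕋) {V : Ω → ℝ} (hV : MemLinf P (ℱ t) V) :
    ∫ p, onTail 𝕋 ℱ t V p ∂Qs = ∫ ω, D t ω * V ω ∂Q := by
  have h1 := h.integral_condLoss h𝕋 hμ (cash_mem_bddProcess hV) ht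
  have h2 : ∫ p in {p | (t : ℕ∞) ≤ p.time}, onOptional 𝕋 ℱ
      (fun (s : ℕ∞) ω => if (t : ℕ∞) ≤ s then V ω else 0) p ∂Qs = ∫ p, onTail 𝕋 ℱ t V p ∂Qs := by
    rw [← integral_indicator measurableSet_time]
    refine integral_congr_ae (ae_of_all _ fun p => ?_)
    rw [onTail_apply]
    by_cases hp : (t : ℕ∞) ≤ p.time <;> simp [hp, onOptional, Set.indicator]
  rw [h2] at h1
  have h3 : ∫ ω, condLoss 𝕋 ℱ Q D t (fun (s : ℕ∞) ω => if (t : ℕ∞) ≤ s then V ω else 0) ω ∂Q =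
      ∫ ω, (condLoss 𝕋 ℱ Q D t 0 ω - D t ω * V ω) ∂Q := by
    refine integral_congr_ae ?_
    filter_upwards [h.condLoss_add_cash h𝕋 hμ zero_mem_bddProcess ht hV] with ω hω
    rw [← hω]
    simp
  rw [integral_sub (integrable_condLoss _ _) (h.integrable_discount_mul h𝕋 ht hV),
    h.integral_condLoss h𝕋 hμ zero_mem_bddProcess ht] at h3
  simp only [onOptional, Pi.zero_apply, integral_zero, neg_zero, zero_sub] at h3
  linarith

/-- Replacing a fraction of an equivalent measure with finite penalty after time `t` keeps the
penalty finite. -/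
theorem exists_isEquivFinitePenalty_pasted [IsProbabilityMeasure P] (h𝕋 : IsTimeSet 𝕋)
    (hzero : ℱ 0 = ⊥) (htop : ⨆ (n : ℕ) (_ : (n : ℕ∞) ∈ 𝕋), ℱ n = mΩ)
    (hreg : InfiniteHorizon 𝕋 → IsRegularFiltration ℱ)
    (hμ : IsReferenceProcess P 𝕋 ℱ μ) (hρ : IsDynamicConvexRiskMeasure P 𝕋 ℱ ρ)
    (hE : IsEquivFinitePenalty P 𝕋 ℱ μ ρ Qs Q D) (H : SupermartingaleInequality P 𝕋 ℱ ρ Q D)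
    (ht : (t : ℕ∞) ∈ 𝕋) [IsFiniteMeasure Q₀] (hac : Q₀ ≪ refMeasure P 𝕋 ℱ μ)
    (h0 : Q₀ {p | ¬ (t : ℕ∞) ≤ p.time} = 0)
    (hmarg : ∀ A, MeasurableSet[ℱ t] A → Q₀ {p | (t : ℕ∞) ≤ p.time ∧ p.state ∈ A} =
        Qs {p | (t : ℕ∞) ≤ p.time ∧ p.state ∈ A}) {b : ℝ}
    (hb : ∀ Y ∈ acceptedBy P 𝕋 ℱ t (ρ t), -∫ p, onOptional 𝕋 ℱ Y p ∂Q₀ ≤ b) {k : ℝ} (hk0 : 0 ≤ k)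
    (hk1 : k < 1) :
    ∃ Q' D', IsEquivFinitePenalty P 𝕋 ℱ μ ρ (pasted t k Qs Q₀) Q' D' := by
  obtain ⟨h, hQs', hfin⟩ := hE
  have := h.isProbabilityMeasure
  have hQs := h.absolutelyContinuous
  have hmt := hmarg Set.univ MeasurableSet.univ
  simp only [Set.mem_univ, and_true] at hmt
  have := isProbabilityMeasure_pasted hk0 hk1.le h0 hmt
  have hac' : pasted t k Qs Q₀ ≪ refMeasure P 𝕋 ℱ μ := pasted_absolutelyContinuous hQs hac k
  obtain ⟨Q', D', h'⟩ := hμ.exists_isDecomposition h𝕋 hzero htop hreg hac'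
  refine ⟨Q', D', h', absolutelyContinuous_pasted hQs' hk1,
    (h'.penalty_zero_lt_top_iff h𝕋 hzero hμ hρ).2 ?_⟩
  obtain ⟨e, he⟩ := (h.penalty_zero_lt_top_iff h𝕋 hzero hμ hρ).1 hfin
  have hr := hρ t ht
  -- The loss under the pasted measure is 1 − k times the loss under Qs plus k times the Qs-loss
  -- before t followed by the Q₀-loss from t on. The first loss is at most e. In the second, the
  -- summed inequality bounds the past by e − E[D_t ρ_t(X)], and `hb` for X raised by ρ_t(X) bounds
  -- the future by b + E[D_t ρ_t(X)]. The risk terms cancel because the marginals on ℱ t agree.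
  refine ⟨e + k * b, fun X hX => ?_⟩
  have hXb : X ∈ BddProcess P 𝕋 ℱ := hX.1.1
  have hV := memLinf_riskAt hr hXb
  set V := riskAt ρ t X with hVdef
  have hp := proj_top_mem_from hXb (t : ℕ∞)
  set X' : ℕ∞ → Ω → ℝ := fun s ω => proj t ⊤ X s ω + if (t : ℕ∞) ≤ s then V ω else 0 with hX'
  have hacc : X' ∈ acceptedBy P 𝕋 ℱ t (ρ t) := hr.add_cash_mem hp
  have hclaim := h.integral_supermartingale h𝕋 hμ hρ H he hXb t ht
  have hc1 := hclaim X' hacc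
  have hc0 := hclaim 0 hr.zero_mem
  have hz : ∫ ω, condLoss 𝕋 ℱ Q D t 0 ω ∂Q = 0 := by
    rw [h.integral_condLoss h𝕋 hμ zero_mem_bddProcess ht]
    simp [onOptional]
  have hK : ∫ ω, D ((0 : ℕ) : ℕ∞) ω * riskAt ρ 0 X ω ∂Q ≤ 0 := by
    refine integral_nonpos_of_ae ?_
    have hr0 := hρ 0 h𝕋.zero_mem
    have hle : ∀ᵐ ω ∂P, riskAt ρ 0 X ω ≤ 0 := by
      filter_upwards [riskAt_eq hr0 hX.1, hX.2] with ω h1 h2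
      rwa [h1]
    filter_upwards [h.ae_nonneg, h.locAC.ae_of_ae h𝕋.zero_mem
      (measurableSet_le (memLinf_riskAt hr0 hXb).1 measurable_const) hle] with ω h1 h2
    exact mul_nonpos_of_nonneg_of_nonpos (h1 _ h𝕋.zero_mem) h2
  have iV := h.integrable_discount_mul h𝕋 ht hV
  have hLX' : ∫ ω, condLoss 𝕋 ℱ Q D t X' ω ∂Q =
      ∫ ω, condLoss 𝕋 ℱ Q D t X ω ∂Q - ∫ ω, D t ω * V ω ∂Q := by
    rw [← integral_sub (integrable_condLoss _ _) iV]
    refine integral_congr_ae ?_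
    filter_upwards [h.condLoss_add_cash h𝕋 hμ hp.1 ht hV,
      h.condLoss_congr h𝕋 hμ hp.1 hXb t fun s _ hst => by
        filter_upwards with ω
        rw [proj_top, if_pos hst]] with ω h1 h2
    rw [h1, h2]
  have : Nonempty Ω := P.nonempty_of_neZero
  have hQ₀X' : ∫ p, onOptional 𝕋 ℱ X' p ∂Q₀ =
      ∫ p in {p | (t : ℕ∞) ≤ p.time}, onOptional 𝕋 ℱ X p ∂Q₀ + ∫ ω, D t ω * V ω ∂Q := by
    rw [← h.integral_onTail h𝕋 hμ ht hV, ← integral_onTail_eq_of_marginal hV.1 hmarg,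
      ← integral_indicator measurableSet_time,
      ← integral_add ((integrable_onOptional hμ hac hXb).indicator measurableSet_time)
        (integrable_onTail hμ hac hV)]
    refine integral_congr_ae (ae_of_all _ fun p => ?_)
    simp only [onTail_apply]
    by_cases hp : (t : ℕ∞) ≤ p.time <;> simp [hp, onOptional, hX', proj_top, Set.indicator]
  have hb' := hb X' hacc
  have hsplit : ∀ {ν : Measure (OptionalSpace 𝕋 ℱ)} [IsFiniteMeasure ν], ν ≪ refMeasure P 𝕋 ℱ μ →
      ∫ p, onOptional 𝕋 ℱ X p ∂ν = ∫ p in {p | (t : ℕ∞) ≤ p.time}, onOptional 𝕋 ℱ X p ∂ν +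
        ∫ p in {p | (t : ℕ∞) ≤ p.time}ᶜ, onOptional 𝕋 ℱ X p ∂ν := fun {ν} _ hν =>
    (integral_add_compl measurableSet_time (integrable_onOptional hμ hν hXb)).symm
  have e1 := h.integral_condLoss_zero h𝕋 hμ hXb
  have e2 := h.integral_condLoss h𝕋 hμ hXb ht
  rw [h'.integral_condLoss_zero h𝕋 hμ hXb, hsplit hac', setIntegral_pasted_compl k h0,
    setIntegral_pasted hk0 hk1.le measurableSet_time subset_rfl (integrable_onOptional hμ hQs hXb)
      (integrable_onOptional hμ hac hXb)]
  rw [hsplit hQs] at e1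
  rw [hz, e1, e2] at hc0
  rw [hLX', e1, e2] at hc1
  rw [hQ₀X'] at hb'
  have f1 := mul_le_mul_of_nonneg_left hc1 (sub_nonneg.2 hk1.le)
  have f2 := mul_le_mul_of_nonneg_left hc0 hk0
  have f3 := mul_le_mul_of_nonneg_left hb' hk0
  linarith

/-- A position whose losses are dominated, under every equivalent measure with finite penalty, by
`V` and the penalty has risk at most `V`. -/
theorem ae_le_of_forall_isEquivFinitePenalty [IsProbabilityMeasure P] (h𝕋 : IsTimeSet 𝕋)
    (hzero : ℱ 0 = ⊥) (htop : ⨆ (n : ℕ) (_ : (n : ℕ∞) ∈ 𝕋), ℱ n = mΩ)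
    (hreg : InfiniteHorizon 𝕋 → IsRegularFiltration ℱ)
    (hμ : IsReferenceProcess P 𝕋 ℱ μ) (hρ : IsDynamicConvexRiskMeasure P 𝕋 ℱ ρ)
    (hE : IsEquivFinitePenalty P 𝕋 ℱ μ ρ Qs Q D) (H : SupermartingaleInequality P 𝕋 ℱ ρ Q D)
    (ht : (t : ℕ∞) ∈ 𝕋) (hc : IsContinuousFromAbove P 𝕋 ℱ ρ t) {X : ℕ∞ → Ω → ℝ}
    (hX : X ∈ BddProcessFrom P 𝕋 ℱ t) {V : Ω → ℝ} (hV : MemLinf P (ℱ t) V)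
    (hdom : ∀ Qbar Q D, IsEquivFinitePenalty P 𝕋 ℱ μ ρ Qbar Q D →
      ∀ᵐ ω ∂Q, (condLoss 𝕋 ℱ Q D t X ω : EReal) ≤
        (D t ω : EReal) * (V ω : EReal) + (D t ω : EReal) * penalty P 𝕋 ℱ ρ Q D t ω) :
    ∀ᵐ ω ∂P, ρ t X ω ≤ V ω := by
  by_contra hXV
  have h := hE.1
  have := h.isProbabilityMeasure
  have hQs := h.absolutelyContinuous
  have hr := hρ t ht
  obtain ⟨A, hA, Q₀, hfin, hac, h0, hmarg, b, c, hcpos, hb, hbc⟩ :=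
    exists_separating hμ hr hc ht hQs hE.2.1 hX hV hXV
  obtain ⟨e₀, he₀⟩ := (h.penalty_zero_lt_top_iff h𝕋 hzero hμ hρ).1 hE.2.2
  -- The inequality summed up to t, for the zero process, bounds the Qs-losses of all positions
  -- accepted at t.
  obtain ⟨e, he⟩ : ∃ e : ℝ, ∀ Y ∈ acceptedBy P 𝕋 ℱ t (ρ t),
      -∫ p in {p | (t : ℕ∞) ≤ p.time}, onOptional 𝕋 ℱ Y p ∂Qs ≤ e := by
    refine ⟨∫ ω, D ((0 : ℕ) : ℕ∞) ω * riskAt ρ 0 0 ω ∂Q + e₀ -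
      (∫ ω, condLoss 𝕋 ℱ Q D 0 0 ω ∂Q - ∫ ω, condLoss 𝕋 ℱ Q D t 0 ω ∂Q +
        ∫ ω, D t ω * riskAt ρ t 0 ω ∂Q), fun Y hY => ?_⟩
    have := h.integral_supermartingale h𝕋 hμ hρ H he₀ zero_mem_bddProcess t ht Y hY
    rw [← h.integral_condLoss h𝕋 hμ hY.1.1 ht]
    exact le_sub_iff_add_le'.2 this
  have hW : (fun s ω => X s ω + if (t : ℕ∞) ≤ s then V ω else 0) ∈ BddProcess P 𝕋 ℱ :=
    add_mem_bddProcess hX.1 (cash_mem_bddProcess hV)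
  set x := -∫ p in {p | (t : ℕ∞) ≤ p.time ∧ p.state ∈ A},
    onOptional 𝕋 ℱ (fun s ω => X s ω + if (t : ℕ∞) ≤ s then V ω else 0) p ∂Qs with hx
  -- Keeping the fraction δ of Qs after t changes the separation gap c to at least (1 − δ)c + δ(x −
  -- e) ≥ c − δ(|e − x| + c) = c/2.
  set δ := c / (2 * (|e - x| + c)) with hδ
  have hden : 0 < |e - x| + c := by positivity
  have hδ0 : 0 < δ := by positivity
  have hδc : δ * (|e - x| + c) = c / 2 := by
    rw [hδ]
    field_simp
  have hδ1 : δ ≤ 1 := by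
    have : c ≤ |e - x| + c := by linarith [abs_nonneg (e - x)]
    rw [hδ, div_le_one (by positivity)]
    linarith
  have hk0 : 0 ≤ 1 - δ := by linarith
  have hk1 : 1 - δ < 1 := by linarith
  obtain ⟨Q', D', hE'⟩ := exists_isEquivFinitePenalty_pasted h𝕋 hzero htop hreg hμ hρ hE H ht hac h0
    hmarg hb hk0 hk1
  refine hE'.1.not_dominated h𝕋 hμ ht (fun _ hY => hY.1.1) hr.zero_mem
    (hE'.1.isLossSup_penalty h𝕋 hμ ht hr) (b := δ * e + (1 - δ) * b) (fun Y hY => ?_) hX.1 hV hA ?_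
    (hdom _ _ _ hE')
  · rw [setIntegral_pasted hk0 hk1.le measurableSet_time subset_rfl
      (integrable_onOptional hμ hQs hY.1.1) (integrable_onOptional hμ hac hY.1.1),
      setIntegral_eq_integral_of_ae_compl_eq_zero (μ := Q₀)]
    · have h1 := mul_le_mul_of_nonneg_left (he Y hY) hδ0.le
      have h2 := mul_le_mul_of_nonneg_left (hb Y hY) hk0
      linarith
    · filter_upwards [measure_eq_zero_iff_ae_notMem.1 h0] with p hp hp'
      exact absurd hp' hp
  · rw [setIntegral_pasted hk0 hk1.le (measurableSet_time_state hA) (fun p hp => hp.1)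
      (integrable_onOptional hμ hQs hW) (integrable_onOptional hμ hac hW)]
    have h2 := mul_le_mul_of_nonneg_left hbc hk0
    have h3 : δ * (e - x) ≤ δ * |e - x| := mul_le_mul_of_nonneg_left (le_abs_self _) hδ0.le
    rw [mul_add] at hδc
    rw [mul_sub] at h3
    rw [hx] at h3 hδc
    linarith

end FinitePenalty

/-! ### Robust representation and time consistency from 𝓠* alone -/

section Representation

variable {Ω : Type*} [mΩ : MeasurableSpace Ω] {P : Measure Ω} {𝕋 : Set ℕ∞}
  {ℱ : Filtration ℕ mΩ} {μ : ℕ∞ → Ω → ℝ} {t : ℕ} {ρ : ℕ → (ℕ∞ → Ω → ℝ) → Ω → ℝ}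
  {Qbar Qs Q₀ : Measure (OptionalSpace 𝕋 ℱ)} {Q : Measure Ω} {D : ℕ∞ → Ω → ℝ}

theorem measurable_discountedLoss (X : ℕ∞ → Ω → ℝ) :
    Measurable[ℱ t] (discountedLoss 𝕋 ℱ Q D t X) :=
  stronglyMeasurable_condExp.measurable

theorem IsDecomposition.measurable_penalty (h : IsDecomposition P 𝕋 ℱ μ Qbar Q D)
    (ht : (t : ℕ∞) ∈ 𝕋) : Measurable[ℱ t] (penalty P 𝕋 ℱ ρ Q D t) := by
  have := h.isProbabilityMeasure_left
  refine Measurable.ite (m := ℱ t) (h.measurable_discount ht measurableSet_Ioi)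
    (isEssSup_essSupFamily Q (ℱ.le t) _ ?_).measurable measurable_const
  rintro f ⟨X, -, rfl⟩
  exact (measurable_discountedLoss X).coe_real_ereal

theorem measurableSet_le_coe_add {m : MeasurableSpace Ω} {u v : Ω → ℝ} {w : Ω → EReal}
    (hu : Measurable[m] u) (hv : Measurable[m] v) (hw : Measurable[m] w) :
    MeasurableSet[m] {ω | (u ω : EReal) ≤ (v ω : EReal) + w ω} := by
  have : {ω | (u ω : EReal) ≤ (v ω : EReal) + w ω} = {ω | ((u ω - v ω : ℝ) : EReal) ≤ w ω} := by
    ext ω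
    simp only [Set.mem_ofPred_eq]
    rw [EReal.coe_sub, EReal.sub_le_iff_le_add (Or.inl (EReal.coe_ne_bot _))
      (Or.inl (EReal.coe_ne_top _)), add_comm]
  rw [this]
  exact measurableSet_le (hu.sub hv).coe_real_ereal hw

theorem coe_sub_le_coe_iff (a v : ℝ) (x : EReal) :
    (a : EReal) - x ≤ v ↔ (a : EReal) ≤ (v : EReal) + x :=
  EReal.sub_le_iff_le_add (Or.inr (EReal.coe_ne_top _)) (Or.inr (EReal.coe_ne_bot _))

theorem IsDecomposition.ae_discount_pos (h𝕋 : IsTimeSet 𝕋) (hμ : IsReferenceProcess P 𝕋 ℱ μ)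
    (h : IsDecomposition P 𝕋 ℱ μ Qbar Q D) (hQ : refMeasure P 𝕋 ℱ μ ≪ Qbar) (ht : (t : ℕ∞) ∈ 𝕋) :
    ∀ᵐ ω ∂Q, 0 < D t ω := by
  have hg := h.locAC.ae_of_ae ht (h.measurable_gamma ht measurableSet_Ioi)
    (h.ae_gamma_pos h𝕋 hμ hQ ht)
  filter_upwards [hg, h.ae_nonneg] with ω h1 h2
  have h1 : 0 < gammaOf 𝕋 D t ω := h1
  unfold gammaOf at h1
  split_ifs at h1 with hc
  · linarith [h2 _ hc.2]
  · exact h1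

/-- Each member of the dual family lies below the risk measure. -/
theorem IsEquivFinitePenalty.le_risk (h𝕋 : IsTimeSet 𝕋) (hμ : IsReferenceProcess P 𝕋 ℱ μ)
    (hρ : IsDynamicConvexRiskMeasure P 𝕋 ℱ ρ) (hE : IsEquivFinitePenalty P 𝕋 ℱ μ ρ Qbar Q D)
    (ht : (t : ℕ∞) ∈ 𝕋) {X : ℕ∞ → Ω → ℝ} (hX : X ∈ BddProcessFrom P 𝕋 ℱ t) :
    ∀ᵐ ω ∂P, (discountedLoss 𝕋 ℱ Q D t X ω : EReal) ≤
      (ρ t X ω : EReal) + penalty P 𝕋 ℱ ρ Q D t ω := by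
  obtain ⟨h, hQ, -⟩ := hE
  have hr := hρ t ht
  refine (h.isLocEquiv h𝕋 hμ hQ).ae_of_ae ht (measurableSet_le_coe_add (measurable_discountedLoss X)
    (hr.memLinf X hX).1 (h.measurable_penalty ht)) ?_
  have hB := h.isLossSup_penalty h𝕋 hμ ht hr
  filter_upwards [hB.condLoss_le h𝕋 hμ h ht hr hX.1, h.condLoss_eq h𝕋 hμ hX.1 ht,
    h.ae_discount_pos h𝕋 hμ hQ ht, h.locAC.ae_of_ae ht
      (measurableSet_eq_fun (hr.memLinf _ (proj_top_mem_from hX.1 t)).1 (hr.memLinf X hX).1)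
      (hr.proj_eq hX)] with ω h1 h2 h3 h4
  rw [h4, h2, EReal.coe_mul, ← EReal.left_distrib_of_nonneg_of_ne_top (EReal.coe_nonneg.2 h3.le)
    (EReal.coe_ne_top _)] at h1
  have h5 := mul_le_mul_of_nonneg_left h1 (EReal.coe_nonneg.2 (inv_nonneg.2 h3.le))
  rwa [← mul_assoc, ← mul_assoc, ← EReal.coe_mul, inv_mul_cancel₀ h3.ne', EReal.coe_one, one_mul,
    one_mul] at h5

/-- Given an extended upper bound g of the dual family, its truncation to a bounded variable still
dominates the family, and duality over 𝓠* places ρ_t(X) below it. -/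
theorem robustRepresentation [IsProbabilityMeasure P] (h𝕋 : IsTimeSet 𝕋)
    (hzero : ℱ 0 = ⊥) (htop : ⨆ (n : ℕ) (_ : (n : ℕ∞) ∈ 𝕋), ℱ n = mΩ)
    (hreg : InfiniteHorizon 𝕋 → IsRegularFiltration ℱ)
    (hμ : IsReferenceProcess P 𝕋 ℱ μ) (hρ : IsDynamicConvexRiskMeasure P 𝕋 ℱ ρ)
    (hc : ∀ t : ℕ, (t : ℕ∞) ∈ 𝕋 → IsContinuousFromAbove P 𝕋 ℱ ρ t)
    (hE : IsEquivFinitePenalty P 𝕋 ℱ μ ρ Qs Q D) (H : SupermartingaleInequality P 𝕋 ℱ ρ Q D) :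
    RobustRepresentation P 𝕋 ℱ μ ρ := by
  intro t ht X hX
  have hr := hρ t ht
  have hXm := hr.memLinf X hX
  refine ⟨hXm.1.coe_real_ereal, ?_, fun g hg hle => ?_⟩
  · rintro f ⟨Qbar, Q, D, hQ, rfl⟩
    filter_upwards [hQ.le_risk h𝕋 hμ hρ ht hX] with ω hω
    rwa [coe_sub_le_coe_iff]
  · obtain ⟨C, hC⟩ := hXm.2
    -- The upper level costs nothing, since the family lies below ρ_t(X) ≤ |C|. The lower level is
    -- strictly below ρ_t(X), so ρ_t(X) ≤ G still implies ρ_t(X) ≤ g.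
    set G : Ω → EReal := fun ω => max ((-|C| - 1 : ℝ) : EReal) (min (g ω) ((|C| : ℝ) : EReal)) with hG
    have hlo : (-|C| - 1 : ℝ) ≤ |C| := by linarith [abs_nonneg C]
    have hGle : ∀ ω, G ω ≤ ((|C| : ℝ) : EReal) := fun ω =>
      max_le (EReal.coe_le_coe_iff.2 hlo) (min_le_right _ _)
    have hGge : ∀ ω, ((-|C| - 1 : ℝ) : EReal) ≤ G ω := fun ω => le_max_left _ _
    have hGcoe : ∀ ω, ((G ω).toReal : EReal) = G ω := fun ω =>
      EReal.coe_toReal ((hGle ω).trans_lt (EReal.coe_lt_top _)).ne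
        ((EReal.bot_lt_coe _).trans_le (hGge ω)).ne'
    have hV : MemLinf P (ℱ t) (fun ω => (G ω).toReal) := by
      refine ⟨(measurable_const.max (hg.min measurable_const)).ereal_toReal, |C| + 1,
        ae_of_all _ fun ω => abs_le.2 ⟨?_, ?_⟩⟩
      · have := hGge ω
        rw [← hGcoe, EReal.coe_le_coe_iff] at this
        linarith
      · have := hGle ω
        rw [← hGcoe, EReal.coe_le_coe_iff] at this
        linarith
    have hXV := ae_le_of_forall_isEquivFinitePenalty h𝕋 hzero htop hreg hμ hρ hE H ht (hc t ht) hX hV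
      fun Qbar Q D hQ => by
        have hP : ∀ᵐ ω ∂P, (discountedLoss 𝕋 ℱ Q D t X ω : EReal) ≤
            ((G ω).toReal : EReal) + penalty P 𝕋 ℱ ρ Q D t ω := by
          filter_upwards [hQ.le_risk h𝕋 hμ hρ ht hX, hle _ ⟨Qbar, Q, D, hQ, rfl⟩, hC] with ω h1 h2 h3
          rw [← coe_sub_le_coe_iff] at h1 ⊢
          rw [hGcoe]
          exact le_max_of_le_right (le_min h2 (h1.trans
            (EReal.coe_le_coe_iff.2 ((abs_le.1 h3).2.trans (le_abs_self C)))))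
        filter_upwards [hQ.1.condLoss_eq h𝕋 hμ hX.1 ht, hQ.1.ae_nonneg, hQ.1.locAC.ae_of_ae ht
          (measurableSet_le_coe_add (measurable_discountedLoss X) hV.1 (hQ.1.measurable_penalty ht))
          hP] with ω h1 h2 h3
        have hD := EReal.coe_nonneg.2 (h2 _ ht)
        rw [h1, EReal.coe_mul, ← EReal.left_distrib_of_nonneg_of_ne_top hD (EReal.coe_ne_top _)]
        exact mul_le_mul_of_nonneg_left h3 hD
    filter_upwards [hXV, hC] with ω h1 h2
    have h3 : (ρ t X ω : EReal) ≤ G ω := by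
      rw [← hGcoe]
      exact EReal.coe_le_coe_iff.2 h1
    rcases le_max_iff.1 h3 with h4 | h4
    · rw [EReal.coe_le_coe_iff] at h4
      linarith [(abs_le.1 h2).1, le_abs_self C]
    · exact h4.trans (min_le_left _ _)

/-- The same domination of losses as for (iv) ⟹ (i), now tested on 𝓠* only; the given member of 𝓠*
is the base measure for pasting. -/
theorem isTimeConsistent_of_supermartingale [IsProbabilityMeasure P] (h𝕋 : IsTimeSet 𝕋)
    (hzero : ℱ 0 = ⊥) (htop : ⨆ (n : ℕ) (_ : (n : ℕ∞) ∈ 𝕋), ℱ n = mΩ)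
    (hreg : InfiniteHorizon 𝕋 → IsRegularFiltration ℱ)
    (hμ : IsReferenceProcess P 𝕋 ℱ μ) (hρ : IsDynamicConvexRiskMeasure P 𝕋 ℱ ρ)
    (hc : ∀ t : ℕ, (t : ℕ∞) ∈ 𝕋 → IsContinuousFromAbove P 𝕋 ℱ ρ t)
    (hE : IsEquivFinitePenalty P 𝕋 ℱ μ ρ Qs Q D)
    (H : ∀ Qbar Q D, IsEquivFinitePenalty P 𝕋 ℱ μ ρ Qbar Q D →
      SupermartingaleInequality P 𝕋 ℱ ρ Q D) : IsTimeConsistent P 𝕋 ℱ ρ := by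
  intro t ht X hX Y hY hXY hXY'
  have htt := h𝕋.mem_of_succ ht
  have hr := hρ t htt
  refine ae_le_of_forall_isEquivFinitePenalty h𝕋 hzero htop hreg hμ hρ hE (H _ _ _ hE) htt (hc t htt)
    (proj_top_mem_from hX t) (memLinf_riskAt hr hY) fun Qbar Q D hQ => ?_
  filter_upwards [hQ.1.condLoss_le_of_supermartingale h𝕋 hμ (H Qbar Q D hQ) ht (hρ _ ht) hX hY hXY
    hXY', hQ.1.condLoss_congr h𝕋 hμ (proj_top_mem hX t) hX t fun s _ hst => by
      filter_upwards with ω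
      rw [proj_top, if_pos hst]] with ω h1 h2
  rwa [h2]

end Representation

end ProcessRisk

theorem theorem4p2 {Ω : Type*} [mΩ : MeasurableSpace Ω] (P : Measure Ω) [IsProbabilityMeasure P]
    (𝕋 : Set ℕ∞) (h𝕋 : IsTimeSet 𝕋)
    (ℱ : Filtration ℕ mΩ) (hℱ_zero : ℱ 0 = ⊥)
    (hℱ_top : ⨆ (n : ℕ) (_ : (n : ℕ∞) ∈ 𝕋), ℱ n = mΩ)
    (hℱ_reg : InfiniteHorizon 𝕋 → IsRegularFiltration ℱ)
    (μ : ℕ∞ → Ω → ℝ) (hμ : IsReferenceProcess P 𝕋 ℱ μ)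
    (ρ : ℕ → (ℕ∞ → Ω → ℝ) → Ω → ℝ) (hρ : IsDynamicConvexRiskMeasure P 𝕋 ℱ ρ)
    (hρ_cont : ∀ t : ℕ, (t : ℕ∞) ∈ 𝕋 → IsContinuousFromAbove P 𝕋 ℱ ρ t) :
    -- the four equivalent conditions
    List.TFAE [
      IsTimeConsistent P 𝕋 ℱ ρ,
      AcceptanceSplitting P 𝕋 ℱ ρ,
      ∀ Qbar Q D, IsDecomposition P 𝕋 ℱ μ Qbar Q D → PenaltyRecursion P 𝕋 ℱ ρ Q D,
      ∀ Qbar Q D, IsDecomposition P 𝕋 ℱ μ Qbar Q D → SupermartingaleInequality P 𝕋 ℱ ρ Q D] ∧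
    -- description of the equivalent measures in terms of their decomposition
    (∀ Qbar Q D, IsDecomposition P 𝕋 ℱ μ Qbar Q D →
      (refMeasure P 𝕋 ℱ μ ≪ Qbar ↔
        IsLocEquiv P 𝕋 ℱ Q ∧ (∀ t ∈ 𝕋, ∀ᵐ ω ∂P, 0 < gammaOf 𝕋 D t ω) ∧ (⊤ ∈ 𝕋 → P ≪ Q))) ∧
    -- if some equivalent measure has finite penalty, equivalent measures with finite penalty suffice
    ((∃ Qbar Q D, IsEquivFinitePenalty P 𝕋 ℱ μ ρ Qbar Q D) →
      (∀ Qbar Q D, IsEquivFinitePenalty P 𝕋 ℱ μ ρ Qbar Q D →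
        SupermartingaleInequality P 𝕋 ℱ ρ Q D) →
      IsTimeConsistent P 𝕋 ℱ ρ ∧ RobustRepresentation P 𝕋 ℱ μ ρ) := by
  refine ⟨isTimeConsistent_tfae h𝕋 hℱ_zero hℱ_top hℱ_reg hμ hρ hρ_cont,
    fun Qbar Q D h => h.absolutelyContinuous_iff h𝕋 hℱ_top hμ, ?_⟩
  rintro ⟨Qbar, Q, D, hE⟩ H
  exact ⟨isTimeConsistent_of_supermartingale h𝕋 hℱ_zero hℱ_top hℱ_reg hμ hρ hρ_cont hE H,
    robustRepresentation h𝕋 hℱ_zero hℱ_top hℱ_reg hμ hρ hρ_cont hE (H _ _ _ hE)⟩
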